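/- Let $\mathfrak o$ be a complete discrete valuation ring of characteristic $0$ with uniformizer $\pi$, normalized valuation $w$ and residue field $k$ of characteristic $p>0$; let $q=p^a$ with $a\ge 1$, and let $\sigma_K$ be a ring endomorphism of $\mathfrak o$ lifting the $q$-power map on $k$. Let $L$ be a free abelian group with basis $z_1,\dots,z_m$ ($m\ge 0$), let $\lambda:L\to\mathbb R$ be an injective homomorphism, and let $\Gamma$ be the $\pi$-adic completion of $\mathfrak o((L))_\lambda$, where $\mathfrak o((L))_\lambda$ is the ring of formal sums $\sum_{z\in L}c_z\{z\}$ with only finitely many nonzero $c_z$ with $\lambda(z)\le b$, for each $b\in\mathbb R$. Let $E=\Gamma/\pi\Gamma=k((L))_\lambda$, with its valuation $v(\sum c_z\{z\})=\min\{\lambda(z):c_z\ne 0\}$. The naive partial valuations on $\Gamma$ are $v_n^{\mathrm{naive}}(\sum c_z\{z\})=\min\{\lambda(z): w(c_z)\le n\}$, and a sequence $(x_i)$ in $\Gamma$ tends to $0$ levelwise if $v_n^{\mathrm{naive}}(x_i)\to\infty$ for each $n$. A Frobenius lift is a ring endomorphism $\sigma$ of $\Gamma$ that extends $\sigma_K$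 and lifts the $q$-power map of $E$. It embeds $\Gamma$ into the $\pi$-adic completion of $\varinjlim(\Gamma\xrightarrow{\sigma}\Gamma\xrightarrow{\sigma}\cdots)$, whose residue field is the perfect closure of $E$, to which $v$ extends; writing $x\in\Gamma$ there as $\sum_i[\bar x_i]\pi^i$ with Teichmüller representatives, put $v_n(x)=\min_{i\le n}v(\bar x_i)$. For $r>0$ let $\Gamma_r=\{x\in\Gamma: rv_n(x)+n\to\infty\}$, $w_r(x)=\min_n\{rv_n(x)+n\}$, and $\Gamma_{\mathrm{con}}=\bigcup_{r>0}\Gamma_r$. One says that $\Gamma$ has enough units with respect to $\sigma$ if for some $r>0$ every nonzero element of $E$ lifts to a unit of $\Gamma_r$. Using $v_n^{\mathrm{naive}}$ instead of $v_n$, one gets the naive versions of $\Gamma_r$, $w_r$, $\Gamma_{\mathrm{con}}$. Let $\sigma_1,\sigma_2$ be Frobenius lifts on $\Gamma$, continuous for the levelwise topology, such that $\Gamma$ has enough units with respect to each of them and, for each nonzero $z\in L$, $\{z\}$ is a unit in $\Gamma_{\mathrm{con}}$ as defined by $\sigma_1$ and as defined by $\sigma_2$. Then: (1) There is $r_0>0$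 such that for all $0<r\le r_0$ the ring $\Gamma_r$ and the function $w_r$ on $\Gamma$ are the same for $\sigma_1$, for $\sigma_2$, and in the naive sense. In particular $\Gamma_{\mathrm{con}}$ is the same for $\sigma_1$ and $\sigma_2$, and so is $\Gamma_{\mathrm{an},\mathrm{con}}=\bigcup_{r>0}\Gamma_{\mathrm{an},r}$, where $\Gamma_{\mathrm{an},r}$ is the Fréchet completion of $\Gamma_r[1/\pi]$ under $w_s$, $0<s\le r$ (for small $r$). (2) Let $S$ be $\Gamma_{\mathrm{an},\mathrm{con}}$ (resp. $\Gamma_{\mathrm{con}}[1/\pi]$). The derivations $\partial_i(\sum c_z\{z\})=\sum\mu_i(z)c_z\{z\}$ (where $\mu_1,\dots,\mu_m$ is the basis dual to $z_1,\dots,z_m$) and the maps $\sigma_1,\sigma_2$ have continuous extensions from $\Gamma_{\mathrm{con}}$ to $S$. Let $\Omega^1$ be the free $S$-module on $d\log\{z_1\},\dots,d\log\{z_m\}$ with $ds=\sum_i\partial_i(s)\,d\log\{z_i\}$. A $\nabla$-module is a finite free $S$-module $M$ with an integrable connection $\nabla:M\to M\otimes\Omega^1$, $\nabla\mathbf v=\sum_i\Delta_i(\mathbf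 v)\otimes d\log\{z_i\}$; an $(F,\nabla)$-module relative to $\sigma_j$ is a $\nabla$-module with a $\sigma_j$-linear map $F:M\to M$ whose linearization $\sigma_j^*M\to M$ is an isomorphism and such that $\nabla\circ F=(F\otimes d\sigma_j)\circ\nabla$. Then there is an equivalence between the categories of $(F,\nabla)$-modules over $S$ relative to $\sigma_1$ and relative to $\sigma_2$ that is the identity on the underlying $\nabla$-modules and their morphisms, and that takes $(M,F_1)$ to $(M,F_2)$ with $$F_2(\mathbf v)=\sum_{j_1,\dots,j_m\ge 0}\frac1{j_1!\cdots j_m!}\Big(\prod_{i=1}^m u_i^{j_i}\Big)F_1\Big(\prod_{i=1}^m\prod_{l=0}^{j_i-1}(\Delta_i-l)\,\mathbf v\Big),\qquad u_i=\frac{\{z_i\}^{\sigma_2}}{\{z_i\}^{\sigma_1}}-1,$$ where the series converges in $M$. -/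

import Mathlib

open Filter Topology

noncomputable section

namespace FakeAnnulus

/-! ### The ring `Γ` of formal sums -/

section Gam

variable {𝔬 : Type*} [CommRing 𝔬] {L : Type*} [AddCommGroup L] [LinearOrder L]
  [IsOrderedAddMonoid L]

/-- Reduction of coefficients from `𝔬 / π ^ (n + 1)` to `𝔬 / π ^ n`. -/
def red (π : 𝔬) (n : ℕ) : 𝔬 ⧸ Ideal.span {π ^ (n + 1)} →+* 𝔬 ⧸ Ideal.span {π ^ n} :=
  Ideal.Quotient.factor
    ((Ideal.span_singleton_le_span_singleton).2 (pow_dvd_pow π (Nat.le_succ n)))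

/-- A product with nonzero coefficient at `z` has a nonzero term `x_a y_b`, `a + b = z`. -/
theorem exists_of_coeff_mul_ne_zero {R : Type*} [CommRing R] {x y : HahnSeries L R} {z : L}
    (h : (x * y).coeff z ≠ 0) :
    ∃ a b, a + b = z ∧ x.coeff a * y.coeff b ≠ 0 := by
  rw [HahnSeries.coeff_mul] at h
  obtain ⟨ab, hab, hne⟩ := Finset.exists_ne_zero_of_sum_ne_zero h
  exact ⟨ab.1, ab.2, by simp_all, hne⟩

/-- The ring `Γ = Γ^λ`, the `π`-adic completion of `𝔬((L))_λ`.  Here `R((L))_λ`, the `v_λ`-adic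
completion of `R[L]`, is the ring of formal sums `∑ c_z {z}` having only finitely many `z` with
`c_z ≠ 0` and `λ(z) ≤ b`, for each real `b`; and the `π`-adic completion is
`lim_n 𝔬((L))_λ / π ^ n = lim_n (𝔬 / π ^ n)((L))_λ`.  Thus `x n` is `x` modulo `π ^ n`, and
`c_z ≡ (x n).coeff z` modulo `π ^ n`. -/
def GamSub (π : 𝔬) (lam : L →+ ℝ) :
    Subalgebra 𝔬 (∀ n : ℕ, HahnSeries L (𝔬 ⧸ Ideal.span {π ^ n})) where
  carrier := {x | (∀ n, ∀ b : ℝ, {z : L | (x n).coeff z ≠ 0 ∧ lam z ≤ b}.Finite) ∧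
    ∀ n z, red π n ((x (n + 1)).coeff z) = (x n).coeff z}
  add_mem' := by
    rintro x y ⟨hx, hx'⟩ ⟨hy, hy'⟩
    refine ⟨fun n b => ((hx n b).union (hy n b)).subset ?_, fun n z => by simp [hx', hy']⟩
    rintro z ⟨hz, hb⟩
    by_cases h : (x n).coeff z = 0
    · right
      refine ⟨fun h' => hz (by simp [h, h']), hb⟩
    · exact Or.inl ⟨h, hb⟩
  mul_mem' := by
    rintro x y ⟨hx, hx'⟩ ⟨hy, hy'⟩
    have bdd : ∀ {R : Type _} [CommRing R] (f : HahnSeries L R),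
        (∀ b : ℝ, {z : L | f.coeff z ≠ 0 ∧ lam z ≤ b}.Finite) →
        ∃ B : ℝ, ∀ z, f.coeff z ≠ 0 → B ≤ lam z := by
      intro R _ f hf
      obtain ⟨B, hB⟩ := ((hf 0).image lam).bddBelow
      refine ⟨min B 0, fun z hz => ?_⟩
      by_cases h0 : lam z ≤ 0
      · exact (min_le_left _ _).trans (hB ⟨z, ⟨hz, h0⟩, rfl⟩)
      · exact (min_le_right _ _).trans (not_le.1 h0).le
    refine ⟨fun n b => ?_, fun n z => ?_⟩
    · obtain ⟨A, hA⟩ := bdd _ (hx n)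
      obtain ⟨B, hB⟩ := bdd _ (hy n)
      refine ((hx n (b - B)).image2 (fun a b => a + b) (hy n (b - A))).subset ?_
      rintro z ⟨hz, hb⟩
      obtain ⟨u, v, rfl, huv⟩ := exists_of_coeff_mul_ne_zero hz
      have hu := left_ne_zero_of_mul huv
      have hv := right_ne_zero_of_mul huv
      rw [map_add] at hb
      exact ⟨u, ⟨hu, by linarith [hB v hv]⟩, v, ⟨hv, by linarith [hA u hu]⟩, rfl⟩
    · have e : ∀ w : ∀ n : ℕ, HahnSeries L (𝔬 ⧸ Ideal.span {π ^ n}),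
          (∀ n z, red π n ((w (n + 1)).coeff z) = (w n).coeff z) →
          (w (n + 1)).map (red π n : 𝔬 ⧸ Ideal.span {π ^ (n + 1)} →ₙ+* 𝔬 ⧸ Ideal.span {π ^ n}) = w n := by
        intro w hw
        ext z
        exact hw n z
      have := HahnSeries.map_mul
        (red π n : 𝔬 ⧸ Ideal.span {π ^ (n + 1)} →ₙ+* 𝔬 ⧸ Ideal.span {π ^ n})
        (x := x (n + 1)) (y := y (n + 1))
      rw [e x hx', e y hy'] at this
      rw [Pi.mul_apply, Pi.mul_apply, ← this]
      rfl
  algebraMap_mem' := by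
    intro a
    refine ⟨fun n b => (Set.finite_singleton (0 : L)).subset ?_, fun n z => ?_⟩
    · rintro z ⟨hz, -⟩
      by_contra h
      exact hz (by
        rw [Pi.algebraMap_apply, HahnSeries.algebraMap_apply, HahnSeries.C_apply,
          HahnSeries.coeff_single_of_ne h])
    · simp only [Pi.algebraMap_apply, HahnSeries.algebraMap_apply, HahnSeries.C_apply,
        HahnSeries.coeff_single]
      split_ifs
      · rfl
      · simp

/-- The ring `Γ = Γ^λ` as a type. -/
def Gam (π : 𝔬) (lam : L →+ ℝ) : Type _ := GamSub π lam

instance (π : 𝔬) (lam : L →+ ℝ) : CommRing (Gam π lam) := inferInstanceAs (CommRing (GamSub π lam))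

instance (π : 𝔬) (lam : L →+ ℝ) : Algebra 𝔬 (Gam π lam) :=
  inferInstanceAs (Algebra 𝔬 (GamSub π lam))

variable {π : 𝔬} {lam : L →+ ℝ}

/-- The monomial `{z}`. -/
def mono (π : 𝔬) (lam : L →+ ℝ) (z : L) : Gam π lam :=
  ⟨fun _ => HahnSeries.single z 1, by
    refine ⟨fun n b => (Set.finite_singleton z).subset ?_, fun n y => ?_⟩
    · rintro y ⟨hy, -⟩
      by_contra h
      exact hy (HahnSeries.coeff_single_of_ne h)
    · simp only [HahnSeries.coeff_single]
      split_ifs <;> simp⟩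

/-- `∑ c_z {z} ↦ ∑ μ(z) c_z {z}`, for an additive `μ : L → ℤ`. -/
def partialMu (mu : L →+ ℤ) (x : Gam π lam) : Gam π lam :=
  ⟨fun n =>
    { coeff := fun z => (mu z : 𝔬 ⧸ Ideal.span {π ^ n}) * (x.1 n).coeff z
      isPWO_support' := (x.1 n).isPWO_support.mono fun z hz => right_ne_zero_of_mul hz }, by
    refine ⟨fun n b => (x.2.1 n b).subset ?_, fun n z => ?_⟩
    · rintro z ⟨hz, hb⟩
      exact ⟨right_ne_zero_of_mul hz, hb⟩
    · simp [x.2.2]⟩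

/-- If `x` modulo `π ^ n` has coefficient `A` at `z`, then so it has modulo `π ^ i`, `i ≤ n`. -/
theorem coeff_of_le (x : Gam π lam) (z : L) (A : 𝔬) {i n : ℕ} (h : i ≤ n)
    (hA : (x.1 n).coeff z = Ideal.Quotient.mk _ A) :
    (x.1 i).coeff z = Ideal.Quotient.mk _ A := by
  induction n, h using Nat.le_induction with
  | base => exact hA
  | succ n _ ih =>
    refine ih ?_
    rw [← x.2.2 n z, hA]
    rfl

theorem exists_of_coeff_mul (x y : Gam π lam) {n : ℕ} {z : L}
    (h : ((x * y).1 (n + 1)).coeff z ≠ 0) :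
    ∃ a b i j, a + b = z ∧ i + j ≤ n ∧ (x.1 (i + 1)).coeff a ≠ 0 ∧
      (y.1 (j + 1)).coeff b ≠ 0 := by
  obtain ⟨a, b, hab, hne⟩ := exists_of_coeff_mul_ne_zero
    (x := x.1 (n + 1)) (y := y.1 (n + 1)) h
  obtain ⟨A, hA⟩ := Ideal.Quotient.mk_surjective ((x.1 (n + 1)).coeff a)
  obtain ⟨B, hB⟩ := Ideal.Quotient.mk_surjective ((y.1 (n + 1)).coeff b)
  have hAB : ¬ π ^ (n + 1) ∣ A * B := by
    rw [← hA, ← hB, ← map_mul, Ne, Ideal.Quotient.eq_zero_iff_mem,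
      Ideal.mem_span_singleton] at hne
    exact hne
  classical
  have key : ∀ C : 𝔬, ¬ π ^ (n + 1) ∣ C → ∃ i, i ≤ n ∧ π ^ i ∣ C ∧ ¬ π ^ (i + 1) ∣ C := by
    intro C hC
    have hex : ∃ i, ¬ π ^ (i + 1) ∣ C := ⟨n, hC⟩
    refine ⟨Nat.find hex, Nat.find_min' hex hC, ?_, Nat.find_spec hex⟩
    rcases hk : Nat.find hex with _ | k
    · simp
    · by_contra hcon
      exact Nat.find_min hex (m := k) (by omega) hcon
  obtain ⟨i, hi, hiA, hiA'⟩ := key A fun h => hAB (h.mul_right B)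
  obtain ⟨j, hj, hjB, hjB'⟩ := key B fun h => hAB (h.mul_left A)
  refine ⟨a, b, i, j, hab, ?_, ?_, ?_⟩
  · by_contra hcon
    refine hAB ((pow_dvd_pow π (show n + 1 ≤ i + j by omega)).trans ?_)
    rw [pow_add]
    exact mul_dvd_mul hiA hjB
  · rw [coeff_of_le x a A (by omega) hA.symm, Ne, Ideal.Quotient.eq_zero_iff_mem,
      Ideal.mem_span_singleton]
    exact hiA'
  · rw [coeff_of_le y b B (by omega) hB.symm, Ne, Ideal.Quotient.eq_zero_iff_mem,
      Ideal.mem_span_singleton]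
    exact hjB'

/-! ### Naive partial valuations -/

/-- The naive partial valuation `v_n(∑ c_z {z}) = min {λ(z) : w(c_z) ≤ n}` on `Γ`, where
`w(c_z) ≤ n` means that `c_z` is nonzero modulo `π ^ (n + 1)`.  (On `Γ` it is `⊤` for `n < 0`.) -/
def vN (n : ℕ) (x : Gam π lam) : EReal :=
  ⨅ (z : L) (_ : (x.1 (n + 1)).coeff z ≠ 0), ((lam z : ℝ) : EReal)

/-- `w_r(x) = min_n (r v_n(x) + n)`, for the naive partial valuations. -/
def wN (r : ℝ) (x : Gam π lam) : EReal := ⨅ n : ℕ, ((r : EReal) * vN n x + (n : EReal))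

/-- `Γ_r`, for the naive partial valuations. -/
def GamN (π : 𝔬) (lam : L →+ ℝ) (r : ℝ) : Set (Gam π lam) :=
  {x | Tendsto (fun n : ℕ => (r : EReal) * vN n x + (n : EReal)) atTop (𝓝 ⊤)}

theorem le_mul_add_iff {r : ℝ} (hr : 0 < r) (C : ℝ) (n : ℕ) (v : EReal) :
    (C : EReal) ≤ (r : EReal) * v + (n : EReal) ↔ (((C - n) / r : ℝ) : EReal) ≤ v := by
  induction v with
  | bot => simp [EReal.coe_mul_bot_of_pos hr]
  | top =>
    have : ((n : ℝ) : EReal) = (n : EReal) := rfl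
    rw [EReal.coe_mul_top_of_pos hr, ← this, EReal.top_add_coe]
    simp
  | coe t =>
    have : ((n : ℝ) : EReal) = (n : EReal) := rfl
    rw [← this, ← EReal.coe_mul, ← EReal.coe_add, EReal.coe_le_coe_iff, EReal.coe_le_coe_iff,
      div_le_iff₀ hr]
    constructor <;> intro <;> linarith

theorem le_vN_iff {r : ℝ} (hr : 0 < r) (C : ℝ) (n : ℕ) (x : Gam π lam) :
    (C : EReal) ≤ (r : EReal) * vN n x + (n : EReal) ↔
      ∀ z, (x.1 (n + 1)).coeff z ≠ 0 → C ≤ r * lam z + n := by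
  rw [le_mul_add_iff hr, vN]
  simp only [le_iInf_iff, EReal.coe_le_coe_iff]
  refine forall₂_congr fun z _ => ?_
  rw [div_le_iff₀ hr]
  constructor <;> intro <;> linarith

theorem le_wN_iff {r : ℝ} (hr : 0 < r) (C : ℝ) (x : Gam π lam) :
    (C : EReal) ≤ wN r x ↔ ∀ n z, (x.1 (n + 1)).coeff z ≠ 0 → C ≤ r * lam z + (n : ℕ) := by
  simp only [wN, le_iInf_iff, le_vN_iff hr]

theorem mem_GamN_iff {r : ℝ} (hr : 0 < r) (x : Gam π lam) :
    x ∈ GamN π lam r ↔ ∀ C : ℝ, ∃ N : ℕ, ∀ n ≥ N, ∀ z, (x.1 (n + 1)).coeff z ≠ 0 →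
      C ≤ r * lam z + n := by
  rw [GamN, Set.mem_ofPred_eq, EReal.tendsto_nhds_top_iff_real]
  constructor
  · intro h C
    obtain ⟨N, hN⟩ := eventually_atTop.1 (h C)
    exact ⟨N, fun n hn => (le_vN_iff hr C n x).1 (hN n hn).le⟩
  · intro h C
    obtain ⟨N, hN⟩ := h (C + 1)
    refine eventually_atTop.2 ⟨N, fun n hn => ?_⟩
    refine lt_of_lt_of_le ?_ ((le_vN_iff hr (C + 1) n x).2 (hN n hn))
    exact EReal.coe_lt_coe_iff.2 (by linarith)

theorem le_wN_add {s : ℝ} (hs : 0 < s) {C : ℝ} {a b : Gam π lam}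
    (ha : (C : EReal) ≤ wN s a) (hb : (C : EReal) ≤ wN s b) : (C : EReal) ≤ wN s (a + b) := by
  rw [le_wN_iff hs] at *
  intro n z h
  by_cases h' : (a.1 (n + 1)).coeff z = 0
  · refine hb n z fun h'' => h ?_
    change (a.1 (n + 1)).coeff z + (b.1 (n + 1)).coeff z = 0
    rw [h', h'', add_zero]
  · exact ha n z h'

theorem le_wN_mul {s : ℝ} (hs : 0 < s) {C D : ℝ} {a b : Gam π lam}
    (ha : (C : EReal) ≤ wN s a) (hb : (D : EReal) ≤ wN s b) :
    ((C + D : ℝ) : EReal) ≤ wN s (a * b) := by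
  rw [le_wN_iff hs] at *
  intro n z h
  obtain ⟨u, v, i, j, rfl, hij, hu, hv⟩ := exists_of_coeff_mul a b h
  have h1 := ha i u hu
  have h2 := hb j v hv
  have h3 : ((i : ℝ) + j) ≤ n := by exact_mod_cast hij
  rw [map_add]
  nlinarith

/-- The coefficients of a constant. -/
theorem coeff_algebraMap_ne_zero {c : 𝔬} {n : ℕ} {z : L}
    (h : ((algebraMap 𝔬 (Gam π lam) c).1 n).coeff z ≠ 0) : z = 0 ∧ ¬ π ^ n ∣ c := by
  have e : ((algebraMap 𝔬 (Gam π lam) c).1 n).coeff z =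
      (HahnSeries.single (0 : L) (Ideal.Quotient.mk (Ideal.span {π ^ n}) c)).coeff z := rfl
  rw [e, HahnSeries.coeff_single] at h
  split_ifs at h with hz
  · refine ⟨hz, fun hd => h ?_⟩
    rwa [Ideal.Quotient.eq_zero_iff_mem, Ideal.mem_span_singleton]
  · exact absurd rfl h

theorem le_wN_pow {s : ℝ} (hs : 0 < s) (k : ℕ) :
    ((k : ℝ) : EReal) ≤ wN s (algebraMap 𝔬 (Gam π lam) π ^ k) := by
  rw [← map_pow, le_wN_iff hs]
  intro n z h
  obtain ⟨rfl, h2⟩ := coeff_algebraMap_ne_zero h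
  have : k ≤ n := by
    by_contra hcon
    exact h2 (pow_dvd_pow π (by omega))
  rw [map_zero, mul_zero, zero_add]
  exact_mod_cast this

theorem GamN_add {r : ℝ} (hr : 0 < r) {a b : Gam π lam} (ha : a ∈ GamN π lam r)
    (hb : b ∈ GamN π lam r) : a + b ∈ GamN π lam r := by
  rw [mem_GamN_iff hr] at *
  intro C
  obtain ⟨N, hN⟩ := ha C
  obtain ⟨M, hM⟩ := hb C
  refine ⟨max N M, fun n hn z h => ?_⟩
  by_cases h' : (a.1 (n + 1)).coeff z = 0
  · refine hM n ((le_max_right _ _).trans hn) z fun h'' => h ?_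
    change (a.1 (n + 1)).coeff z + (b.1 (n + 1)).coeff z = 0
    rw [h', h'', add_zero]
  · exact hN n ((le_max_left _ _).trans hn) z h'

theorem GamN_algebraMap {r : ℝ} (hr : 0 < r) (c : 𝔬) :
    algebraMap 𝔬 (Gam π lam) c ∈ GamN π lam r := by
  rw [mem_GamN_iff hr]
  intro C
  obtain ⟨N, hN⟩ := exists_nat_ge C
  refine ⟨N, fun n hn z h => ?_⟩
  obtain ⟨rfl, -⟩ := coeff_algebraMap_ne_zero h
  have : (N : ℝ) ≤ n := by exact_mod_cast hn
  rw [map_zero, mul_zero, zero_add]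
  linarith

theorem GamN_mono {r t : ℝ} (hr : 0 < r) (ht : 0 < t) (htr : t ≤ r) {a : Gam π lam}
    (ha : a ∈ GamN π lam r) : a ∈ GamN π lam t := by
  rw [mem_GamN_iff hr] at ha
  rw [mem_GamN_iff ht]
  intro C
  obtain ⟨N, hN⟩ := ha (max C 0)
  obtain ⟨M, hM⟩ := exists_nat_ge (max C 0)
  refine ⟨max N M, fun n hn z h => ?_⟩
  have h1 := hN n ((le_max_left _ _).trans hn) z h
  have h2 : (M : ℝ) ≤ n := by exact_mod_cast (le_max_right _ _).trans hn
  have h3 : max C 0 ≤ (n : ℝ) := hM.trans h2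
  have h4 : C ≤ max C 0 := le_max_left _ _
  by_cases hl : lam z ≤ 0
  · nlinarith
  · have : 0 ≤ t * lam z := mul_nonneg ht.le (not_le.1 hl).le
    linarith

theorem exists_le_wN {s : ℝ} (hs : 0 < s) {a : Gam π lam} (ha : a ∈ GamN π lam s) :
    ∃ C : ℝ, (C : EReal) ≤ wN s a := by
  rw [mem_GamN_iff hs] at ha
  obtain ⟨N, hN⟩ := ha 0
  have h1 : ∀ n : ℕ, ∃ B : ℝ, ∀ z, (a.1 (n + 1)).coeff z ≠ 0 → B ≤ s * lam z + n := by
    intro n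
    obtain ⟨B, hB⟩ := ((a.2.1 (n + 1) 0).image lam).bddBelow
    refine ⟨min (s * B) 0, fun z hz => ?_⟩
    have hn : (0 : ℝ) ≤ n := n.cast_nonneg
    by_cases h0 : lam z ≤ 0
    · have h2 : B ≤ lam z := hB ⟨z, ⟨hz, h0⟩, rfl⟩
      have h3 : s * B ≤ s * lam z := mul_le_mul_of_nonneg_left h2 hs.le
      linarith [min_le_left (s * B) 0]
    · have h3 : 0 ≤ s * lam z := mul_nonneg hs.le (not_le.1 h0).le
      linarith [min_le_right (s * B) 0]
  choose B hB using h1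
  obtain ⟨D, hD⟩ := ((Finset.range N).image B).bddBelow
  refine ⟨min D 0, (le_wN_iff hs _ _).2 fun n z hz => ?_⟩
  by_cases hn : N ≤ n
  · exact (min_le_right _ _).trans (hN n hn z hz)
  · refine (min_le_left _ _).trans (le_trans (hD ?_) (hB n z hz))
    simpa using ⟨n, not_le.1 hn, rfl⟩

theorem GamN_mul {r : ℝ} (hr : 0 < r) {a b : Gam π lam} (ha : a ∈ GamN π lam r)
    (hb : b ∈ GamN π lam r) : a * b ∈ GamN π lam r := by
  obtain ⟨A, hA⟩ := exists_le_wN hr ha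
  obtain ⟨B, hB⟩ := exists_le_wN hr hb
  rw [le_wN_iff hr] at hA hB
  rw [mem_GamN_iff hr] at *
  intro C
  obtain ⟨N, hN⟩ := ha (C - B)
  obtain ⟨M, hM⟩ := hb (C - A)
  obtain ⟨P, hP⟩ := exists_nat_ge (C - A - B)
  refine ⟨N + M + P, fun n hn z h => ?_⟩
  obtain ⟨u, v, i, j, rfl, hij, hu, hv⟩ := exists_of_coeff_mul a b h
  have h1 := hA i u hu
  have h2 := hB j v hv
  have h3 : ((i : ℝ) + j) ≤ n := by exact_mod_cast hij
  rw [map_add]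
  by_cases hi : N ≤ i
  · have := hN i hi u hu
    nlinarith
  by_cases hj : M ≤ j
  · have := hM j hj v hv
    nlinarith
  · have h4 : ((i : ℝ) + j + P) ≤ n := by exact_mod_cast (by omega : i + j + P ≤ n)
    nlinarith

/-- `Γ_con = ⋃ Γ_r`, for the naive partial valuations. -/
def GamCon (π : 𝔬) (lam : L →+ ℝ) : Subalgebra 𝔬 (Gam π lam) where
  carrier := {x | ∃ r : ℝ, 0 < r ∧ x ∈ GamN π lam r}
  add_mem' := by
    rintro a b ⟨r, hr, ha⟩ ⟨t, ht, hb⟩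
    have h := lt_min hr ht
    exact ⟨min r t, h, GamN_add h (GamN_mono hr h (min_le_left _ _) ha)
      (GamN_mono ht h (min_le_right _ _) hb)⟩
  mul_mem' := by
    rintro a b ⟨r, hr, ha⟩ ⟨t, ht, hb⟩
    have h := lt_min hr ht
    exact ⟨min r t, h, GamN_mul h (GamN_mono hr h (min_le_left _ _) ha)
      (GamN_mono ht h (min_le_right _ _) hb)⟩
  algebraMap_mem' c := ⟨1, one_pos, GamN_algebraMap one_pos c⟩

theorem mono_mul_mono (a b : L) : mono π lam a * mono π lam b = mono π lam (a + b) := by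
  refine Subtype.ext (funext fun n => ?_)
  change HahnSeries.single a (1 : 𝔬 ⧸ Ideal.span {π ^ n}) * HahnSeries.single b 1 = _
  rw [HahnSeries.single_mul_single, one_mul]
  rfl

theorem mono_zero : mono π lam 0 = 1 := rfl

theorem mono_mem (z : L) : mono π lam z ∈ GamCon π lam := by
  refine ⟨1, one_pos, (mem_GamN_iff one_pos _).2 fun C => ?_⟩
  obtain ⟨N, hN⟩ := exists_nat_ge (C - lam z)
  refine ⟨N, fun n hn y h => ?_⟩
  have hy : y = z := by
    by_contra hne
    exact h (HahnSeries.coeff_single_of_ne hne)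
  have : (N : ℝ) ≤ n := by exact_mod_cast hn
  subst hy
  linarith

/-- The monomial `{z}` as a unit of `Γ_con`, with inverse `{-z}`. -/
def monoUnit (π : 𝔬) (lam : L →+ ℝ) (z : L) : (GamCon π lam)ˣ where
  val := ⟨mono π lam z, mono_mem z⟩
  inv := ⟨mono π lam (-z), mono_mem (-z)⟩
  val_inv := Subtype.ext (by
    change mono π lam z * mono π lam (-z) = 1
    rw [mono_mul_mono, add_neg_cancel, mono_zero])
  inv_val := Subtype.ext (by
    change mono π lam (-z) * mono π lam z = 1
    rw [mono_mul_mono, neg_add_cancel, mono_zero])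

/-! ### The rings `Γ_con[1/π]` and `Γ_an,con` -/

/-- `Γ[1/π]`. -/
def GamPi (π : 𝔬) (lam : L →+ ℝ) : Type _ :=
  Localization.Away (algebraMap 𝔬 (Gam π lam) π)

instance : CommRing (GamPi π lam) :=
  inferInstanceAs (CommRing (Localization.Away (algebraMap 𝔬 (Gam π lam) π)))

instance : Algebra (Gam π lam) (GamPi π lam) :=
  inferInstanceAs (Algebra (Gam π lam) (Localization.Away (algebraMap 𝔬 (Gam π lam) π)))

instance : IsLocalization.Away (algebraMap 𝔬 (Gam π lam) π) (GamPi π lam) :=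
  inferInstanceAs (IsLocalization.Away (algebraMap 𝔬 (Gam π lam) π)
    (Localization.Away (algebraMap 𝔬 (Gam π lam) π)))

instance : Algebra 𝔬 (GamPi π lam) :=
  inferInstanceAs (Algebra 𝔬 (Localization.Away (algebraMap 𝔬 (Gam π lam) π)))

instance : IsScalarTower 𝔬 (Gam π lam) (GamPi π lam) :=
  inferInstanceAs (IsScalarTower 𝔬 (Gam π lam) (Localization.Away (algebraMap 𝔬 (Gam π lam) π)))

/-- `π` in `Γ[1/π]`. -/
abbrev piLoc (π : 𝔬) (lam : L →+ ℝ) : GamPi π lam :=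
  algebraMap (Gam π lam) (GamPi π lam) (algebraMap 𝔬 (Gam π lam) π)

/-- `x = a / π ^ k` with `a ∈ Γ_r`, i.e. `x ∈ Γ_r[1/π]`. -/
def MemR (r : ℝ) (x : GamPi π lam) : Prop :=
  ∃ (k : ℕ) (a : Gam π lam), a ∈ GamN π lam r ∧ x * piLoc π lam ^ k = algebraMap _ _ a

/-- `x ∈ Γ_r[1/π]` and `w_s(x) ≥ C`; here `w_s(a / π ^ k) = w_s(a) - k`. -/
def GE (r s C : ℝ) (x : GamPi π lam) : Prop :=
  ∃ (k : ℕ) (a : Gam π lam), a ∈ GamN π lam r ∧ x * piLoc π lam ^ k = algebraMap _ _ a ∧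
    ((C + k : ℝ) : EReal) ≤ wN s a

theorem MemR.mono {r t : ℝ} (ht : 0 < t) (htr : t ≤ r) {x : GamPi π lam} (h : MemR r x) :
    MemR t x := by
  obtain ⟨k, a, ha, hx⟩ := h
  exact ⟨k, a, GamN_mono (ht.trans_le htr) ht htr ha, hx⟩

theorem GE.mono {r t s C D : ℝ} (ht : 0 < t) (htr : t ≤ r) (hCD : D ≤ C) {x : GamPi π lam}
    (h : GE r s C x) : GE t s D x := by
  obtain ⟨k, a, ha, hx, hw⟩ := h
  exact ⟨k, a, GamN_mono (ht.trans_le htr) ht htr ha, hx,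
    le_trans (EReal.coe_le_coe_iff.2 (by linarith)) hw⟩

theorem GE.memR {r s C : ℝ} {x : GamPi π lam} (h : GE r s C x) : MemR r x := by
  obtain ⟨k, a, ha, hx, -⟩ := h
  exact ⟨k, a, ha, hx⟩

theorem MemR.exists_GE {r s : ℝ} (hs : 0 < s) (hsr : s ≤ r) {x : GamPi π lam} (h : MemR r x) :
    ∃ C, GE r s C x := by
  obtain ⟨k, a, ha, hx⟩ := h
  obtain ⟨C, hC⟩ := exists_le_wN hs (GamN_mono (hs.trans_le hsr) hs hsr ha)
  exact ⟨C - k, k, a, ha, hx, by simpa using hC⟩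

theorem MemR.mul {r : ℝ} (hr : 0 < r) {x y : GamPi π lam} (hx : MemR r x) (hy : MemR r y) :
    MemR r (x * y) := by
  obtain ⟨k, a, ha, hx⟩ := hx
  obtain ⟨l, b, hb, hy⟩ := hy
  exact ⟨k + l, a * b, GamN_mul hr ha hb, by rw [map_mul, ← hx, ← hy]; ring⟩

theorem MemR.add {r : ℝ} (hr : 0 < r) {x y : GamPi π lam} (hx : MemR r x) (hy : MemR r y) :
    MemR r (x + y) := by
  obtain ⟨k, a, ha, hx⟩ := hx
  obtain ⟨l, b, hb, hy⟩ := hy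
  refine ⟨k + l, a * algebraMap 𝔬 _ π ^ l + b * algebraMap 𝔬 _ π ^ k,
    GamN_add hr (GamN_mul hr ha ?_) (GamN_mul hr hb ?_), ?_⟩
  · rw [← map_pow]
    exact GamN_algebraMap hr _
  · rw [← map_pow]
    exact GamN_algebraMap hr _
  · rw [map_add, map_mul, map_mul, ← hx, ← hy, map_pow, map_pow]
    ring

theorem MemR.algebraMap {r : ℝ} (hr : 0 < r) (c : 𝔬) :
    MemR r (algebraMap 𝔬 (GamPi π lam) c) :=
  ⟨0, _, GamN_algebraMap hr c, by
    rw [pow_zero, mul_one]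
    exact IsScalarTower.algebraMap_apply 𝔬 (Gam π lam) (GamPi π lam) c⟩

theorem GE.mul {r s C D : ℝ} (hr : 0 < r) (hs : 0 < s) {x y : GamPi π lam}
    (hx : GE r s C x) (hy : GE r s D y) : GE r s (C + D) (x * y) := by
  obtain ⟨k, a, ha, hx, hC⟩ := hx
  obtain ⟨l, b, hb, hy, hD⟩ := hy
  refine ⟨k + l, a * b, GamN_mul hr ha hb, by rw [map_mul, ← hx, ← hy]; ring, ?_⟩
  have := le_wN_mul hs hC hD
  rwa [show C + D + ((k + l : ℕ) : ℝ) = C + k + (D + l) by push_cast; ring]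

theorem GE.add {r s C : ℝ} (hr : 0 < r) (hs : 0 < s) {x y : GamPi π lam}
    (hx : GE r s C x) (hy : GE r s C y) : GE r s C (x + y) := by
  obtain ⟨k, a, ha, hx, hC⟩ := hx
  obtain ⟨l, b, hb, hy, hD⟩ := hy
  refine ⟨k + l, a * algebraMap 𝔬 _ π ^ l + b * algebraMap 𝔬 _ π ^ k,
    GamN_add hr (GamN_mul hr ha ?_) (GamN_mul hr hb ?_), ?_, le_wN_add hs ?_ ?_⟩
  · rw [← map_pow]
    exact GamN_algebraMap hr _
  · rw [← map_pow]
    exact GamN_algebraMap hr _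
  · rw [map_add, map_mul, map_mul, ← hx, ← hy, map_pow, map_pow]
    ring
  · have := le_wN_mul hs hC (le_wN_pow (π := π) (lam := lam) hs l)
    rwa [show C + ((k + l : ℕ) : ℝ) = C + k + l by push_cast; ring]
  · have := le_wN_mul hs hD (le_wN_pow (π := π) (lam := lam) hs k)
    rwa [show C + ((k + l : ℕ) : ℝ) = C + l + k by push_cast; ring]

theorem GE.zero {r s : ℝ} (hr : 0 < r) (hs : 0 < s) (C : ℝ) : GE r s C (0 : GamPi π lam) := by
  have h0 := GamN_algebraMap (π := π) (lam := lam) hr 0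
  rw [map_zero] at h0
  exact ⟨0, 0, h0, by simp, (le_wN_iff hs _ _).2 fun n z h => absurd rfl h⟩

/-- `Γ_con[1/π]`. -/
def GamConPi (π : 𝔬) (lam : L →+ ℝ) : Subalgebra 𝔬 (GamPi π lam) where
  carrier := {x | ∃ r : ℝ, 0 < r ∧ MemR r x}
  add_mem' := by
    rintro a b ⟨r, hr, ha⟩ ⟨t, ht, hb⟩
    have h := lt_min hr ht
    exact ⟨min r t, h, (ha.mono h (min_le_left _ _)).add h (hb.mono h (min_le_right _ _))⟩
  mul_mem' := by
    rintro a b ⟨r, hr, ha⟩ ⟨t, ht, hb⟩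
    have h := lt_min hr ht
    exact ⟨min r t, h, (ha.mono h (min_le_left _ _)).mul h (hb.mono h (min_le_right _ _))⟩
  algebraMap_mem' c := ⟨1, one_pos, MemR.algebraMap one_pos c⟩

/-- A sequence in `Γ_r[1/π]` that is Cauchy for `w_s`, for all `s ∈ (0, r]`. -/
def CauR (r : ℝ) (x : ℕ → GamPi π lam) : Prop :=
  (∀ i, MemR r (x i)) ∧
    ∀ s, 0 < s → s ≤ r → ∀ C : ℝ, ∃ N, ∀ i ≥ N, ∀ j ≥ N, GE r s C (x i - x j)

/-- A sequence that is eventually in `Γ_r[1/π]` and tends to zero there for `w_s`, for all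
`s ∈ (0, r]`. -/
def NullR (r : ℝ) (x : ℕ → GamPi π lam) : Prop :=
  ∀ s, 0 < s → s ≤ r → ∀ C : ℝ, ∃ N, ∀ i ≥ N, GE r s C (x i)

theorem CauR.mono {r t : ℝ} (ht : 0 < t) (htr : t ≤ r) {x : ℕ → GamPi π lam} (h : CauR r x) :
    CauR t x := by
  refine ⟨fun i => (h.1 i).mono ht htr, fun s hs hst C => ?_⟩
  obtain ⟨N, hN⟩ := h.2 s hs (hst.trans htr) C
  exact ⟨N, fun i hi j hj => (hN i hi j hj).mono ht htr le_rfl⟩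

theorem NullR.mono {r t : ℝ} (ht : 0 < t) (htr : t ≤ r) {x : ℕ → GamPi π lam} (h : NullR r x) :
    NullR t x := by
  intro s hs hst C
  obtain ⟨N, hN⟩ := h s hs (hst.trans htr) C
  exact ⟨N, fun i hi => (hN i hi).mono ht htr le_rfl⟩

theorem CauR.bdd {r s : ℝ} (hs : 0 < s) (hsr : s ≤ r) {x : ℕ → GamPi π lam} (h : CauR r x) :
    ∃ B, ∀ i, GE r s B (x i) := by
  have hr := hs.trans_le hsr
  obtain ⟨N, hN⟩ := h.2 s hs hsr 0
  choose B hB using fun i => (h.1 i).exists_GE hs hsr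
  obtain ⟨D, hD⟩ := ((Finset.range (N + 1)).image B).bddBelow
  have hD' : ∀ i ≤ N, D ≤ B i := fun i hi => hD (by simpa using ⟨i, by omega, rfl⟩)
  refine ⟨min D 0, fun i => ?_⟩
  by_cases hi : i ≤ N
  · exact (hB i).mono hr le_rfl ((min_le_left _ _).trans (hD' i hi))
  · have h1 := (hN i (by omega) N le_rfl).mono hr le_rfl (min_le_right D 0)
    have h2 := (hB N).mono hr le_rfl ((min_le_left D 0).trans (hD' N le_rfl))
    simpa using h1.add hr hs h2

/-- The sequences in some `Γ_r[1/π]`, `r > 0`, that are Cauchy for all `w_s`, `s ∈ (0, r]`. -/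
def CauchySeqs (π : 𝔬) (lam : L →+ ℝ) : Subalgebra 𝔬 (ℕ → GamPi π lam) where
  carrier := {x | ∃ r : ℝ, 0 < r ∧ CauR r x}
  add_mem' := by
    rintro x y ⟨r, hr, hx⟩ ⟨t, ht, hy⟩
    have h := lt_min hr ht
    replace hx := hx.mono h (min_le_left r t)
    replace hy := hy.mono h (min_le_right r t)
    refine ⟨min r t, h, fun i => (hx.1 i).add h (hy.1 i), fun s hs hst C => ?_⟩
    obtain ⟨N, hN⟩ := hx.2 s hs hst C
    obtain ⟨M, hM⟩ := hy.2 s hs hst C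
    refine ⟨max N M, fun i hi j hj => ?_⟩
    have h1 := hN i ((le_max_left _ _).trans hi) j ((le_max_left _ _).trans hj)
    have h2 := hM i ((le_max_right _ _).trans hi) j ((le_max_right _ _).trans hj)
    have := h1.add h hs h2
    rwa [show x i - x j + (y i - y j) = (x + y) i - (x + y) j by
      simp only [Pi.add_apply]; ring] at this
  mul_mem' := by
    rintro x y ⟨r, hr, hx⟩ ⟨t, ht, hy⟩
    have h := lt_min hr ht
    replace hx := hx.mono h (min_le_left r t)
    replace hy := hy.mono h (min_le_right r t)
    refine ⟨min r t, h, fun i => (hx.1 i).mul h (hy.1 i), fun s hs hst C => ?_⟩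
    obtain ⟨A, hA⟩ := hx.bdd hs hst
    obtain ⟨B, hB⟩ := hy.bdd hs hst
    obtain ⟨N, hN⟩ := hx.2 s hs hst (C - B)
    obtain ⟨M, hM⟩ := hy.2 s hs hst (C - A)
    refine ⟨max N M, fun i hi j hj => ?_⟩
    have h1 := hN i ((le_max_left _ _).trans hi) j ((le_max_left _ _).trans hj)
    have h2 := hM i ((le_max_right _ _).trans hi) j ((le_max_right _ _).trans hj)
    have h3 := (h1.mul h hs (hB i)).mono (D := C) h le_rfl (by linarith)
    have h4 := (h2.mul h hs (hA j)).mono (D := C) h le_rfl (by linarith)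
    have := h3.add h hs h4
    rwa [show (x i - x j) * y i + (y i - y j) * x j = (x * y) i - (x * y) j by
      simp only [Pi.mul_apply]; ring] at this
  algebraMap_mem' c := by
    refine ⟨1, one_pos, fun i => MemR.algebraMap one_pos c, fun s hs _ C => ⟨0, fun i _ j _ => ?_⟩⟩
    rw [Pi.algebraMap_apply, Pi.algebraMap_apply, sub_self]
    exact GE.zero one_pos hs C

/-- The ideal of null sequences. -/
def NullSeqs (π : 𝔬) (lam : L →+ ℝ) : Ideal (CauchySeqs π lam) where
  carrier := {x | ∃ r : ℝ, 0 < r ∧ NullR r x.1}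
  zero_mem' := ⟨1, one_pos, fun s hs _ C => ⟨0, fun _ _ => GE.zero one_pos hs C⟩⟩
  add_mem' := by
    rintro x y ⟨r, hr, hx⟩ ⟨t, ht, hy⟩
    have h := lt_min hr ht
    refine ⟨min r t, h, fun s hs hst C => ?_⟩
    obtain ⟨N, hN⟩ := hx.mono h (min_le_left r t) s hs hst C
    obtain ⟨M, hM⟩ := hy.mono h (min_le_right r t) s hs hst C
    exact ⟨max N M, fun i hi => (hN i ((le_max_left _ _).trans hi)).add h hs
      (hM i ((le_max_right _ _).trans hi))⟩
  smul_mem' := by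
    rintro c x ⟨t, ht, hx⟩
    obtain ⟨r, hr, hc⟩ := c.2
    have h := lt_min hr ht
    refine ⟨min r t, h, fun s hs hst C => ?_⟩
    obtain ⟨B, hB⟩ := (hc.mono h (min_le_left r t)).bdd hs hst
    obtain ⟨N, hN⟩ := hx.mono h (min_le_right r t) s hs hst (C - B)
    exact ⟨N, fun i hi => ((hB i).mul h hs (hN i hi)).mono h le_rfl (by linarith)⟩

/-- `Γ_an,con = ⋃ Γ_an,r`, where `Γ_an,r` is the Fréchet completion of `Γ_r[1/π]` for the
valuations `w_s`, `s ∈ (0, r]`.  The completions are realized by Cauchy sequences modulo null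
sequences, and the union (direct limit) over `r → 0` is taken at the same time. -/
def GamAnCon (π : 𝔬) (lam : L →+ ℝ) : Type _ := CauchySeqs π lam ⧸ NullSeqs π lam

instance : CommRing (GamAnCon π lam) := inferInstanceAs (CommRing (CauchySeqs π lam ⧸ NullSeqs π lam))

instance : Algebra 𝔬 (GamAnCon π lam) :=
  inferInstanceAs (Algebra 𝔬 (CauchySeqs π lam ⧸ NullSeqs π lam))

/-- The class of a Cauchy sequence. -/
def GamAnCon.mk (π : 𝔬) (lam : L →+ ℝ) : CauchySeqs π lam →ₐ[𝔬] GamAnCon π lam :=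
  Ideal.Quotient.mkₐ 𝔬 (NullSeqs π lam)

/-- `Γ_con → Γ_con[1/π]`. -/
def toConPi (π : 𝔬) (lam : L →+ ℝ) : GamCon π lam →ₐ[𝔬] GamConPi π lam :=
  ((IsScalarTower.toAlgHom 𝔬 (Gam π lam) (GamPi π lam)).comp (GamCon π lam).val).codRestrict _ (by
    rintro ⟨a, r, hr, ha⟩
    exact ⟨r, hr, 0, a, ha, by rw [pow_zero, mul_one]; rfl⟩)

/-- `Γ_con → Γ_an,con`, by constant sequences. -/
def toAnCon (π : 𝔬) (lam : L →+ ℝ) : GamCon π lam →ₐ[𝔬] GamAnCon π lam :=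
  (GamAnCon.mk π lam).comp
    (((Pi.constAlgHom 𝔬 ℕ (GamPi π lam)).comp
      ((GamConPi π lam).val.comp (toConPi π lam))).codRestrict (CauchySeqs π lam) (by
        intro a
        obtain ⟨r, hr, h⟩ := (toConPi π lam a).2
        refine ⟨r, hr, fun _ => h, fun s hs _ C => ⟨0, fun i _ j _ => ?_⟩⟩
        have h0 := GE.zero (π := π) (lam := lam) hr hs C
        rwa [← sub_self (toConPi π lam a : GamPi π lam)] at h0))

/-- `f → y` along `l` in `Γ_con[1/π]`: for some `r > 0`, the differences `f i - y` are eventually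
in `Γ_r[1/π]` and tend to zero there for `w_s`, for all `s ∈ (0, r]`. -/
def TendstoCon {ι : Type} (l : Filter ι) (f : ι → GamConPi π lam) (y : GamConPi π lam) : Prop :=
  ∃ r : ℝ, 0 < r ∧ ∀ s, 0 < s → s ≤ r → ∀ C : ℝ, ∀ᶠ i in l, GE r s C (f i - y : GamPi π lam)

/-- `y ∈ Γ_an,r` and `w_s(y) ≥ C`. -/
def GEAn (r s C : ℝ) (y : GamAnCon π lam) : Prop :=
  ∃ x : CauchySeqs π lam, CauR r x.1 ∧ GamAnCon.mk π lam x = y ∧ ∀ i, GE r s C (x.1 i)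

/-- `f → y` along `l` in `Γ_an,con`: for some `r > 0`, the differences `f i - y` are eventually
in `Γ_an,r` and tend to zero there for `w_s`, for all `s ∈ (0, r]`. -/
def TendstoAn {ι : Type} (l : Filter ι) (f : ι → GamAnCon π lam) (y : GamAnCon π lam) : Prop :=
  ∃ r : ℝ, 0 < r ∧ ∀ s, 0 < s → s ≤ r → ∀ C : ℝ, ∀ᶠ i in l, GEAn r s C (f i - y)

/-! ### Frobenius lifts and the valuations they induce -/

/-- A Frobenius lift on `Γ`: a ring endomorphism that extends `σ_K` and lifts the `q`-power map
on the residue field `E = Γ / π = k((L))_λ`. -/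
structure IsFrobeniusLift (q : ℕ) (σK : 𝔬 →+* 𝔬) (σ : Gam π lam →+* Gam π lam) : Prop where
  extends_base : ∀ c, σ (algebraMap 𝔬 _ c) = algebraMap 𝔬 _ (σK c)
  lifts_pow : ∀ x, algebraMap 𝔬 _ π ∣ σ x - x ^ q

/-- Convergence to zero for the levelwise topology of `Γ`: `v_n(x_i) → ∞` for each `n`. -/
def LevelwiseNull (x : ℕ → Gam π lam) : Prop := ∀ n, Tendsto (fun i => vN n (x i)) atTop (𝓝 ⊤)

/-- Continuity of `σ` for the (metrizable, additive) levelwise topology of `Γ`. -/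
def LevelwiseContinuous (σ : Gam π lam →+* Gam π lam) : Prop :=
  ∀ x, LevelwiseNull x → LevelwiseNull fun i => σ (x i)

/-- The direct limit of `Γ → Γ → ⋯` along `σ`. -/
abbrev Colim (σ : Gam π lam →+* Gam π lam) : Type _ :=
  Ring.DirectLimit (fun _ : ℕ => Gam π lam) fun i j _ => ⇑(σ ^ (j - i))

/-- The `i`-th canonical map `Γ → colim Γ`. -/
abbrev Colim.of (σ : Gam π lam →+* Gam π lam) (i : ℕ) : Gam π lam →+* Colim σ :=
  Ring.DirectLimit.of (fun _ : ℕ => Gam π lam) (fun i j _ => ⇑(σ ^ (j - i))) i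

/-- The `π`-adic completion of the direct limit of `Γ → Γ → ⋯` along `σ`.  It is a complete
discrete valuation ring with uniformizer `π` and residue field the perfect closure of `E`, a
subring of `Γ^perf`; `Γ` is embedded by the first term of the direct system. -/
abbrev Perf (σ : Gam π lam →+* Gam π lam) : Type _ :=
  AdicCompletion (Ideal.span {Colim.of σ 0 (algebraMap 𝔬 _ π)}) (Colim σ)

/-- The `i`-th canonical map `Γ → Perf σ`. -/
abbrev Perf.of (σ : Gam π lam →+* Gam π lam) (i : ℕ) : Gam π lam →+* Perf σ :=
  (algebraMap (Colim σ) (Perf σ)).comp (Colim.of σ i)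

/-- `π` in `Perf σ`. -/
abbrev Perf.pi (σ : Gam π lam →+* Gam π lam) : Perf σ := Perf.of σ 0 (algebraMap 𝔬 _ π)

/-- The valuation of the residue class of `t`, for the extension of `v` to the perfect closure of
`E`: if `t` is congruent modulo `π` to the image of `y ∈ Γ` from the `i`-th term, then the residue
class of `t` is the `q ^ i`-th root of that of `y`.  On `E = Γ / π`, `v` is `vN 0`. -/
def vRes (q : ℕ) (σ : Gam π lam →+* Gam π lam) (t : Perf σ) : EReal :=
  ⨅ (i : ℕ) (y : Gam π lam) (_ : t - Perf.of σ i y ∈ Ideal.span {Perf.pi σ}),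
    (((q : ℝ) ^ i)⁻¹ : ℝ) * vN 0 y

/-- `x = ∑ t_i π ^ i` in `Perf σ`, with Teichmüller representatives `t_i`.  (As the residue field
is perfect, the Teichmüller representatives are the elements that are `p ^ n`-th powers for all
`n`.) -/
structure IsTeichmullerExpansion (p : ℕ) (σ : Gam π lam →+* Gam π lam) (x : Gam π lam)
    (t : ℕ → Perf σ) : Prop where
  teichmuller : ∀ i n, ∃ s, s ^ p ^ n = t i
  expansion : ∀ n, Perf.of σ 0 x - ∑ i ∈ Finset.range n, t i * Perf.pi σ ^ i ∈
    Ideal.span {Perf.pi σ ^ n}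

/-- The partial valuation `v_n(x) = min_{i ≤ n} v(x_i)`, where `x = ∑ [x_i] π ^ i` is the (unique)
Teichmüller expansion of `x ∈ Γ`.  (On `Γ` it is `⊤` for `n < 0`.) -/
def vF (p q : ℕ) (σ : Gam π lam →+* Gam π lam) (n : ℕ) (x : Gam π lam) : EReal :=
  ⨅ (t : ℕ → Perf σ) (_ : IsTeichmullerExpansion p σ x t) (i : ℕ) (_ : i ≤ n), vRes q σ (t i)

/-- `w_r(x) = min_n (r v_n(x) + n)`, for the partial valuations induced by `σ`. -/
def wF (p q : ℕ) (σ : Gam π lam →+* Gam π lam) (r : ℝ) (x : Gam π lam) : EReal :=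
  ⨅ n : ℕ, ((r : EReal) * vF p q σ n x + (n : EReal))

/-- `Γ_r`, for the partial valuations induced by `σ`. -/
def GamF (p q : ℕ) (σ : Gam π lam →+* Gam π lam) (r : ℝ) : Set (Gam π lam) :=
  {x | Tendsto (fun n : ℕ => (r : EReal) * vF p q σ n x + (n : EReal)) atTop (𝓝 ⊤)}

/-- `Γ_con = ⋃ Γ_r`, for the partial valuations induced by `σ`. -/
def GamConF (p q : ℕ) (σ : Gam π lam →+* Gam π lam) : Set (Gam π lam) :=
  {x | ∃ r : ℝ, 0 < r ∧ x ∈ GamF p q σ r}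

/-- `Γ` has enough units with respect to `σ`: for some `r > 0`, every nonzero element of
`E = Γ / π` lifts to a unit of `Γ_r`. -/
def HasEnoughUnits (p q : ℕ) (σ : Gam π lam →+* Gam π lam) : Prop :=
  ∃ r : ℝ, 0 < r ∧ ∀ x : Gam π lam, ¬ algebraMap 𝔬 _ π ∣ x →
    ∃ u ∈ GamF p q σ r, ∃ v ∈ GamF p q σ r, u * v = 1 ∧ algebraMap 𝔬 _ π ∣ u - x

/-- Each monomial `{z}`, `z ≠ 0`, is a unit in `Γ_con`, as defined by `σ`. -/
def MonomialsAreUnits (p q : ℕ) (σ : Gam π lam →+* Gam π lam) : Prop :=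
  ∀ z : L, z ≠ 0 → mono π lam z ∈ GamConF p q σ ∧
    ∃ v ∈ GamConF p q σ, mono π lam z * v = 1

end Gam

/-! ### `(F, ∇)`-modules -/

section Modules

open CategoryTheory

universe u w

variable {𝔬 : Type*} [CommRing 𝔬] {m : ℕ} {S : Type u} [CommRing S] [Algebra 𝔬 S]

/-- A `∇`-module over `S`.  Here `Ω¹` is the free `S`-module on `dlog z_1, …, dlog z_m`, with
`ds = ∑ D_i(s) dlog z_i`, and the connection is `∇ v = ∑ Δ_i(v) ⊗ dlog z_i`.  The Leibniz rule is
`∇(s v) = s ∇ v + v ⊗ ds`, and as the `dlog z_i` are closed, integrability says that the `Δ_i`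
commute.  (The `𝔬`-linearity of `∇` follows from the Leibniz rule.) -/
structure NablaMod (D : Fin m → Derivation 𝔬 S S) where
  carrier : Type w
  [addCommGroup : AddCommGroup carrier]
  [module : Module S carrier]
  [finite : Module.Finite S carrier]
  [free : Module.Free S carrier]
  Δ : Fin m → carrier →+ carrier
  leibniz : ∀ i (s : S) v, Δ i (s • v) = s • Δ i v + D i s • v
  integrable : ∀ i j v, Δ i (Δ j v) = Δ j (Δ i v)

attribute [instance] NablaMod.addCommGroup NablaMod.module NablaMod.finite NablaMod.free

variable {D : Fin m → Derivation 𝔬 S S}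

namespace NablaMod

/-- `Δ_i` as an element of the endomorphism ring of the additive group `M`. -/
def deltaEnd (X : NablaMod.{u, w} D) (i : Fin m) : AddMonoid.End X.carrier := X.Δ i

/-- Horizontal `S`-linear maps. -/
@[ext]
structure Hom (X Y : NablaMod.{u, w} D) where
  lin : X.carrier →ₗ[S] Y.carrier
  comm : ∀ i v, lin (X.Δ i v) = Y.Δ i (lin v)

instance : Category (NablaMod.{u, w} D) where
  Hom := Hom
  id X := ⟨LinearMap.id, fun _ _ => rfl⟩
  comp f g := ⟨g.lin.comp f.lin, fun i v => by simp [f.comm, g.comm]⟩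

end NablaMod

/-- The coefficient of `dlog z_i` in `dlog (φ z_h) = d(φ z_h) / φ z_h`. -/
def dlogCoeff (D : Fin m → Derivation 𝔬 S S) (zs : Fin m → Sˣ) (φ : S →+* S) (h i : Fin m) : S :=
  D i (φ (zs h)) * ↑(Units.map (φ : S →* S) (zs h))⁻¹

/-- A Frobenius structure, relative to `φ`, on a `∇`-module over a ring `S` in which `π` is
invertible: a `φ`-linear map `F` whose linearization `φ^* M → M` is an isomorphism (i.e. which
carries bases to bases), with `∇ (F v) = (F ⊗ dφ) (∇ v)`, where `dφ` is the `φ`-linear map of `Ω¹`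
given by `dlog z_h ↦ dlog (φ z_h)`. -/
@[ext]
structure FrobStr (D : Fin m → Derivation 𝔬 S S) (zs : Fin m → Sˣ) (φ : S →+* S)
    (X : NablaMod.{u, w} D) where
  F : X.carrier →ₛₗ[φ] X.carrier
  isogeny : ∀ (n : ℕ) (b : Module.Basis (Fin n) S X.carrier),
    ∃ b' : Module.Basis (Fin n) S X.carrier, ∀ l, b' l = F (b l)
  compat : ∀ i v, X.Δ i (F v) = ∑ h, dlogCoeff D zs φ h i • F (X.Δ h v)

/-- An `(F, ∇)`-module over `S`, relative to `φ`. -/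
structure FNablaMod (D : Fin m → Derivation 𝔬 S S) (zs : Fin m → Sˣ) (φ : S →+* S) where
  base : NablaMod.{u, w} D
  frob : FrobStr D zs φ base

variable {zs : Fin m → Sˣ} {φ : S →+* S}

namespace FNablaMod

/-- Horizontal `F`-equivariant maps. -/
@[ext]
structure Hom (X Y : FNablaMod.{u, w} D zs φ) where
  hom : X.base ⟶ Y.base
  equivariant : ∀ v, hom.lin (X.frob.F v) = Y.frob.F (hom.lin v)

instance : Category (FNablaMod.{u, w} D zs φ) where
  Hom := Hom
  id X := ⟨𝟙 X.base, fun _ => rfl⟩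
  comp f g := ⟨f.hom ≫ g.hom, fun v => by
    change g.hom.lin (f.hom.lin _) = _
    rw [f.equivariant, g.equivariant]
    rfl⟩

end FNablaMod

/-- The underlying `∇`-module. -/
def forgetF (D : Fin m → Derivation 𝔬 S S) (zs : Fin m → Sˣ) (φ : S →+* S) :
    FNablaMod.{u, w} D zs φ ⥤ NablaMod.{u, w} D where
  obj X := X.base
  map f := f.hom

/-! ### The Taylor series -/

/-- `∏_i ∏_{l < j_i} (Δ_i - l)`. -/
def fallingDelta (X : NablaMod.{u, w} D) (J : Fin m → ℕ) : AddMonoid.End X.carrier :=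
  (List.ofFn fun i => ((List.range (J i)).map fun l : ℕ =>
    X.deltaEnd i - (l : AddMonoid.End X.carrier)).prod).prod

/-- `U ^ J F_1(Δ^J v) / J!` with `U_i = φ₂(z_i) / φ₁(z_i) - 1`. -/
def taylorTerm (φ₁ φ₂ : S →+* S) (X : NablaMod.{u, w} D) (F₁ : FrobStr D zs φ₁ X)
    (v : X.carrier) (J : Fin m → ℕ) : X.carrier :=
  (Ring.inverse ((∏ i, (J i).factorial : ℕ) : S) *
    ∏ i, (φ₂ (zs i) * ↑(Units.map (φ₁ : S →* S) (zs i))⁻¹ - 1) ^ J i) • F₁.F (fallingDelta X J v)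

/-- A notion of convergence in `S`, along filters. -/
abbrev Convergence (S : Type u) : Type (max 1 u) :=
  ∀ {ι : Type}, Filter ι → (ι → S) → S → Prop

/-- The series `∑_J f(J)` converges to `y` in the finite free module `M`: its coordinates in any
basis converge, the convergence being that of finite partial sums. -/
def SeriesConverges (conv : Convergence S) {M : Type w} [AddCommGroup M] [Module S M]
    (f : (Fin m → ℕ) → M) (y : M) : Prop :=
  ∀ (n : ℕ) (b : Module.Basis (Fin n) S M) (l : Fin n),
    conv atTop (fun A : Finset (Fin m → ℕ) => ∑ J ∈ A, b.repr (f J) l) (b.repr y l)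

/-- Continuity of a map `S → S`, in terms of sequences. -/
def SeqCont (conv : Convergence S) (f : S → S) : Prop :=
  ∀ (x : ℕ → S) (y : S), conv atTop x y → conv atTop (fun i => f (x i)) (f y)

end Modules

section Main

open CategoryTheory

universe u w

variable {𝔬 : Type*} [CommRing 𝔬] {L : Type*} [AddCommGroup L] [LinearOrder L]
  [IsOrderedAddMonoid L] {π : 𝔬} {lam : L →+ ℝ} {m : ℕ}

/-- `f` extends the map `g` of `Γ` to `S`, where `Γ_con → S` is given; in particular `g` preserves
`Γ_con`. -/
def ExtendsFromCon {S : Type u} (ι : GamCon π lam → S) (g : Gam π lam → Gam π lam) (f : S → S) :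
    Prop :=
  ∀ a : GamCon π lam, ∃ b : GamCon π lam, (b : Gam π lam) = g a ∧ f (ι a) = ι b

/-- The images in `S` of the monomials `{z_1}, …, {z_m}`, where `z` is a basis of `L`. -/
def coordUnits (z : Module.Basis (Fin m) ℤ L) {S : Type u} [CommRing S] [Algebra 𝔬 S]
    (ι : GamCon π lam →ₐ[𝔬] S) (i : Fin m) : Sˣ :=
  Units.map ((ι : GamCon π lam →+* S) : GamCon π lam →* S) (monoUnit π lam (z i))

/-- The change of Frobenius over `S` (either `Γ_con[1/π]` or `Γ_an,con`, with the canonical map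
`ι` from `Γ_con` and the convergence `conv`).  The derivations `∂_i` of `Γ` and the Frobenius lifts
`σ₁`, `σ₂` have continuous extensions `D_i`, `φ₁`, `φ₂` to `S` (unique, as `Γ_con[1/π]` is dense);
and there is an equivalence between the `(F, ∇)`-modules over `S` relative to `φ₁` and those
relative to `φ₂` that is the identity on the underlying `∇`-modules and their morphisms, and that
replaces `F₁` by `F₂(v) = ∑_J U ^ J F₁(Δ^J v) / J!`, a convergent series. -/
def ChangeOfFrobenius (z : Module.Basis (Fin m) ℤ L) (σ₁ σ₂ : Gam π lam →+* Gam π lam)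
    (S : Type u) [CommRing S] [Algebra 𝔬 S] (ι : GamCon π lam →ₐ[𝔬] S)
    (conv : Convergence S) : Prop :=
  ∃ (D : Fin m → Derivation 𝔬 S S) (φ₁ φ₂ : S →+* S),
    (∀ i, ExtendsFromCon ι (partialMu (z.coord i).toAddMonoidHom) (D i) ∧ SeqCont conv (D i)) ∧
    (ExtendsFromCon ι σ₁ φ₁ ∧ SeqCont conv φ₁) ∧
    (ExtendsFromCon ι σ₂ φ₂ ∧ SeqCont conv φ₂) ∧
    ∃ e : FNablaMod.{u, w} D (coordUnits z ι) φ₁ ≌ FNablaMod.{u, w} D (coordUnits z ι) φ₂,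
      e.functor ⋙ forgetF D (coordUnits z ι) φ₂ = forgetF D (coordUnits z ι) φ₁ ∧
      e.inverse ⋙ forgetF D (coordUnits z ι) φ₁ = forgetF D (coordUnits z ι) φ₂ ∧
      ∀ (X : NablaMod.{u, w} D) (F₁ : FrobStr D (coordUnits z ι) φ₁ X),
        ∃ F₂ : FrobStr D (coordUnits z ι) φ₂ X,
        e.functor.obj ⟨X, F₁⟩ = ⟨X, F₂⟩ ∧
        ∀ v, SeriesConverges conv (taylorTerm φ₁ φ₂ X F₁ v) (F₂.F v)

end Main

end FakeAnnulus

end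

open Filter Topology

noncomputable section

set_option linter.unusedSectionVars false

/-! Comparison of valuations. Modulo `π^(n+1)`, every element of the completed direct limit along
`σ` comes from all late terms of the direct system. A Teichmüller element is a `p^n`-th power, so
modulo `π^(n+1)` it is represented by some `y^(p^n)`, where `y` can be taken with coefficients that
are units or zero; all naive partial valuations of such a `y` coincide. Hence (`coe_le_vF_iff`) `c ≤
v_n(x)` holds if and only if `q^N c ≤ v_n^naive(σ^N x)` for all large `N`.

The monomials `{z_i}` and `{-z_i}` being overconvergent, one slope `ρ` gives `v_j({z}) ≥ λ(z) - ρ j`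
for all `z` and `j` (`exists_slope`). It follows that the bounds `c_i ≤ v_i(x)`, `i ≤ n`, mean the
same for the naive valuations and for those of `σ`, provided that `c` drops by at least `ρ` at each
step. From naive to `σ`, expand `x` into monomials and discard the tail by levelwise continuity;
conversely, subtract a lift of the residue class and divide by `π`. Now `w_r(x) ≥ C` is the family
of bounds `v_i(x) ≥ (C - i)/r`, which is steep enough for small `r`; so `w_r` and `Γ_r` agree. As
`σ` multiplies its own partial valuations by `q`, it also follows that `σ` maps `Γ_r` to `Γ_{r/q}`
with `w_{r/q}(σ x) ≥ w_r(x)` (`SlopeBound`).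

Change of Frobenius. Both coefficient rings are instances of `FrechetUnion`, an axiomatic union of
Fréchet rings with derivations. The quantities `u_i` and the coefficients of `dlog {z_h}^σ` are
overconvergent and divisible by `π`, so `w_s ≥ 1/2` on them for all small `s`. The series converges
by Dwork's trick (`IsLift.exists_taylor_bound`): by horizontality each application of `F` to a basis
gains `1/2` in the matrix of `∇` and divides the radius by `q`, so that at any small radius some
basis makes the matrix of `∇` as small as `(p^f)!`. A block of `p^f` consecutive factors of `∏ (Δ_i
- l)` then gains the valuation of `(p^f)!`, as it does for `∂_i`, where it multiplies coefficients
by products of consecutive integers. After division by `J!` the remaining loss is at most `|J|/8` up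
to a constant, against the gain `|J|/2` of `u^J`.

The formal properties of the sum `G` are identities of binomial polynomials in the commuting
operators `Δ_i`. Semilinearity over `{z_h}` is Pascal's rule, and it spreads to `S` by density and
continuity. Horizontality follows by differentiating term by term and shifting an index. For the
inverse, the product of two binomial polynomials expands with the coefficients of `(s + t + st)^l`,
and the quotients `u`, `u'` of the two directions satisfy `u + u' + u u' = 0`; so the composite
double series collapses to its constant term `F_1` (`IsTaylorSum.inverse`). This shows that the two
changes of Frobenius are mutually inverse, and that the image of `G` spans `M`, so that `G` carries
bases to bases. -/

namespace FakeAnnulus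

/-! ### The ring `Γ`: coefficients and naive partial valuations -/

section GamBasics

variable {𝔬 : Type*} [CommRing 𝔬] {L : Type*} [AddCommGroup L] [LinearOrder L]
  [IsOrderedAddMonoid L] {π : 𝔬} {lam : L →+ ℝ}

/-- `c ≤ v_n(x)`, for the naive partial valuations and a real number `c`. -/
def VGe (x : Gam π lam) (n : ℕ) (c : ℝ) : Prop :=
  ∀ z, (x.1 (n + 1)).coeff z ≠ 0 → c ≤ lam z

/-- `π` as an element of `Γ`. -/
abbrev piG (π : 𝔬) (lam : L →+ ℝ) : Gam π lam := algebraMap 𝔬 (Gam π lam) π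

theorem coe_le_vN_iff {c : ℝ} {n : ℕ} {x : Gam π lam} : (c : EReal) ≤ vN n x ↔ VGe x n c := by
  simp only [vN, VGe, le_iInf_iff, EReal.coe_le_coe_iff]

/-- The coefficient of `{z}` modulo `π ^ n`. -/
def coeffHom (n : ℕ) (z : L) : Gam π lam →+ 𝔬 ⧸ Ideal.span {π ^ n} where
  toFun x := (x.1 n).coeff z
  map_zero' := rfl
  map_add' _ _ := rfl

theorem coeffHom_apply (n : ℕ) (z : L) (x : Gam π lam) : coeffHom n z x = (x.1 n).coeff z := rfl

theorem Gam.ext_coeff {x y : Gam π lam} (h : ∀ n z, coeffHom n z x = coeffHom n z y) : x = y :=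
  Subtype.ext (funext fun n => HahnSeries.ext (funext fun z => h n z))

theorem coeffHom_algebraMap_mul (n : ℕ) (z : L) (c : 𝔬) (x : Gam π lam) :
    coeffHom n z (algebraMap 𝔬 _ c * x) = Ideal.Quotient.mk _ c * coeffHom n z x := by
  rw [← Algebra.smul_def]
  change c • (x.1 n).coeff z = _
  rw [Algebra.smul_def]
  rfl

theorem coeffHom_mono (n : ℕ) (z y : L) :
    coeffHom n y (mono π lam z) = if y = z then 1 else 0 := by
  change (HahnSeries.single z (1 : 𝔬 ⧸ Ideal.span {π ^ n})).coeff y = _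
  rw [HahnSeries.coeff_single]
  congr

theorem red_mk (n : ℕ) (c : 𝔬) :
    red π n (Ideal.Quotient.mk (Ideal.span {π ^ (n + 1)}) c) =
      Ideal.Quotient.mk (Ideal.span {π ^ n}) c := rfl

theorem coeffHom_eq_zero_of_le {x : Gam π lam} {i n : ℕ} {z : L} (h : i ≤ n)
    (hx : coeffHom n z x = 0) : coeffHom i z x = 0 := by
  have := coeff_of_le x z 0 h (by rw [map_zero]; exact hx)
  rwa [map_zero] at this

theorem mk_span_pow_eq_zero {n : ℕ} {c : 𝔬} :
    Ideal.Quotient.mk (Ideal.span {π ^ n}) c = 0 ↔ π ^ n ∣ c := by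
  rw [Ideal.Quotient.eq_zero_iff_mem, Ideal.mem_span_singleton]

theorem coeffHom_piG_pow_mul (n : ℕ) (z : L) (x : Gam π lam) :
    coeffHom n z (piG π lam ^ n * x) = 0 := by
  rw [← map_pow, coeffHom_algebraMap_mul, mk_span_pow_eq_zero.2 dvd_rfl, zero_mul]

theorem coeffHom_eq_zero_of_dvd {n : ℕ} {z : L} {x : Gam π lam} (h : piG π lam ^ n ∣ x) :
    coeffHom n z x = 0 := by
  obtain ⟨y, rfl⟩ := h
  exact coeffHom_piG_pow_mul n z y

/-- The condition `w(c) ≤ n` means that `c` is nonzero modulo `π^(n+1)`, so `v_n` only sees the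
class modulo that power; hence the exponent `n + 1`. -/
theorem VGe.congr {x y : Gam π lam} {n : ℕ} {c : ℝ} (h : piG π lam ^ (n + 1) ∣ x - y)
    (hx : VGe x n c) : VGe y n c := by
  intro z hz
  refine hx z ?_
  have := coeffHom_eq_zero_of_dvd (z := z) h
  rw [map_sub, sub_eq_zero] at this
  change coeffHom (n + 1) z x ≠ 0
  rw [this]
  exact hz

theorem VGe.le {x : Gam π lam} {n : ℕ} {c d : ℝ} (hx : VGe x n c) (h : d ≤ c) : VGe x n d :=
  fun z hz => h.trans (hx z hz)

theorem VGe.anti {x : Gam π lam} {i n : ℕ} {c : ℝ} (hx : VGe x n c) (h : i ≤ n) : VGe x i c :=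
  fun z hz => hx z fun h' => hz (coeffHom_eq_zero_of_le (Nat.succ_le_succ h) h')

theorem VGe.zero (n : ℕ) (c : ℝ) : VGe (0 : Gam π lam) n c := fun _ hz => absurd rfl hz

theorem VGe.add {x y : Gam π lam} {n : ℕ} {c : ℝ} (hx : VGe x n c) (hy : VGe y n c) :
    VGe (x + y) n c := by
  intro z hz
  by_cases h : (x.1 (n + 1)).coeff z = 0
  · refine hy z fun h' => hz ?_
    change coeffHom (n + 1) z (x + y) = 0
    rw [map_add, coeffHom_apply, coeffHom_apply, h, h', add_zero]
  · exact hx z h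

theorem VGe.neg {x : Gam π lam} {n : ℕ} {c : ℝ} (hx : VGe x n c) : VGe (-x) n c := by
  intro z hz
  refine hx z fun h => hz ?_
  change coeffHom (n + 1) z (-x) = 0
  rw [map_neg, coeffHom_apply, h, neg_zero]

theorem VGe.sub {x y : Gam π lam} {n : ℕ} {c : ℝ} (hx : VGe x n c) (hy : VGe y n c) :
    VGe (x - y) n c := by
  rw [sub_eq_add_neg]
  exact hx.add hy.neg

theorem VGe.sum {ι : Type*} {A : Finset ι} {f : ι → Gam π lam} {n : ℕ} {c : ℝ}
    (h : ∀ i ∈ A, VGe (f i) n c) : VGe (∑ i ∈ A, f i) n c := by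
  classical
  induction A using Finset.induction_on with
  | empty => exact VGe.zero n c
  | insert a A ha ih =>
    rw [Finset.sum_insert ha]
    exact (h a (by simp)).add (ih fun i hi => h i (by simp [hi]))

/-- A nonzero coefficient of `x y` modulo `π^(n+1)` has a contributing pair of coefficients of
valuations `i` and `j` with `i + j ≤ n`, so only such pairs of levels have to be tested. -/
theorem VGe.mul_of_forall {x y : Gam π lam} {n : ℕ} {c : ℝ}
    (h : ∀ i j, i + j ≤ n → ∃ a b, VGe x i a ∧ VGe y j b ∧ c ≤ a + b) : VGe (x * y) n c := by
  intro z hz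
  obtain ⟨u, v, i, j, rfl, hij, hu, hv⟩ := exists_of_coeff_mul x y hz
  obtain ⟨a, b, ha, hb, hc⟩ := h i j hij
  rw [map_add]
  linarith [ha u hu, hb v hv]

/-- Linear bounds of slope `-ρ` are multiplicative, since levels with `j + k ≤ i` lose together at
most `ρ i`. This propagates slopes from the `{±z_i}` to all monomials. -/
theorem VGe.mul_steep {x y : Gam π lam} {n : ℕ} {a b ρ : ℝ} (hρ : 0 ≤ ρ)
    (hx : ∀ i ≤ n, VGe x i (a - ρ * i)) (hy : ∀ i ≤ n, VGe y i (b - ρ * i)) :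
    ∀ i ≤ n, VGe (x * y) i (a + b - ρ * i) := by
  intro i hi
  refine VGe.mul_of_forall fun j k hjk => ⟨_, _, hx j (by omega), hy k (by omega), ?_⟩
  have : (j : ℝ) + k ≤ i := by exact_mod_cast hjk
  nlinarith

theorem VGe.mul {x y : Gam π lam} {n : ℕ} {a b : ℝ}
    (hx : VGe x n a) (hy : VGe y n b) : VGe (x * y) n (a + b) :=
  VGe.mul_of_forall fun _ _ _ => ⟨a, b, hx.anti (by omega), hy.anti (by omega), le_rfl⟩

theorem VGe.const (c : 𝔬) (n : ℕ) : VGe (algebraMap 𝔬 (Gam π lam) c) n 0 := by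
  intro z hz
  rw [(coeff_algebraMap_ne_zero hz).1, map_zero]

theorem VGe.one (n : ℕ) : VGe (1 : Gam π lam) n 0 := by
  simpa using VGe.const (π := π) (lam := lam) 1 n

theorem VGe.const_mul (c : 𝔬) {x : Gam π lam} {n : ℕ} {a : ℝ} (h : VGe x n a) :
    VGe (algebraMap 𝔬 _ c * x) n a := by
  simpa using (VGe.const c n).mul h

theorem VGe.pow {x : Gam π lam} {n : ℕ} {a : ℝ} (hx : VGe x n a) (k : ℕ) :
    VGe (x ^ k) n (k * a) := by
  induction k with
  | zero => simpa using VGe.one n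
  | succ k ih =>
    rw [pow_succ]
    exact (ih.mul hx).le (by push_cast; linarith)

theorem VGe.mono_self (z : L) (n : ℕ) : VGe (mono π lam z) n (lam z) := by
  intro y hy
  have : coeffHom (n + 1) y (mono π lam z) ≠ 0 := hy
  rw [coeffHom_mono] at this
  split_ifs at this with h
  · rw [h]
  · exact absurd rfl this

theorem VGe.exists_bound (x : Gam π lam) (n : ℕ) : ∃ c, VGe x n c := by
  obtain ⟨B, hB⟩ := ((x.2.1 (n + 1) 0).image lam).bddBelow
  refine ⟨min B 0, fun z hz => ?_⟩
  by_cases h0 : lam z ≤ 0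
  · exact (min_le_left _ _).trans (hB ⟨z, ⟨hz, h0⟩, rfl⟩)
  · exact (min_le_right _ _).trans (not_le.1 h0).le

theorem VGe.of_piG_pow_dvd {x : Gam π lam} {k n : ℕ} (hk : n < k) (h : piG π lam ^ k ∣ x) (c : ℝ) :
    VGe x n c := by
  intro z hz
  exact absurd (coeffHom_eq_zero_of_dvd (dvd_trans (pow_dvd_pow _ hk) h)) hz

theorem mono_pow (z : L) (k : ℕ) : mono π lam z ^ k = mono π lam (k • z) := by
  induction k with
  | zero => rw [pow_zero, zero_nsmul, mono_zero]
  | succ k ih => rw [pow_succ, ih, mono_mul_mono, succ_nsmul]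

variable [IsDomain 𝔬]

theorem coeffHom_piG_pow_mul_eq_zero (hπ : π ≠ 0) {k n : ℕ} {z : L} {x : Gam π lam} :
    coeffHom (k + n) z (piG π lam ^ k * x) = 0 ↔ coeffHom n z x = 0 := by
  obtain ⟨A, hA⟩ := Ideal.Quotient.mk_surjective (coeffHom (k + n) z x)
  have h1 : coeffHom n z x = Ideal.Quotient.mk _ A :=
    coeff_of_le x z A (by omega) hA.symm
  rw [← map_pow, coeffHom_algebraMap_mul, ← hA, h1, ← map_mul, mk_span_pow_eq_zero,
    mk_span_pow_eq_zero, pow_add, mul_dvd_mul_iff_left (pow_ne_zero _ hπ)]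

theorem piG_pow_mul_eq_zero (hπ : π ≠ 0) {k : ℕ} {x : Gam π lam} (h : piG π lam ^ k * x = 0) :
    x = 0 := by
  refine Gam.ext_coeff fun n z => ?_
  rw [map_zero, ← coeffHom_piG_pow_mul_eq_zero hπ (k := k), h, map_zero]

theorem piG_mul_left_cancel (hπ : π ≠ 0) {k : ℕ} {x y : Gam π lam}
    (h : piG π lam ^ k * x = piG π lam ^ k * y) : x = y :=
  sub_eq_zero.1 (piG_pow_mul_eq_zero hπ (k := k) (by rw [mul_sub, h, sub_self]))

theorem VGe.piG_pow_mul_iff (hπ : π ≠ 0) {k n : ℕ} {x : Gam π lam} {c : ℝ} :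
    VGe (piG π lam ^ k * x) (k + n) c ↔ VGe x n c := by
  refine forall_congr' fun z => imp_congr (not_congr ?_) Iff.rfl
  exact coeffHom_piG_pow_mul_eq_zero (n := n + 1) hπ

theorem VGe.piG_mul_iff (hπ : π ≠ 0) {n : ℕ} {x : Gam π lam} {c : ℝ} :
    VGe (piG π lam * x) (n + 1) c ↔ VGe x n c := by
  rw [← VGe.piG_pow_mul_iff hπ (k := 1) (x := x), pow_one, add_comm]

variable [IsDiscreteValuationRing 𝔬] [IsAdicComplete (IsLocalRing.maximalIdeal 𝔬) 𝔬]

theorem exists_limit (hπ : Irreducible π) (f : ℕ → 𝔬) (hf : ∀ n, π ^ n ∣ f (n + 1) - f n) :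
    ∃ c, ∀ n, π ^ n ∣ f n - c := by
  obtain ⟨c, hc⟩ := IsPrecomplete.prec (I := IsLocalRing.maximalIdeal 𝔬) (M := 𝔬) inferInstance
    (f := f) (by
      intro m n hmn
      rw [SModEq.sub_mem, smul_eq_mul, Ideal.mul_top, hπ.maximalIdeal_eq, Ideal.span_singleton_pow,
        Ideal.mem_span_singleton]
      induction n, hmn using Nat.le_induction with
      | base => simp
      | succ n hmn ih =>
        have := dvd_trans (pow_dvd_pow π hmn) (hf n)
        have := dvd_sub ih this
        rwa [show f m - f n - (f (n + 1) - f n) = f m - f (n + 1) by ring] at this)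
  refine ⟨c, fun n => ?_⟩
  have := hc n
  rwa [SModEq.sub_mem, smul_eq_mul, Ideal.mul_top, hπ.maximalIdeal_eq, Ideal.span_singleton_pow,
    Ideal.mem_span_singleton] at this

/-- The coefficients of an element of `Γ`, as elements of `𝔬`. -/
theorem exists_coeffs (hπ : Irreducible π) (x : Gam π lam) :
    ∃ c : L → 𝔬, ∀ n z, coeffHom n z x = Ideal.Quotient.mk _ (c z) := by
  have : ∀ z, ∃ c : 𝔬, ∀ n, coeffHom n z x = Ideal.Quotient.mk _ c := by
    intro z
    choose f hf using fun n => Ideal.Quotient.mk_surjective (coeffHom n z x)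
    obtain ⟨c, hc⟩ := exists_limit hπ f (fun n => by
      rw [← mk_span_pow_eq_zero, map_sub, hf, ← red_mk, hf, sub_eq_zero]
      exact x.2.2 n z)
    refine ⟨c, fun n => ?_⟩
    rw [← hf n, ← sub_eq_zero, ← map_sub, mk_span_pow_eq_zero]
    exact hc n
  choose c hc using this
  exact ⟨c, fun n z => hc z n⟩

/-- A strictly descending sequence in `s` would be infinite and stay in the finite part of `s` where
`λ` is at most its first value. -/
theorem isPWO_of_finite (hlam : StrictMono lam) {s : Set L}
    (h : ∀ b : ℝ, {z | z ∈ s ∧ lam z ≤ b}.Finite) : s.IsPWO := by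
  refine Set.IsWF.isPWO ?_
  rw [Set.isWF_iff_no_descending_seq]
  intro f hf hfs
  have h1 : Set.range f ⊆ {z | z ∈ s ∧ lam z ≤ lam (f 0)} := by
    rintro _ ⟨n, rfl⟩
    exact ⟨hfs n, hlam.monotone (hf.antitone (Nat.zero_le n))⟩
  exact (Set.infinite_range_of_injective hf.injective) ((h _).subset h1)

/-- Every family of coefficients subject to the finiteness conditions comes from `Γ`. -/
theorem exists_of_coeffs (hlam : StrictMono lam) (c : L → 𝔬)
    (h : ∀ n, ∀ b : ℝ, {z | ¬ π ^ n ∣ c z ∧ lam z ≤ b}.Finite) :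
    ∃ x : Gam π lam, ∀ n z, coeffHom n z x = Ideal.Quotient.mk _ (c z) := by
  have hw : ∀ n, {z | Ideal.Quotient.mk (Ideal.span {π ^ n}) (c z) ≠ 0}.IsPWO := fun n =>
    isPWO_of_finite hlam fun b => (h n b).subset fun z hz =>
      ⟨fun h' => hz.1 (mk_span_pow_eq_zero.2 h'), hz.2⟩
  let f : ∀ n, HahnSeries L (𝔬 ⧸ Ideal.span {π ^ n}) := fun n =>
    { coeff := fun z => Ideal.Quotient.mk _ (c z), isPWO_support' := hw n }
  have hf : f ∈ GamSub π lam := ⟨fun n b => (h n b).subset fun z hz =>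
      ⟨fun h' => hz.1 (mk_span_pow_eq_zero.2 h'), hz.2⟩, fun n z => rfl⟩
  exact ⟨⟨f, hf⟩, fun n z => rfl⟩

theorem finite_coeffs {x : Gam π lam} {c : L → 𝔬}
    (h : ∀ n z, coeffHom n z x = Ideal.Quotient.mk _ (c z)) (n : ℕ) (b : ℝ) :
    {z | ¬ π ^ n ∣ c z ∧ lam z ≤ b}.Finite := by
  refine (x.2.1 n b).subset ?_
  rintro z ⟨hz, hb⟩
  refine ⟨fun h' => hz ?_, hb⟩
  rw [← mk_span_pow_eq_zero, ← h]
  exact h'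

/-- Divide the coefficients by `π^n`; finiteness for the quotient modulo `π^k` is finiteness for `x`
modulo `π^(n+k)`. -/
theorem piG_pow_dvd_iff (hπ : Irreducible π) (hlam : StrictMono lam) {n : ℕ} {x : Gam π lam} :
    piG π lam ^ n ∣ x ↔ ∀ z, coeffHom n z x = 0 := by
  refine ⟨fun h z => coeffHom_eq_zero_of_dvd h, fun h => ?_⟩
  obtain ⟨c, hc⟩ := exists_coeffs hπ x
  have h1 : ∀ z, ∃ d, c z = π ^ n * d := fun z => by
    have := h z
    rwa [hc, mk_span_pow_eq_zero] at this
  choose d hd using h1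
  obtain ⟨y, hy⟩ := exists_of_coeffs hlam d (π := π) (fun k b => by
    refine (finite_coeffs hc (n + k) b).subset ?_
    rintro z ⟨hz, hb⟩
    refine ⟨fun h' => hz ?_, hb⟩
    rwa [hd, pow_add, mul_dvd_mul_iff_left (pow_ne_zero _ hπ.ne_zero)] at h')
  refine ⟨y, Gam.ext_coeff fun k z => ?_⟩
  rw [← map_pow, coeffHom_algebraMap_mul, hy, hc, hd, map_mul]

theorem isDomain_quotient (hπ : Irreducible π) : IsDomain (𝔬 ⧸ Ideal.span {π ^ 1}) := by
  rw [pow_one]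
  have : (Ideal.span {π}).IsPrime := (Ideal.span_singleton_prime hπ.ne_zero).2 hπ.prime
  infer_instance

/-- The reduction modulo `π` lies in a ring of Hahn series over a domain with linearly ordered
exponents, which is a domain. -/
theorem piG_prime (hπ : Irreducible π) (hlam : StrictMono lam) {x y : Gam π lam}
    (h : piG π lam ∣ x * y) : piG π lam ∣ x ∨ piG π lam ∣ y := by
  have := isDomain_quotient hπ
  rw [← pow_one (piG π lam), piG_pow_dvd_iff hπ hlam] at *
  rw [piG_pow_dvd_iff hπ hlam]
  have h1 : x.1 1 * y.1 1 = 0 := HahnSeries.ext (funext h)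
  rcases mul_eq_zero.1 h1 with h2 | h2
  · exact Or.inl fun z => by rw [coeffHom_apply, h2]; rfl
  · exact Or.inr fun z => by rw [coeffHom_apply, h2]; rfl

theorem piG_dvd_of_dvd_pow (hπ : Irreducible π) (hlam : StrictMono lam) {x : Gam π lam} {k : ℕ}
    (h : piG π lam ∣ x ^ k) : piG π lam ∣ x := by
  induction k with
  | zero =>
    rw [pow_zero] at h
    exact h.trans (one_dvd _)
  | succ k ih =>
    rw [pow_succ] at h
    exact (piG_prime hπ hlam h).elim ih id

theorem VGe.zero_iff_order (hlam : StrictMono lam) {x : Gam π lam} (h : x.1 1 ≠ 0) {c : ℝ} :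
    VGe x 0 c ↔ c ≤ lam (x.1 1).order := by
  constructor
  · intro h'
    exact h' _ (HahnSeries.coeff_order_eq_zero.not.2 h)
  · intro h' z hz
    exact h'.trans (hlam.monotone (HahnSeries.order_le_of_coeff_ne_zero hz))

/-- At level `0` there is a genuine valuation, the order of a Hahn series over a domain, and this is
additive; at higher levels only one implication would survive. -/
theorem VGe.pow_zero_iff (hπ : Irreducible π) (hlam : StrictMono lam) {x : Gam π lam} {k : ℕ}
    (hk : 0 < k) {c : ℝ} : VGe (x ^ k) 0 (k * c) ↔ VGe x 0 c := by
  refine ⟨fun h => ?_, fun h => h.pow k⟩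
  have := isDomain_quotient hπ
  by_cases h0 : x.1 1 = 0
  · intro z hz
    rw [zero_add, h0] at hz
    exact absurd rfl hz
  have h1 : (x ^ k).1 1 = (x.1 1) ^ k := rfl
  rw [VGe.zero_iff_order hlam (by rw [h1]; exact pow_ne_zero _ h0), h1, HahnSeries.order_pow,
    map_nsmul, nsmul_eq_mul] at h
  rw [VGe.zero_iff_order hlam h0]
  exact le_of_mul_le_mul_left h (by exact_mod_cast hk)

/-- An element of `Γ` has a lift of its reduction modulo `π` whose coefficients are units or
zero. -/
theorem exists_sparse_lift (hπ : Irreducible π) (hlam : StrictMono lam) (x : Gam π lam) :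
    ∃ y : Gam π lam, piG π lam ∣ x - y ∧ ∀ n c, VGe x 0 c → VGe y n c := by
  classical
  obtain ⟨c, hc⟩ := exists_coeffs hπ x
  obtain ⟨y, hy⟩ := exists_of_coeffs (π := π) hlam (fun z => if π ^ 1 ∣ c z then 0 else c z)
    (fun n b => by
      refine (finite_coeffs hc 1 b).subset ?_
      rintro z ⟨hz, hb⟩
      refine ⟨fun h => hz ?_, hb⟩
      simp only [if_pos h, dvd_zero])
  -- The nonzero coefficients of `y` are units, so a coefficient that survives at any level already
  -- survives modulo `π`: all `v_n(y)` equal `v_0(x)`.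
  refine ⟨y, ?_, fun n d hd z hz => hd z ?_⟩
  · rw [← pow_one (piG π lam), piG_pow_dvd_iff hπ hlam]
    intro z
    rw [map_sub, hc, hy, sub_eq_zero]
    split_ifs with h
    · rw [map_zero, mk_span_pow_eq_zero.2 h]
    · rfl
  · intro h
    have h1 : coeffHom (0 + 1) z x = 0 := h
    have h2 : coeffHom (n + 1) z y ≠ 0 := hz
    rw [hc, mk_span_pow_eq_zero] at h1
    rw [hy] at h2
    rw [if_pos h1, map_zero] at h2
    exact h2 rfl

/-- Modulo `π ^ n` and up to a part of large valuation, an element of `Γ` is a finite sum of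
monomials. -/
theorem exists_finite_approx (hπ : Irreducible π) (hlam : StrictMono lam) (x : Gam π lam) :
    ∃ (c : L → 𝔬) (T : ℕ → Gam π lam), (∀ n z, coeffHom n z x = Ideal.Quotient.mk _ (c z)) ∧
      (∀ k n, VGe (T k) n k) ∧
      ∀ k n, ∃ A : Finset L,
        piG π lam ^ n ∣ x - T k - ∑ z ∈ A, algebraMap 𝔬 _ (c z) * mono π lam z := by
  classical
  obtain ⟨c, hc⟩ := exists_coeffs hπ x
  -- The tail `T k` collects the terms with `λ(z) > k`; what remains has finitely many terms modulo
  -- each `π^n`.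
  have h1 : ∀ k : ℕ, ∃ t : Gam π lam, ∀ n z, coeffHom n z t =
      Ideal.Quotient.mk _ (if lam z ≤ k then 0 else c z) := fun k =>
    exists_of_coeffs (π := π) hlam _ (fun n b => by
      refine (finite_coeffs hc n b).subset ?_
      rintro z ⟨hz, hb⟩
      refine ⟨fun h => hz ?_, hb⟩
      split_ifs
      · exact dvd_zero _
      · exact h)
  choose T hT using h1
  refine ⟨c, T, hc, fun k n z hz => ?_, fun k n => ⟨(finite_coeffs hc n k).toFinset, ?_⟩⟩
  · by_contra h
    have h2 : coeffHom (n + 1) z (T k) ≠ 0 := hz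
    rw [hT, if_pos (not_le.1 h).le, map_zero] at h2
    exact h2 rfl
  · rw [piG_pow_dvd_iff hπ hlam]
    intro y
    rw [map_sub, map_sub, map_sum, hc, hT]
    simp only [coeffHom_algebraMap_mul, coeffHom_mono, mul_ite, mul_one, mul_zero]
    rw [Finset.sum_ite_eq]
    simp only [Set.Finite.mem_toFinset, Set.mem_ofPred_eq]
    by_cases hy : lam y ≤ k
    · simp only [hy, and_true, if_true, map_zero, sub_zero]
      split_ifs with h
      · rw [sub_zero, mk_span_pow_eq_zero]
        exact not_not.1 (by simpa using h)
      · exact sub_self _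
    · simp [hy]

end GamBasics

/-! ### The Frobenius lift of the base ring -/

section Base

variable {𝔬 : Type*} [CommRing 𝔬] [IsDomain 𝔬] [IsDiscreteValuationRing 𝔬]

theorem pi_dvd_prime {p : ℕ} [CharP (IsLocalRing.ResidueField 𝔬) p] {π : 𝔬}
    (hπ : Irreducible π) : π ∣ (p : 𝔬) := by
  rw [← Ideal.mem_span_singleton, ← hπ.maximalIdeal_eq, ← IsLocalRing.residue_eq_zero_iff,
    map_natCast, CharP.cast_eq_zero]

/-- A lift of Frobenius on `𝔬` preserves the valuation. -/
theorem exists_unit_map_pi [CharZero 𝔬] {p : ℕ} [Fact p.Prime]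
    [CharP (IsLocalRing.ResidueField 𝔬) p] {q : ℕ} (hq : 0 < q) {π : 𝔬} (hπ : Irreducible π)
    {σK : 𝔬 →+* 𝔬} (hσK : ∀ c, π ∣ σK c - c ^ q) : ∃ u : 𝔬ˣ, σK π = u * π := by
  have hp0 : (p : 𝔬) ≠ 0 := by exact_mod_cast (Fact.out : p.Prime).ne_zero
  -- The integer `p` is fixed by `σ_K`. Comparing `p = v π^e` with its image, where `σ_K π = π w`,
  -- shows that `w^e` is a unit; `e` is positive because `π` divides `p`.
  obtain ⟨e, v, hv⟩ := IsDiscreteValuationRing.eq_unit_mul_pow_irreducible hp0 hπ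
  have he : e ≠ 0 := by
    rintro rfl
    rw [pow_zero, mul_one] at hv
    have := pi_dvd_prime (p := p) hπ
    rw [hv] at this
    exact hπ.not_isUnit (isUnit_of_dvd_unit this v.isUnit)
  obtain ⟨w, hw⟩ : π ∣ σK π := by
    have := dvd_add (hσK π) (dvd_pow_self π hq.ne')
    rwa [sub_add_cancel] at this
  have h1 : (v : 𝔬) * π ^ e = σK v * w ^ e * π ^ e := by
    have := congrArg σK hv
    rw [map_natCast, map_mul, map_pow, hw, mul_pow, hv] at this
    rw [this]; ring
  have h2 := mul_right_cancel₀ (pow_ne_zero _ hπ.ne_zero) h1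
  have h3 : IsUnit w := by
    have : w ∣ v := by rw [h2]; exact dvd_mul_of_dvd_right (dvd_pow_self w he) _
    exact isUnit_of_dvd_unit this v.isUnit
  exact ⟨h3.unit, by rw [hw, mul_comm]; rfl⟩

end Base

/-! ### Iterates of a Frobenius lift, and the completed direct limit -/

section Lift

variable {𝔬 : Type*} [CommRing 𝔬] {L : Type*} [AddCommGroup L] [LinearOrder L]
  [IsOrderedAddMonoid L] {π : 𝔬} {lam : L →+ ℝ} {q : ℕ} {σK : 𝔬 →+* 𝔬}
  {σ : Gam π lam →+* Gam π lam}

theorem IsFrobeniusLift.pow_algebraMap (hσ : IsFrobeniusLift q σK σ) (N : ℕ) (c : 𝔬) :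
    (σ ^ N) (algebraMap 𝔬 _ c) = algebraMap 𝔬 _ ((σK ^ N) c) := by
  induction N with
  | zero => rfl
  | succ N ih =>
    rw [pow_succ', pow_succ', RingHom.mul_def, RingHom.mul_def, RingHom.comp_apply,
      RingHom.comp_apply, ih, hσ.extends_base]

theorem IsFrobeniusLift.pow_piG (hσ : IsFrobeniusLift q σK σ) (hσπ : ∃ u : 𝔬ˣ, σK π = u * π)
    (N : ℕ) : ∃ u : 𝔬ˣ, (σ ^ N) (piG π lam) = algebraMap 𝔬 _ (u : 𝔬) * piG π lam := by
  obtain ⟨u, hu⟩ := hσπ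
  induction N with
  | zero => exact ⟨1, by simp⟩
  | succ N ih =>
    obtain ⟨v, hv⟩ := ih
    refine ⟨Units.map (σK : 𝔬 →* 𝔬) v * u, ?_⟩
    rw [pow_succ', RingHom.mul_def, RingHom.comp_apply, hv, map_mul, hσ.extends_base,
      hσ.extends_base, hu, map_mul, ← mul_assoc, Units.val_mul, map_mul]
    rfl

theorem piG_pow_dvd_of_unit_mul {u : 𝔬ˣ} {n : ℕ} {x : Gam π lam}
    (h : piG π lam ^ n ∣ algebraMap 𝔬 _ (u : 𝔬) * x) : piG π lam ^ n ∣ x := by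
  obtain ⟨y, hy⟩ := h
  refine ⟨algebraMap 𝔬 _ (↑u⁻¹ : 𝔬) * y, ?_⟩
  rw [mul_left_comm, ← hy, ← mul_assoc, ← map_mul, Units.inv_mul, map_one, one_mul]

theorem IsFrobeniusLift.piG_pow_dvd (hσ : IsFrobeniusLift q σK σ) (hσπ : ∃ u : 𝔬ˣ, σK π = u * π)
    (N : ℕ) {n : ℕ} {x : Gam π lam} (h : piG π lam ^ n ∣ x) : piG π lam ^ n ∣ (σ ^ N) x := by
  obtain ⟨y, rfl⟩ := h
  obtain ⟨u, hu⟩ := hσ.pow_piG hσπ N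
  rw [map_mul, map_pow, hu, mul_pow]
  exact ⟨algebraMap 𝔬 _ (u : 𝔬) ^ n * (σ ^ N) y, by ring⟩

variable [IsDomain 𝔬] [IsDiscreteValuationRing 𝔬]
  [IsAdicComplete (IsLocalRing.maximalIdeal 𝔬) 𝔬]

/-- Modulo `π` the map `σ` is the `q`-power map, which kills nothing nonzero. Having divided `x` by
`π`, which `σ` sends to a unit multiple of itself, one repeats. -/
theorem IsFrobeniusLift.dvd_of_map (hσ : IsFrobeniusLift q σK σ)
    (hσπ : ∃ u : 𝔬ˣ, σK π = u * π) (hπ : Irreducible π) (hlam : StrictMono lam) {n : ℕ}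
    {x : Gam π lam} (h : piG π lam ^ n ∣ σ x) : piG π lam ^ n ∣ x := by
  induction n generalizing x with
  | zero => simp
  | succ n ih =>
    have h1 : piG π lam ∣ x := by
      refine piG_dvd_of_dvd_pow hπ hlam (k := q) ?_
      have h2 : piG π lam ∣ σ x := (dvd_pow_self _ (Nat.succ_ne_zero n)).trans h
      have := dvd_sub h2 (hσ.lifts_pow x)
      rwa [sub_sub_cancel] at this
    obtain ⟨y, rfl⟩ := h1
    obtain ⟨u, hu⟩ := hσ.pow_piG hσπ 1
    rw [pow_one] at hu
    rw [map_mul, hu, mul_assoc] at h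
    obtain ⟨t, ht⟩ := piG_pow_dvd_of_unit_mul h
    have h3 : σ y = piG π lam ^ n * t := by
      refine piG_mul_left_cancel hπ.ne_zero (k := 1) ?_
      rw [pow_one, ht, pow_succ']
      ring
    rw [pow_succ']
    exact mul_dvd_mul_left _ (ih ⟨t, h3⟩)

theorem IsFrobeniusLift.dvd_of_pow_map (hσ : IsFrobeniusLift q σK σ)
    (hσπ : ∃ u : 𝔬ˣ, σK π = u * π) (hπ : Irreducible π) (hlam : StrictMono lam) {N n : ℕ}
    {x : Gam π lam} (h : piG π lam ^ n ∣ (σ ^ N) x) : piG π lam ^ n ∣ x := by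
  induction N with
  | zero => exact h
  | succ N ih =>
    rw [pow_succ', RingHom.mul_def, RingHom.comp_apply] at h
    exact ih (hσ.dvd_of_map hσπ hπ hlam h)

theorem eq_zero_of_forall_dvd {x : Gam π lam} (h : ∀ n, piG π lam ^ n ∣ x) : x = 0 :=
  Gam.ext_coeff fun n z => by rw [map_zero, coeffHom_eq_zero_of_dvd (h n)]

/-- On the residue ring `σ^N` is the `q^N`-power map, and there `v` is multiplicative. -/
theorem IsFrobeniusLift.vGe_zero (hσ : IsFrobeniusLift q σK σ) (hq : 0 < q)
    (hπ : Irreducible π) (hlam : StrictMono lam) (N : ℕ) {x : Gam π lam} {c : ℝ} :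
    VGe ((σ ^ N) x) 0 ((q : ℝ) ^ N * c) ↔ VGe x 0 c := by
  induction N with
  | zero =>
    rw [pow_zero, pow_zero, one_mul]
    rfl
  | succ N ih =>
    rw [← ih, ← VGe.pow_zero_iff hπ hlam hq (x := (σ ^ N) x), pow_succ', pow_succ',
      RingHom.mul_def, RingHom.comp_apply, mul_assoc]
    have h := hσ.lifts_pow ((σ ^ N) x)
    constructor
    · exact VGe.congr (by simpa using h)
    · exact VGe.congr (by rw [← dvd_neg]; simpa using h)

/-! ### The perfection -/

theorem Colim.of_apply_eq (σ : Gam π lam →+* Gam π lam) {i j : ℕ} (h : i ≤ j) (y : Gam π lam) :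
    Colim.of σ j ((σ ^ (j - i)) y) = Colim.of σ i y :=
  Ring.DirectLimit.of_f (G := fun _ : ℕ => Gam π lam) (f := fun i j _ => ⇑(σ ^ (j - i))) h y

instance (σ : Gam π lam →+* Gam π lam) :
    DirectedSystem (fun _ : ℕ => Gam π lam) (fun i j (_ : i ≤ j) => ⇑(σ ^ (j - i))) where
  map_self i x := by simp
  map_map k j i hij hjk x := by
    rw [← RingHom.comp_apply, ← RingHom.mul_def, ← pow_add]
    congr 2
    omega

theorem Colim.of_injective (hσ : IsFrobeniusLift q σK σ)
    (hσπ : ∃ u : 𝔬ˣ, σK π = u * π) (hπ : Irreducible π) (hlam : StrictMono lam) (i : ℕ) :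
    Function.Injective (Colim.of σ i) := by
  refine Ring.DirectLimit.of_injective (G := fun _ : ℕ => Gam π lam)
    (fun i j _ => σ ^ (j - i)) (fun i j hij => ?_) i
  refine (injective_iff_map_eq_zero _).2 fun x hx => eq_zero_of_forall_dvd fun n =>
    hσ.dvd_of_pow_map hσπ hπ hlam (N := j - i) ?_
  rw [hx]
  exact dvd_zero _

theorem Colim.exists_of (x : Colim σ) : ∃ N0, ∀ N ≥ N0, ∃ y, Colim.of σ N y = x := by
  obtain ⟨i, y, rfl⟩ := Ring.DirectLimit.exists_of x
  exact ⟨i, fun N hN => ⟨_, Colim.of_apply_eq σ hN y⟩⟩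

/-- The image of `π` from the `N`-th term is a unit multiple of `π`. -/
theorem Colim.of_piG (hσ : IsFrobeniusLift q σK σ)
    (hσπ : ∃ u : 𝔬ˣ, σK π = u * π) (N : ℕ) :
    ∃ u : 𝔬ˣ, Colim.of σ 0 (piG π lam) = Colim.of σ N (algebraMap 𝔬 _ (u : 𝔬) * piG π lam) := by
  obtain ⟨u, hu⟩ := hσ.pow_piG hσπ N
  exact ⟨u, by rw [← hu, ← Colim.of_apply_eq σ (Nat.zero_le N)]; rfl⟩

theorem Colim.dvd_iff (hσ : IsFrobeniusLift q σK σ)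
    (hσπ : ∃ u : 𝔬ˣ, σK π = u * π) (hπ : Irreducible π) (hlam : StrictMono lam) {N n : ℕ}
    {y : Gam π lam} :
    Colim.of σ 0 (piG π lam) ^ n ∣ Colim.of σ N y ↔ piG π lam ^ n ∣ y := by
  constructor
  · rintro ⟨w, hw⟩
    obtain ⟨M, hM⟩ := Colim.exists_of w
    obtain ⟨t, rfl⟩ := hM (max M N) (le_max_left _ _)
    obtain ⟨u, hu⟩ := Colim.of_piG (lam := lam) hσ hσπ (max M N)
    rw [hu, ← Colim.of_apply_eq σ (le_max_right M N), ← map_pow, ← map_mul] at hw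
    have h := Colim.of_injective hσ hσπ hπ hlam _ hw
    refine hσ.dvd_of_pow_map hσπ hπ hlam (N := max M N - N) ?_
    rw [h, mul_pow]
    exact ⟨algebraMap 𝔬 _ (u : 𝔬) ^ n * t, by ring⟩
  · rintro ⟨t, rfl⟩
    obtain ⟨u, hu⟩ := Colim.of_piG (lam := lam) hσ hσπ N
    rw [hu, ← map_pow]
    refine map_dvd _ ⟨algebraMap 𝔬 _ (↑u⁻¹ : 𝔬) ^ n * t, ?_⟩
    have : algebraMap 𝔬 (Gam π lam) (u : 𝔬) * algebraMap 𝔬 _ (↑u⁻¹ : 𝔬) = 1 := by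
      rw [← map_mul, Units.mul_inv, map_one]
    calc _ = (algebraMap 𝔬 (Gam π lam) (u : 𝔬) * algebraMap 𝔬 _ (↑u⁻¹ : 𝔬)) ^ n *
          (piG π lam ^ n * t) := by rw [this, one_pow, one_mul]
      _ = _ := by ring

/-- For a finitely generated ideal `I`, the kernel of the projection of the completion to the
quotient by `I^n` is `I^n` times the completion, and here `I^n` is principal. -/
theorem Perf.pow_dvd_iff {n : ℕ} {ξ : Perf σ} :
    Perf.pi σ ^ n ∣ ξ ↔ AdicCompletion.evalₐ _ n ξ = 0 := by
  set I : Ideal (Colim σ) := Ideal.span {Colim.of σ 0 (piG π lam)} with hI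
  have hfg : I.FG := ⟨{Colim.of σ 0 (piG π lam)}, by simp [hI]⟩
  have hIn : I ^ n = Ideal.span {Colim.of σ 0 (piG π lam) ^ n} := Ideal.span_singleton_pow _ _
  have h1 : AdicCompletion.evalₐ I n ξ = 0 ↔ AdicCompletion.eval I (Colim σ) n ξ = 0 := by
    constructor <;> intro h
    · have := AdicCompletion.factor_evalₐ_eq_eval I ξ (n := n) (by simp)
      rw [h, map_zero] at this
      exact this.symm
    · have := AdicCompletion.factor_eval_eq_evalₐ I ξ (n := n) (by simp)
      rw [h] at this
      rw [← this]
      exact map_zero _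
  rw [h1, ← LinearMap.mem_ker, ← AdicCompletion.pow_smul_top_eq_ker_eval hfg, hIn,
    Submodule.ideal_span_singleton_smul, Submodule.mem_smul_pointwise_iff_exists]
  constructor
  · rintro ⟨c, rfl⟩
    exact ⟨c, trivial, by rw [Algebra.smul_def, map_pow]; rfl⟩
  · rintro ⟨c, -, rfl⟩
    exact ⟨c, by rw [Algebra.smul_def, map_pow]; rfl⟩

theorem Perf.exists_of (ξ : Perf σ) (n : ℕ) :
    ∃ N0, ∀ N ≥ N0, ∃ y, Perf.pi σ ^ n ∣ ξ - Perf.of σ N y := by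
  obtain ⟨x, hx⟩ := Ideal.Quotient.mk_surjective (AdicCompletion.evalₐ _ n ξ)
  obtain ⟨N0, hN⟩ := Colim.exists_of x
  refine ⟨N0, fun N h => ?_⟩
  obtain ⟨y, rfl⟩ := hN N h
  refine ⟨y, Perf.pow_dvd_iff.2 ?_⟩
  rw [map_sub, sub_eq_zero, ← hx]
  exact (AdicCompletion.evalₐ_of _ n _).symm

theorem Perf.pow_dvd_of_iff (hσ : IsFrobeniusLift q σK σ)
    (hσπ : ∃ u : 𝔬ˣ, σK π = u * π) (hπ : Irreducible π) (hlam : StrictMono lam) {N n : ℕ}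
    {y : Gam π lam} :
    Perf.pi σ ^ n ∣ Perf.of σ N y ↔ piG π lam ^ n ∣ y := by
  rw [Perf.pow_dvd_iff, ← Colim.dvd_iff hσ hσπ hπ hlam (N := N)]
  have : AdicCompletion.evalₐ (Ideal.span {Colim.of σ 0 (piG π lam)}) n (Perf.of σ N y) =
      Ideal.Quotient.mk _ (Colim.of σ N y) := AdicCompletion.evalₐ_of _ n _
  rw [this, Ideal.Quotient.eq_zero_iff_mem, Ideal.span_singleton_pow, Ideal.mem_span_singleton]

theorem Perf.of_apply_eq (σ : Gam π lam →+* Gam π lam) {i j : ℕ} (h : i ≤ j) (y : Gam π lam) :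
    Perf.of σ j ((σ ^ (j - i)) y) = Perf.of σ i y := by
  rw [Perf.of, RingHom.comp_apply, Colim.of_apply_eq σ h, Perf.of, RingHom.comp_apply]

theorem Perf.pi_eq (hσ : IsFrobeniusLift q σK σ)
    (hσπ : ∃ u : 𝔬ˣ, σK π = u * π) (N : ℕ) :
    ∃ u : 𝔬ˣ, Perf.pi σ = Perf.of σ N (algebraMap 𝔬 _ (u : 𝔬) * piG π lam) := by
  obtain ⟨u, hu⟩ := Colim.of_piG (lam := lam) hσ hσπ N
  exact ⟨u, congrArg (algebraMap (Colim σ) (Perf σ)) hu⟩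

/-- Cancellation of `π` is tested on an approximation modulo `π^(n+1)` by an element of `Γ` from
some term of the system, where `π` is a nonzerodivisor. -/
theorem Perf.pow_succ_dvd_pi_mul_iff (hσ : IsFrobeniusLift q σK σ)
    (hσπ : ∃ u : 𝔬ˣ, σK π = u * π) (hπ : Irreducible π) (hlam : StrictMono lam) {n : ℕ}
    {ξ : Perf σ} :
    Perf.pi σ ^ (n + 1) ∣ Perf.pi σ * ξ ↔ Perf.pi σ ^ n ∣ ξ := by
  constructor
  · intro h
    obtain ⟨N, hN⟩ := Perf.exists_of ξ (n + 1)
    obtain ⟨y, hy⟩ := hN N le_rfl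
    obtain ⟨u, hu⟩ := Perf.pi_eq (lam := lam) hσ hσπ N
    have h1 : Perf.pi σ ^ (n + 1) ∣ Perf.pi σ * Perf.of σ N y := by
      have h0 := dvd_sub h (dvd_mul_of_dvd_right hy (Perf.pi σ))
      rwa [mul_sub, sub_sub_cancel] at h0
    have h2 : Perf.pi σ * Perf.of σ N y =
        Perf.of σ N (algebraMap 𝔬 _ (u : 𝔬) * (piG π lam * y)) := by
      rw [← mul_assoc, map_mul _ _ y, ← hu]
    rw [h2, Perf.pow_dvd_of_iff hσ hσπ hπ hlam] at h1
    obtain ⟨t, ht⟩ := piG_pow_dvd_of_unit_mul h1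
    have h3 : y = piG π lam ^ n * t := by
      refine piG_mul_left_cancel hπ.ne_zero (k := 1) ?_
      rw [pow_one, ht, pow_succ']
      ring
    have h4 := (Perf.pow_dvd_of_iff hσ hσπ hπ hlam (N := N) (n := n)).2 ⟨t, h3⟩
    have h5 := dvd_add ((pow_dvd_pow _ (Nat.le_succ n)).trans hy) h4
    rwa [sub_add_cancel] at h5
  · intro h
    rw [pow_succ']
    exact mul_dvd_mul_left _ h

/-- Every element of the perfection is congruent modulo `π` to a Teichmüller representative. -/
theorem Perf.exists_teichmuller {p a : ℕ} [Fact p.Prime] (ha : 0 < a) (hpπ : π ∣ (p : 𝔬))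
    (hσ : IsFrobeniusLift (p ^ a) σK σ)
    (hσπ : ∃ u : 𝔬ˣ, σK π = u * π) (hπ : Irreducible π) (hlam : StrictMono lam) (ξ : Perf σ) :
    ∃ t : Perf σ, (∀ n, ∃ s, s ^ p ^ n = t) ∧ ξ - t ∈ Ideal.span {Perf.pi σ} := by
  -- The ideal `(π)` is written as an extended ideal, since that is the form in which the completion
  -- is known to be complete.
  set J : Ideal (Perf σ) := (Ideal.span {Colim.of σ 0 (piG π lam)}).map
    (algebraMap (Colim σ) (Perf σ)) with hJ
  have hJ' : J = Ideal.span {Perf.pi σ} := by rw [hJ, Ideal.map_span, Set.image_singleton]; rfl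
  have hc : IsAdicComplete J (Perf σ) := (IsAdicComplete.map_algebraMap_iff _ _).mpr
    (AdicCompletion.isAdicComplete ⟨{Colim.of σ 0 (piG π lam)}, by simp⟩)
  have hpJ : (p : Perf σ) ∈ J := by
    obtain ⟨d, hd⟩ := hpπ
    rw [hJ', Ideal.mem_span_singleton]
    refine ⟨Perf.of σ 0 (algebraMap 𝔬 _ d), ?_⟩
    rw [← map_mul, ← map_mul, ← hd, map_natCast, map_natCast]
  have hnt : Nontrivial (Perf σ ⧸ J) := by
    rw [Ideal.Quotient.nontrivial_iff, Ne, Ideal.eq_top_iff_one, hJ', Ideal.mem_span_singleton, ← pow_one (Perf.pi σ),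
      ← map_one (Perf.of σ 0), Perf.pow_dvd_of_iff hσ hσπ hπ hlam, piG_pow_dvd_iff hπ hlam]
    intro h
    have h0 := h 0
    rw [← mono_zero, coeffHom_mono, if_pos rfl] at h0
    have := isDomain_quotient hπ
    exact one_ne_zero h0
  have hch : CharP (Perf σ ⧸ J) p := by
    refine (CharP.charP_iff_prime_eq_zero (Fact.out : p.Prime)).2 ?_
    rw [← map_natCast (Ideal.Quotient.mk J), Ideal.Quotient.eq_zero_iff_mem]
    exact hpJ
  -- The element `y` of the `N`-th term is identified with `σ y` of the next term, which is
  -- `y^(p^a)` modulo `π`. As `a > 0`, it is a `p`-th power there.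
  have hsurj : Function.Surjective (frobenius (Perf σ ⧸ J) p) := by
    intro x
    obtain ⟨η, rfl⟩ := Ideal.Quotient.mk_surjective x
    obtain ⟨N, hN⟩ := Perf.exists_of η 1
    obtain ⟨y, hy⟩ := hN N le_rfl
    obtain ⟨b, rfl⟩ := Nat.exists_eq_succ_of_ne_zero ha.ne'
    refine ⟨Ideal.Quotient.mk J (Perf.of σ (N + 1) y ^ p ^ b), ?_⟩
    rw [frobenius_def, ← map_pow, ← pow_mul, ← pow_succ, Ideal.Quotient.eq, hJ',
      Ideal.mem_span_singleton, ← pow_one (Perf.pi σ)]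
    have h1 := (Perf.pow_dvd_of_iff hσ hσπ hπ hlam (N := N + 1) (n := 1)
      (y := σ y - y ^ p ^ (b + 1))).2 (by rw [pow_one]; exact hσ.lifts_pow y)
    have h2 := Perf.of_apply_eq σ (Nat.le_succ N) y
    rw [Nat.succ_sub (le_refl N), Nat.sub_self, pow_one] at h2
    rw [map_sub, map_pow, h2] at h1
    have := (dvd_neg.2 (dvd_add hy h1))
    rwa [sub_add_sub_cancel, neg_sub] at this
  -- Surjectivity of Frobenius lifts the residue class of `ξ` to the perfection. The multiplicative
  -- Teichmüller map carries the `p^n`-th roots that exist there to roots in the completion.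
  obtain ⟨f, hf⟩ := Perfection.coeff_surjective hsurj 0 (Ideal.Quotient.mk J ξ)
  refine ⟨Perfection.teichmuller p J f, fun n => ?_, ?_⟩
  · have h1 : ∀ n (g : Perfection (Perf σ ⧸ J) p), ∃ s, s ^ p ^ n = g := by
      intro n
      induction n with
      | zero => exact fun g => ⟨g, by simp⟩
      | succ n ih =>
        intro g
        obtain ⟨s, hs⟩ := ih (Perfection.pthRoot _ p g)
        refine ⟨s, ?_⟩
        rw [pow_succ, pow_mul, hs]
        exact congrFun (congrArg DFunLike.coe (Perfection.frobenius_pthRoot (R := Perf σ ⧸ J) (p := p))) g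
    obtain ⟨s, hs⟩ := h1 n f
    exact ⟨Perfection.teichmuller p J s, by rw [← map_pow, hs]⟩
  · have := Perfection.teichmuller_sModEq (n := 0) hf.symm
    rw [SModEq.sub_mem, zero_add, pow_zero, pow_one, pow_one, ← neg_mem_iff, neg_sub] at this
    rwa [← hJ']

/-- Every element of `Γ` has a Teichmüller expansion. -/
theorem exists_isTeichmullerExpansion {p a : ℕ} [Fact p.Prime] (ha : 0 < a) (hpπ : π ∣ (p : 𝔬))
    (hσ : IsFrobeniusLift (p ^ a) σK σ)
    (hσπ : ∃ u : 𝔬ˣ, σK π = u * π) (hπ : Irreducible π) (hlam : StrictMono lam)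
    (x : Gam π lam) : ∃ t, IsTeichmullerExpansion p σ x t := by
  choose T hT hT' using Perf.exists_teichmuller ha hpπ hσ hσπ hπ hlam
  choose R hR using fun ξ => Ideal.mem_span_singleton.1 (hT' ξ)
  -- Greedy expansion: `ξ = T ξ + π R ξ`, applied again to `R ξ`.
  refine ⟨fun i => T (R^[i] (Perf.of σ 0 x)), fun i n => hT _ n, fun n => ?_⟩
  rw [Ideal.mem_span_singleton]
  refine ⟨R^[n] (Perf.of σ 0 x), ?_⟩
  induction n with
  | zero => simp
  | succ n ih =>
    rw [Finset.sum_range_succ, ← sub_sub, ih, Function.iterate_succ_apply', mul_comm (T _),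
      ← mul_sub, hR, pow_succ, mul_assoc]

end Lift

/-! ### Partial valuations computed on iterates of `σ` -/

section Teichmuller

variable {𝔬 : Type*} [CommRing 𝔬] {L : Type*} [AddCommGroup L] [LinearOrder L]
  [IsOrderedAddMonoid L] {π : 𝔬} {lam : L →+ ℝ} {p a q : ℕ} {σK : 𝔬 →+* 𝔬}
  {σ : Gam π lam →+* Gam π lam} [IsDomain 𝔬] [IsDiscreteValuationRing 𝔬]
  [IsAdicComplete (IsLocalRing.maximalIdeal 𝔬) 𝔬]

/-- `ξ` modulo `π ^ (n + 1)` is the image of elements `y` from all late terms of the direct system,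
with `q ^ N c ≤ v_n(y)`. -/
def PGe (q : ℕ) (σ : Gam π lam →+* Gam π lam) (ξ : Perf σ) (n : ℕ) (c : ℝ) : Prop :=
  ∀ᶠ N in atTop, ∃ y, Perf.pi σ ^ (n + 1) ∣ ξ - Perf.of σ N y ∧ VGe y n ((q : ℝ) ^ N * c)

theorem PGe.add {ξ η : Perf σ} {n : ℕ} {c : ℝ} (h1 : PGe q σ ξ n c) (h2 : PGe q σ η n c) :
    PGe q σ (ξ + η) n c := by
  filter_upwards [h1, h2] with N ⟨y, hy, hy'⟩ ⟨t, ht, ht'⟩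
  refine ⟨y + t, ?_, hy'.add ht'⟩
  rw [map_add, add_sub_add_comm]
  exact dvd_add hy ht

theorem PGe.neg {ξ : Perf σ} {n : ℕ} {c : ℝ} (h1 : PGe q σ ξ n c) : PGe q σ (-ξ) n c := by
  filter_upwards [h1] with N ⟨y, hy, hy'⟩
  refine ⟨-y, ?_, hy'.neg⟩
  rw [map_neg, ← neg_sub', dvd_neg]
  exact hy

theorem PGe.sub {ξ η : Perf σ} {n : ℕ} {c : ℝ} (h1 : PGe q σ ξ n c) (h2 : PGe q σ η n c) :
    PGe q σ (ξ - η) n c := by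
  rw [sub_eq_add_neg]
  exact h1.add h2.neg

theorem PGe.zero (n : ℕ) (c : ℝ) : PGe q σ 0 n c :=
  Eventually.of_forall fun N => ⟨0, by simp, VGe.zero _ _⟩

theorem PGe.sum {ι : Type*} {A : Finset ι} {f : ι → Perf σ} {n : ℕ} {c : ℝ}
    (h : ∀ i ∈ A, PGe q σ (f i) n c) : PGe q σ (∑ i ∈ A, f i) n c := by
  classical
  induction A using Finset.induction_on with
  | empty => exact PGe.zero n c
  | insert a A ha ih =>
    rw [Finset.sum_insert ha]
    exact (h a (by simp)).add (ih fun i hi => h i (by simp [hi]))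

theorem PGe.congr {ξ η : Perf σ} {n : ℕ} {c : ℝ} (h : Perf.pi σ ^ (n + 1) ∣ η - ξ)
    (h1 : PGe q σ ξ n c) : PGe q σ η n c := by
  filter_upwards [h1] with N ⟨y, hy, hy'⟩
  refine ⟨y, ?_, hy'⟩
  rw [← sub_add_sub_cancel]
  exact dvd_add h hy

theorem PGe.mul_pi_pow (hσ : IsFrobeniusLift q σK σ) (hσπ : ∃ u : 𝔬ˣ, σK π = u * π)
    {ξ : Perf σ} {n : ℕ} {c : ℝ} (h : PGe q σ ξ n c) (i : ℕ) :
    PGe q σ (ξ * Perf.pi σ ^ i) n c := by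
  filter_upwards [h] with N ⟨y, hy, hy'⟩
  obtain ⟨u, hu⟩ := Perf.pi_eq (lam := lam) hσ hσπ N
  refine ⟨algebraMap 𝔬 _ ((u * π) ^ i) * y, ?_, hy'.const_mul _⟩
  have : Perf.of σ N (algebraMap 𝔬 _ ((u * π) ^ i) * y) = Perf.of σ N y * Perf.pi σ ^ i := by
    rw [hu, map_mul, mul_comm, map_pow, map_pow, map_mul]
  rw [this, ← sub_mul]
  exact dvd_mul_of_dvd_left hy _

theorem PGe.of_zero_iff (hσ : IsFrobeniusLift q σK σ) (hσπ : ∃ u : 𝔬ˣ, σK π = u * π)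
    (hπ : Irreducible π) (hlam : StrictMono lam) {x : Gam π lam} {n : ℕ} {c : ℝ} :
    PGe q σ (Perf.of σ 0 x) n c ↔ ∀ᶠ N in atTop, VGe ((σ ^ N) x) n ((q : ℝ) ^ N * c) := by
  refine eventually_congr (Eventually.of_forall fun N => ?_)
  have h0 := Perf.of_apply_eq σ (Nat.zero_le N) x
  rw [Nat.sub_zero] at h0
  rw [← h0]
  constructor
  · rintro ⟨y, hy, hy'⟩
    rw [← map_sub, Perf.pow_dvd_of_iff hσ hσπ hπ hlam, ← dvd_neg, neg_sub] at hy
    exact hy'.congr hy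
  · intro h
    exact ⟨_, by rw [sub_self]; exact dvd_zero _, h⟩

theorem coe_le_coe_mul_iff {r : ℝ} (hr : 0 < r) {c : ℝ} {v : EReal} :
    (c : EReal) ≤ (r : EReal) * v ↔ ((c / r : ℝ) : EReal) ≤ v := by
  have := le_mul_add_iff hr c 0 v
  simpa using this

theorem coe_le_vRes_iff (hq : 0 < q) {t : Perf σ} {c : ℝ} :
    (c : EReal) ≤ vRes q σ t ↔
      ∀ i y, Perf.pi σ ∣ t - Perf.of σ i y → VGe y 0 ((q : ℝ) ^ i * c) := by
  have hq' : (0 : ℝ) < q := by exact_mod_cast hq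
  simp only [vRes, le_iInf_iff, Ideal.mem_span_singleton]
  refine forall₂_congr fun i y => imp_congr_right fun _ => ?_
  rw [coe_le_coe_mul_iff (by positivity), coe_le_vN_iff, div_inv_eq_mul, mul_comm]

/-- A representative of `t` from the `i`-th term can be moved to a late term `N`, where it is
compared with the one given by the bound; the move multiplies `v` by `q^(N-i)`, which matches the
normalization of `vRes`. -/
theorem PGe.le_vRes (hq : 0 < q) (hσ : IsFrobeniusLift q σK σ) (hσπ : ∃ u : 𝔬ˣ, σK π = u * π)
    (hπ : Irreducible π) (hlam : StrictMono lam) {ξ t : Perf σ} {n : ℕ} {c : ℝ}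
    (h : PGe q σ ξ n c) (ht : Perf.pi σ ∣ ξ - t) : (c : EReal) ≤ vRes q σ t := by
  rw [coe_le_vRes_iff hq]
  intro i y hy
  obtain ⟨N, ⟨x, hx, hx'⟩, hN⟩ := (h.and (eventually_ge_atTop i)).exists
  rw [← Perf.of_apply_eq σ hN y] at hy
  have h1 : Perf.pi σ ^ (0 + 1) ∣ Perf.of σ N (x - (σ ^ (N - i)) y) := by
    rw [map_sub, zero_add, pow_one]
    have h2 := dvd_sub (dvd_add ht hy) ((dvd_pow_self _ (Nat.succ_ne_zero n)).trans hx)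
    have e : ξ - t + (t - Perf.of σ N ((σ ^ (N - i)) y)) - (ξ - Perf.of σ N x) =
      Perf.of σ N x - Perf.of σ N ((σ ^ (N - i)) y) := by ring
    rwa [e] at h2
  rw [Perf.pow_dvd_of_iff hσ hσπ hπ hlam] at h1
  have h3 := (hx'.anti (Nat.zero_le n)).congr h1
  rw [← Nat.sub_add_cancel hN, Nat.add_sub_cancel, pow_add, mul_assoc,
    hσ.vGe_zero hq hπ hlam] at h3
  exact h3

/-- For a Teichmüller element a bound on the residue class is a bound at every level. Write `t =
s^(p^n)` and represent `s` modulo `π` by a `y` from a late term with unit or zero coefficients. As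
`π` divides `p`, raising to the `p^n`-th power improves the congruence to one modulo `π^(n+1)`.
Finally `v_n(y) = v_0(y)`, and `p^n v_0(y)` is the scaled valuation of `t`. -/
theorem PGe.of_teichmuller [Fact p.Prime] (hq : 0 < q) (hpπ : π ∣ (p : 𝔬))
    (hπ : Irreducible π) (hlam : StrictMono lam)
    (hσ : IsFrobeniusLift q σK σ) (hσπ : ∃ u : 𝔬ˣ, σK π = u * π)
    {t : Perf σ} (ht : ∀ n, ∃ s, s ^ p ^ n = t) {c : ℝ} (hc : (c : EReal) ≤ vRes q σ t) (n : ℕ) :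
    PGe q σ t n c := by
  have hp : 0 < p := (Fact.out : p.Prime).pos
  obtain ⟨s, rfl⟩ := ht n
  rw [coe_le_vRes_iff hq] at hc
  obtain ⟨N0, hN0⟩ := Perf.exists_of s 1
  filter_upwards [eventually_ge_atTop N0] with N hN
  obtain ⟨x, hx⟩ := hN0 N hN
  obtain ⟨y, hxy, hy⟩ := exists_sparse_lift hπ hlam x
  rw [pow_one] at hx
  have hsy : Perf.pi σ ∣ s - Perf.of σ N y := by
    have h1 := (Perf.pow_dvd_of_iff hσ hσπ hπ hlam (N := N) (n := 1)
      (y := x - y)).2 (by rw [pow_one]; exact hxy)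
    rw [pow_one, map_sub] at h1
    have := dvd_add hx h1
    rwa [sub_add_sub_cancel] at this
  have hpow : Perf.pi σ ^ (n + 1) ∣ s ^ p ^ n - Perf.of σ N y ^ p ^ n := by
    have hpI : (p : Perf σ) ∈ Ideal.span {Perf.pi σ} := by
      obtain ⟨d, hd⟩ := hpπ
      rw [Ideal.mem_span_singleton]
      refine ⟨Perf.of σ 0 (algebraMap 𝔬 _ d), ?_⟩
      rw [← map_mul, ← map_mul, ← hd, map_natCast, map_natCast]
    have := SModEq.pow_pow_add_one (m := n) hpI
      (SModEq.sub_mem.2 (Ideal.mem_span_singleton.2 hsy))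
    rwa [SModEq.sub_mem, Ideal.span_singleton_pow, Ideal.mem_span_singleton] at this
  rw [← map_pow (Perf.of σ N)] at hpow
  refine ⟨y ^ p ^ n, hpow, ?_⟩
  have h2 := hc N (y ^ p ^ n) ((dvd_pow_self _ (Nat.succ_ne_zero n)).trans hpow)
  have hpn : (0 : ℝ) < ((p ^ n : ℕ) : ℝ) := by exact_mod_cast pow_pos hp n
  have e : (q : ℝ) ^ N * c = ((p ^ n : ℕ) : ℝ) * ((q : ℝ) ^ N * c / ((p ^ n : ℕ) : ℝ)) := by
    field_simp
  rw [e] at h2 ⊢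
  rw [VGe.pow_zero_iff hπ hlam (pow_pos hp n)] at h2
  have h3 : VGe x 0 ((q : ℝ) ^ N * c / ((p ^ n : ℕ) : ℝ)) :=
    h2.congr (by rw [zero_add, pow_one, ← dvd_neg, neg_sub]; exact hxy)
  exact (hy n _ h3).pow _

theorem PGe.of_pi_mul (hσ : IsFrobeniusLift q σK σ) (hσπ : ∃ u : 𝔬ˣ, σK π = u * π)
    (hπ : Irreducible π) (hlam : StrictMono lam) {ξ : Perf σ} {n : ℕ} {c : ℝ}
    (h : PGe q σ (Perf.pi σ * ξ) (n + 1) c) : PGe q σ ξ n c := by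
  filter_upwards [h] with N ⟨y, hy, hy'⟩
  obtain ⟨u, hu⟩ := Perf.pi_eq (lam := lam) hσ hσπ N
  have h1 : Perf.pi σ ^ 1 ∣ Perf.of σ N y := by
    have h2 : Perf.pi σ ∣ Perf.pi σ * ξ - Perf.of σ N y :=
      (dvd_pow_self _ (Nat.succ_ne_zero _)).trans hy
    have := dvd_sub (dvd_mul_right (Perf.pi σ) ξ) h2
    rwa [sub_sub_cancel, ← pow_one (Perf.pi σ)] at this
  rw [Perf.pow_dvd_of_iff hσ hσπ hπ hlam, pow_one] at h1
  obtain ⟨x, rfl⟩ := h1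
  rw [VGe.piG_mul_iff hπ.ne_zero] at hy'
  refine ⟨algebraMap 𝔬 _ (↑u⁻¹ : 𝔬) * x, ?_, hy'.const_mul _⟩
  have e : piG π lam * x =
      (algebraMap 𝔬 _ (u : 𝔬) * piG π lam) * (algebraMap 𝔬 _ (↑u⁻¹ : 𝔬) * x) := by
    rw [mul_mul_mul_comm, ← map_mul, Units.mul_inv, map_one, one_mul]
  rw [e, map_mul, ← hu, ← mul_sub, Perf.pow_succ_dvd_pi_mul_iff hσ hσπ hπ hlam] at hy
  exact hy

/-- Peel off the leading term: `t_0` satisfies the bound at all levels by `PGe.of_teichmuller`, so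
the difference satisfies it at level `n + 1`, and its quotient by `π` at level `n`. -/
theorem PGe.le_vRes_expansion [Fact p.Prime] (hq : 0 < q) (hpπ : π ∣ (p : 𝔬))
    (hπ : Irreducible π) (hlam : StrictMono lam)
    (hσ : IsFrobeniusLift q σK σ) (hσπ : ∃ u : 𝔬ˣ, σK π = u * π) {c : ℝ} {n : ℕ} {ξ : Perf σ}
    {t : ℕ → Perf σ} (ht : ∀ i n, ∃ s, s ^ p ^ n = t i)
    (hξ : ∀ n, Perf.pi σ ^ n ∣ ξ - ∑ i ∈ Finset.range n, t i * Perf.pi σ ^ i)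
    (h : PGe q σ ξ n c) : ∀ i ≤ n, (c : EReal) ≤ vRes q σ (t i) := by
  have h0 : ∀ {ξ : Perf σ} {t : ℕ → Perf σ} {n},
      (∀ n, Perf.pi σ ^ n ∣ ξ - ∑ i ∈ Finset.range n, t i * Perf.pi σ ^ i) →
      PGe q σ ξ n c → Perf.pi σ ∣ ξ - t 0 ∧ (c : EReal) ≤ vRes q σ (t 0) := by
    intro ξ t n hξ h
    have h1 : Perf.pi σ ∣ ξ - t 0 := by simpa using hξ 1
    exact ⟨h1, h.le_vRes hq hσ hσπ hπ hlam h1⟩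
  induction n generalizing ξ t with
  | zero =>
    intro i hi
    obtain rfl : i = 0 := by omega
    exact (h0 hξ h).2
  | succ n ih =>
    obtain ⟨⟨η, hη⟩, h2⟩ := h0 hξ h
    rintro (_ | i) hi
    · exact h2
    refine ih (ξ := η) (t := fun i => t (i + 1)) (fun i n => ht _ n) (fun k => ?_) ?_ i (by omega)
    · have h3 := hξ (k + 1)
      rw [Finset.sum_range_succ'] at h3
      rw [← Perf.pow_succ_dvd_pi_mul_iff hσ hσπ hπ hlam, mul_sub, ← hη, Finset.mul_sum]
      convert h3 using 1
      rw [pow_zero, mul_one, sub_sub, add_comm]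
      congr 2
      exact Finset.sum_congr rfl fun i _ => by ring
    · refine PGe.of_pi_mul hσ hσπ hπ hlam ?_
      rw [← hη]
      exact h.sub (PGe.of_teichmuller hq hpπ hπ hlam hσ hσπ (ht 0) h2 _)

/-- The partial valuations induced by `σ` can be computed on the iterates of `σ`. -/
theorem coe_le_vF_iff [Fact p.Prime] (ha : 0 < a) (hpπ : π ∣ (p : 𝔬))
    (hπ : Irreducible π) (hlam : StrictMono lam)
    (hσ : IsFrobeniusLift (p ^ a) σK σ) (hσπ : ∃ u : 𝔬ˣ, σK π = u * π) {c : ℝ} {n : ℕ}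
    {x : Gam π lam} :
    (c : EReal) ≤ vF p (p ^ a) σ n x ↔
      ∀ᶠ N in atTop, VGe ((σ ^ N) x) n (((p ^ a : ℕ) : ℝ) ^ N * c) := by
  have hq : 0 < p ^ a := pow_pos (Fact.out : p.Prime).pos a
  rw [← PGe.of_zero_iff hσ hσπ hπ hlam]
  simp only [vF, le_iInf_iff]
  constructor
  · intro h
    obtain ⟨t, ht⟩ := exists_isTeichmullerExpansion ha hpπ hσ hσπ hπ hlam x
    -- Only the first `n + 1` Teichmüller terms matter modulo `π^(n+1)`, and each of them satisfies
    -- the bound at level `n`.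
    refine PGe.congr (Ideal.mem_span_singleton.1 (ht.expansion (n + 1))) (PGe.sum fun i hi => ?_)
    exact (PGe.of_teichmuller hq hpπ hπ hlam hσ hσπ (ht.teichmuller i)
      (h t ht i (by simpa [Nat.lt_succ_iff] using hi)) n).mul_pi_pow hσ hσπ i
  · intro h t ht i hi
    exact PGe.le_vRes_expansion hq hpπ hπ hlam hσ hσπ ht.teichmuller
      (fun n => Ideal.mem_span_singleton.1 (ht.expansion n)) h i hi

end Teichmuller

/-! ### Steep sequences of bounds -/

/-- A sequence that decreases by at least `ρ` at each step. -/
def Steep (ρ : ℝ) (c : ℕ → ℝ) : Prop := ∀ i, c (i + 1) ≤ c i - ρ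

theorem Steep.le {ρ : ℝ} {c : ℕ → ℝ} (h : Steep ρ c) (i l : ℕ) : c (i + l) ≤ c i - ρ * l := by
  induction l with
  | zero => simp
  | succ l ih =>
    have := h (i + l)
    rw [← add_assoc]
    push_cast
    linarith

theorem Steep.le_zero {ρ : ℝ} (hρ : 0 ≤ ρ) {c : ℕ → ℝ} (h : Steep ρ c) (i : ℕ) : c i ≤ c 0 := by
  have := h.le 0 i
  rw [zero_add] at this
  have h2 : 0 ≤ ρ * i := by positivity
  linarith

theorem Steep.tail {ρ : ℝ} {c : ℕ → ℝ} (h : Steep ρ c) : Steep ρ fun i => c (i + 1) :=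
  fun i => h (i + 1)

theorem Steep.min {ρ : ℝ} {c d : ℕ → ℝ} (hc : Steep ρ c) (hd : Steep ρ d) :
    Steep ρ fun i => min (c i) (d i) := by
  intro i
  have h1 := hc i
  have h2 := hd i
  simp only [le_sub_iff_add_le, le_min_iff]
  exact ⟨by linarith [min_le_left (c (i + 1)) (d (i + 1))],
    by linarith [min_le_right (c (i + 1)) (d (i + 1))]⟩

theorem Steep.linear (ρ B : ℝ) : Steep ρ fun i => B - ρ * i := by
  intro i
  push_cast
  linarith

/-- This is the sequence that occurs in practice: `w_s(x) ≥ C` says that `v_i(x) ≥ (C - i)/s` for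
all `i`, with slope `-1/s`. -/
theorem Steep.div {ρ s : ℝ} (hs : 0 < s) (h : ρ * s ≤ 1) (C : ℝ) :
    Steep ρ fun i => (C - i) / s := by
  intro i
  have : ρ ≤ 1 / s := by rwa [le_div_iff₀ hs]
  have e : (C - ((i + 1 : ℕ) : ℝ)) / s = (C - i) / s - 1 / s := by
    push_cast
    field_simp
    ring
  linarith

theorem Steep.mul {ρ : ℝ} (hρ : 0 ≤ ρ) {c : ℕ → ℝ} (h : Steep ρ c) {q : ℝ} (hq : 1 ≤ q) :
    Steep ρ fun i => q * c i := by
  intro i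
  have := mul_le_mul_of_nonneg_left (h i) (zero_le_one.trans hq)
  nlinarith

/-- Because `1/s > ρ`, the steeper line eventually lies below the other one, so the minimum of the
two lines is eventually the steeper one. -/
theorem exists_eventually_eq_min {ρ s : ℝ} (hs : 0 < s) (h : ρ * s < 1) (B C : ℝ) :
    ∃ N : ℕ, ∀ n ≥ N, ((C - n) / s : ℝ) ≤ B - ρ * n := by
  obtain ⟨N, hN⟩ := exists_nat_ge ((C - B * s) / (1 - ρ * s))
  refine ⟨N, fun n hn => ?_⟩
  have h1 : (C - B * s) / (1 - ρ * s) ≤ n := hN.trans (by exact_mod_cast hn)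
  rw [div_le_iff₀ (by linarith)] at h1
  rw [div_le_iff₀ hs]
  nlinarith

section EReal

variable {ρ r : ℝ} {v v' : ℕ → EReal}

theorem iInf_le_iInf_of_steep (hr : 0 < r) (hrρ : ρ * r ≤ 1)
    (h : ∀ c, Steep ρ c → ∀ n, (∀ i ≤ n, (c i : EReal) ≤ v i) → ∀ i ≤ n, (c i : EReal) ≤ v' i) :
    ⨅ n : ℕ, ((r : EReal) * v n + (n : EReal)) ≤ ⨅ n : ℕ, ((r : EReal) * v' n + (n : EReal)) := by
  refine EReal.ge_of_forall_gt_iff_ge.1 fun C hC => ?_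
  refine le_iInf fun n => ?_
  rw [le_mul_add_iff hr]
  refine h _ (Steep.div hr hrρ C) n (fun i _ => ?_) n le_rfl
  rw [← le_mul_add_iff hr]
  exact hC.le.trans (iInf_le _ i)

/-- The limit gives the bound `(C + 1 - i)/r` only for `i > M`; for `i ≤ M` there is just a constant
`B`. The minimum of this line and of `B - ρ i` is steep and valid at every level, and eventually it
is the line wanted. -/
theorem tendsto_of_steep (hr : 0 < r) (hrρ : ρ * r < 1) (hρ : 0 ≤ ρ)
    (hv : ∀ n, ∃ B : ℝ, ∀ i ≤ n, (B : EReal) ≤ v i)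
    (h : ∀ c, Steep ρ c → ∀ n, (∀ i ≤ n, (c i : EReal) ≤ v i) → ∀ i ≤ n, (c i : EReal) ≤ v' i)
    (hT : Tendsto (fun n : ℕ => (r : EReal) * v n + (n : EReal)) atTop (𝓝 ⊤)) :
    Tendsto (fun n : ℕ => (r : EReal) * v' n + (n : EReal)) atTop (𝓝 ⊤) := by
  rw [EReal.tendsto_nhds_top_iff_real] at hT ⊢
  intro C
  obtain ⟨M, hM⟩ := eventually_atTop.1 (hT (C + 1))
  obtain ⟨B, hB⟩ := hv M
  obtain ⟨N, hN⟩ := exists_eventually_eq_min hr hrρ B (C + 1)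
  refine eventually_atTop.2 ⟨N, fun n hn => ?_⟩
  refine lt_of_lt_of_le (EReal.coe_lt_coe_iff.2 (show C < C + 1 by linarith)) ?_
  rw [le_mul_add_iff hr]
  have := h _ ((Steep.linear ρ B).min (Steep.div hr hrρ.le (C + 1))) n (fun i _ => ?_) n le_rfl
  · rwa [min_eq_right (hN n hn)] at this
  · by_cases hi : i ≤ M
    · refine le_trans (EReal.coe_le_coe_iff.2 ((min_le_left _ _).trans ?_)) (hB i hi)
      have : 0 ≤ ρ * i := by positivity
      linarith
    · refine le_trans (EReal.coe_le_coe_iff.2 (min_le_right _ _)) ?_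
      rw [← le_mul_add_iff hr]
      exact (hM i (by omega)).le

end EReal

/-! ### Comparison of the naive valuations with those of `σ` -/

section Compare

variable {𝔬 : Type*} [CommRing 𝔬] {L : Type*} [AddCommGroup L] [LinearOrder L]
  [IsOrderedAddMonoid L] {π : 𝔬} {lam : L →+ ℝ} {p a q : ℕ} {σK : 𝔬 →+* 𝔬}
  {σ : Gam π lam →+* Gam π lam} [IsDomain 𝔬] [IsDiscreteValuationRing 𝔬]
  [IsAdicComplete (IsLocalRing.maximalIdeal 𝔬) 𝔬]

/-- `c ≤ v_n(x)`, for the partial valuations induced by `σ`. -/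
def FGe (q : ℕ) (σ : Gam π lam →+* Gam π lam) (x : Gam π lam) (n : ℕ) (c : ℝ) : Prop :=
  ∀ᶠ N in atTop, VGe ((σ ^ N) x) n ((q : ℝ) ^ N * c)

theorem FGe.sub {x y : Gam π lam} {n : ℕ} {c : ℝ} (hx : FGe q σ x n c) (hy : FGe q σ y n c) :
    FGe q σ (x - y) n c := by
  filter_upwards [hx, hy] with N h1 h2
  rw [map_sub]
  exact h1.sub h2

theorem FGe.map {x : Gam π lam} {n : ℕ} {c : ℝ} (hx : FGe q σ x n c) :
    FGe q σ (σ x) n (q * c) := by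
  have := (tendsto_add_atTop_nat 1).eventually hx
  filter_upwards [this] with N h
  rwa [pow_succ, RingHom.mul_def, RingHom.comp_apply, pow_succ, mul_assoc] at h

theorem FGe.anti {x : Gam π lam} {i n : ℕ} {c d : ℝ} (hx : FGe q σ x n c) (hi : i ≤ n)
    (hd : d ≤ c) : FGe q σ x i d := by
  filter_upwards [hx] with N h
  exact (h.anti hi).le (mul_le_mul_of_nonneg_left hd (by positivity))

theorem FGe.zero_iff (hσ : IsFrobeniusLift q σK σ) (hq : 0 < q)
    (hπ : Irreducible π) (hlam : StrictMono lam) {x : Gam π lam} {c : ℝ} :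
    FGe q σ x 0 c ↔ VGe x 0 c := by
  simp only [FGe, hσ.vGe_zero hq hπ hlam, eventually_const]

theorem FGe.of_piG_mul (hσ : IsFrobeniusLift q σK σ) (hσπ : ∃ u : 𝔬ˣ, σK π = u * π)
    (hπ : Irreducible π) {x : Gam π lam} {n : ℕ} {c : ℝ}
    (h : FGe q σ (piG π lam * x) (n + 1) c) : FGe q σ x n c := by
  filter_upwards [h] with N h1
  obtain ⟨u, hu⟩ := hσ.pow_piG hσπ N
  rw [map_mul, hu, mul_assoc] at h1
  have h2 := h1.const_mul (↑u⁻¹ : 𝔬)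
  rwa [← mul_assoc, ← map_mul, Units.inv_mul, map_one, one_mul, VGe.piG_mul_iff hπ.ne_zero] at h2

/-- The valuation of the monomials with respect to `σ`, up to a bounded slope. -/
theorem exists_slope_monomial [Fact p.Prime] (ha : 0 < a) (hpπ : π ∣ (p : 𝔬))
    (hπ : Irreducible π) (hlam : StrictMono lam)
    (hσ : IsFrobeniusLift (p ^ a) σK σ) (hσπ : ∃ u : 𝔬ˣ, σK π = u * π) {z : L}
    (hz : mono π lam z ∈ GamConF p (p ^ a) σ) :
    ∃ ρ : ℝ, 0 ≤ ρ ∧ ∀ j, FGe (p ^ a) σ (mono π lam z) j (lam z - ρ * j) := by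
  have hq : 0 < p ^ a := pow_pos (Fact.out : p.Prime).pos a
  obtain ⟨r, hr, hz⟩ := hz
  rw [GamF, Set.mem_ofPred_eq, EReal.tendsto_nhds_top_iff_real] at hz
  obtain ⟨M, hM⟩ := eventually_atTop.1 (hz 0)
  have h1 : ∀ n ≥ M, FGe (p ^ a) σ (mono π lam z) n ((0 - n) / r) := by
    intro n hn
    have := (hM n hn).le
    rw [le_mul_add_iff hr, coe_le_vF_iff ha hpπ hπ hlam hσ hσπ] at this
    exact this
  refine ⟨|lam z| + (M + 1) / r, by positivity, fun j => ?_⟩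
  -- At level `0` the bound is needed without loss and holds since `v_0({z}) = λ(z)`. For `j ≥ 1`
  -- the slope absorbs `λ(z)` and the constant, and levels below `M` are bounded by level `M`.
  by_cases hj : j = 0
  · subst hj
    rw [FGe.zero_iff hσ hq hπ hlam]
    simpa using VGe.mono_self z 0
  refine (h1 (max j M) (le_max_right _ _)).anti (le_max_left _ _) ?_
  have hj1 : (1 : ℝ) ≤ j := by exact_mod_cast Nat.one_le_iff_ne_zero.2 hj
  have h2 : ((max j M : ℕ) : ℝ) ≤ (M + 1) * j := by
    rw [Nat.cast_max]
    refine max_le ?_ ?_ <;> nlinarith [(Nat.cast_nonneg M : (0 : ℝ) ≤ M)]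
  have h3 : ((max j M : ℕ) : ℝ) / r ≤ (M + 1) / r * j := by
    rw [div_mul_eq_mul_div]
    exact div_le_div_of_nonneg_right h2 hr.le
  have h4 : lam z ≤ |lam z| * j := (le_abs_self _).trans (le_mul_of_one_le_right (abs_nonneg _) hj1)
  rw [zero_sub, neg_div]
  nlinarith

/-- Bounds with a common slope are multiplicative, and every monomial is a product of the finitely
many `{±z_i}`. So one `ρ`, and for each `n` one threshold for `N`, serve all `y ∈ L` simultaneously;
this uniformity in `y` is what is needed for infinite sums of monomials. -/
theorem exists_slope [Fact p.Prime] (ha : 0 < a) (hpπ : π ∣ (p : 𝔬))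
    (hπ : Irreducible π) (hlam : StrictMono lam)
    (hσ : IsFrobeniusLift (p ^ a) σK σ) (hσπ : ∃ u : 𝔬ˣ, σK π = u * π) {m : ℕ}
    (z : Module.Basis (Fin m) ℤ L) (hz : MonomialsAreUnits p (p ^ a) σ) :
    ∃ ρ : ℝ, 0 < ρ ∧ ∀ n, ∀ᶠ N in atTop, ∀ y : L, ∀ j ≤ n,
      VGe ((σ ^ N) (mono π lam y)) j (((p ^ a : ℕ) : ℝ) ^ N * (lam y - ρ * j)) := by
  have h1 : ∀ i, z i ≠ 0 := fun i => z.ne_zero i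
  choose ρ₁ hρ₁ h₁ using fun i => exists_slope_monomial ha hpπ hπ hlam hσ hσπ (hz (z i) (h1 i)).1
  choose ρ₂ hρ₂ h₂ using fun i =>
    exists_slope_monomial ha hpπ hπ hlam hσ hσπ (hz (-z i) (neg_ne_zero.2 (h1 i))).1
  have hs : ∀ i, ρ₁ i ≤ 1 + ∑ i, (ρ₁ i + ρ₂ i) ∧ ρ₂ i ≤ 1 + ∑ i, (ρ₁ i + ρ₂ i) := by
    intro i
    have := Finset.single_le_sum (f := fun i => ρ₁ i + ρ₂ i)
      (fun i _ => add_nonneg (hρ₁ i) (hρ₂ i)) (Finset.mem_univ i)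
    exact ⟨by linarith [hρ₂ i], by linarith [hρ₁ i]⟩
  have hρ : 0 < 1 + ∑ i, (ρ₁ i + ρ₂ i) := by
    have := Finset.sum_nonneg fun i (_ : i ∈ Finset.univ) => add_nonneg (hρ₁ i) (hρ₂ i)
    linarith
  set ρ := 1 + ∑ i, (ρ₁ i + ρ₂ i)
  refine ⟨ρ, hρ, fun n => ?_⟩
  have h3 : ∀ᶠ N in atTop, ∀ i, ∀ j ∈ Finset.range (n + 1),
      VGe ((σ ^ N) (mono π lam (z i))) j (((p ^ a : ℕ) : ℝ) ^ N * (lam (z i) - ρ * j)) ∧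
      VGe ((σ ^ N) (mono π lam (-z i))) j (((p ^ a : ℕ) : ℝ) ^ N * (lam (-z i) - ρ * j)) := by
    rw [eventually_all]
    intro i
    rw [Filter.eventually_all_finset]
    intro j _
    have hj : (0 : ℝ) ≤ j := j.cast_nonneg
    refine ((h₁ i j).anti le_rfl ?_).and ((h₂ i j).anti le_rfl ?_)
    · nlinarith [(hs i).1]
    · nlinarith [(hs i).2]
  filter_upwards [h3] with N hN
  let P : L → Prop := fun y => ∀ j ≤ n,
    VGe ((σ ^ N) (mono π lam y)) j (((p ^ a : ℕ) : ℝ) ^ N * (lam y - ρ * j))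
  have hadd : ∀ x y, P x → P y → P (x + y) := by
    intro x y hx hy j hj
    rw [← mono_mul_mono, map_mul]
    have := VGe.mul_steep (ρ := ((p ^ a : ℕ) : ℝ) ^ N * ρ) (n := n) (by positivity)
      (fun i hi => (hx i hi).le (le_of_eq (by ring_nf)))
      (fun i hi => (hy i hi).le (le_of_eq (by ring_nf))) j hj
      (a := ((p ^ a : ℕ) : ℝ) ^ N * lam x) (b := ((p ^ a : ℕ) : ℝ) ^ N * lam y)
    refine this.le (le_of_eq ?_)
    rw [map_add]
    ring
  have hzero : P 0 := by
    intro j _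
    rw [mono_zero, map_one, map_zero]
    refine (VGe.one j).le ?_
    have : 0 ≤ ((p ^ a : ℕ) : ℝ) ^ N * (ρ * j) := by positivity
    linarith
  let K : AddSubgroup L :=
    { carrier := {y | P y ∧ P (-y)}
      add_mem' := fun {x y} hx hy => ⟨hadd x y hx.1 hy.1, by
        rw [neg_add]; exact hadd _ _ hx.2 hy.2⟩
      zero_mem' := ⟨hzero, by rw [neg_zero]; exact hzero⟩
      neg_mem' := fun {x} hx => ⟨hx.2, by rw [neg_neg]; exact hx.1⟩ }
  intro y
  have hy : y ∈ K := by
    rw [← z.sum_repr y]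
    refine AddSubgroup.sum_mem _ fun i _ => AddSubgroup.zsmul_mem _ ?_ _
    exact ⟨fun j hj => (hN i j (by simpa [Nat.lt_succ_iff] using hj)).1,
      fun j hj => (hN i j (by simpa [Nat.lt_succ_iff] using hj)).2⟩
  exact hy.1

theorem LevelwiseContinuous.pow (hc : LevelwiseContinuous σ) (N : ℕ) :
    LevelwiseContinuous (σ ^ N) := by
  induction N with
  | zero => exact fun x hx => hx
  | succ N ih =>
    intro x hx
    rw [pow_succ']
    exact hc _ (ih x hx)

/-- The naive partial valuations bound those induced by `σ`, along steep sequences. -/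
theorem VGe.eventually_map (hπ : Irreducible π) (hlam : StrictMono lam)
    (hσ : IsFrobeniusLift q σK σ) (hσπ : ∃ u : 𝔬ˣ, σK π = u * π) (hc : LevelwiseContinuous σ)
    {ρ : ℝ} {n : ℕ}
    (hs : ∀ᶠ N in atTop, ∀ y : L, ∀ j ≤ n,
      VGe ((σ ^ N) (mono π lam y)) j ((q : ℝ) ^ N * (lam y - ρ * j)))
    {c : ℕ → ℝ} (hst : Steep ρ c) {x : Gam π lam} (hx : ∀ i ≤ n, VGe x i (c i)) :
    ∀ i ≤ n, FGe q σ x i (c i) := by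
  intro j hj
  filter_upwards [hs] with N hN
  obtain ⟨d, T, hd, hT, hA⟩ := exists_finite_approx hπ hlam x
  have hT' : LevelwiseNull T := by
    intro n
    rw [EReal.tendsto_nhds_top_iff_real]
    intro C
    obtain ⟨k, hk⟩ := exists_nat_gt C
    refine eventually_atTop.2 ⟨k, fun l hl => ?_⟩
    refine lt_of_lt_of_le (EReal.coe_lt_coe_iff.2 (hk.trans_le (?_ : (k : ℝ) ≤ l)))
      (coe_le_vN_iff.2 (hT l n))
    exact_mod_cast hl
  have h1 := hc.pow N T hT' j
  rw [EReal.tendsto_nhds_top_iff_real] at h1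
  -- With `N` fixed, continuity of `σ^N` makes the image of the tail `T k` negligible at level `j`
  -- for a large `k`; a finite sum of monomials remains.
  obtain ⟨k, hk⟩ := (h1 ((q : ℝ) ^ N * c j)).exists
  have h2 := coe_le_vN_iff.1 hk.le
  obtain ⟨A, hA⟩ := hA k (j + 1)
  have h3 := hσ.piG_pow_dvd hσπ N hA
  rw [map_sub, map_sub, sub_sub, ← dvd_neg, neg_sub] at h3
  refine (h2.add ?_).congr h3
  rw [map_sum]
  refine VGe.sum fun y _ => ?_
  classical
  by_cases hy : π ^ (j + 1) ∣ d y
  · obtain ⟨e, he⟩ := hy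
    refine VGe.of_piG_pow_dvd (Nat.lt_succ_self j) (hσ.piG_pow_dvd hσπ N ?_) _
    rw [he, map_mul, map_pow, mul_assoc]
    exact dvd_mul_right _ _
  have hex : ∃ i, ¬ π ^ (i + 1) ∣ d y := ⟨j, hy⟩
  obtain ⟨i, hi, hiA, hiA'⟩ : ∃ i, i ≤ j ∧ π ^ i ∣ d y ∧ ¬ π ^ (i + 1) ∣ d y := by
    refine ⟨Nat.find hex, Nat.find_min' hex hy, ?_, Nat.find_spec hex⟩
    rcases hk : Nat.find hex with _ | k
    · simp
    · by_contra hcon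
      exact Nat.find_min hex (m := k) (by omega) hcon
  have h4 : c i ≤ lam y := hx i (by omega) y (by
    change coeffHom (i + 1) y x ≠ 0
    rwa [hd, Ne, mk_span_pow_eq_zero])
  obtain ⟨e, he⟩ := hiA
  obtain ⟨u, hu⟩ := hσ.pow_piG hσπ N
  obtain ⟨l, rfl⟩ := Nat.exists_eq_add_of_le hi
  have e1 : (σ ^ N) (algebraMap 𝔬 _ (d y) * mono π lam y) =
      algebraMap 𝔬 _ ((u : 𝔬) ^ i * (σK ^ N) e) * (piG π lam ^ i * (σ ^ N) (mono π lam y)) := by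
    rw [map_mul, he, map_mul, map_mul, map_pow, map_pow, hu, hσ.pow_algebraMap, map_mul, map_pow]
    ring
  rw [e1]
  -- A coefficient of valuation `i` shifts the levels by `i`, so level `j = i + l` of the term is
  -- level `l` of the monomial. There the bound is `λ(y) - ρ l ≥ c_i - ρ l ≥ c_(i+l)`, by steepness.
  refine VGe.const_mul _ ((VGe.piG_pow_mul_iff hπ.ne_zero).2 ((hN y l (by omega)).le ?_))
  refine mul_le_mul_of_nonneg_left ?_ (by positivity)
  linarith [hst.le i l]

/-- The partial valuations induced by `σ` bound the naive ones, along steep sequences. -/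
theorem VGe.of_eventually_map (hq : 0 < q) (hπ : Irreducible π) (hlam : StrictMono lam)
    (hσ : IsFrobeniusLift q σK σ) (hσπ : ∃ u : 𝔬ˣ, σK π = u * π) (hc : LevelwiseContinuous σ)
    {ρ : ℝ} (hρ : 0 ≤ ρ)
    (hs : ∀ n, ∀ᶠ N in atTop, ∀ y : L, ∀ j ≤ n,
      VGe ((σ ^ N) (mono π lam y)) j ((q : ℝ) ^ N * (lam y - ρ * j)))
    {c : ℕ → ℝ} (hst : Steep ρ c) {n : ℕ} {x : Gam π lam}
    (hx : ∀ i ≤ n, FGe q σ x i (c i)) : ∀ i ≤ n, VGe x i (c i) := by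
  induction n generalizing x c with
  | zero =>
    intro i hi
    obtain rfl : i = 0 := by omega
    exact (FGe.zero_iff hσ hq hπ hlam).1 (hx 0 le_rfl)
  | succ n ih =>
    have h0 := (FGe.zero_iff hσ hq hπ hlam).1 (hx 0 (Nat.zero_le _))
    -- The lift `y` of the residue class satisfies the naive bounds at all levels, hence also those
    -- of `σ`. So does the difference `π x'`, and induction applies to `x'` with the shifted
    -- sequence.
    obtain ⟨y, ⟨x', hxy⟩, hy⟩ := exists_sparse_lift hπ hlam x
    have hy' : ∀ i, VGe y i (c i) := fun i => (hy i _ h0).le (hst.le_zero hρ i)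
    have h1 := VGe.eventually_map hπ hlam hσ hσπ hc (hs (n + 1)) hst fun i _ => hy' i
    have h2 := ih hst.tail (x := x') fun i hi => FGe.of_piG_mul hσ hσπ hπ (by
      rw [← hxy]
      exact (hx (i + 1) (by omega)).sub (h1 (i + 1) (by omega)))
    rintro (_ | i) hi
    · exact h0
    · have h3 := ((VGe.piG_mul_iff hπ.ne_zero).2 (h2 i (by omega))).add (hy' (i + 1))
      rwa [← hxy, sub_add_cancel] at h3

/-- Along `ρ`-steep sequences, the naive partial valuations of `x` and of `σ x` compare as
for the `q`-power map. -/
def SlopeBound (q : ℕ) (σ : Gam π lam →+* Gam π lam) (ρ : ℝ) : Prop :=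
  ∀ c, Steep ρ c → ∀ n (x : Gam π lam), (∀ i ≤ n, VGe x i (c i)) → ∀ i ≤ n, VGe (σ x) i (q * c i)

theorem SlopeBound.mono {ρ ρ' : ℝ} (h : SlopeBound q σ ρ) (hρ : ρ ≤ ρ') : SlopeBound q σ ρ' :=
  fun c hc => h c fun i => (hc i).trans (by linarith)

/-- For small `r`, the rings `Γ_r` and the functions `w_r` are the same for `σ` and in the naive
sense. -/
theorem exists_radius [Fact p.Prime] (ha : 0 < a) (hpπ : π ∣ (p : 𝔬))
    (hπ : Irreducible π) (hlam : StrictMono lam)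
    (hσ : IsFrobeniusLift (p ^ a) σK σ) (hσπ : ∃ u : 𝔬ˣ, σK π = u * π)
    (hc : LevelwiseContinuous σ) {m : ℕ}
    (z : Module.Basis (Fin m) ℤ L) (hz : MonomialsAreUnits p (p ^ a) σ) :
    ∃ ρ : ℝ, 0 < ρ ∧ SlopeBound (p ^ a) σ ρ ∧ ∀ r, 0 < r → ρ * r < 1 →
      GamF p (p ^ a) σ r = GamN π lam r ∧
      ∀ x : Gam π lam, wF p (p ^ a) σ r x = wN r x := by
  have hq : 0 < p ^ a := pow_pos (Fact.out : p.Prime).pos a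
  obtain ⟨ρ, hρ, hs⟩ := exists_slope ha hpπ hπ hlam hσ hσπ z hz
  have h1 : ∀ (x : Gam π lam) c, Steep ρ c → ∀ n, (∀ i ≤ n, (c i : EReal) ≤ vN i x) →
      ∀ i ≤ n, (c i : EReal) ≤ vF p (p ^ a) σ i x := by
    intro x c hst n hx i hi
    rw [coe_le_vF_iff ha hpπ hπ hlam hσ hσπ]
    exact VGe.eventually_map hπ hlam hσ hσπ hc (hs n) hst
      (fun i hi => coe_le_vN_iff.1 (hx i hi)) i hi
  have h2 : ∀ (x : Gam π lam) c, Steep ρ c → ∀ n, (∀ i ≤ n, (c i : EReal) ≤ vF p (p ^ a) σ i x) →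
      ∀ i ≤ n, (c i : EReal) ≤ vN i x := by
    intro x c hst n hx i hi
    rw [coe_le_vN_iff]
    exact VGe.of_eventually_map hq hπ hlam hσ hσπ hc hρ.le hs hst
      (fun i hi => (coe_le_vF_iff ha hpπ hπ hlam hσ hσπ).1 (hx i hi)) i hi
  have b1 : ∀ (x : Gam π lam) n, ∃ B : ℝ, ∀ i ≤ n, (B : EReal) ≤ vN i x := by
    intro x n
    obtain ⟨B, hB⟩ := VGe.exists_bound x n
    exact ⟨B, fun i hi => coe_le_vN_iff.2 (hB.anti hi)⟩
  have b2 : ∀ (x : Gam π lam) n, ∃ B : ℝ, ∀ i ≤ n, (B : EReal) ≤ vF p (p ^ a) σ i x := by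
    intro x n
    obtain ⟨B, hB⟩ := b1 x n
    refine ⟨B - ρ * n, fun i hi => ?_⟩
    have h := h1 x _ (Steep.linear ρ B) n (fun i hi => le_trans (EReal.coe_le_coe_iff.2 ?_)
      (hB i hi)) i hi
    · refine le_trans (EReal.coe_le_coe_iff.2 ?_) h
      have : (i : ℝ) ≤ n := by exact_mod_cast hi
      nlinarith
    · have : 0 ≤ ρ * i := by positivity
      linarith
  refine ⟨ρ, hρ, fun c hst n x hx => ?_, fun r hr hrρ => ⟨?_, fun x => ?_⟩⟩
  -- Pass to the valuations of `σ`, which `σ` multiplies by `q`, and back; the sequence `q c_i` is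
  -- still steep because `q ≥ 1`.
  · refine VGe.of_eventually_map hq hπ hlam hσ hσπ hc hρ.le hs
      (hst.mul hρ.le (by exact_mod_cast hq)) fun i hi => FGe.map ?_
    exact VGe.eventually_map hπ hlam hσ hσπ hc (hs n) hst hx i hi
  · ext x
    exact ⟨tendsto_of_steep hr hrρ hρ.le (b2 x) (h2 x),
      tendsto_of_steep hr hrρ hρ.le (b1 x) (h1 x)⟩
  · exact le_antisymm (iInf_le_iInf_of_steep hr hrρ.le (h2 x))
      (iInf_le_iInf_of_steep hr hrρ.le (h1 x))

end Compare

/-! ### Sums for a topology defined by a family of subgroups -/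

section Sums

variable {M M' : Type*} [AddCommGroup M] [AddCommGroup M'] {𝓕 : Set (AddSubgroup M)}
  {𝓕' : Set (AddSubgroup M')} {ι κ : Type*}

/-- The sum of the family `f` is `y`, for the topology with the subgroups in `𝓕` as a subbasis at
zero. -/
def HS (𝓕 : Set (AddSubgroup M)) (f : ι → M) (y : M) : Prop :=
  ∀ U ∈ 𝓕, ∃ A₀ : Finset ι, ∀ A, A₀ ⊆ A → ∑ i ∈ A, f i - y ∈ U

theorem HS.unique (h𝓕 : ∀ x, (∀ U ∈ 𝓕, x ∈ U) → x = 0) {f : ι → M} {y y' : M} (h : HS 𝓕 f y)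
    (h' : HS 𝓕 f y') : y = y' := by
  classical
  refine sub_eq_zero.1 (h𝓕 _ fun U hU => ?_)
  obtain ⟨A, hA⟩ := h U hU
  obtain ⟨B, hB⟩ := h' U hU
  have := U.sub_mem (hB (A ∪ B) Finset.subset_union_right) (hA (A ∪ B) Finset.subset_union_left)
  rwa [sub_sub_sub_cancel_left] at this

theorem HS.add {f g : ι → M} {y y' : M} (h : HS 𝓕 f y) (h' : HS 𝓕 g y') :
    HS 𝓕 (fun i => f i + g i) (y + y') := by
  classical
  intro U hU
  obtain ⟨A, hA⟩ := h U hU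
  obtain ⟨B, hB⟩ := h' U hU
  refine ⟨A ∪ B, fun C hC => ?_⟩
  rw [Finset.sum_add_distrib, add_sub_add_comm]
  exact U.add_mem (hA C (Finset.subset_union_left.trans hC))
    (hB C (Finset.subset_union_right.trans hC))

theorem HS.map {f : ι → M} {y : M} (h : HS 𝓕 f y) (T : M →+ M')
    (hT : ∀ U' ∈ 𝓕', ∃ U ∈ 𝓕, ∀ x ∈ U, T x ∈ U') : HS 𝓕' (fun i => T (f i)) (T y) := by
  intro U' hU'
  obtain ⟨U, hU, hT⟩ := hT U' hU'
  obtain ⟨A₀, hA⟩ := h U hU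
  refine ⟨A₀, fun A hAA => ?_⟩
  rw [← map_sum, ← map_sub]
  exact hT _ (hA A hAA)

theorem HS.zero : HS 𝓕 (fun _ : ι => (0 : M)) 0 :=
  fun U _ => ⟨∅, fun A _ => by simp [U.zero_mem]⟩

/-- The sum of the sums over the fibers. -/
theorem HS.fiber {f : ι → M} {y : M} (hf : HS 𝓕 f y) (p : ι → κ) {h : κ → M}
    (hh : ∀ U ∈ 𝓕, ∀ k, ∃ A₀ : Finset ι, (∀ i ∈ A₀, p i = k) ∧
      ∀ A, A₀ ⊆ A → (∀ i ∈ A, p i = k) → ∑ i ∈ A, f i - h k ∈ U) : HS 𝓕 h y := by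
  classical
  intro U hU
  obtain ⟨A₀, hA₀⟩ := hf U hU
  choose B hB hB' using hh U hU
  refine ⟨A₀.image p, fun K hK => ?_⟩
  -- Enlarging `B k` by the part of `A₀` over `k` keeps the partial sum over the fiber close to `h
  -- k`, and makes the union over `K` contain `A₀`.
  let A : κ → Finset ι := fun k => B k ∪ A₀.filter (fun i => p i = k)
  have hA : ∀ k, ∀ i ∈ A k, p i = k := by
    intro k i hi
    rcases Finset.mem_union.1 hi with hi | hi
    · exact hB k i hi
    · exact (Finset.mem_filter.1 hi).2
  have h1 : ∑ i ∈ K.biUnion A, f i = ∑ k ∈ K, ∑ i ∈ A k, f i := by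
    refine Finset.sum_biUnion fun k _ l _ hkl => ?_
    exact Finset.disjoint_left.2 fun i hi hi' => hkl ((hA k i hi).symm.trans (hA l i hi'))
  have h2 : A₀ ⊆ K.biUnion A := by
    intro i hi
    refine Finset.mem_biUnion.2 ⟨p i, hK (Finset.mem_image_of_mem p hi), ?_⟩
    exact Finset.mem_union_right _ (Finset.mem_filter.2 ⟨hi, rfl⟩)
  have h3 := hA₀ _ h2
  have h4 : ∑ k ∈ K, (∑ i ∈ A k, f i - h k) ∈ U :=
    U.sum_mem fun k _ => hB' k (A k) Finset.subset_union_left (hA k)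
  have h5 := U.sub_mem h3 h4
  rw [h1, Finset.sum_sub_distrib] at h5
  rwa [sub_sub_sub_cancel_left] at h5

/-- The sum of the sums over the fibers, when these are finite sums. -/
theorem HS.fiber_finite {f : ι → M} {y : M} (hf : HS 𝓕 f y) (p : ι → κ) {h : κ → M}
    (A : κ → Finset ι) (hA : ∀ k, ∀ i ∈ A k, p i = k) (hA' : ∀ i, f i ≠ 0 → i ∈ A (p i))
    (hh : ∀ k, ∑ i ∈ A k, f i = h k) : HS 𝓕 h y := by
  classical
  refine hf.fiber p fun U hU k => ⟨A k, hA k, fun B hB hB' => ?_⟩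
  rw [← hh k, ← Finset.sum_subset hB fun i hi hi' => ?_, sub_self]
  · exact U.zero_mem
  · by_contra h0
    have := hA' i h0
    rw [hB' i hi] at this
    exact hi' this

theorem HS.reindex {f : ι → M} {y : M} (hf : HS 𝓕 f y) {p : ι → κ} (hp : Function.Injective p)
    {h : κ → M} (hh : ∀ i, h (p i) = f i) (h0 : ∀ k, k ∉ Set.range p → h k = 0) : HS 𝓕 h y := by
  classical
  refine hf.fiber_finite p (fun k => if hk : k ∈ Set.range p then {hk.choose} else ∅) ?_ ?_ ?_
  · intro k i hi
    split_ifs at hi with hk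
    · rw [Finset.mem_singleton.1 hi]
      exact hk.choose_spec
    · simp at hi
  · intro i _
    have hk : p i ∈ Set.range p := ⟨i, rfl⟩
    rw [dif_pos hk, Finset.mem_singleton]
    exact (hp hk.choose_spec).symm
  · intro k
    split_ifs with hk
    · rw [Finset.sum_singleton, ← hh, hk.choose_spec]
    · rw [Finset.sum_empty, h0 k hk]

theorem HS.single {f : ι → M} (i : ι) (hf : ∀ j, j ≠ i → f j = 0) : HS 𝓕 f (f i) := by
  classical
  intro U _
  refine ⟨{i}, fun A hA => ?_⟩
  rw [Finset.sum_eq_single_of_mem i (hA (by simp)) (fun j _ hj => hf j hj), sub_self]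
  exact U.zero_mem

theorem HS.mem_of_forall {f : ι → M} {y : M} (hf : HS 𝓕 f y) {U : AddSubgroup M} (hU : U ∈ 𝓕)
    (h : ∀ i, f i ∈ U) : y ∈ U := by
  obtain ⟨A, hA⟩ := hf U hU
  have := U.sub_mem (U.sum_mem fun i (_ : i ∈ A) => h i) (hA A subset_rfl)
  rwa [sub_sub_cancel] at this

theorem HS.of_family_le {𝓖 : Set (AddSubgroup M)} {f : ι → M} {y : M} (hf : HS 𝓕 f y)
    (h : ∀ U ∈ 𝓖, ∃ V ∈ 𝓕, V ≤ U) : HS 𝓖 f y :=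
  hf.map (AddMonoidHom.id M) fun U hU => by
    obtain ⟨V, hV, hVU⟩ := h U hU
    exact ⟨V, hV, fun x hx => hVU hx⟩

end Sums

/-! ### Binomial polynomials -/

section Binomial

variable {A : Type*} [CommRing A] [Algebra ℚ A]

/-- The binomial polynomial `x (x - 1) ⋯ (x - j + 1) / j!`. -/
def binom (j : ℕ) (x : A) : A :=
  algebraMap ℚ A (1 / (j.factorial : ℚ)) * ∏ l ∈ Finset.range j, (x - l)

theorem factorial_mul_binom (j : ℕ) (x : A) :
    (j.factorial : A) * binom j x = ∏ l ∈ Finset.range j, (x - l) := by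
  rw [binom, ← mul_assoc, ← map_natCast (algebraMap ℚ A), ← map_mul,
    mul_one_div_cancel (by exact_mod_cast j.factorial_ne_zero), map_one, one_mul]

theorem natCast_mul_cancel {n : ℕ} (hn : n ≠ 0) {x y : A} (h : (n : A) * x = n * y) : x = y := by
  have h1 : algebraMap ℚ A (1 / (n : ℚ)) * (n : A) = 1 := by
    rw [← map_natCast (algebraMap ℚ A), ← map_mul, one_div_mul_cancel (by exact_mod_cast hn),
      map_one]
  rw [← one_mul x, ← h1, mul_assoc, h, ← mul_assoc, h1, one_mul]

theorem succ_mul_binom_succ (j : ℕ) (x : A) :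
    ((j : A) + 1) * binom (j + 1) x = (x - j) * binom j x := by
  refine natCast_mul_cancel j.factorial_ne_zero ?_
  have h1 := factorial_mul_binom (j + 1) x
  rw [Finset.prod_range_succ, ← factorial_mul_binom, Nat.factorial_succ] at h1
  push_cast at h1
  linear_combination h1

theorem mul_binom (j : ℕ) (x : A) :
    x * binom j x = ((j : A) + 1) * binom (j + 1) x + j * binom j x := by
  rw [succ_mul_binom_succ]
  ring

theorem binom_zero (x : A) : binom 0 x = 1 := by simp [binom]

theorem binom_succ_add_one (j : ℕ) (x : A) :
    binom (j + 1) (x + 1) = binom (j + 1) x + binom j x := by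
  refine natCast_mul_cancel (j + 1).factorial_ne_zero ?_
  rw [mul_add, factorial_mul_binom, factorial_mul_binom, Finset.prod_range_succ',
    Finset.prod_range_succ]
  have h1 := factorial_mul_binom j x
  have h2 : ∀ l : ℕ, x + 1 - ((l + 1 : ℕ) : A) = x - l := fun l => by push_cast; ring
  simp only [h2, ← h1, Nat.factorial_succ]
  push_cast
  ring

theorem map_binom {B : Type*} [CommRing B] [Algebra ℚ B] (f : A →+* B) (j : ℕ) (x : A) :
    f (binom j x) = binom j (f x) := by
  refine natCast_mul_cancel j.factorial_ne_zero ?_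
  rw [factorial_mul_binom, ← map_natCast f, ← map_mul, factorial_mul_binom, map_prod]
  simp

theorem binom_natCast (j n : ℕ) : binom j (n : ℚ) = n.choose j := by
  refine natCast_mul_cancel j.factorial_ne_zero ?_
  rw [factorial_mul_binom, ← Nat.cast_mul, ← Nat.descFactorial_eq_factorial_mul_choose,
    Nat.descFactorial_eq_prod_range]
  by_cases h : j ≤ n
  · rw [Nat.cast_prod]
    refine Finset.prod_congr rfl fun l hl => ?_
    rw [Nat.cast_sub (by have := Finset.mem_range.1 hl; omega)]
  · have : n ∈ Finset.range j := by simpa using h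
    rw [Finset.prod_eq_zero this (sub_self _), Finset.prod_eq_zero this (Nat.sub_self _),
      Nat.cast_zero]

/-- The coefficient of `s ^ j t ^ k` in `(s + t + s t) ^ l`. -/
def mulCoeff (l j k : ℕ) : ℕ := if l ≤ j + k then l.choose k * k.choose (j + k - l) else 0

theorem mulCoeff_ne_zero {l j k : ℕ} (h : mulCoeff l j k ≠ 0) : l ≤ j + k ∧ j ≤ l ∧ k ≤ l := by
  unfold mulCoeff at h
  split_ifs at h with h1
  · refine ⟨h1, ?_, ?_⟩
    · by_contra h2
      exact h (by rw [Nat.choose_eq_zero_of_lt (n := k) (by omega), mul_zero])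
    · by_contra h2
      exact h (by rw [Nat.choose_eq_zero_of_lt (n := l) (by omega), zero_mul])
  · exact absurd rfl h

/-- Write `s + t + st = t (1 + s) + s` and expand twice: `t^k` comes with `s^(l-k) (1 + s)^k`, in
which the coefficient of `s^j` is `k` choose `j + k - l`. -/
theorem sum_mulCoeff {R : Type*} [CommSemiring R] (l : ℕ) (s t : R) :
    ∑ jk ∈ Finset.range (l + 1) ×ˢ Finset.range (l + 1),
      (mulCoeff l jk.1 jk.2 : R) * (s ^ jk.1 * t ^ jk.2) = (s + t + s * t) ^ l := by
  rw [Finset.sum_product_right]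
  have e : s + t + s * t = t * (1 + s) + s := by ring
  rw [e, add_pow]
  refine Finset.sum_congr rfl fun k hk => ?_
  have hk' : k ≤ l := Nat.lt_succ_iff.1 (Finset.mem_range.1 hk)
  have h1 : (1 + s) ^ k = ∑ i ∈ Finset.range (k + 1), (k.choose i : R) * s ^ i := by
    rw [add_comm, add_pow]
    exact Finset.sum_congr rfl fun i _ => by rw [one_pow, mul_one, mul_comm]
  rw [mul_pow, h1]
  rw [← Finset.sum_subset (s₁ := Finset.Icc (l - k) l)
    (fun j hj => by simp only [Finset.mem_Icc, Finset.mem_range] at *; omega)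
    (fun j hj hj' => by
      have : mulCoeff l j k = 0 := by
        by_contra h0
        have := mulCoeff_ne_zero h0
        exact hj' (Finset.mem_Icc.2 ⟨by omega, by omega⟩)
      rw [this, Nat.cast_zero, zero_mul])]
  simp only [Finset.mul_sum, Finset.sum_mul]
  symm
  refine Finset.sum_bij (fun i _ => i + (l - k)) (fun i hi => ?_) (fun _ _ _ _ h => by omega)
    (fun j hj => ?_) (fun i hi => ?_)
  · simp only [Finset.mem_range, Finset.mem_Icc] at *
    omega
  · simp only [Finset.mem_Icc] at hj
    exact ⟨j - (l - k), by simp only [Finset.mem_range]; omega, by omega⟩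
  · have hi' := Finset.mem_range.1 hi
    rw [mulCoeff, if_pos (by omega), show i + (l - k) + k - l = i by omega, pow_add]
    push_cast
    ring

theorem choose_mul_choose (x j k : ℕ) :
    x.choose j * x.choose k = ∑ l ∈ Finset.range (j + k + 1), mulCoeff l j k * x.choose l := by
  -- compare the coefficients of `s ^ j t ^ k` in `(1 + s) ^ x (1 + t) ^ x`
  have h1 : ((1 + Polynomial.X : Polynomial ℕ) ^ x).coeff j = x.choose j := by
    rw [add_comm, Polynomial.coeff_X_add_one_pow]; rfl
  let s : Polynomial (Polynomial ℕ) := Polynomial.C Polynomial.X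
  let t : Polynomial (Polynomial ℕ) := Polynomial.X
  have hL : (((1 + s) ^ x * (1 + t) ^ x).coeff k).coeff j = x.choose j * x.choose k := by
    have e : (1 + s) ^ x = Polynomial.C ((1 + Polynomial.X) ^ x) := by simp [s]
    have e2 : ((1 + t) ^ x).coeff k = (x.choose k : Polynomial ℕ) := by
      rw [add_comm, Polynomial.coeff_X_add_one_pow]
    rw [e, Polynomial.coeff_C_mul, e2, mul_comm, ← Polynomial.C_eq_natCast,
      Polynomial.coeff_C_mul, h1, mul_comm]
    rfl
  have hc : ∀ a b c : ℕ, (((c : Polynomial (Polynomial ℕ)) * (s ^ a * t ^ b)).coeff k).coeff j =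
      if k = b ∧ j = a then c else 0 := by
    intro a b c
    have e : (c : Polynomial (Polynomial ℕ)) * (s ^ a * t ^ b) =
        Polynomial.C (Polynomial.C c * Polynomial.X ^ a) * Polynomial.X ^ b := by
      simp [s, t, mul_assoc]
    rw [e, Polynomial.coeff_C_mul_X_pow]
    split_ifs with h2 h3 h3
    · rw [Polynomial.coeff_C_mul_X_pow, if_pos h3.2]
    · rw [Polynomial.coeff_C_mul_X_pow, if_neg fun h => h3 ⟨h2, h⟩]
    · exact absurd h3.1 h2
    · simp
  have hR : ∀ l, (((s + t + s * t) ^ l).coeff k).coeff j = mulCoeff l j k := by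
    intro l
    refine (congrArg (fun f : Polynomial (Polynomial ℕ) => (f.coeff k).coeff j)
      (sum_mulCoeff l s t).symm).trans ?_
    simp only [Polynomial.finsetSum_coeff, hc]
    by_cases h0 : mulCoeff l j k = 0
    · rw [h0]
      refine Finset.sum_eq_zero fun a _ => ?_
      split_ifs with h2
      · rw [← h2.1, ← h2.2, h0]
      · rfl
    · have := mulCoeff_ne_zero h0
      rw [Finset.sum_eq_single_of_mem (j, k) (by simp; omega)]
      · simp
      · rintro ⟨a, b⟩ _ hab
        rw [if_neg]
        rintro ⟨rfl, rfl⟩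
        exact hab rfl
  have e : (1 + s) ^ x * (1 + t) ^ x =
      ∑ l ∈ Finset.range (x + 1), (x.choose l : Polynomial (Polynomial ℕ)) * (s + t + s * t) ^ l := by
    refine (mul_pow (1 + s) (1 + t) x).symm.trans ?_
    rw [show (1 + s) * (1 + t) = (s + t + s * t) + 1 by ring]
    refine (add_pow (s + t + s * t) 1 x).trans ?_
    exact Finset.sum_congr rfl fun i _ => by rw [one_pow, mul_one]; exact mul_comm ((s + t + s * t) ^ i) (x.choose i : Polynomial (Polynomial ℕ))
  rw [← hL, e]
  have hm : ∀ (c : ℕ) (f : Polynomial (Polynomial ℕ)),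
      (((c : Polynomial (Polynomial ℕ)) * f).coeff k).coeff j = c * (f.coeff k).coeff j := by
    intro c f
    rw [← nsmul_eq_mul, Polynomial.coeff_smul, Polynomial.coeff_smul, nsmul_eq_mul]
    simp
  simp only [Polynomial.finsetSum_coeff, hm, hR]
  -- The two summation ranges can be exchanged: `x.choose l` vanishes for `l > x`, and `mulCoeff l j
  -- k` for `l > j + k`.
  rcases le_total (x + 1) (j + k + 1) with h | h
  · rw [Finset.sum_subset (Finset.range_mono h) fun l _ hl => ?_]
    · exact Finset.sum_congr rfl fun l _ => mul_comm _ _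
    · rw [Nat.choose_eq_zero_of_lt (by simpa using hl), zero_mul]
  · symm
    rw [Finset.sum_subset (Finset.range_mono h) fun l _ hl => ?_]
    · exact Finset.sum_congr rfl fun l _ => mul_comm _ _
    · have : mulCoeff l j k = 0 := by
        by_contra h0
        exact hl (Finset.mem_range.2 (by have := mulCoeff_ne_zero h0; omega))
      rw [this, zero_mul]

/-- Both sides are polynomials in `x` over `ℚ` that agree at all natural numbers, by
`choose_mul_choose`. -/
theorem binom_mul_binom (j k : ℕ) (x : A) :
    binom j x * binom k x = ∑ l ∈ Finset.range (j + k + 1), (mulCoeff l j k : A) * binom l x := by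
  have h : (binom j Polynomial.X * binom k Polynomial.X : Polynomial ℚ) =
      ∑ l ∈ Finset.range (j + k + 1), (mulCoeff l j k : Polynomial ℚ) * binom l Polynomial.X := by
    refine Polynomial.eq_of_infinite_eval_eq _ _
      ((Set.infinite_range_of_injective Nat.cast_injective).mono ?_)
    rintro _ ⟨n, rfl⟩
    change Polynomial.evalRingHom (n : ℚ) _ = Polynomial.evalRingHom (n : ℚ) _
    simp only [map_mul, map_sum, map_binom, map_natCast, Polynomial.coe_evalRingHom,
      Polynomial.eval_X, binom_natCast]
    exact_mod_cast choose_mul_choose n j k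
  have := congrArg (Polynomial.aeval x : Polynomial ℚ →ₐ[ℚ] A).toRingHom h
  simp only [map_mul, map_sum, map_binom, map_natCast] at this
  simpa using this

end Binomial

/-! ### Unions of Fréchet rings with derivations -/

/-- `T (T - 1) ⋯ (T - j + 1)`, shifted by `t`. -/
def fallProd {M : Type*} [AddCommGroup M] (T : AddMonoid.End M) (t j : ℕ) : AddMonoid.End M :=
  ((List.range j).map fun l : ℕ => T - ((t + l : ℕ) : AddMonoid.End M)).prod

theorem fallProd_zero {M : Type*} [AddCommGroup M] (T : AddMonoid.End M) (t : ℕ) :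
    fallProd T t 0 = 1 := rfl

theorem fallProd_succ {M : Type*} [AddCommGroup M] (T : AddMonoid.End M) (t j : ℕ) :
    fallProd T t (j + 1) = fallProd T t j * (T - ((t + j : ℕ) : AddMonoid.End M)) := by
  simp [fallProd, List.range_succ]

theorem fallProd_add {M : Type*} [AddCommGroup M] (T : AddMonoid.End M) (t j k : ℕ) :
    fallProd T t (j + k) = fallProd T t j * fallProd T (t + j) k := by
  induction k with
  | zero => rw [add_zero, fallProd_zero, mul_one]
  | succ k ih => rw [← add_assoc, fallProd_succ, ih, fallProd_succ, mul_assoc, add_assoc t j k]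

/-- A derivation as an element of the ring of additive endomorphisms. -/
def derEnd {𝔬 S : Type*} [CommRing 𝔬] [CommRing S] [Algebra 𝔬 S] (D : Derivation 𝔬 S S) :
    AddMonoid.End S := (D : S →ₗ[𝔬] S).toAddMonoidHom

/-- A ring `S = ⋃_{r > 0} S_r`, where `S_r = Mem r` is a Fréchet ring for a family of valuations
`w_s`, `s ∈ I`, `s ≤ r`, with commuting derivations `D_i` and units `z_i`; the elements with
`w_s ≥ C` form the group `W s C`. -/
structure FrechetUnion {𝔬 : Type*} [CommRing 𝔬] {m : ℕ} {S : Type*} [CommRing S] [Algebra 𝔬 S]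
    (π : 𝔬) (p e : ℕ) (q : ℝ) (D : Fin m → Derivation 𝔬 S S) (zs : Fin m → Sˣ) where
  -- The index `0` may or may not belong to `I`: it is the `π`-adic valuation on `Γ_con[1/π]` and
  -- does not exist on `Γ_an,con`.
  I : Set ℝ
  Mem : ℝ → AddSubgroup S
  W : ℝ → ℝ → AddSubgroup S
  nonneg : ∀ s ∈ I, 0 ≤ s
  mem_I : ∀ s, 0 < s → s ∈ I
  Mem_anti : ∀ {r t}, 0 < t → t ≤ r → Mem r ≤ Mem t
  Mem_mul : ∀ {r x y}, x ∈ Mem r → y ∈ Mem r → x * y ∈ Mem r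
  Mem_algebraMap : ∀ {r} c, algebraMap 𝔬 S c ∈ Mem r
  Mem_natCast_mul : ∀ {r} {k : ℕ} {x : S}, k ≠ 0 → (k : S) * x ∈ Mem r → x ∈ Mem r
  W_anti : ∀ {s C C'}, C' ≤ C → W s C ≤ W s C'
  W_mul : ∀ {s C C' x y}, x ∈ W s C → y ∈ W s C' → x * y ∈ W s (C + C')
  W_algebraMap : ∀ {s} c, algebraMap 𝔬 S c ∈ W s 0
  W_natCast_mul : ∀ {s C} {k : ℕ} {x : S}, k ≠ 0 →
    ((k : S) * x ∈ W s (C + e * padicValNat p k) ↔ x ∈ W s C)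
  exists_Mem : ∀ x, ∃ r, 0 < r ∧ x ∈ Mem r
  exists_W : ∀ {r x}, 0 < r → x ∈ Mem r → ∀ s ∈ I, s ≤ r → ∃ C, x ∈ W s C
  -- Uniformity is required only on one period `[r/q, r]` of `s ↦ s/q`, and at the fixed point `0`.
  -- The Frobenius reaches all other small radii from there, and in `Γ_an,con` nothing uniform holds
  -- as `s → 0`.
  exists_W_unif : ∀ {r x}, 0 < r → x ∈ Mem r → ∃ C, ∀ s ∈ I, s ≤ r → s = 0 ∨ r / q ≤ s → x ∈ W s C
  sep : ∀ {s x}, s ∈ I → (∀ C, x ∈ W s C) → x = 0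
  complete : ∀ {r} (f : ℕ → S), 0 < r → (∀ i, f i ∈ Mem r) →
    (∀ s ∈ I, s ≤ r → ∀ C, ∀ᶠ i in atTop, f i ∈ W s C) →
    ∃ y ∈ Mem r, ∀ s ∈ I, s ≤ r → ∀ C, ∀ᶠ k in atTop, ∑ i ∈ Finset.range k, f i - y ∈ W s C
  dense : ∀ Q : Subring S, (∀ c, algebraMap 𝔬 S c ∈ Q) → (∀ h, (zs h : S) ∈ Q) →
    (∀ h, (↑(zs h)⁻¹ : S) ∈ Q) → (∀ x, algebraMap 𝔬 S π * x ∈ Q → x ∈ Q) →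
    ∀ x, ∃ r, 0 < r ∧ ∀ s, 0 < s → s ≤ r → ∀ C, ∃ x' ∈ Q, x - x' ∈ Mem r ∧ x - x' ∈ W s C
  D_Mem : ∀ {r x} i, x ∈ Mem r → D i x ∈ Mem r
  D_W : ∀ {s C x} i, x ∈ W s C → D i x ∈ W s C
  -- On a monomial, `P` consecutive factors act by a product of `P` consecutive integers, a multiple
  -- of `P!`.
  D_block : ∀ {s C x} i (t P : ℕ), x ∈ W s C →
    fallProd (derEnd (D i)) t P x ∈ W s (C + e * padicValNat p P.factorial)
  D_unit : ∀ i h, D i (zs h) = if i = h then (zs h : S) else 0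

namespace FrechetUnion

section Basic

variable {𝔬 : Type*} [CommRing 𝔬] {m : ℕ} {S : Type*} [CommRing S] [Algebra 𝔬 S]
  {π : 𝔬} {p e : ℕ} {q : ℝ} {D : Fin m → Derivation 𝔬 S S} {zs : Fin m → Sˣ}
  (𝓢 : FrechetUnion π p e q D zs)

theorem W_natCast (s : ℝ) (k : ℕ) : (k : S) ∈ 𝓢.W s 0 := by
  simpa using 𝓢.W_algebraMap (s := s) (k : 𝔬)

theorem Mem_natCast (r : ℝ) (k : ℕ) : (k : S) ∈ 𝓢.Mem r := by
  simpa using 𝓢.Mem_algebraMap (r := r) (k : 𝔬)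

theorem Mem_one (r : ℝ) : (1 : S) ∈ 𝓢.Mem r := by simpa using 𝓢.Mem_natCast r 1

theorem W_one (s : ℝ) : (1 : S) ∈ 𝓢.W s 0 := by simpa using 𝓢.W_natCast s 1

theorem Mem_pow {r : ℝ} {x : S} (h : x ∈ 𝓢.Mem r) (k : ℕ) : x ^ k ∈ 𝓢.Mem r := by
  induction k with
  | zero => simpa using 𝓢.Mem_one r
  | succ k ih => rw [pow_succ]; exact 𝓢.Mem_mul ih h

theorem W_pow {s C : ℝ} {x : S} (h : x ∈ 𝓢.W s C) (k : ℕ) : x ^ k ∈ 𝓢.W s (k * C) := by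
  induction k with
  | zero => simpa using 𝓢.W_one s
  | succ k ih =>
    rw [pow_succ]
    have := 𝓢.W_mul ih h
    rwa [show (k : ℝ) * C + C = ((k + 1 : ℕ) : ℝ) * C by push_cast; ring] at this

theorem Mem_prod {r : ℝ} {α : Type*} (A : Finset α) {f : α → S} (h : ∀ i ∈ A, f i ∈ 𝓢.Mem r) :
    ∏ i ∈ A, f i ∈ 𝓢.Mem r := by
  classical
  induction A using Finset.induction_on with
  | empty => simpa using 𝓢.Mem_one r
  | insert a A ha ih =>
    rw [Finset.prod_insert ha]
    exact 𝓢.Mem_mul (h a (by simp)) (ih fun i hi => h i (by simp [hi]))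

theorem W_prod {s : ℝ} {α : Type*} (A : Finset α) {f : α → S} {C : α → ℝ}
    (h : ∀ i ∈ A, f i ∈ 𝓢.W s (C i)) : ∏ i ∈ A, f i ∈ 𝓢.W s (∑ i ∈ A, C i) := by
  classical
  induction A using Finset.induction_on with
  | empty => simpa using 𝓢.W_one s
  | insert a A ha ih =>
    rw [Finset.prod_insert ha, Finset.sum_insert ha]
    exact 𝓢.W_mul (h a (by simp)) (ih fun i hi => h i (by simp [hi]))

theorem exists_Mem_finite {α : Type*} [Finite α] (f : α → S) :
    ∃ r, 0 < r ∧ ∀ i, f i ∈ 𝓢.Mem r := by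
  choose r hr h using fun i => 𝓢.exists_Mem (f i)
  obtain ⟨ρ, hρ, hle⟩ : ∃ ρ, 0 < ρ ∧ ∀ i, ρ ≤ r i := by
    obtain h0 | h0 := isEmpty_or_nonempty α
    · exact ⟨1, one_pos, fun i => h0.elim i⟩
    · obtain ⟨i, hi⟩ := Finite.exists_min r
      exact ⟨r i, hr i, hi⟩
  exact ⟨ρ, hρ, fun i => 𝓢.Mem_anti hρ (hle i) (h i)⟩

theorem exists_le_finite {α : Type*} [Finite α] {P : α → ℝ → Prop}
    (hP : ∀ i C C', C' ≤ C → P i C → P i C') (h : ∀ i, ∃ C, P i C) : ∃ C, ∀ i, P i C := by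
  choose C hC using h
  obtain h0 | h0 := isEmpty_or_nonempty α
  · exact ⟨0, fun i => h0.elim i⟩
  · obtain ⟨i, hi⟩ := Finite.exists_min C
    exact ⟨C i, fun j => hP j _ _ (hi j) (hC j)⟩

theorem exists_W_finite {α : Type*} [Finite α] {f : α → S} {r : ℝ} (hr : 0 < r)
    (hf : ∀ i, f i ∈ 𝓢.Mem r) {s : ℝ} (hs : s ∈ 𝓢.I) (hsr : s ≤ r) : ∃ C, ∀ i, f i ∈ 𝓢.W s C :=
  exists_le_finite (fun _ _ _ h h' => 𝓢.W_anti h h') fun i => 𝓢.exists_W hr (hf i) s hs hsr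

theorem div_mem (hq : 1 < q) {s : ℝ} (hs : s ∈ 𝓢.I) : s / q ∈ 𝓢.I := by
  rcases (𝓢.nonneg s hs).eq_or_lt with h | h
  · rw [← h, zero_div, h]
    exact hs
  · exact 𝓢.mem_I _ (div_pos h (by linarith))

end Basic

section Module

variable {𝔬 : Type*} [CommRing 𝔬] {m : ℕ} {S : Type*} [CommRing S] [Algebra 𝔬 S]
  {π : 𝔬} {p e : ℕ} {q : ℝ} {D : Fin m → Derivation 𝔬 S S} {zs : Fin m → Sˣ}
  (𝓢 : FrechetUnion π p e q D zs) {M : Type*} [AddCommGroup M] [Module S M] {n : ℕ}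
  (b : Module.Basis (Fin n) S M)

/-- The vectors with coordinates in `S_r`. -/
def MM (r : ℝ) : AddSubgroup M where
  carrier := {v | ∀ l, b.repr v l ∈ 𝓢.Mem r}
  zero_mem' l := by simp [(𝓢.Mem r).zero_mem]
  add_mem' hx hy l := by simpa using (𝓢.Mem r).add_mem (hx l) (hy l)
  neg_mem' hx l := by simpa using (𝓢.Mem r).neg_mem (hx l)

/-- The vectors whose coordinates have `w_s ≥ C`. -/
def WM (s C : ℝ) : AddSubgroup M where
  carrier := {v | ∀ l, b.repr v l ∈ 𝓢.W s C}
  zero_mem' l := by simp [(𝓢.W s C).zero_mem]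
  add_mem' hx hy l := by simpa using (𝓢.W s C).add_mem (hx l) (hy l)
  neg_mem' hx l := by simpa using (𝓢.W s C).neg_mem (hx l)

/-- The neighborhoods of zero in `M_r`. -/
def Nhds (r : ℝ) : Set (AddSubgroup M) :=
  {U | ∃ s ∈ 𝓢.I, s ≤ r ∧ ∃ C, U = 𝓢.MM b r ⊓ 𝓢.WM b s C}

theorem mem_Nhds {r s : ℝ} (hs : s ∈ 𝓢.I) (hsr : s ≤ r) (C : ℝ) :
    𝓢.MM b r ⊓ 𝓢.WM b s C ∈ 𝓢.Nhds b r := ⟨s, hs, hsr, C, rfl⟩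

theorem MM_anti {r t : ℝ} (ht : 0 < t) (htr : t ≤ r) : 𝓢.MM b r ≤ 𝓢.MM b t :=
  fun _ hv l => 𝓢.Mem_anti ht htr (hv l)

theorem WM_anti {s C C' : ℝ} (h : C' ≤ C) : 𝓢.WM b s C ≤ 𝓢.WM b s C' :=
  fun _ hv l => 𝓢.W_anti h (hv l)

theorem smul_MM {r : ℝ} {a : S} {v : M} (ha : a ∈ 𝓢.Mem r) (hv : v ∈ 𝓢.MM b r) :
    a • v ∈ 𝓢.MM b r := fun l => by
  rw [map_smul, Finsupp.smul_apply, smul_eq_mul]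
  exact 𝓢.Mem_mul ha (hv l)

theorem smul_WM {s C C' : ℝ} {a : S} {v : M} (ha : a ∈ 𝓢.W s C) (hv : v ∈ 𝓢.WM b s C') :
    a • v ∈ 𝓢.WM b s (C + C') := fun l => by
  rw [map_smul, Finsupp.smul_apply, smul_eq_mul]
  exact 𝓢.W_mul ha (hv l)

theorem exists_MM (v : M) : ∃ r, 0 < r ∧ v ∈ 𝓢.MM b r := 𝓢.exists_Mem_finite _

theorem exists_WM {v : M} {r : ℝ} (hr : 0 < r) (hv : v ∈ 𝓢.MM b r) {s : ℝ} (hs : s ∈ 𝓢.I)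
    (hsr : s ≤ r) : ∃ C, v ∈ 𝓢.WM b s C := 𝓢.exists_W_finite hr hv hs hsr

theorem Nhds_anti {r t : ℝ} (ht : 0 < t) (htr : t ≤ r) {ι : Type*} {f : ι → M} {y : M}
    (h : HS (𝓢.Nhds b r) f y) : HS (𝓢.Nhds b t) f y :=
  h.of_family_le (by
    rintro _ ⟨s, hs, hst, C, rfl⟩
    exact ⟨_, 𝓢.mem_Nhds b hs (hst.trans htr) C, inf_le_inf_right _ (𝓢.MM_anti b ht htr)⟩)

theorem Nhds_sep {r : ℝ} (hr : 0 < r) (x : M) (h : ∀ U ∈ 𝓢.Nhds b r, x ∈ U) : x = 0 := by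
  refine b.repr.map_eq_zero_iff.1 (Finsupp.ext fun l => ?_)
  exact 𝓢.sep (𝓢.mem_I r hr) fun C => (h _ (𝓢.mem_Nhds b (𝓢.mem_I r hr) le_rfl C)).2 l

/-- Completeness, for sums of countable families. -/
theorem exists_sum {ι : Type*} [Countable ι] {r : ℝ} (hr : 0 < r) {f : ι → S}
    (hf : ∀ i, f i ∈ 𝓢.Mem r)
    (h0 : ∀ s ∈ 𝓢.I, s ≤ r → ∀ C, {i | f i ∉ 𝓢.W s C}.Finite) :
    ∃ y ∈ 𝓢.Mem r, ∀ s ∈ 𝓢.I, s ≤ r → ∀ C, ∃ A₀ : Finset ι, ∀ A, A₀ ⊆ A →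
      ∑ i ∈ A, f i - y ∈ 𝓢.W s C := by
  classical
  obtain ⟨c, hc⟩ := Countable.exists_injective_nat ι
  let g : ℕ → S := Function.extend c f 0
  have hg : ∀ i, g (c i) = f i := fun i => hc.extend_apply f 0 i
  have hg0 : ∀ k, (¬∃ i, c i = k) → g k = 0 := fun k hk => Function.extend_apply' f (0 : ℕ → S) k hk
  have hgC : ∀ (U : AddSubgroup S) k, (∀ i, c i = k → f i ∈ U) → g k ∈ U := by
    intro U k hk
    by_cases h : ∃ i, c i = k
    · obtain ⟨i, rfl⟩ := h
      rw [hg]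
      exact hk i rfl
    · rw [hg0 k h]
      exact U.zero_mem
  obtain ⟨y, hy, hlim⟩ := 𝓢.complete g hr (fun k => hgC _ k fun i _ => hf i) (by
    intro s hs hsr C
    have := ((h0 s hs hsr C).image c)
    obtain ⟨N, hN⟩ := this.bddAbove
    refine eventually_atTop.2 ⟨N + 1, fun k hk => hgC _ k fun i hi => ?_⟩
    by_contra hcon
    have := hN ⟨i, hcon, rfl⟩
    omega)
  refine ⟨y, hy, fun s hs hsr C => ?_⟩
  obtain ⟨N, hN⟩ := eventually_atTop.1 (hlim s hs hsr C)
  obtain ⟨N', hN'⟩ := ((h0 s hs hsr C).image c).bddAbove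
  let R := max N (N' + 1)
  refine ⟨(h0 s hs hsr C).toFinset, fun A hA => ?_⟩
  have h1 := hN R (le_max_left _ _)
  -- Terms that occur in only one of the two sums, over `A` and over the initial segment up to `R`,
  -- are already in `W s C`, so the two sums differ by an element of it.
  have hgW : ∀ k, k ∉ A.image c ∩ Finset.range R →
      (k ∈ A.image c ∨ k ∈ Finset.range R) → g k ∈ 𝓢.W s C := by
    intro k hk _
    refine hgC _ k fun i hi => ?_
    by_contra hcon
    refine hk (Finset.mem_inter.2 ⟨Finset.mem_image.2 ⟨i, hA ?_, hi⟩, ?_⟩)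
    · simpa using hcon
    · have := hN' ⟨i, hcon, rfl⟩
      have : N' + 1 ≤ R := le_max_right _ _
      rw [Finset.mem_range]
      omega
  have h2 : ∑ i ∈ A, f i = ∑ k ∈ A.image c, g k := by
    rw [Finset.sum_image fun _ _ _ _ h => hc h]
    exact Finset.sum_congr rfl fun i _ => (hg i).symm
  have h3 : ∑ k ∈ A.image c \ (A.image c ∩ Finset.range R), g k ∈ 𝓢.W s C :=
    (𝓢.W s C).sum_mem fun k hk => hgW k (Finset.mem_sdiff.1 hk).2 (Or.inl (Finset.mem_sdiff.1 hk).1)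
  have h4 : ∑ k ∈ Finset.range R \ (A.image c ∩ Finset.range R), g k ∈ 𝓢.W s C :=
    (𝓢.W s C).sum_mem fun k hk => hgW k (Finset.mem_sdiff.1 hk).2 (Or.inr (Finset.mem_sdiff.1 hk).1)
  have h5 := Finset.sum_sdiff (f := g) (Finset.inter_subset_left (s₁ := A.image c)
    (s₂ := Finset.range R))
  have h6 := Finset.sum_sdiff (f := g) (Finset.inter_subset_right (s₁ := A.image c)
    (s₂ := Finset.range R))
  have := (𝓢.W s C).add_mem ((𝓢.W s C).sub_mem h3 h4) h1
  rw [h2, ← h5]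
  rw [← h6] at this
  convert this using 1
  abel

theorem exists_HS {ι : Type*} [Countable ι] {r : ℝ} (hr : 0 < r) {f : ι → M}
    (hf : ∀ i, f i ∈ 𝓢.MM b r)
    (h0 : ∀ s ∈ 𝓢.I, s ≤ r → ∀ C, {i | f i ∉ 𝓢.WM b s C}.Finite) :
    ∃ y, HS (𝓢.Nhds b r) f y := by
  classical
  have key := fun l => 𝓢.exists_sum hr (f := fun i => b.repr (f i) l) (fun i => hf i l)
    (fun s hs hsr C => (h0 s hs hsr C).subset fun i hi h => hi (h l))
  choose y hy hlim using key
  refine ⟨b.equivFun.symm y, ?_⟩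
  have hrepr : ∀ l, b.repr (b.equivFun.symm y) l = y l := fun l => by
    rw [← Module.Basis.equivFun_apply, LinearEquiv.apply_symm_apply]
  have hyM : b.equivFun.symm y ∈ 𝓢.MM b r := fun l => by
    rw [hrepr]
    exact hy l
  rintro _ ⟨s, hs, hsr, C, rfl⟩
  choose A hA using fun l => hlim l s hs hsr C
  refine ⟨Finset.univ.biUnion A, fun B hB =>
    ⟨AddSubgroup.sub_mem _ (AddSubgroup.sum_mem _ fun i _ => hf i) hyM, fun l => ?_⟩⟩
  have := hA l B ((Finset.subset_biUnion_of_mem A (Finset.mem_univ l)).trans hB)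
  rw [map_sub, Finsupp.sub_apply, hrepr, map_sum, Finsupp.finsetSum_apply]
  exact this

end Module

end FrechetUnion

/-! ### Valuations of factorials -/

theorem padicValNat_factorial_prime_pow (p : ℕ) [hp : Fact p.Prime] (f : ℕ) :
    (p - 1) * padicValNat p (p ^ f).factorial + 1 = p ^ f := by
  obtain ⟨k, rfl⟩ : ∃ k, p = k + 1 := ⟨p - 1, by have := hp.out.pos; omega⟩
  induction f with
  | zero => simp
  | succ f ih =>
    rw [pow_succ', padicValNat_factorial_mul, Nat.add_sub_cancel] at *
    linarith

/-- Legendre's formula gives `(p-1) v_p(j!) ≤ j`. Write `j = a p^f + b` and replace `p^f` by `(p-1)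
v_p((p^f)!) + 1`: blocks of length `p^f` account for almost all of `v_p(j!)`, the excess being at
most `a + b`. -/
theorem padicValNat_factorial_le (p : ℕ) [hp : Fact p.Prime] (f j : ℕ) :
    padicValNat p j.factorial ≤
      (j / p ^ f) * padicValNat p (p ^ f).factorial + j / p ^ f + j % p ^ f := by
  have h1 := padicValNat_factorial_prime_pow p f
  have h2 : (p - 1) * padicValNat p j.factorial ≤ j := by
    rw [sub_one_mul_padicValNat_factorial]
    exact Nat.sub_le _ _
  have h3 := Nat.div_add_mod j (p ^ f)
  obtain ⟨k, rfl⟩ : ∃ k, p = k + 2 := ⟨p - 2, by have := hp.out.two_le; omega⟩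
  rw [show k + 2 - 1 = k + 1 by omega] at h1 h2
  set a := j / (k + 2) ^ f
  set b := j % (k + 2) ^ f
  set v := padicValNat (k + 2) ((k + 2) ^ f).factorial
  set u := padicValNat (k + 2) j.factorial
  rw [← h1] at h3
  have : (k + 1) * u ≤ (k + 1) * (a * v + a + b) := by nlinarith
  exact Nat.le_of_mul_le_mul_left this k.succ_pos

namespace FrechetUnion

/-! ### Operators on a finite free module and their effect on `w_s` -/

section Operators

universe u w

variable {𝔬 : Type*} [CommRing 𝔬] {m : ℕ} {S : Type u} [CommRing S] [Algebra 𝔬 S]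
  {π : 𝔬} {p e : ℕ} {q : ℝ} {D : Fin m → Derivation 𝔬 S S} {zs : Fin m → Sˣ}
  (𝓢 : FrechetUnion π p e q D zs) {M : Type w} [AddCommGroup M] [Module S M] {n : ℕ}
  (b b' : Module.Basis (Fin n) S M)

theorem mem_MM_of_basis {r : ℝ} (h : ∀ l, b' l ∈ 𝓢.MM b r) {v : M} (hv : v ∈ 𝓢.MM b' r) :
    v ∈ 𝓢.MM b r := by
  rw [← b'.sum_repr v]
  exact AddSubgroup.sum_mem _ fun l _ => 𝓢.smul_MM b (hv l) (h l)

theorem mem_WM_of_basis {s C C' : ℝ} (h : ∀ l, b' l ∈ 𝓢.WM b s C) {v : M}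
    (hv : v ∈ 𝓢.WM b' s C') : v ∈ 𝓢.WM b s (C' + C) := by
  rw [← b'.sum_repr v]
  exact AddSubgroup.sum_mem _ fun l _ => 𝓢.smul_WM b (hv l) (h l)

/-- The operator `T` raises `w_s` by at least `E`. -/
def Raises (s E : ℝ) (T : AddMonoid.End M) : Prop :=
  ∀ C v, v ∈ 𝓢.WM b s C → T v ∈ 𝓢.WM b s (C + E)

variable {𝓢 b}

theorem Raises.mono {s E E' : ℝ} {T : AddMonoid.End M} (h : 𝓢.Raises b s E T) (hE : E' ≤ E) :
    𝓢.Raises b s E' T := fun C v hv => 𝓢.WM_anti b (by linarith) (h C v hv)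

theorem Raises.one {s : ℝ} : 𝓢.Raises b s 0 1 := fun C v hv => by rwa [add_zero]

theorem Raises.mul {s E E' : ℝ} {T T' : AddMonoid.End M} (h : 𝓢.Raises b s E T)
    (h' : 𝓢.Raises b s E' T') : 𝓢.Raises b s (E + E') (T * T') := fun C v hv => by
  have := h _ _ (h' C v hv)
  rwa [add_assoc, add_comm E'] at this

theorem Raises.add {s E : ℝ} {T T' : AddMonoid.End M} (h : 𝓢.Raises b s E T)
    (h' : 𝓢.Raises b s E T') : 𝓢.Raises b s E (T + T') := fun C v hv =>
  AddSubgroup.add_mem _ (h C v hv) (h' C v hv)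

theorem Raises.sub {s E : ℝ} {T T' : AddMonoid.End M} (h : 𝓢.Raises b s E T)
    (h' : 𝓢.Raises b s E T') : 𝓢.Raises b s E (T - T') := fun C v hv =>
  AddSubgroup.sub_mem _ (h C v hv) (h' C v hv)

theorem Raises.natCast {s : ℝ} (k : ℕ) : 𝓢.Raises b s 0 (k : AddMonoid.End M) := by
  induction k with
  | zero => exact fun C v _ => by simp
  | succ k ih => rw [Nat.cast_succ]; exact ih.add Raises.one

theorem Raises.fallProd {s : ℝ} {T : AddMonoid.End M} (h : 𝓢.Raises b s 0 T) (t j : ℕ) :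
    𝓢.Raises b s 0 (fallProd T t j) := by
  induction j with
  | zero => exact Raises.one
  | succ j ih =>
    rw [fallProd_succ]
    simpa using ih.mul (h.sub (Raises.natCast (t + j)))

/-- Replace one factor at a time: each term of the telescoping sum contains `T - T'` once, and all
its other factors preserve `w_s`. -/
theorem Raises.fallProd_sub {s E : ℝ} {T T' : AddMonoid.End M} (h : 𝓢.Raises b s 0 T)
    (h' : 𝓢.Raises b s 0 T') (hTT : 𝓢.Raises b s E (T - T')) (t j : ℕ) :
    𝓢.Raises b s E (FakeAnnulus.fallProd T t j - FakeAnnulus.fallProd T' t j) := by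
  induction j with
  | zero =>
    rw [fallProd_zero, fallProd_zero, sub_self]
    exact fun C v _ => AddSubgroup.zero_mem _
  | succ j ih =>
    rw [fallProd_succ, fallProd_succ]
    have h1 := ih.mul (h.sub (Raises.natCast (t + j)))
    have h2 := (h'.fallProd t j).mul hTT
    rw [add_zero] at h1
    rw [zero_add] at h2
    have h3 := h1.add h2
    convert h3 using 1
    noncomm_ring

variable (b) in
/-- The derivation `D_i` acting on coordinates. -/
def _root_.FakeAnnulus.coordD (D : Derivation 𝔬 S S) : AddMonoid.End M where
  toFun v := b.equivFun.symm fun l => D (b.repr v l)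
  map_zero' := by simp [← Pi.zero_def]
  map_add' x y := by
    rw [← map_add]
    congr 1
    ext l
    simp

theorem repr_coordD (D : Derivation 𝔬 S S) (v : M) (l : Fin n) :
    b.repr (coordD b D v) l = D (b.repr v l) := by
  rw [← Module.Basis.equivFun_apply]
  change b.equivFun (b.equivFun.symm _) l = _
  rw [LinearEquiv.apply_symm_apply]

theorem Raises.coordD (s : ℝ) (i : Fin m) : 𝓢.Raises b s 0 (coordD b (D i)) := fun C v hv l => by
  rw [repr_coordD, add_zero]
  exact 𝓢.D_W i (hv l)

theorem repr_fallProd_coordD (i : Fin m) (t j : ℕ) (v : M) (l : Fin n) :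
    b.repr (FakeAnnulus.fallProd (FakeAnnulus.coordD b (D i)) t j v) l =
      FakeAnnulus.fallProd (derEnd (D i)) t j (b.repr v l) := by
  induction j generalizing v with
  | zero => rfl
  | succ j ih =>
    rw [fallProd_succ, fallProd_succ]
    change b.repr (FakeAnnulus.fallProd _ t j _) l = FakeAnnulus.fallProd _ t j _
    rw [ih]
    congr 1
    change b.repr (FakeAnnulus.coordD b (D i) v - ((t + j : ℕ) : AddMonoid.End M) v) l =
      D i (b.repr v l) - ((t + j : ℕ) : AddMonoid.End S) (b.repr v l)
    rw [map_sub, Finsupp.sub_apply, repr_coordD, AddMonoid.End.natCast_apply,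
      AddMonoid.End.natCast_apply, map_nsmul, Finsupp.smul_apply]

theorem Raises.fallProd_coordD (s : ℝ) (i : Fin m) (t P : ℕ) :
    𝓢.Raises b s (e * padicValNat p P.factorial)
      (FakeAnnulus.fallProd (FakeAnnulus.coordD b (D i)) t P) := fun C v hv l => by
  rw [repr_fallProd_coordD]
  exact 𝓢.D_block i t P (hv l)

/-- By the Leibniz rule the difference between `Δ_i` and `D_i` acting on coordinates is `S`-linear,
with the matrix of `Δ_i` on the basis. -/
theorem Raises.delta_sub {X : NablaMod.{u, w} D} {b : Module.Basis (Fin n) S X.carrier} {s E : ℝ}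
    {i : Fin m} (h : ∀ l, X.Δ i (b l) ∈ 𝓢.WM b s E) :
    𝓢.Raises b s E (X.deltaEnd i - FakeAnnulus.coordD b (D i)) := fun C v hv => by
  have h1 : X.deltaEnd i v = ∑ l, (b.repr v l • X.Δ i (b l) + D i (b.repr v l) • b l) := by
    conv_lhs => rw [← b.sum_repr v, map_sum]
    exact Finset.sum_congr rfl fun l _ => X.leibniz i _ _
  have h2 : FakeAnnulus.coordD b (D i) v = ∑ l, D i (b.repr v l) • b l :=
    b.equivFun_symm_apply _
  change X.deltaEnd i v - FakeAnnulus.coordD b (D i) v ∈ _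
  rw [h1, h2, Finset.sum_add_distrib, add_sub_cancel_right]
  exact AddSubgroup.sum_mem _ fun l _ => 𝓢.smul_WM b (hv l) (h l)

/-- When the matrix of `Δ_i` is as small as `P!`, the operator is so close to `D_i` on coordinates
that every block of `P` consecutive factors gains the valuation of `P!`. The incomplete last block
loses nothing. -/
theorem Raises.fallProd_delta {X : NablaMod.{u, w} D} {b : Module.Basis (Fin n) S X.carrier}
    {s : ℝ} {i : Fin m} (P : ℕ)
    (h : ∀ l, X.Δ i (b l) ∈ 𝓢.WM b s (e * padicValNat p P.factorial)) (j : ℕ) :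
    𝓢.Raises b s ((j / P : ℕ) * (e * padicValNat p P.factorial))
      (FakeAnnulus.fallProd (X.deltaEnd i) 0 j) := by
  set E : ℝ := e * padicValNat p P.factorial with hE
  have hE0 : 0 ≤ E := by positivity
  have h1 := Raises.delta_sub h
  have hD : 𝓢.Raises b s 0 (X.deltaEnd i) := by
    simpa using (h1.mono hE0).add (Raises.coordD s i)
  have hblock : ∀ t, 𝓢.Raises b s E (FakeAnnulus.fallProd (X.deltaEnd i) t P) := fun t => by
    simpa using (hD.fallProd_sub (Raises.coordD s i) h1 t P).add (Raises.fallProd_coordD s i t P)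
  have hblocks : ∀ a : ℕ, 𝓢.Raises b s (a * E) (FakeAnnulus.fallProd (X.deltaEnd i) 0 (a * P)) := by
    intro a
    induction a with
    | zero => simpa [fallProd_zero] using Raises.one
    | succ a ih =>
      rw [Nat.succ_mul, fallProd_add]
      exact (ih.mul (hblock _)).mono (by push_cast; linarith)
  have h2 := (hblocks (j / P)).mul (hD.fallProd (0 + j / P * P) (j % P))
  rw [← fallProd_add, add_zero, Nat.div_add_mod'] at h2
  exact h2

theorem _root_.FakeAnnulus.fallingDelta_eq (X : NablaMod.{u, w} D) (J : Fin m → ℕ) :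
    fallingDelta X J = (List.ofFn fun i => FakeAnnulus.fallProd (X.deltaEnd i) 0 (J i)).prod := by
  simp only [fallingDelta, FakeAnnulus.fallProd, zero_add]

theorem Raises.list_prod {s : ℝ} {k : ℕ} {T : Fin k → AddMonoid.End M} {E : Fin k → ℝ}
    (h : ∀ i, 𝓢.Raises b s (E i) (T i)) : 𝓢.Raises b s (∑ i, E i) (List.ofFn T).prod := by
  induction k with
  | zero => simpa using Raises.one
  | succ k ih =>
    rw [List.ofFn_succ, List.prod_cons, Fin.sum_univ_succ]
    exact (h 0).mul (ih fun i => h i.succ)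

end Operators

end FrechetUnion

/-! ### Divided powers of the connection -/

section Lifts

universe u w

variable {𝔬 : Type*} [CommRing 𝔬] {m : ℕ} {S : Type u} [CommRing S] [Algebra 𝔬 S]

/-- The divided power `∏_i Δ_i (Δ_i - 1) ⋯ (Δ_i - j_i + 1) / j_i!`. -/
def taylorOp {D : Fin m → Derivation 𝔬 S S} (X : NablaMod.{u, w} D) (J : Fin m → ℕ) :
    AddMonoid.End X.carrier :=
  (DistribSMul.toAddMonoidHom X.carrier (Ring.inverse ((∏ i, (J i).factorial : ℕ) : S))).comp
    (fallingDelta X J)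

theorem isUnit_natCast_of_rat [Algebra ℚ S] {k : ℕ} (hk : k ≠ 0) : IsUnit (k : S) := by
  rw [← map_natCast (algebraMap ℚ S)]
  exact (isUnit_iff_ne_zero.2 (Nat.cast_ne_zero.2 hk)).map _

theorem prod_factorial_ne_zero (J : Fin m → ℕ) : ∏ i, (J i).factorial ≠ 0 :=
  Finset.prod_ne_zero_iff.2 fun i _ => (J i).factorial_ne_zero

theorem natCast_smul_taylorOp [Algebra ℚ S] {D : Fin m → Derivation 𝔬 S S} (X : NablaMod.{u, w} D)
    (J : Fin m → ℕ) (v : X.carrier) :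
    ((∏ i, (J i).factorial : ℕ) : S) • taylorOp X J v = fallingDelta X J v := by
  change _ • (Ring.inverse ((∏ i, (J i).factorial : ℕ) : S) • fallingDelta X J v) = _
  rw [smul_smul, Ring.mul_inverse_cancel _ (isUnit_natCast_of_rat (prod_factorial_ne_zero J)),
    one_smul]

theorem padicValNat_prod_factorial (p : ℕ) [Fact p.Prime] (J : Fin m → ℕ) :
    padicValNat p (∏ i, (J i).factorial) = ∑ i, padicValNat p (J i).factorial := by
  induction m with
  | zero => simp
  | succ m ih =>
    rw [Fin.prod_univ_succ, Fin.sum_univ_succ, padicValNat.mul (Nat.factorial_ne_zero _)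
      (prod_factorial_ne_zero fun i : Fin m => J i.succ), ih]

variable {π : 𝔬} {p e : ℕ} {q : ℝ} {D : Fin m → Derivation 𝔬 S S} {zs : Fin m → Sˣ}

/-- The ring endomorphism `φ` divides radii by `q`, and is topologically nilpotent on `Ω¹`. -/
structure IsLift (𝓢 : FrechetUnion π p e q D zs) (φ : S →+* S) (r₀ : ℝ) : Prop where
  pos : 0 < r₀
  map_Mem : ∀ {r x}, 0 < r → r ≤ r₀ → x ∈ 𝓢.Mem r → φ x ∈ 𝓢.Mem (r / q)
  map_W : ∀ {s C x}, s ∈ 𝓢.I → s ≤ r₀ → x ∈ 𝓢.W s C → φ x ∈ 𝓢.W (s / q) C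
  dlog_Mem : ∀ h i, dlogCoeff D zs φ h i ∈ 𝓢.Mem r₀
  dlog_W : ∀ {s} h i, s ∈ 𝓢.I → s ≤ r₀ → dlogCoeff D zs φ h i ∈ 𝓢.W s (1 / 2)

theorem IsLift.mono {𝓢 : FrechetUnion π p e q D zs} {φ : S →+* S} {r₀ r₁ : ℝ}
    (h : IsLift 𝓢 φ r₀) (h1 : 0 < r₁) (h2 : r₁ ≤ r₀) : IsLift 𝓢 φ r₁ where
  pos := h1
  map_Mem hr hr1 := h.map_Mem hr (hr1.trans h2)
  map_W hs hs1 := h.map_W hs (hs1.trans h2)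
  dlog_Mem i j := 𝓢.Mem_anti h1 h2 (h.dlog_Mem i j)
  dlog_W i j hs hs1 := h.dlog_W i j hs (hs1.trans h2)

namespace FrechetUnion

variable {𝓢 : FrechetUnion π p e q D zs} {X : NablaMod.{u, w} D} {n : ℕ}
  {b : Module.Basis (Fin n) S X.carrier}

/-- The gain of the blocks is set against the valuation of `J!`. By `padicValNat_factorial_le` the
deficit for one index `j` is at most `e ⌊j/p^f⌋ + e p^f`, and the choice `8 e ≤ p^f` makes the first
part at most `j/8`; the second occurs once for each of the `m` variables. -/
theorem Raises.taylorOp [Algebra ℚ S] [Fact p.Prime] {s : ℝ} {f : ℕ} (hf : 8 * e ≤ p ^ f)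
    (h : ∀ i l, X.Δ i (b l) ∈ 𝓢.WM b s (e * padicValNat p (p ^ f).factorial)) (J : Fin m → ℕ) :
    𝓢.Raises b s (-((∑ i, J i : ℕ) : ℝ) / 8 - m * (e * p ^ f : ℕ)) (taylorOp X J) := by
  intro C v hv l
  set E : ℝ := e * padicValNat p (p ^ f).factorial with hE
  have h1 := Raises.list_prod (fun i => Raises.fallProd_delta (p ^ f) (h i) (J i)) C v hv
  rw [← fallingDelta_eq, ← natCast_smul_taylorOp] at h1
  have h2 := h1 l
  rw [map_smul, Finsupp.smul_apply, smul_eq_mul] at h2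
  have key : ∀ j : ℕ, (e : ℝ) * padicValNat p j.factorial ≤
      (j / p ^ f : ℕ) * E + j / 8 + (e * p ^ f : ℕ) := by
    intro j
    have hP : 0 < p ^ f := pow_pos (Fact.out : p.Prime).pos f
    have k1 := padicValNat_factorial_le p f j
    have k2 : e * (j % p ^ f) ≤ e * p ^ f := Nat.mul_le_mul_left _ (Nat.mod_lt _ hP).le
    have k3 : 8 * e * (j / p ^ f) ≤ j :=
      (Nat.mul_le_mul_right _ hf).trans (by rw [mul_comm]; exact Nat.div_mul_le_self _ _)
    have k4 : e * padicValNat p j.factorial ≤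
        e * ((j / p ^ f) * padicValNat p (p ^ f).factorial) + e * (j / p ^ f) + e * (j % p ^ f) := by
      rw [← mul_add, ← mul_add]
      exact Nat.mul_le_mul_left _ k1
    have k1' : (e : ℝ) * padicValNat p j.factorial ≤
        e * ((j / p ^ f : ℕ) * padicValNat p (p ^ f).factorial) + e * (j / p ^ f : ℕ)
          + e * (j % p ^ f : ℕ) := by exact_mod_cast k4
    have k2' : (e : ℝ) * (j % p ^ f : ℕ) ≤ (e * p ^ f : ℕ) := by exact_mod_cast k2
    have k3' : (8 : ℝ) * e * (j / p ^ f : ℕ) ≤ j := by exact_mod_cast k3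
    rw [hE]
    linarith
  refine 𝓢.W_anti ?_ ((𝓢.W_natCast_mul (C := C + ∑ i, ((J i / p ^ f : ℕ) : ℝ) * E -
    e * padicValNat p (∏ i, (J i).factorial)) (prod_factorial_ne_zero J)).1 (by simpa using h2))
  rw [padicValNat_prod_factorial]
  have := Finset.sum_le_sum fun i (_ : i ∈ Finset.univ) => key (J i)
  rw [Finset.sum_add_distrib, Finset.sum_add_distrib, ← Finset.mul_sum, ← Finset.sum_div,
    Finset.sum_const, Finset.card_univ, Fintype.card_fin, nsmul_eq_mul] at this
  push_cast at this ⊢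
  linarith

theorem taylorOp_mem_MM [Algebra ℚ S] {r : ℝ} (h : ∀ i v, v ∈ 𝓢.MM b r → X.Δ i v ∈ 𝓢.MM b r)
    (J : Fin m → ℕ) {v : X.carrier} (hv : v ∈ 𝓢.MM b r) : taylorOp X J v ∈ 𝓢.MM b r := by
  have hmul : ∀ T T' : AddMonoid.End X.carrier, (∀ v ∈ 𝓢.MM b r, T v ∈ 𝓢.MM b r) →
      (∀ v ∈ 𝓢.MM b r, T' v ∈ 𝓢.MM b r) → ∀ v ∈ 𝓢.MM b r, (T * T') v ∈ 𝓢.MM b r :=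
    fun T T' h h' v hv => h _ (h' v hv)
  have hprod : ∀ l : List (AddMonoid.End X.carrier), (∀ T ∈ l, ∀ v ∈ 𝓢.MM b r, T v ∈ 𝓢.MM b r) →
      ∀ v ∈ 𝓢.MM b r, l.prod v ∈ 𝓢.MM b r := by
    intro l
    induction l with
    | nil => exact fun _ v hv => hv
    | cons T l ih =>
      intro hl
      rw [List.prod_cons]
      exact hmul _ _ (hl T (by simp)) (ih fun T' hT' => hl T' (by simp [hT']))
  intro l
  have h1 : fallingDelta X J v ∈ 𝓢.MM b r := by
    refine hprod _ (fun T hT => ?_) v hv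
    obtain ⟨i, rfl⟩ := (List.mem_ofFn' _ _).1 hT
    refine hprod _ fun T hT v hv => ?_
    obtain ⟨k, -, rfl⟩ := List.mem_map.1 hT
    change X.Δ i v - (k : AddMonoid.End X.carrier) v ∈ _
    rw [AddMonoid.End.natCast_apply]
    exact AddSubgroup.sub_mem _ (h i v hv) (AddSubgroup.nsmul_mem _ hv k)
  rw [← natCast_smul_taylorOp] at h1
  have h2 := h1 l
  rw [map_smul, Finsupp.smul_apply, smul_eq_mul] at h2
  exact 𝓢.Mem_natCast_mul (prod_factorial_ne_zero J) h2

theorem exists_delta_MM (𝓢 : FrechetUnion π p e q D zs) (b : Module.Basis (Fin n) S X.carrier) :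
    ∃ ρ, 0 < ρ ∧ ∀ r, 0 < r → r ≤ ρ → ∀ i v, v ∈ 𝓢.MM b r → X.Δ i v ∈ 𝓢.MM b r := by
  obtain ⟨ρ, hρ, h⟩ := 𝓢.exists_Mem_finite
    fun x : Fin m × Fin n × Fin n => b.repr (X.Δ x.1 (b x.2.1)) x.2.2
  refine ⟨ρ, hρ, fun r hr hrρ i v hv => ?_⟩
  rw [← b.sum_repr v, map_sum]
  refine AddSubgroup.sum_mem _ fun l _ => ?_
  rw [X.leibniz]
  refine AddSubgroup.add_mem _ (𝓢.smul_MM b (hv l) fun j => 𝓢.Mem_anti hr hrρ (h (i, l, j)))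
    fun j => ?_
  rw [map_smul, Finsupp.smul_apply, smul_eq_mul, Module.Basis.repr_self, Finsupp.single_apply]
  refine 𝓢.Mem_mul (𝓢.D_Mem i (hv l)) ?_
  split_ifs
  · exact 𝓢.Mem_one r
  · exact AddSubgroup.zero_mem _

end FrechetUnion

/-! ### Dwork's trick -/

section Dwork

variable {φ : S →+* S} {X : NablaMod.{u, w} D} (F : FrobStr D zs φ X) {n : ℕ}

theorem repr_frob {b b' : Module.Basis (Fin n) S X.carrier} (h : ∀ l, b' l = F.F (b l))
    (v : X.carrier) (l : Fin n) : b'.repr (F.F v) l = φ (b.repr v l) := by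
  have : F.F v = ∑ l, φ (b.repr v l) • b' l := by
    conv_lhs => rw [← b.sum_repr v, map_sum]
    exact Finset.sum_congr rfl fun l _ => by rw [map_smulₛₗ, h]
  rw [this, Module.Basis.repr_sum_self]

/-- The bases `F ^ k (b)`. -/
def frobBasis (b : Module.Basis (Fin n) S X.carrier) : ℕ → Module.Basis (Fin n) S X.carrier
  | 0 => b
  | k + 1 => (F.isogeny n (frobBasis b k)).choose

theorem frobBasis_succ (b : Module.Basis (Fin n) S X.carrier) (k : ℕ) (l : Fin n) :
    frobBasis F b (k + 1) l = F.F (frobBasis F b k l) :=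
  (F.isogeny n (frobBasis F b k)).choose_spec l

variable {F} {𝓢 : FrechetUnion π p e q D zs} {r₀ : ℝ}

theorem IsLift.frob_MM (hφ : IsLift 𝓢 φ r₀) {b b' : Module.Basis (Fin n) S X.carrier}
    (h : ∀ l, b' l = F.F (b l)) {r : ℝ} (hr : 0 < r) (hr0 : r ≤ r₀) {v : X.carrier}
    (hv : v ∈ 𝓢.MM b r) : F.F v ∈ 𝓢.MM b' (r / q) := fun l => by
  rw [repr_frob F h]
  exact hφ.map_Mem hr hr0 (hv l)

theorem IsLift.frob_WM (hφ : IsLift 𝓢 φ r₀) {b b' : Module.Basis (Fin n) S X.carrier}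
    (h : ∀ l, b' l = F.F (b l)) {s C : ℝ} (hs : s ∈ 𝓢.I) (hs0 : s ≤ r₀) {v : X.carrier}
    (hv : v ∈ 𝓢.WM b s C) : F.F v ∈ 𝓢.WM b' (s / q) C := fun l => by
  rw [repr_frob F h]
  exact hφ.map_W hs hs0 (hv l)

theorem div_pow_le {q r : ℝ} (hq : 1 < q) (hr : 0 ≤ r) (k : ℕ) : r / q ^ k ≤ r :=
  div_le_self hr (one_le_pow₀ hq.le)

theorem div_pow_mem_I (hq : 1 < q) {s : ℝ} (hs : s ∈ 𝓢.I) (k : ℕ) : s / q ^ k ∈ 𝓢.I := by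
  induction k with
  | zero => simpa using hs
  | succ k ih =>
    rw [pow_succ, ← div_div]
    exact 𝓢.div_mem hq ih

/-- In `Δ_i F = ∑_h η_(hi) F Δ_h` the coefficients have `w_s(η) ≥ 1/2`, so each application of `F`
to the basis gains `1/2` in the matrix of `∇`, at the price of a division of the radius by `q`. -/
theorem IsLift.delta_frobBasis (hφ : IsLift 𝓢 φ r₀) (hq : 1 < q)
    {b : Module.Basis (Fin n) S X.carrier} {s B : ℝ} (hs : s ∈ 𝓢.I) (hs0 : s ≤ r₀)
    (h : ∀ i l, X.Δ i (b l) ∈ 𝓢.WM b s B) (k : ℕ) (i : Fin m) (l : Fin n) :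
    X.Δ i (frobBasis F b k l) ∈ 𝓢.WM (frobBasis F b k) (s / q ^ k) (B + k / 2) := by
  induction k generalizing i with
  | zero => simpa [frobBasis] using h i l
  | succ k ih =>
    have hsk := div_pow_mem_I hq hs k
    have hsk0 := (div_pow_le hq (𝓢.nonneg s hs) k).trans hs0
    rw [frobBasis_succ, F.compat, pow_succ, ← div_div]
    refine AddSubgroup.sum_mem _ fun h _ => 𝓢.WM_anti _ ?_ (𝓢.smul_WM _ (hφ.dlog_W h i
      (𝓢.div_mem hq hsk) ((div_le_self (𝓢.nonneg _ hsk) hq.le).trans hsk0))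
      (hφ.frob_WM (frobBasis_succ F b k) hsk hsk0 (ih h)))
    push_cast
    linarith

/-- The matrix relating `F^(k+1) b` to `F^k b` is the `k`-th Frobenius twist of the one relating `F
b` to `b`; multiplying these, one only has to shrink the radius to `r/q^k`. -/
theorem IsLift.frobBasis_MM (hφ : IsLift 𝓢 φ r₀) (hq : 1 < q)
    {b : Module.Basis (Fin n) S X.carrier} {r : ℝ} (hr : 0 < r) (hr0 : r ≤ r₀)
    (h : ∀ l, frobBasis F b 1 l ∈ 𝓢.MM b r) (h' : ∀ l, b l ∈ 𝓢.MM (frobBasis F b 1) r) (k : ℕ) :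
    (∀ l, frobBasis F b k l ∈ 𝓢.MM b (r / q ^ k)) ∧
      ∀ l, b l ∈ 𝓢.MM (frobBasis F b k) (r / q ^ k) := by
  have hpos : ∀ k, 0 < r / q ^ k := fun k => div_pos hr (pow_pos (by linarith) k)
  have step : ∀ k, (∀ l, frobBasis F b (k + 1) l ∈ 𝓢.MM (frobBasis F b k) (r / q ^ k)) ∧
      ∀ l, frobBasis F b k l ∈ 𝓢.MM (frobBasis F b (k + 1)) (r / q ^ k) := by
    intro k
    induction k with
    | zero => simpa using ⟨h, h'⟩
    | succ k ih =>
      have hk0 := (div_pow_le hq hr.le k).trans hr0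
      rw [pow_succ, ← div_div]
      refine ⟨fun l => ?_, fun l => ?_⟩
      · rw [frobBasis_succ F b (k + 1)]
        exact hφ.frob_MM (frobBasis_succ F b k) (hpos k) hk0 (ih.1 l)
      · rw [frobBasis_succ F b k]
        exact hφ.frob_MM (frobBasis_succ F b (k + 1)) (hpos k) hk0 (ih.2 l)
  have hle : ∀ k, r / q ^ (k + 1) ≤ r / q ^ k := fun k => by
    rw [pow_succ, ← div_div]
    exact div_le_self (hpos k).le hq.le
  induction k with
  | zero =>
    refine ⟨fun l j => ?_, fun l j => ?_⟩ <;>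
    · change b.repr (b l) j ∈ _
      rw [Module.Basis.repr_self, Finsupp.single_apply]
      split_ifs
      · exact 𝓢.Mem_one _
      · exact AddSubgroup.zero_mem _
  | succ k ih =>
    exact ⟨fun l => 𝓢.MM_anti _ (hpos _) (hle k) (𝓢.mem_MM_of_basis _ _ ih.1 ((step k).1 l)),
      fun l => 𝓢.MM_anti _ (hpos _) (hle k) (𝓢.mem_MM_of_basis _ _ (step k).2 (ih.2 l))⟩

/-- Dwork's trick: the divided powers of `∇` have arbitrarily small exponential growth. -/
theorem IsLift.exists_taylor_bound [Algebra ℚ S] [hp : Fact p.Prime] (hφ : IsLift 𝓢 φ r₀)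
    (hq : 1 < q) (F : FrobStr D zs φ X) (b : Module.Basis (Fin n) S X.carrier) :
    ∃ ρ, 0 < ρ ∧ ∀ s ∈ 𝓢.I, s ≤ ρ → ∃ c : ℝ, ∀ J : Fin m → ℕ,
      𝓢.Raises b s (c - ((∑ i, J i : ℕ) : ℝ) / 8) (taylorOp X J) := by
  obtain ⟨r₁, hr₁, h1⟩ := 𝓢.exists_Mem_finite fun x : Fin n × Fin n =>
    b.repr (frobBasis F b 1 x.1) x.2
  obtain ⟨r₂, hr₂, h2⟩ := 𝓢.exists_Mem_finite fun x : Fin n × Fin n =>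
    (frobBasis F b 1).repr (b x.1) x.2
  obtain ⟨r₃, hr₃, h3⟩ := 𝓢.exists_Mem_finite fun x : Fin m × Fin n × Fin n =>
    b.repr (X.Δ x.1 (b x.2.1)) x.2.2
  obtain ⟨r, hr, hrr₀, hrr₁, hrr₂, hrr₃⟩ : ∃ r, 0 < r ∧ r ≤ r₀ ∧ r ≤ r₁ ∧ r ≤ r₂ ∧ r ≤ r₃ :=
    ⟨min (min r₀ r₁) (min r₂ r₃), lt_min (lt_min hφ.pos hr₁) (lt_min hr₂ hr₃),
      (min_le_left _ _).trans (min_le_left _ _), (min_le_left _ _).trans (min_le_right _ _),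
      (min_le_right _ _).trans (min_le_left _ _), (min_le_right _ _).trans (min_le_right _ _)⟩
  have hMM := hφ.frobBasis_MM (F := F) (b := b) hq hr hrr₀
    (fun l j => 𝓢.Mem_anti hr hrr₁ (h1 (l, j))) (fun l j => 𝓢.Mem_anti hr hrr₂ (h2 (l, j)))
  -- The constant `B` bounds the matrix of `∇` at all radii in `[r/q, r]` and at `0`. It must not
  -- depend on the radius, because `K` is chosen from it.
  obtain ⟨B, hB⟩ := FrechetUnion.exists_le_finite
    (P := fun (x : Fin m × Fin n × Fin n) C => ∀ s ∈ 𝓢.I, s ≤ r → s = 0 ∨ r / q ≤ s →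
      b.repr (X.Δ x.1 (b x.2.1)) x.2.2 ∈ 𝓢.W s C)
    (fun x C C' hC h s hs hsr hs' => 𝓢.W_anti hC (h s hs hsr hs'))
    fun x => 𝓢.exists_W_unif hr (𝓢.Mem_anti hr hrr₃ (h3 x))
  obtain ⟨f, hf⟩ : ∃ f, 8 * e ≤ p ^ f := ⟨8 * e, (Nat.lt_pow_self hp.out.one_lt).le⟩
  -- After `K` Frobenius steps the bound `B + K/2` exceeds the valuation of `(p^f)!`.
  obtain ⟨K, hK⟩ := exists_nat_ge (2 * (e * padicValNat p (p ^ f).factorial - B))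
  have hqk : ∀ k, 0 < q ^ k := fun k => pow_pos (by linarith) k
  refine ⟨r / q ^ K, div_pos hr (hqk K), fun s hs hsK => ?_⟩
  -- For `s > 0` take `k` with `r/q < s q^k ≤ r`; then `k ≥ K` because `s ≤ r/q^K`. The value `s =
  -- 0` is fixed by scaling, and `k = K` will do.
  obtain ⟨k, hKk, hsI, hsr, hs'⟩ : ∃ k ≥ K, s * q ^ k ∈ 𝓢.I ∧ s * q ^ k ≤ r ∧
      (s * q ^ k = 0 ∨ r / q ≤ s * q ^ k) := by
    rcases (𝓢.nonneg s hs).eq_or_lt with h0 | h0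
    · refine ⟨K, le_rfl, ?_, ?_, ?_⟩ <;> rw [← h0, zero_mul]
      · rwa [h0]
      · exact hr.le
      · exact Or.inl rfl
    · have hsK' : q ^ K ≤ r / s := by
        rw [le_div_iff₀ h0, mul_comm]
        exact (le_div_iff₀ (hqk K)).1 hsK
      obtain ⟨k, hk1, hk2⟩ := exists_nat_pow_near ((one_le_pow₀ hq.le).trans hsK') hq
      refine ⟨k, ?_, 𝓢.mem_I _ (mul_pos h0 (hqk k)), ?_, Or.inr ?_⟩
      · have := (pow_lt_pow_iff_right₀ hq).1 (hsK'.trans_lt hk2)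
        omega
      · rw [mul_comm]
        exact (le_div_iff₀ h0).1 hk1
      · rw [div_lt_iff₀ h0, pow_succ] at hk2
        rw [div_le_iff₀ (by linarith)]
        linarith
  have hsk : s * q ^ k / q ^ k = s := mul_div_cancel_right₀ _ (hqk k).ne'
  have hsrk : s ≤ r / q ^ k := (le_div_iff₀ (hqk k)).2 hsr
  have hΔ : ∀ i l, X.Δ i (frobBasis F b k l) ∈
      𝓢.WM (frobBasis F b k) s (e * padicValNat p (p ^ f).factorial) := by
    intro i l
    have := hφ.delta_frobBasis (F := F) hq hsI (hsr.trans hrr₀)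
      (fun i l j => hB (i, l, j) _ hsI hsr hs') k i l
    rw [hsk] at this
    refine 𝓢.WM_anti _ ?_ this
    have : (K : ℝ) ≤ k := by exact_mod_cast hKk
    linarith
  have hrk := div_pos hr (hqk k)
  obtain ⟨c₁, hc₁⟩ := FrechetUnion.exists_le_finite (P := fun l C => frobBasis F b k l ∈ 𝓢.WM b s C)
    (fun _ _ _ h => (𝓢.WM_anti b h ·)) fun l => 𝓢.exists_WM b hrk ((hMM k).1 l) hs hsrk
  obtain ⟨c₂, hc₂⟩ := FrechetUnion.exists_le_finite (P := fun l C => b l ∈ 𝓢.WM (frobBasis F b k) s C)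
    (fun _ _ _ h => (𝓢.WM_anti _ h ·)) fun l => 𝓢.exists_WM _ hrk ((hMM k).2 l) hs hsrk
  -- Going back from `F^k b` to `b` costs the constants `c₁` and `c₂`, which depend on `s` but not
  -- on `J`; so the rate `1/8` is unchanged.
  refine ⟨c₁ + c₂ - m * (e * p ^ f : ℕ), fun J C v hv => ?_⟩
  refine 𝓢.WM_anti b ?_ (𝓢.mem_WM_of_basis b _ hc₁
    (FrechetUnion.Raises.taylorOp hf hΔ J _ v (𝓢.mem_WM_of_basis _ b hc₂ hv)))
  linarith

end Dwork

end Lifts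

/-! ### Identities for divided powers of commuting operators -/

section Identities

universe u w

/-- Commuting operators generate a commutative `ℚ`-algebra, on which polynomials can be evaluated.
This turns identities of binomial polynomials into identities of divided powers of `∇`. -/
theorem exists_mvPolynomial_hom {m : ℕ} {M : Type*} [AddCommGroup M] [Module ℚ M]
    (T : Fin m → AddMonoid.End M) (hT : ∀ i j, T i * T j = T j * T i) :
    ∃ ψ : MvPolynomial (Fin m) ℚ →+* AddMonoid.End M, ∀ i, ψ (MvPolynomial.X i) = T i := by
  let T' : Fin m → Module.End ℚ M := fun i => (T i : M →+ M).toRatLinearMap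
  have hc : ∀ a ∈ Set.range T', ∀ b ∈ Set.range T', a * b = b * a := by
    rintro _ ⟨i, rfl⟩ _ ⟨j, rfl⟩
    ext v
    exact DFunLike.congr_fun (hT i j) v
  have hcomm := Algebra.isMulCommutative_adjoin ℚ hc
  let _ : CommRing (Algebra.adjoin ℚ (Set.range T')) :=
    { (inferInstance : Ring (Algebra.adjoin ℚ (Set.range T'))) with
      mul_comm := hcomm.is_comm.comm }
  let x : Fin m → Algebra.adjoin ℚ (Set.range T') := fun i =>
    ⟨T' i, Algebra.subset_adjoin ⟨i, rfl⟩⟩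
  refine ⟨(Module.toAddMonoidEnd (Module.End ℚ M) M).comp
    ((Algebra.adjoin ℚ (Set.range T')).val.toRingHom.comp (MvPolynomial.aeval x).toRingHom), ?_⟩
  intro i
  ext v
  change ((MvPolynomial.aeval x (MvPolynomial.X i : MvPolynomial (Fin m) ℚ) :
    Algebra.adjoin ℚ (Set.range T')) : Module.End ℚ M) v = T i v
  rw [MvPolynomial.aeval_X]
  rfl

/-- The product of the binomial polynomials of the variables. -/
def polyBinom {m : ℕ} (J : Fin m → ℕ) : MvPolynomial (Fin m) ℚ :=
  ∏ i, binom (J i) (MvPolynomial.X i)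

theorem map_prod_sub {m : ℕ} {M : Type*} [AddCommGroup M]
    (ψ : MvPolynomial (Fin m) ℚ →+* AddMonoid.End M) (x : MvPolynomial (Fin m) ℚ) (j : ℕ) :
    ψ (∏ l ∈ Finset.range j, (x - l)) = fallProd (ψ x) 0 j := by
  induction j with
  | zero => simp [fallProd_zero]
  | succ j ih => rw [Finset.prod_range_succ, map_mul, ih, fallProd_succ, map_sub, map_natCast,
      zero_add]

variable {𝔬 : Type*} [CommRing 𝔬] {m : ℕ} {S : Type u} [CommRing S] [Algebra 𝔬 S] [Algebra ℚ S]
  {D : Fin m → Derivation 𝔬 S S} (X : NablaMod.{u, w} D)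

theorem smul_natCast_cancel {M : Type*} [AddCommGroup M] [Module S M] {k : ℕ} (hk : k ≠ 0)
    {v v' : M} (h : (k : S) • v = (k : S) • v') : v = v' :=
  (isUnit_natCast_of_rat hk).smul_left_cancel.1 h

theorem polyBinom_eq_taylorOp (ψ : MvPolynomial (Fin m) ℚ →+* AddMonoid.End X.carrier)
    (hψ : ∀ i, ψ (MvPolynomial.X i) = X.deltaEnd i) (J : Fin m → ℕ) :
    ψ (polyBinom J) = taylorOp X J := by
  ext v
  refine smul_natCast_cancel (S := S) (prod_factorial_ne_zero J) ?_
  rw [natCast_smul_taylorOp, fallingDelta_eq, Nat.cast_smul_eq_nsmul]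
  have h1 : ((∏ i, (J i).factorial : ℕ) : MvPolynomial (Fin m) ℚ) * polyBinom J =
      (List.ofFn fun i => ∏ l ∈ Finset.range (J i),
        ((MvPolynomial.X i : MvPolynomial (Fin m) ℚ) - l)).prod := by
    rw [List.prod_ofFn, polyBinom, Nat.cast_prod, ← Finset.prod_mul_distrib]
    exact Finset.prod_congr rfl fun i _ => factorial_mul_binom _ _
  have h2 := congrArg ψ h1
  rw [map_mul, map_natCast, map_list_prod, List.map_ofFn] at h2
  have h3 := DFunLike.congr_fun h2 v
  change ((∏ i, (J i).factorial : ℕ) : AddMonoid.End X.carrier) (ψ (polyBinom J) v) = _ at h3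
  rw [AddMonoid.End.natCast_apply] at h3
  rw [h3]
  congr 3
  funext i
  rw [Function.comp_apply, map_prod_sub, hψ]

theorem exists_taylor_hom : ∃ ψ : MvPolynomial (Fin m) ℚ →+* AddMonoid.End X.carrier,
    (∀ i, ψ (MvPolynomial.X i) = X.deltaEnd i) ∧ ∀ J, ψ (polyBinom J) = taylorOp X J := by
  let _ : Module ℚ X.carrier := Module.compHom X.carrier (algebraMap ℚ S)
  obtain ⟨ψ, hψ⟩ := exists_mvPolynomial_hom X.deltaEnd fun i j => by
    ext v
    exact X.integrable i j v
  exact ⟨ψ, hψ, polyBinom_eq_taylorOp X ψ hψ⟩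

theorem polyBinom_add_single (J : Fin m → ℕ) (h : Fin m) :
    polyBinom (J + Pi.single h 1) = binom (J h + 1) (MvPolynomial.X h) *
      ∏ i ∈ Finset.univ.erase h, binom (J i) (MvPolynomial.X i : MvPolynomial (Fin m) ℚ) := by
  rw [polyBinom, ← Finset.mul_prod_erase _ _ (Finset.mem_univ h)]
  congr 1
  · simp
  · refine Finset.prod_congr rfl fun i hi => ?_
    rw [Pi.add_apply, Pi.single_eq_of_ne (Finset.ne_of_mem_erase hi), add_zero]

theorem polyBinom_eq_mul (J : Fin m → ℕ) (h : Fin m) :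
    polyBinom J = binom (J h) (MvPolynomial.X h) *
      ∏ i ∈ Finset.univ.erase h, binom (J i) (MvPolynomial.X i : MvPolynomial (Fin m) ℚ) :=
  (Finset.mul_prod_erase _ _ (Finset.mem_univ h)).symm

/-- It is the identity `x binom(j, x) = (j+1) binom(j+1, x) + j binom(j, x)` in the variable of
index `h`. -/
theorem delta_taylorOp (J : Fin m → ℕ) (h : Fin m) (v : X.carrier) :
    X.Δ h (taylorOp X J v) =
      (J h + 1) • taylorOp X (J + Pi.single h 1) v + J h • taylorOp X J v := by
  obtain ⟨ψ, hψ, hJ⟩ := exists_taylor_hom X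
  have h1 : MvPolynomial.X h * polyBinom J = ((J h + 1 : ℕ) : MvPolynomial (Fin m) ℚ) *
      polyBinom (J + Pi.single h 1) + (J h : MvPolynomial (Fin m) ℚ) * polyBinom J := by
    rw [polyBinom_add_single, polyBinom_eq_mul J h, ← mul_assoc, mul_binom]
    push_cast
    ring
  have h2 := DFunLike.congr_fun (congrArg ψ h1) v
  rw [map_mul, map_add, map_mul, map_mul, map_natCast, map_natCast, hψ, hJ, hJ] at h2
  exact h2

theorem taylorOp_delta (J : Fin m → ℕ) (h : Fin m) (v : X.carrier) :
    taylorOp X J (X.Δ h v) = X.Δ h (taylorOp X J v) := by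
  obtain ⟨ψ, hψ, hJ⟩ := exists_taylor_hom X
  have h2 := DFunLike.congr_fun (congrArg ψ (mul_comm (polyBinom J) (MvPolynomial.X h))) v
  rw [map_mul, map_mul, hψ, hJ] at h2
  exact h2

theorem taylorOp_zero (v : X.carrier) : taylorOp X 0 v = v := by
  obtain ⟨ψ, hψ, hJ⟩ := exists_taylor_hom X
  rw [← hJ, polyBinom]
  simp [binom_zero]

theorem taylorOp_taylorOp (J K : Fin m → ℕ) (v : X.carrier) :
    taylorOp X J (taylorOp X K v) =
      ∑ L ∈ Fintype.piFinset fun i => Finset.range (J i + K i + 1),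
        (∏ i, mulCoeff (L i) (J i) (K i)) • taylorOp X L v := by
  obtain ⟨ψ, hψ, hJ⟩ := exists_taylor_hom X
  have h1 : polyBinom J * polyBinom K =
      ∑ L ∈ Fintype.piFinset fun i => Finset.range (J i + K i + 1),
        ((∏ i, mulCoeff (L i) (J i) (K i) : ℕ) : MvPolynomial (Fin m) ℚ) * polyBinom L := by
    simp only [polyBinom, ← Finset.prod_mul_distrib, binom_mul_binom, Nat.cast_prod]
    rw [Finset.prod_univ_sum]
  have h2 := DFunLike.congr_fun (congrArg ψ h1) v
  rw [map_mul, map_sum, hJ, hJ] at h2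
  refine h2.trans ((AddMonoidHom.finsetSum_apply _ _ _).trans ?_)
  refine Finset.sum_congr rfl fun L _ => ?_
  rw [map_mul, map_natCast, hJ]
  rfl

/-- Conjugation by an additive automorphism. -/
def conjEnd {M : Type*} [AddCommGroup M] (g : M ≃+ M) : AddMonoid.End M →+* AddMonoid.End M where
  toFun T := (g.symm : M →+ M).comp ((T : M →+ M).comp (g : M →+ M))
  map_one' := AddMonoidHom.ext fun v => g.symm_apply_apply v
  map_zero' := AddMonoidHom.ext fun _ => map_zero g.symm
  map_mul' T _ := AddMonoidHom.ext fun _ => congrArg (fun x => g.symm (T x))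
    (g.apply_symm_apply _).symm
  map_add' _ _ := AddMonoidHom.ext fun _ => map_add g.symm _ _

/-- Conjugation by `g` translates `Δ_i` by `c_i`, so it translates the variables of every polynomial
in the `Δ_i`. The case of interest is multiplication by `{z_h}`, which translates `Δ_h` by `1`. -/
theorem exists_shift_hom (c : Fin m → ℕ) (g : X.carrier ≃+ X.carrier)
    (hg : ∀ i v, X.Δ i (g v) = g (X.Δ i v + c i • v)) (J : Fin m → ℕ) (v : X.carrier) :
    ∃ ψ : MvPolynomial (Fin m) ℚ →+* AddMonoid.End X.carrier, (∀ J, ψ (polyBinom J) = taylorOp X J) ∧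
      taylorOp X J (g v) = g (ψ (∏ i, binom (J i) (MvPolynomial.X i + (c i : MvPolynomial (Fin m) ℚ))) v) := by
  obtain ⟨ψ, hψ, hJ⟩ := exists_taylor_hom X
  refine ⟨ψ, hJ, ?_⟩
  have h1 : (conjEnd g).comp ψ = ψ.comp (MvPolynomial.aeval
      (fun i => (MvPolynomial.X i + (c i : MvPolynomial (Fin m) ℚ)))).toRingHom := by
    refine MvPolynomial.ringHom_ext (fun a => ?_) fun i => ?_
    · exact DFunLike.congr_fun (RingHom.ext_rat
        (((conjEnd g).comp ψ).comp MvPolynomial.C) ((ψ.comp (MvPolynomial.aeval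
      (fun i => (MvPolynomial.X i + (c i : MvPolynomial (Fin m) ℚ)))).toRingHom).comp
        MvPolynomial.C)) a
    · ext v
      change g.symm (ψ (MvPolynomial.X i) (g v)) = ψ (MvPolynomial.aeval _ (MvPolynomial.X i)) v
      rw [MvPolynomial.aeval_X, hψ, map_add, map_natCast, hψ]
      change g.symm (X.Δ i (g v)) = _
      rw [hg, AddEquiv.symm_apply_apply]
      rfl
  have h2 := DFunLike.congr_fun (DFunLike.congr_fun h1 (polyBinom J)) v
  change g.symm (ψ (polyBinom J) (g v)) = ψ ((MvPolynomial.aeval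
      (fun i => (MvPolynomial.X i + (c i : MvPolynomial (Fin m) ℚ)))).toRingHom (polyBinom J)) v at h2
  rw [hJ, polyBinom, map_prod] at h2
  rw [g.symm_apply_eq.1 h2]
  congr 3
  refine Finset.prod_congr rfl fun i _ => ?_
  rw [map_binom]
  congr 1
  exact MvPolynomial.aeval_X _ _

theorem shift_hyp {zs : Fin m → Sˣ} (hD : ∀ i h, D i (zs h) = if i = h then (zs h : S) else 0)
    (h i : Fin m) (v : X.carrier) :
    X.Δ i ((zs h : S) • v) = (zs h : S) • (X.Δ i v + (Pi.single h 1 : Fin m → ℕ) i • v) := by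
  rw [X.leibniz, hD, smul_add]
  congr 1
  by_cases hi : i = h
  · subst hi
    simp
  · simp [hi]

/-- Multiplication by a unit. -/
def smulEquiv {M : Type*} [AddCommGroup M] [Module S M] (a : Sˣ) : M ≃+ M :=
  DistribMulAction.toAddEquiv M a

theorem taylorOp_smul_of_eq_zero {zs : Fin m → Sˣ}
    (hD : ∀ i h, D i (zs h) = if i = h then (zs h : S) else 0) {J : Fin m → ℕ} {h : Fin m}
    (hJh : J h = 0) (v : X.carrier) :
    taylorOp X J ((zs h : S) • v) = (zs h : S) • taylorOp X J v := by
  obtain ⟨ψ, hψ, e⟩ := exists_shift_hom X (Pi.single h 1) (smulEquiv (zs h))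
    (fun i v => shift_hyp X hD h i v) J v
  refine e.trans ?_
  change (zs h : S) • (_ : X.carrier) = _
  rw [← hψ, polyBinom]
  congr 3
  refine Finset.prod_congr rfl fun i _ => ?_
  by_cases hi : i = h
  · subst hi
    rw [hJh, binom_zero, binom_zero]
  · simp [hi]

/-- Pascal's rule for `binom(j+1, x+1)`, since moving `Δ_h` past `{z_h}` replaces `x` by `x + 1`. -/
theorem taylorOp_smul_add_single {zs : Fin m → Sˣ}
    (hD : ∀ i h, D i (zs h) = if i = h then (zs h : S) else 0) (J : Fin m → ℕ) (h : Fin m)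
    (v : X.carrier) :
    taylorOp X (J + Pi.single h 1) ((zs h : S) • v) =
      (zs h : S) • (taylorOp X (J + Pi.single h 1) v + taylorOp X J v) := by
  obtain ⟨ψ, hψ, e⟩ := exists_shift_hom X (Pi.single h 1) (smulEquiv (zs h))
    (fun i v => shift_hyp X hD h i v) (J + Pi.single h 1) v
  refine e.trans ?_
  change (zs h : S) • (_ : X.carrier) = _
  congr 1
  rw [← hψ, ← hψ]
  have h1 : ∏ i, binom ((J + Pi.single h 1 : Fin m → ℕ) i) (MvPolynomial.X i +
      ((Pi.single h 1 : Fin m → ℕ) i : MvPolynomial (Fin m) ℚ)) =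
        polyBinom (J + Pi.single h 1) + polyBinom J := by
    rw [polyBinom_add_single, polyBinom_eq_mul J h, ← add_mul, ← binom_succ_add_one,
      ← Finset.mul_prod_erase _ _ (Finset.mem_univ h)]
    congr 1
    · simp
    refine Finset.prod_congr rfl fun i hi => ?_
    simp [Finset.ne_of_mem_erase hi]
  rw [h1, map_add]
  rfl

theorem map_fallingDelta {X Y : NablaMod.{u, w} D} (g : X.carrier →+ Y.carrier)
    (hg : ∀ i v, g (X.Δ i v) = Y.Δ i (g v)) (J : Fin m → ℕ) (v : X.carrier) :
    g (fallingDelta X J v) = fallingDelta Y J (g v) := by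
  have h1 : ∀ i t j v, g (fallProd (X.deltaEnd i) t j v) = fallProd (Y.deltaEnd i) t j (g v) := by
    intro i t j
    induction j with
    | zero => exact fun v => rfl
    | succ j ih =>
      intro v
      rw [fallProd_succ, fallProd_succ]
      refine (ih _).trans ?_
      change fallProd _ t j _ = fallProd _ t j _
      congr 1
      change g (X.Δ i v - ((t + j : ℕ) : AddMonoid.End X.carrier) v) =
        Y.Δ i (g v) - ((t + j : ℕ) : AddMonoid.End Y.carrier) (g v)
      rw [map_sub, hg, AddMonoid.End.natCast_apply, AddMonoid.End.natCast_apply, map_nsmul]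
  have h2 : ∀ l : List (Fin m × ℕ), ∀ v,
      g ((l.map fun x => fallProd (X.deltaEnd x.1) 0 x.2).prod v) =
        (l.map fun x => fallProd (Y.deltaEnd x.1) 0 x.2).prod (g v) := by
    intro l
    induction l with
    | nil => exact fun v => rfl
    | cons x l ih =>
      intro v
      rw [List.map_cons, List.map_cons, List.prod_cons, List.prod_cons]
      exact (h1 _ _ _ _).trans (congrArg (fallProd (Y.deltaEnd x.1) 0 x.2) (ih v))
  have := h2 (List.ofFn fun i => (i, J i)) v
  rw [List.map_ofFn, List.map_ofFn] at this
  rw [fallingDelta_eq, fallingDelta_eq]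
  exact this

theorem map_taylorOp {X Y : NablaMod.{u, w} D} (g : X.carrier →+ Y.carrier)
    (hg : ∀ i v, g (X.Δ i v) = Y.Δ i (g v)) (J : Fin m → ℕ) (v : X.carrier) :
    g (taylorOp X J v) = taylorOp Y J (g v) := by
  refine smul_natCast_cancel (S := S) (prod_factorial_ne_zero J) ?_
  rw [natCast_smul_taylorOp, Nat.cast_smul_eq_nsmul, ← map_nsmul, ← Nat.cast_smul_eq_nsmul S,
    natCast_smul_taylorOp, map_fallingDelta g hg]

theorem taylorOp_algebraMap_smul (J : Fin m → ℕ) (c : 𝔬) (v : X.carrier) :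
    taylorOp X J (algebraMap 𝔬 S c • v) = algebraMap 𝔬 S c • taylorOp X J v :=
  (map_taylorOp (DistribSMul.toAddMonoidHom X.carrier (algebraMap 𝔬 S c)) (fun i v => by
    change algebraMap 𝔬 S c • X.Δ i v = X.Δ i (algebraMap 𝔬 S c • v)
    rw [X.leibniz, Derivation.map_algebraMap, zero_smul, add_zero]) J v).symm

end Identities

/-! ### Convergent sums in a module and bounded maps -/

section Sums

universe u w

variable {𝔬 : Type*} [CommRing 𝔬] {m : ℕ} {S : Type u} [CommRing S] [Algebra 𝔬 S]
  {π : 𝔬} {p e : ℕ} {q : ℝ} {D : Fin m → Derivation 𝔬 S S} {zs : Fin m → Sˣ}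

namespace FrechetUnion

variable (𝓢 : FrechetUnion π p e q D zs) {M M' : Type*} [AddCommGroup M] [Module S M]
  [AddCommGroup M'] [Module S M'] {n n' : ℕ}
  (b : Module.Basis (Fin n) S M) (b' : Module.Basis (Fin n') S M')

/-- `T` is bounded for `w_s`, for all small `s`. -/
def Tame (T : M →+ M') : Prop :=
  ∃ ρ, 0 < ρ ∧ (∀ r, 0 < r → r ≤ ρ → ∀ v ∈ 𝓢.MM b r, T v ∈ 𝓢.MM b' r) ∧
    ∀ s ∈ 𝓢.I, s ≤ ρ → ∃ c, ∀ C, ∀ v ∈ 𝓢.WM b s C, T v ∈ 𝓢.WM b' s (C + c)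

/-- The sum of the family `f` is `y`, in `M_r` for some `r`. -/
def SumsTo {ι : Type*} (f : ι → M) (y : M) : Prop := ∃ r, 0 < r ∧ HS (𝓢.Nhds b r) f y

variable {𝓢 b b'}

theorem SumsTo.unique {ι : Type*} {f : ι → M} {y y' : M} (h : 𝓢.SumsTo b f y)
    (h' : 𝓢.SumsTo b f y') : y = y' := by
  obtain ⟨r, hr, h⟩ := h
  obtain ⟨r', hr', h'⟩ := h'
  have hm := lt_min hr hr'
  exact (𝓢.Nhds_anti b hm (min_le_left _ _) h).unique (𝓢.Nhds_sep b hm)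
    (𝓢.Nhds_anti b hm (min_le_right _ _) h')

theorem SumsTo.add {ι : Type*} {f f' : ι → M} {y y' : M} (h : 𝓢.SumsTo b f y)
    (h' : 𝓢.SumsTo b f' y') : 𝓢.SumsTo b (fun i => f i + f' i) (y + y') := by
  obtain ⟨r, hr, h⟩ := h
  obtain ⟨r', hr', h'⟩ := h'
  have hm := lt_min hr hr'
  exact ⟨_, hm, (𝓢.Nhds_anti b hm (min_le_left _ _) h).add
    (𝓢.Nhds_anti b hm (min_le_right _ _) h')⟩

theorem SumsTo.zero {ι : Type*} : 𝓢.SumsTo b (fun _ : ι => 0) 0 := ⟨1, one_pos, HS.zero⟩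

theorem SumsTo.sum {ι α : Type*} {A : Finset α} {f : α → ι → M} {y : α → M}
    (h : ∀ a ∈ A, 𝓢.SumsTo b (f a) (y a)) :
    𝓢.SumsTo b (fun i => ∑ a ∈ A, f a i) (∑ a ∈ A, y a) := by
  classical
  induction A using Finset.induction_on with
  | empty => simpa using SumsTo.zero
  | insert a A ha ih =>
    simp only [Finset.sum_insert ha]
    exact (h a (by simp)).add (ih fun b hb => h b (by simp [hb]))

theorem SumsTo.map {ι : Type*} {f : ι → M} {y : M} (h : 𝓢.SumsTo b f y) {T : M →+ M'}
    (hT : 𝓢.Tame b b' T) : 𝓢.SumsTo b' (fun i => T (f i)) (T y) := by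
  obtain ⟨r, hr, h⟩ := h
  obtain ⟨ρ, hρ, hM, hW⟩ := hT
  have hm := lt_min hr hρ
  refine ⟨_, hm, (𝓢.Nhds_anti b hm (min_le_left _ _) h).map T ?_⟩
  rintro _ ⟨s, hs, hsr, C, rfl⟩
  obtain ⟨c, hc⟩ := hW s hs (hsr.trans (min_le_right _ _))
  refine ⟨_, 𝓢.mem_Nhds b hs hsr (C - c), fun x hx => ⟨hM _ hm (min_le_right _ _) x hx.1, ?_⟩⟩
  have := hc _ x hx.2
  rwa [sub_add_cancel] at this

theorem SumsTo.reindex {ι κ : Type*} {f : ι → M} {y : M} (hf : 𝓢.SumsTo b f y) {g : ι → κ}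
    (hg : Function.Injective g) {h : κ → M} (hh : ∀ i, h (g i) = f i)
    (h0 : ∀ k, k ∉ Set.range g → h k = 0) : 𝓢.SumsTo b h y := by
  obtain ⟨r, hr, hf⟩ := hf
  exact ⟨r, hr, hf.reindex hg hh h0⟩

variable (𝓢 b b') in
theorem tame_linear (T : M →ₗ[S] M') : 𝓢.Tame b b' (T : M →+ M') := by
  obtain ⟨ρ, hρ, h⟩ := 𝓢.exists_Mem_finite fun x : Fin n × Fin n' => b'.repr (T (b x.1)) x.2
  have hT : ∀ v, T v = ∑ l, b.repr v l • T (b l) := fun v => by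
    conv_lhs => rw [← b.sum_repr v, map_sum]
    exact Finset.sum_congr rfl fun l _ => map_smul _ _ _
  refine ⟨ρ, hρ, fun r hr hrρ v hv => ?_, fun s hs hsρ => ?_⟩
  · change T v ∈ _
    rw [hT]
    exact AddSubgroup.sum_mem _ fun l _ =>
      𝓢.smul_MM b' (hv l) fun j => 𝓢.Mem_anti hr hrρ (h (l, j))
  · obtain ⟨c, hc⟩ := 𝓢.exists_W_finite hρ h hs hsρ
    refine ⟨c, fun C v hv => ?_⟩
    change T v ∈ _
    rw [hT]
    exact AddSubgroup.sum_mem _ fun l _ => 𝓢.smul_WM b' (hv l) fun j => hc (l, j)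

theorem SumsTo.linear {ι : Type*} {f : ι → M} {y : M} (h : 𝓢.SumsTo b f y) (T : M →ₗ[S] M') :
    𝓢.SumsTo b' (fun i => T (f i)) (T y) := h.map (𝓢.tame_linear b b' T)

theorem SumsTo.smul {ι : Type*} {f : ι → M} {y : M} (h : 𝓢.SumsTo b f y) (a : S) :
    𝓢.SumsTo b (fun i => a • f i) (a • y) := h.linear (LinearMap.lsmul S M a)

theorem tame_delta {X : NablaMod.{u, w} D} (b : Module.Basis (Fin n) S X.carrier) (i : Fin m) :
    𝓢.Tame b b (X.Δ i) := by
  obtain ⟨ρ, hρ, h⟩ := exists_delta_MM 𝓢 b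
  obtain ⟨ρ', hρ', h'⟩ := 𝓢.exists_Mem_finite fun x : Fin n × Fin n => b.repr (X.Δ i (b x.1)) x.2
  have hm := lt_min hρ hρ'
  refine ⟨_, hm, fun r hr hrρ v hv => h r hr (hrρ.trans (min_le_left _ _)) i v hv,
    fun s hs hsρ => ?_⟩
  obtain ⟨c, hc⟩ := 𝓢.exists_W_finite hρ' h' hs (hsρ.trans (min_le_right _ _))
  refine ⟨min c 0, fun C v hv => ?_⟩
  have h1 := Raises.delta_sub (fun l => 𝓢.WM_anti b (min_le_left c 0) fun j => hc (l, j)) C v hv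
  have h2 := 𝓢.WM_anti b (by linarith [min_le_right c 0] : C + min c 0 ≤ C + 0)
    (Raises.coordD s i C v hv)
  have h3 := AddSubgroup.add_mem _ h1 h2
  change X.deltaEnd i v - coordD b (D i) v + _ ∈ _ at h3
  rwa [sub_add_cancel] at h3

theorem mul_mem_I (hq : 1 < q) {s : ℝ} (hs : s ∈ 𝓢.I) : s * q ∈ 𝓢.I := by
  rcases (𝓢.nonneg s hs).eq_or_lt with h | h
  · rw [← h, zero_mul, h]
    exact hs
  · exact 𝓢.mem_I _ (mul_pos h (by linarith))

end FrechetUnion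

/-! ### The change of Frobenius -/

/-- `φ₂(z_i) / φ₁(z_i) - 1`. -/
def frobQuot (zs : Fin m → Sˣ) (φ₁ φ₂ : S →+* S) (i : Fin m) : S :=
  φ₂ (zs i) * ↑(Units.map (φ₁ : S →* S) (zs i))⁻¹ - 1

theorem map_mul_one_add_frobQuot (zs : Fin m → Sˣ) (φ₁ φ₂ : S →+* S) (i : Fin m) :
    φ₁ (zs i) * (1 + frobQuot zs φ₁ φ₂ i) = φ₂ (zs i) := by
  have : φ₁ (zs i) * ↑(Units.map (φ₁ : S →* S) (zs i))⁻¹ = 1 :=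
    (Units.map (φ₁ : S →* S) (zs i)).mul_inv
  rw [frobQuot]
  linear_combination φ₂ (zs i) * this

/-- The ratios `1 + u` and `1 + u'` of the two directions are inverse to each other. -/
theorem frobQuot_add_frobQuot (zs : Fin m → Sˣ) (φ₁ φ₂ : S →+* S) (i : Fin m) :
    frobQuot zs φ₁ φ₂ i + frobQuot zs φ₂ φ₁ i + frobQuot zs φ₁ φ₂ i * frobQuot zs φ₂ φ₁ i = 0 := by
  have h1 := map_mul_one_add_frobQuot zs φ₁ φ₂ i
  have h2 := map_mul_one_add_frobQuot zs φ₂ φ₁ i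
  rw [← h1] at h2
  have h3 : IsUnit (φ₁ (zs i)) := (Units.map (φ₁ : S →* S) (zs i)).isUnit
  refine h3.mul_left_cancel ?_
  linear_combination h2

/-- This is the logarithmic derivative of `1 + u_h`, the quotient of `φ₂(z_h)` by `φ₁(z_h)`. -/
theorem derivation_frobQuot (zs : Fin m → Sˣ) (φ₁ φ₂ : S →+* S) (h i : Fin m) :
    D i (frobQuot zs φ₁ φ₂ h) =
      (1 + frobQuot zs φ₁ φ₂ h) * (dlogCoeff D zs φ₂ h i - dlogCoeff D zs φ₁ h i) := by
  have h1 := map_mul_one_add_frobQuot zs φ₁ φ₂ h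
  have h2 := congrArg (D i) h1
  rw [Derivation.leibniz, map_add, Derivation.map_one_eq_zero, zero_add, smul_eq_mul,
    smul_eq_mul] at h2
  have e1 : φ₁ (zs h) * ↑(Units.map (φ₁ : S →* S) (zs h))⁻¹ = 1 :=
    (Units.map (φ₁ : S →* S) (zs h)).mul_inv
  have e2 : φ₂ (zs h) * ↑(Units.map (φ₂ : S →* S) (zs h))⁻¹ = 1 :=
    (Units.map (φ₂ : S →* S) (zs h)).mul_inv
  have h3 : IsUnit (φ₁ (zs h)) := (Units.map (φ₁ : S →* S) (zs h)).isUnit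
  refine h3.mul_left_cancel ?_
  rw [dlogCoeff, dlogCoeff]
  generalize frobQuot zs φ₁ φ₂ h = u at *
  generalize (↑(Units.map (φ₁ : S →* S) (zs h))⁻¹ : S) = a₁ at *
  generalize (↑(Units.map (φ₂ : S →* S) (zs h))⁻¹ : S) = a₂ at *
  linear_combination h2 - D i (φ₂ (zs h)) * e2 + (1 + u) * D i (φ₁ (zs h)) * e1 -
    D i (φ₂ (zs h)) * a₂ * h1

/-- Two lifts that are close to each other. -/
structure IsLiftPair (𝓢 : FrechetUnion π p e q D zs) (φ₁ φ₂ : S →+* S) (r₀ : ℝ) : Prop where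
  isUnit_pi : IsUnit (algebraMap 𝔬 S π)
  left : IsLift 𝓢 φ₁ r₀
  right : IsLift 𝓢 φ₂ r₀
  base : ∀ c, φ₁ (algebraMap 𝔬 S c) = φ₂ (algebraMap 𝔬 S c)
  quot_Mem : ∀ i, frobQuot zs φ₁ φ₂ i ∈ 𝓢.Mem r₀
  quot_W : ∀ {s} i, s ∈ 𝓢.I → s ≤ r₀ → frobQuot zs φ₁ φ₂ i ∈ 𝓢.W s (1 / 2)
  quot_Mem' : ∀ i, frobQuot zs φ₂ φ₁ i ∈ 𝓢.Mem r₀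
  quot_W' : ∀ {s} i, s ∈ 𝓢.I → s ≤ r₀ → frobQuot zs φ₂ φ₁ i ∈ 𝓢.W s (1 / 2)

theorem IsLiftPair.symm {𝓢 : FrechetUnion π p e q D zs} {φ₁ φ₂ : S →+* S} {r₀ : ℝ}
    (h : IsLiftPair 𝓢 φ₁ φ₂ r₀) : IsLiftPair 𝓢 φ₂ φ₁ r₀ where
  isUnit_pi := h.isUnit_pi
  left := h.right
  right := h.left
  base c := (h.base c).symm
  quot_Mem := h.quot_Mem'
  quot_W := h.quot_W'
  quot_Mem' := h.quot_Mem
  quot_W' := h.quot_W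

variable {φ₁ φ₂ : S →+* S} {X : NablaMod.{u, w} D}

/-- The terms of the Taylor series. -/
def frobTerm (φ₁ φ₂ : S →+* S) (X : NablaMod.{u, w} D) (F₁ : FrobStr D zs φ₁ X) (v : X.carrier)
    (J : Fin m → ℕ) : X.carrier :=
  (∏ i, frobQuot zs φ₁ φ₂ i ^ J i) • F₁.F (taylorOp X J v)

theorem taylorTerm_eq [Algebra ℚ S] (F₁ : FrobStr D zs φ₁ X) (v : X.carrier) (J : Fin m → ℕ) :
    taylorTerm φ₁ φ₂ X F₁ v J = frobTerm φ₁ φ₂ X F₁ v J := by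
  have hk := prod_factorial_ne_zero J
  rw [taylorTerm, frobTerm, mul_comm, mul_smul]
  congr 1
  refine smul_natCast_cancel (S := S) hk ?_
  rw [smul_smul, Ring.mul_inverse_cancel _ (isUnit_natCast_of_rat hk), one_smul,
    ← natCast_smul_taylorOp, map_smulₛₗ, map_natCast]

end Sums

/-! ### The sum of the Taylor series and its semilinearity -/

section TaylorSum

universe u w

variable {𝔬 : Type*} [CommRing 𝔬] {m : ℕ} {S : Type u} [CommRing S] [Algebra 𝔬 S] [Algebra ℚ S]
  {π : 𝔬} {p e : ℕ} [hp : Fact p.Prime] {q : ℝ} {D : Fin m → Derivation 𝔬 S S} {zs : Fin m → Sˣ}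
  {𝓢 : FrechetUnion π p e q D zs} {φ₁ φ₂ : S →+* S} {X : NablaMod.{u, w} D} {n : ℕ} {r₀ : ℝ}

theorem finite_sum_le (N : ℕ) : {J : Fin m → ℕ | ∑ i, J i ≤ N}.Finite :=
  (Set.finite_Iic fun _ => N).subset fun J hJ i =>
    (Finset.single_le_sum (f := J) (fun _ _ => Nat.zero_le _) (Finset.mem_univ i)).trans hJ

/-- The radii `r ≤ ρ` are small enough for the Taylor series to make sense on `M_r`. -/
structure IsRadius (𝓢 : FrechetUnion π p e q D zs) (F₁ : FrobStr D zs φ₁ X)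
    (b : Module.Basis (Fin n) S X.carrier) (ρ : ℝ) : Prop where
  pos : 0 < ρ
  taylor_MM : ∀ {r v}, 0 < r → r ≤ ρ → v ∈ 𝓢.MM b r → ∀ J, taylorOp X J v ∈ 𝓢.MM b r
  frob_MM : ∀ {r v}, 0 < r → r ≤ ρ → v ∈ 𝓢.MM b r → F₁.F v ∈ 𝓢.MM b (r / q)
  taylor_WM : ∀ s ∈ 𝓢.I, s ≤ ρ → ∃ c : ℝ, ∀ C v J, v ∈ 𝓢.WM b s C →
    taylorOp X J v ∈ 𝓢.WM b s (C + c - ((∑ i, J i : ℕ) : ℝ) / 8)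
  frob_WM : ∀ s ∈ 𝓢.I, s ≤ ρ → ∃ c : ℝ, ∀ C v J, v ∈ 𝓢.WM b s C →
    F₁.F (taylorOp X J v) ∈ 𝓢.WM b (s / q) (C + c - ((∑ i, J i : ℕ) : ℝ) / 8)

theorem IsLift.exists_radius (hφ : IsLift 𝓢 φ₁ r₀) (hq : 1 < q) (F₁ : FrobStr D zs φ₁ X)
    (b : Module.Basis (Fin n) S X.carrier) : ∃ ρ, ρ ≤ r₀ ∧ IsRadius 𝓢 F₁ b ρ := by
  obtain ⟨ρ₁, hρ₁, h1⟩ := FrechetUnion.exists_delta_MM 𝓢 b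
  obtain ⟨ρ₂, hρ₂, h2⟩ := hφ.exists_taylor_bound hq F₁ b
  obtain ⟨ρ₃, hρ₃, h3⟩ := 𝓢.exists_Mem_finite fun x : Fin n × Fin n =>
    b.repr (frobBasis F₁ b 1 x.1) x.2
  have hr₀ := hφ.pos
  obtain ⟨ρ, hρ, hρ0, hρ1, hρ2, hρ3⟩ : ∃ ρ, 0 < ρ ∧ ρ ≤ r₀ ∧ ρ ≤ ρ₁ ∧ ρ ≤ ρ₂ ∧ ρ ≤ ρ₃ :=
    ⟨min (min r₀ ρ₁) (min ρ₂ ρ₃), lt_min (lt_min hr₀ hρ₁) (lt_min hρ₂ hρ₃),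
      (min_le_left _ _).trans (min_le_left _ _), (min_le_left _ _).trans (min_le_right _ _),
      (min_le_right _ _).trans (min_le_left _ _), (min_le_right _ _).trans (min_le_right _ _)⟩
  have hdiv : ∀ {r : ℝ}, 0 ≤ r → r / q ≤ r := fun h => div_le_self h hq.le
  have hT : ∀ s ∈ 𝓢.I, s ≤ ρ → ∃ c : ℝ, ∀ C v J, v ∈ 𝓢.WM b s C →
      taylorOp X J v ∈ 𝓢.WM b s (C + c - ((∑ i, J i : ℕ) : ℝ) / 8) := by
    intro s hs hsρ
    obtain ⟨c, hc⟩ := h2 s hs (hsρ.trans hρ2)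
    refine ⟨c, fun C v J hv => ?_⟩
    rw [add_sub_assoc]
    exact hc J C v hv
  refine ⟨ρ, hρ0, hρ, fun {r v} hr hrρ hv J => FrechetUnion.taylorOp_mem_MM (h1 r hr (hrρ.trans hρ1)) J hv,
    fun {r v} hr hrρ hv => ?_, hT, fun s hs hsρ => ?_⟩
  · refine 𝓢.mem_MM_of_basis b (frobBasis F₁ b 1) (fun l j => ?_)
      (hφ.frob_MM (frobBasis_succ F₁ b 0) hr (hrρ.trans hρ0) hv)
    exact 𝓢.Mem_anti (div_pos hr (by linarith)) ((hdiv hr.le).trans (hrρ.trans hρ3)) (h3 (l, j))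
  · obtain ⟨c, hc⟩ := hT s hs hsρ
    obtain ⟨c', hc'⟩ := 𝓢.exists_W_finite hρ₃ h3 (𝓢.div_mem hq hs)
      ((hdiv (𝓢.nonneg s hs)).trans (hsρ.trans hρ3))
    refine ⟨c + c', fun C v J hv => 𝓢.WM_anti b ?_ (𝓢.mem_WM_of_basis b (frobBasis F₁ b 1)
      (fun l j => hc' (l, j)) (hφ.frob_WM (frobBasis_succ F₁ b 0) hs (hsρ.trans hρ0)
        (hc C v J hv)))⟩
    linarith

theorem prod_pow_Mem {x : Fin m → S} {r : ℝ} (hx : ∀ i, x i ∈ 𝓢.Mem r) (J : Fin m → ℕ) :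
    ∏ i, x i ^ J i ∈ 𝓢.Mem r := 𝓢.Mem_prod _ fun i _ => 𝓢.Mem_pow (hx i) _

theorem prod_pow_W {x : Fin m → S} {s : ℝ} (hx : ∀ i, x i ∈ 𝓢.W s (1 / 2)) (J : Fin m → ℕ) :
    ∏ i, x i ^ J i ∈ 𝓢.W s (((∑ i, J i : ℕ) : ℝ) / 2) := by
  have := 𝓢.W_prod Finset.univ (f := fun i => x i ^ J i) fun i _ => 𝓢.W_pow (hx i) (J i)
  rwa [← Finset.sum_mul, ← Nat.cast_sum, mul_one_div] at this

/-- A family with linearly increasing valuations. -/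
theorem finite_of_le {b : Module.Basis (Fin n) S X.carrier} {s c : ℝ} {f : (Fin m → ℕ) → X.carrier}
    (hf : ∀ J, f J ∈ 𝓢.WM b s (c + 3 / 8 * (∑ i, J i : ℕ))) (C : ℝ) :
    {J | f J ∉ 𝓢.WM b s C}.Finite := by
  obtain ⟨N, hN⟩ := exists_nat_ge ((C - c) * (8 / 3))
  refine (finite_sum_le N).subset fun J hJ => ?_
  by_contra hcon
  refine hJ (𝓢.WM_anti b ?_ (hf J))
  have : (N : ℝ) ≤ (∑ i, J i : ℕ) := by
    have hcon' : N < ∑ i, J i := not_le.1 hcon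
    exact_mod_cast hcon'.le
  linarith

variable {F₁ : FrobStr D zs φ₁ X} {b : Module.Basis (Fin n) S X.carrier} {ρ : ℝ}

theorem IsLiftPair.div_bound (h : IsLiftPair 𝓢 φ₁ φ₂ r₀) (hq : 1 < q) {s : ℝ} (hs : s ∈ 𝓢.I)
    (hs0 : s ≤ r₀) (i : Fin m) : frobQuot zs φ₁ φ₂ i ∈ 𝓢.W (s / q) (1 / 2) :=
  h.quot_W i (𝓢.div_mem hq hs) ((div_le_self (𝓢.nonneg s hs) hq.le).trans hs0)

theorem IsLiftPair.div_Mem (h : IsLiftPair 𝓢 φ₁ φ₂ r₀) (hq : 1 < q) {r : ℝ} (hr : 0 < r)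
    (hr0 : r ≤ r₀) (i : Fin m) : frobQuot zs φ₁ φ₂ i ∈ 𝓢.Mem (r / q) :=
  𝓢.Mem_anti (div_pos hr (by linarith)) ((div_le_self hr.le hq.le).trans hr0) (h.quot_Mem i)

theorem frobTerm_MM (h : IsLiftPair 𝓢 φ₁ φ₂ r₀) (hq : 1 < q) (hρ : IsRadius 𝓢 F₁ b ρ)
    (hρ0 : ρ ≤ r₀) {r : ℝ} (hr : 0 < r) (hrρ : r ≤ ρ) {v : X.carrier} (hv : v ∈ 𝓢.MM b r)
    (J : Fin m → ℕ) : frobTerm φ₁ φ₂ X F₁ v J ∈ 𝓢.MM b (r / q) :=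
  𝓢.smul_MM b (prod_pow_Mem (h.div_Mem hq hr (hrρ.trans hρ0)) J)
    (hρ.frob_MM hr hrρ (hρ.taylor_MM hr hrρ hv J))

/-- Each factor `u_i` gains `1/2` and the divided powers lose `1/8` per degree; the net gain `3/8`
gives convergence. -/
theorem frobTerm_WM (h : IsLiftPair 𝓢 φ₁ φ₂ r₀) (hq : 1 < q) (hρ : IsRadius 𝓢 F₁ b ρ)
    (hρ0 : ρ ≤ r₀) {s : ℝ} (hs : s ∈ 𝓢.I) (hsρ : s ≤ ρ) :
    ∃ c : ℝ, ∀ C v, v ∈ 𝓢.WM b s C → ∀ J,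
      frobTerm φ₁ φ₂ X F₁ v J ∈ 𝓢.WM b (s / q) (C + c + 3 / 8 * (∑ i, J i : ℕ)) := by
  obtain ⟨c, hc⟩ := hρ.frob_WM s hs hsρ
  refine ⟨c, fun C v hv J => 𝓢.WM_anti b (le_of_eq ?_) (𝓢.smul_WM b
    (prod_pow_W (h.div_bound hq hs (hsρ.trans hρ0)) J) (hc C v J hv))⟩
  ring

/-- To check the convergence of a sum of radius `r / q`. -/
theorem exists_HS_div (hq : 1 < q) {ι : Type*} [Countable ι] {r : ℝ} (hr : 0 < r)
    {f : ι → X.carrier} (hf : ∀ i, f i ∈ 𝓢.MM b (r / q))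
    (h0 : ∀ s ∈ 𝓢.I, s ≤ r → ∀ C, {i | f i ∉ 𝓢.WM b (s / q) C}.Finite) :
    ∃ y, HS (𝓢.Nhds b (r / q)) f y := by
  have hq0 : 0 < q := by linarith
  refine 𝓢.exists_HS b (div_pos hr hq0) hf fun s hs hsr C => ?_
  have := h0 (s * q) (FrechetUnion.mul_mem_I hq hs) ((le_div_iff₀ hq0).1 hsr) C
  rwa [mul_div_cancel_right₀ _ hq0.ne'] at this

/-- The additive map `G` is the sum of the Taylor series. -/
def IsTaylorSum (𝓢 : FrechetUnion π p e q D zs) (b : Module.Basis (Fin n) S X.carrier)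
    (φ₂ : S →+* S) (F₁ : FrobStr D zs φ₁ X) (G : X.carrier →+ X.carrier) : Prop :=
  ∀ v, 𝓢.SumsTo b (frobTerm φ₁ φ₂ X F₁ v) (G v)

theorem exists_HS_frobTerm (h : IsLiftPair 𝓢 φ₁ φ₂ r₀) (hq : 1 < q) (hρ : IsRadius 𝓢 F₁ b ρ)
    (hρ0 : ρ ≤ r₀) {r : ℝ} (hr : 0 < r) (hrρ : r ≤ ρ) {v : X.carrier} (hv : v ∈ 𝓢.MM b r) :
    ∃ y, HS (𝓢.Nhds b (r / q)) (frobTerm φ₁ φ₂ X F₁ v) y := by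
  refine exists_HS_div hq hr (fun J => frobTerm_MM h hq hρ hρ0 hr hrρ hv J) fun s hs hsr C => ?_
  obtain ⟨c, hc⟩ := frobTerm_WM h hq hρ hρ0 hs (hsr.trans hrρ)
  obtain ⟨C', hC'⟩ := 𝓢.exists_WM b hr hv hs hsr
  exact finite_of_le (hc C' v hC') C

theorem frobTerm_add (v v' : X.carrier) (J : Fin m → ℕ) :
    frobTerm φ₁ φ₂ X F₁ (v + v') J = frobTerm φ₁ φ₂ X F₁ v J + frobTerm φ₁ φ₂ X F₁ v' J := by
  rw [frobTerm, map_add, map_add, smul_add]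
  rfl

theorem IsLiftPair.exists_isTaylorSum (h : IsLiftPair 𝓢 φ₁ φ₂ r₀) (hq : 1 < q)
    (F₁ : FrobStr D zs φ₁ X) (b : Module.Basis (Fin n) S X.carrier) :
    ∃ G, IsTaylorSum 𝓢 b φ₂ F₁ G := by
  obtain ⟨ρ, hρ0, hρ⟩ := h.left.exists_radius hq F₁ b
  have : ∀ v, ∃ y, 𝓢.SumsTo b (frobTerm φ₁ φ₂ X F₁ v) y := by
    intro v
    obtain ⟨r, hr, hv⟩ := 𝓢.exists_MM b v
    have hm := lt_min hr hρ.pos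
    obtain ⟨y, hy⟩ := exists_HS_frobTerm h hq hρ hρ0 hm (min_le_right _ _)
      (𝓢.MM_anti b hm (min_le_left _ _) hv)
    exact ⟨y, _, div_pos hm (by linarith), hy⟩
  choose G hG using this
  refine ⟨AddMonoidHom.mk' G fun v v' => (hG (v + v')).unique ?_, hG⟩
  have := (hG v).add (hG v')
  simpa only [← frobTerm_add] using this

namespace IsTaylorSum

variable {G : X.carrier →+ X.carrier}

theorem hs (hG : IsTaylorSum 𝓢 b φ₂ F₁ G) (h : IsLiftPair 𝓢 φ₁ φ₂ r₀) (hq : 1 < q)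
    (hρ : IsRadius 𝓢 F₁ b ρ) (hρ0 : ρ ≤ r₀) {r : ℝ} (hr : 0 < r) (hrρ : r ≤ ρ) {v : X.carrier}
    (hv : v ∈ 𝓢.MM b r) : HS (𝓢.Nhds b (r / q)) (frobTerm φ₁ φ₂ X F₁ v) (G v) := by
  obtain ⟨y, hy⟩ := exists_HS_frobTerm h hq hρ hρ0 hr hrρ hv
  rwa [(hG v).unique ⟨_, div_pos hr (by linarith), hy⟩]

theorem exists_bound (hG : IsTaylorSum 𝓢 b φ₂ F₁ G) (h : IsLiftPair 𝓢 φ₁ φ₂ r₀) (hq : 1 < q)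
    (hρ : IsRadius 𝓢 F₁ b ρ) (hρ0 : ρ ≤ r₀) {s : ℝ} (hs : s ∈ 𝓢.I) (hs0 : 0 < s) (hsρ : s ≤ ρ) :
    ∃ c : ℝ, ∀ C, ∀ v ∈ 𝓢.MM b s, v ∈ 𝓢.WM b s C → G v ∈ 𝓢.WM b (s / q) (C + c) := by
  obtain ⟨c, hc⟩ := frobTerm_WM h hq hρ hρ0 hs hsρ
  refine ⟨c, fun C v hv hvC => ?_⟩
  refine ((hG.hs h hq hρ hρ0 hs0 hsρ hv).mem_of_forall
    (𝓢.mem_Nhds b (𝓢.div_mem hq hs) le_rfl (C + c)) fun J =>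
      ⟨frobTerm_MM h hq hρ hρ0 hs0 hsρ hv J, 𝓢.WM_anti b ?_ (hc C v hvC J)⟩).2
  have : (0 : ℝ) ≤ (∑ i, J i : ℕ) := Nat.cast_nonneg _
  linarith

/-- Pascal's rule splits the term of index `J` into two. The second parts, with the index shifted by
one in direction `h`, add up to `u_h` times the whole series, and `φ₁(z_h) (1 + u_h) = φ₂(z_h)`. -/
theorem map_unit_smul (hG : IsTaylorSum 𝓢 b φ₂ F₁ G) (h : Fin m) (v : X.carrier) :
    G ((zs h : S) • v) = φ₂ (zs h) • G v := by
  have h1 : 𝓢.SumsTo b (fun J : Fin m → ℕ => if J h = 0 then 0 else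
      frobQuot zs φ₁ φ₂ h • frobTerm φ₁ φ₂ X F₁ v (J - Pi.single h 1)) (frobQuot zs φ₁ φ₂ h • G v) := by
    have h0 := (hG v).smul (frobQuot zs φ₁ φ₂ h)
    refine h0.reindex (g := fun J : Fin m → ℕ => J + Pi.single h 1)
      (fun _ _ => add_right_cancel) (fun J => ?_) fun J hJ => ?_
    · rw [if_neg (by simp), add_tsub_cancel_right]
    · rw [if_pos]
      by_contra h0
      refine hJ ⟨J - Pi.single h 1, tsub_add_cancel_of_le fun i => ?_⟩
      by_cases hi : i = h
      · subst hi
        simpa using Nat.one_le_iff_ne_zero.2 h0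
      · simp [hi]
  have h2 := ((hG v).add h1).smul (φ₁ (zs h))
  have h3 : (φ₁ (zs h) : S) • (G v + frobQuot zs φ₁ φ₂ h • G v) = φ₂ (zs h) • G v := by
    rw [← map_mul_one_add_frobQuot zs φ₁ φ₂ h, mul_smul, add_smul, one_smul]
  rw [h3] at h2
  refine (hG _).unique ?_
  convert h2 using 2 with J
  by_cases hJ : J h = 0
  · rw [if_pos hJ, add_zero, frobTerm, frobTerm, taylorOp_smul_of_eq_zero X 𝓢.D_unit hJ,
      map_smulₛₗ, smul_comm]
  · obtain ⟨K, rfl⟩ : ∃ K, J = K + Pi.single h 1 := by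
      refine ⟨J - Pi.single h 1, (tsub_add_cancel_of_le fun i => ?_).symm⟩
      by_cases hi : i = h
      · subst hi
        simpa using Nat.one_le_iff_ne_zero.2 hJ
      · simp [hi]
    rw [if_neg hJ, add_tsub_cancel_right, frobTerm, frobTerm, frobTerm,
      taylorOp_smul_add_single X 𝓢.D_unit, map_smulₛₗ, map_add, smul_comm, smul_add, smul_add,
      smul_add, smul_smul (frobQuot zs φ₁ φ₂ h)]
    congr 4
    rw [← Finset.mul_prod_erase _ _ (Finset.mem_univ h),
      ← Finset.mul_prod_erase Finset.univ (fun i => frobQuot zs φ₁ φ₂ i ^ K i) (Finset.mem_univ h),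
      ← mul_assoc]
    congr 1
    · simp [pow_succ']
    · refine Finset.prod_congr rfl fun i hi => ?_
      simp [Finset.ne_of_mem_erase hi]

theorem map_algebraMap_smul (hG : IsTaylorSum 𝓢 b φ₂ F₁ G)
    (h : ∀ c, φ₁ (algebraMap 𝔬 S c) = φ₂ (algebraMap 𝔬 S c)) (c : 𝔬) (v : X.carrier) :
    G (algebraMap 𝔬 S c • v) = φ₂ (algebraMap 𝔬 S c) • G v := by
  refine (hG _).unique ?_
  have := (hG v).smul (φ₂ (algebraMap 𝔬 S c))
  convert this using 2 with J
  rw [frobTerm, frobTerm, taylorOp_algebraMap_smul, map_smulₛₗ, smul_comm, h]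

/-- The scalars `a` for which the identity holds form a subring that contains `𝔬` and the `z_h^{±1}`
and is closed under division by `π`. Such a subring is dense, and both sides are continuous in `a`.
-/
theorem map_smul (hG : IsTaylorSum 𝓢 b φ₂ F₁ G) (h : IsLiftPair 𝓢 φ₁ φ₂ r₀) (hq : 1 < q)
    (a : S) (v : X.carrier) : G (a • v) = φ₂ a • G v := by
  let Q : Subring S :=
    { carrier := {a | ∀ v, G (a • v) = φ₂ a • G v}
      mul_mem' := fun {a a'} ha ha' v => by rw [mul_smul, ha, ha', map_mul, mul_smul]
      one_mem' := fun v => by rw [one_smul, map_one, one_smul]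
      add_mem' := fun {a a'} ha ha' v => by rw [add_smul, map_add, ha, ha', map_add, add_smul]
      zero_mem' := fun v => by rw [zero_smul, map_zero, map_zero, zero_smul]
      neg_mem' := fun {a} ha v => by rw [neg_smul, map_neg, ha, map_neg, neg_smul] }
  obtain ⟨r, hr, hdense⟩ := 𝓢.dense Q (hG.map_algebraMap_smul h.base) hG.map_unit_smul (by
    intro k v
    have := hG.map_unit_smul k ((↑(zs k)⁻¹ : S) • v)
    rw [smul_smul, Units.mul_inv, one_smul] at this
    rw [this, smul_smul, ← map_mul, Units.inv_mul, map_one, one_smul]) (by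
    intro x hx v
    have h1 := hx v
    rw [mul_smul, hG.map_algebraMap_smul h.base, map_mul, mul_smul] at h1
    exact (h.isUnit_pi.map φ₂).smul_left_cancel.1 h1) a
  obtain ⟨ρ, hρ0, hρ⟩ := h.left.exists_radius hq F₁ b
  obtain ⟨r', hr', hv⟩ := 𝓢.exists_MM b v
  obtain ⟨s, hs0, hsr, hsr', hsρ⟩ : ∃ s, 0 < s ∧ s ≤ r ∧ s ≤ r' ∧ s ≤ ρ :=
    ⟨min r (min r' ρ), lt_min hr (lt_min hr' hρ.pos), min_le_left _ _,
      (min_le_right _ _).trans (min_le_left _ _), (min_le_right _ _).trans (min_le_right _ _)⟩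
  have hs := 𝓢.mem_I s hs0
  replace hv := 𝓢.MM_anti b hs0 hsr' hv
  obtain ⟨c, hc⟩ := hG.exists_bound h hq hρ hρ0 hs hs0 hsρ
  obtain ⟨C₁, hC₁⟩ := 𝓢.exists_WM b hs0 hv hs le_rfl
  have hC₂ := hc C₁ v hv hC₁
  refine sub_eq_zero.1 (b.repr.map_eq_zero_iff.1 (Finsupp.ext fun l =>
    𝓢.sep (𝓢.div_mem hq hs) fun C => ?_))
  -- The accuracy makes both error terms have `w_(s/q) ≥ C`: the first uses the bound `c` for `G`,
  -- the second the bound `C₁ + c` for `G v`.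
  obtain ⟨a', ha', haM, haW⟩ := hdense s hs0 hsr (max (C - c - C₁) (C - (C₁ + c)))
  replace haM := 𝓢.Mem_anti hs0 hsr haM
  have e : G (a • v) - φ₂ a • G v = G ((a - a') • v) - φ₂ (a - a') • G v := by
    rw [sub_smul, map_sub, ha' v, map_sub, sub_smul]
    abel
  rw [e]
  refine AddSubgroup.sub_mem (𝓢.WM b (s / q) C) (𝓢.WM_anti b ?_ (hc _ _ (𝓢.smul_MM b haM hv)
    (𝓢.smul_WM b haW hC₁))) (𝓢.WM_anti b ?_ (𝓢.smul_WM b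
      (h.right.map_W hs (hsρ.trans hρ0) haW) hC₂)) l
  · linarith [le_max_left (C - c - C₁) (C - (C₁ + c))]
  · linarith [le_max_right (C - c - C₁) (C - (C₁ + c))]

end IsTaylorSum

end TaylorSum

/-! ### Horizontality and inversion of the Taylor series -/

section TaylorSum

universe u w

variable {𝔬 : Type*} [CommRing 𝔬] {m : ℕ} {S : Type u} [CommRing S] [Algebra 𝔬 S]

theorem derivation_prod_pow (D : Derivation 𝔬 S S) (x : Fin m → S) (J : Fin m → ℕ) :
    D (∏ i, x i ^ J i) = ∑ h, (J h * ∏ i, x i ^ (J - Pi.single h 1 : Fin m → ℕ) i) * D (x h) := by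
  have key : ∀ A : Finset (Fin m), D (∏ i ∈ A, x i ^ J i) =
      ∑ h ∈ A, (J h * ∏ i ∈ A, x i ^ (J - Pi.single h 1 : Fin m → ℕ) i) * D (x h) := by
    classical
    intro A
    induction A using Finset.induction_on with
    | empty => simp
    | insert a A ha ih =>
      rw [Finset.prod_insert ha, Derivation.leibniz, Derivation.leibniz_pow, ih,
        Finset.sum_insert ha, Finset.prod_insert ha, smul_eq_mul, smul_eq_mul, Finset.mul_sum,
        add_comm]
      congr 1
      · have hA : ∏ i ∈ A, x i ^ (J - Pi.single a 1 : Fin m → ℕ) i = ∏ i ∈ A, x i ^ J i :=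
          Finset.prod_congr rfl fun i hi => by
            rw [Pi.sub_apply, Pi.single_eq_of_ne (by rintro rfl; exact ha hi), Nat.sub_zero]
        rw [hA]
        simp only [Pi.sub_apply, Pi.single_eq_same, nsmul_eq_mul, smul_eq_mul]
        ring
      · refine Finset.sum_congr rfl fun h hh => ?_
        rw [Finset.prod_insert ha, Pi.sub_apply,
          Pi.single_eq_of_ne (by rintro rfl; exact ha hh), Nat.sub_zero]
        ring
  exact key Finset.univ

variable [Algebra ℚ S]
  {π : 𝔬} {p e : ℕ} [hp : Fact p.Prime] {q : ℝ} {D : Fin m → Derivation 𝔬 S S} {zs : Fin m → Sˣ}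
  {𝓢 : FrechetUnion π p e q D zs} {φ₁ φ₂ : S →+* S} {X : NablaMod.{u, w} D} {n : ℕ} {r₀ : ℝ}
  {F₁ : FrobStr D zs φ₁ X} {b : Module.Basis (Fin n) S X.carrier} {ρ : ℝ}
  {G : X.carrier →+ X.carrier}

/-- Leibniz, with `D_i u_h = (1 + u_h)(η₂ - η₁)`, horizontality of `F₁`, and `delta_taylorOp`. The
terms are grouped so that the difference multiplied by `η₂ - η₁` cancels after summation over `J`,
which leaves `η₂` times the series of `Δ_h v`. -/
theorem delta_frobTerm (i : Fin m) (v : X.carrier) (J : Fin m → ℕ) :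
    X.Δ i (frobTerm φ₁ φ₂ X F₁ v J) = ∑ h,
      ((dlogCoeff D zs φ₂ h i - dlogCoeff D zs φ₁ h i) •
        (J h • (∏ k, frobQuot zs φ₁ φ₂ k ^ (J - Pi.single h 1 : Fin m → ℕ) k) • F₁.F (taylorOp X J v) -
          (J h + 1) • (∏ k, frobQuot zs φ₁ φ₂ k ^ J k) •
            F₁.F (taylorOp X (J + Pi.single h 1) v)) +
        dlogCoeff D zs φ₂ h i • frobTerm φ₁ φ₂ X F₁ (X.Δ h v) J) := by
  rw [frobTerm, X.leibniz, derivation_prod_pow, F₁.compat, Finset.smul_sum, Finset.sum_smul,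
    ← Finset.sum_add_distrib]
  refine Finset.sum_congr rfl fun h _ => ?_
  rw [frobTerm, taylorOp_delta, delta_taylorOp, map_add, map_nsmul, map_nsmul,
    derivation_frobQuot]
  -- The factor `J h` makes this true even where the subtraction in `J - Pi.single h 1` is
  -- truncated.
  have hJ : (J h : S) * (∏ k, frobQuot zs φ₁ φ₂ k ^ (J - Pi.single h 1 : Fin m → ℕ) k) *
      frobQuot zs φ₁ φ₂ h = J h * ∏ k, frobQuot zs φ₁ φ₂ k ^ J k := by
    rcases Nat.eq_zero_or_pos (J h) with h0 | h0
    · simp [h0]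
    · rw [mul_assoc]
      congr 1
      rw [← Finset.mul_prod_erase _ _ (Finset.mem_univ h),
        ← Finset.mul_prod_erase Finset.univ (fun k => frobQuot zs φ₁ φ₂ k ^ J k)
          (Finset.mem_univ h), mul_right_comm]
      congr 1
      · rw [Pi.sub_apply, Pi.single_eq_same, ← pow_succ, Nat.sub_add_cancel h0]
      · refine Finset.prod_congr rfl fun k hk => ?_
        simp [Finset.ne_of_mem_erase hk]
  simp only [← Nat.cast_smul_eq_nsmul S, smul_add, smul_sub, smul_smul]
  generalize F₁.F (taylorOp X J v) = x
  generalize F₁.F (taylorOp X (J + Pi.single h 1) v) = y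
  generalize (∏ k, frobQuot zs φ₁ φ₂ k ^ (J - Pi.single h 1 : Fin m → ℕ) k) = U' at *
  generalize (∏ k, frobQuot zs φ₁ φ₂ k ^ J k) = U at *
  generalize frobQuot zs φ₁ φ₂ h = u at *
  generalize dlogCoeff D zs φ₁ h i = η₁
  generalize dlogCoeff D zs φ₂ h i = η₂
  have e1 : (J h : S) * U' * ((1 + u) * (η₂ - η₁)) =
      (η₂ - η₁) * (J h * U') + (η₂ - η₁) * (J h * U) := by
    linear_combination (η₂ - η₁) * hJ
  rw [e1]
  push_cast
  module

namespace IsTaylorSum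

/-- The two series in the difference of `delta_frobTerm` are the same up to a shift of the `k`-th
index by one, so they have the same sum `y k` and cancel. -/
theorem compat (hG : IsTaylorSum 𝓢 b φ₂ F₁ G) (h : IsLiftPair 𝓢 φ₁ φ₂ r₀) (hq : 1 < q)
    (i : Fin m) (v : X.carrier) :
    X.Δ i (G v) = ∑ h, dlogCoeff D zs φ₂ h i • G (X.Δ h v) := by
  obtain ⟨ρ, hρ0, hρ⟩ := h.left.exists_radius hq F₁ b
  obtain ⟨r', hr', hv⟩ := 𝓢.exists_MM b v
  obtain ⟨r, hr, hrr', hrρ⟩ : ∃ r, 0 < r ∧ r ≤ r' ∧ r ≤ ρ :=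
    ⟨min r' ρ, lt_min hr' hρ.pos, min_le_left _ _, min_le_right _ _⟩
  replace hv := 𝓢.MM_anti b hr hrr' hv
  have h1 : ∀ k, ∃ y, HS (𝓢.Nhds b (r / q)) (fun J : Fin m → ℕ => (J k + 1) •
      (∏ k, frobQuot zs φ₁ φ₂ k ^ J k) • F₁.F (taylorOp X (J + Pi.single k 1) v)) y := by
    intro k
    refine exists_HS_div hq hr (fun J => AddSubgroup.nsmul_mem _ (𝓢.smul_MM b (prod_pow_Mem
      (h.div_Mem hq hr (hrρ.trans hρ0)) J) (hρ.frob_MM hr hrρ (hρ.taylor_MM hr hrρ hv _))) _)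
      fun s hs hsr C => ?_
    obtain ⟨c, hc⟩ := hρ.frob_WM s hs (hsr.trans hrρ)
    obtain ⟨C', hC'⟩ := 𝓢.exists_WM b hr hv hs hsr
    -- The divided power has degree one more than the power of `u`, which costs an additional `1/8`.
    refine finite_of_le (c := C' + c - 1 / 8) (fun J => AddSubgroup.nsmul_mem _
      (𝓢.WM_anti b (le_of_eq ?_) (𝓢.smul_WM b
        (prod_pow_W (h.div_bound hq hs (hsr.trans (hrρ.trans hρ0))) J) (hc C' v _ hC'))) _) C
    simp only [Pi.add_apply, Finset.sum_add_distrib, Finset.sum_pi_single', Finset.mem_univ,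
      if_true]
    push_cast
    ring
  choose y hy using h1
  have h2 : ∀ k, 𝓢.SumsTo b (fun J : Fin m → ℕ => J k • (∏ k', frobQuot zs φ₁ φ₂ k' ^
      (J - Pi.single k 1 : Fin m → ℕ) k') • F₁.F (taylorOp X J v)) (y k) := by
    intro k
    have hyk : 𝓢.SumsTo b _ (y k) := ⟨_, div_pos hr (by linarith), hy k⟩
    refine hyk.reindex (g := fun J : Fin m → ℕ => J + Pi.single k 1)
      (fun _ _ => add_right_cancel) (fun J => ?_) fun J hJ => ?_
    · rw [add_tsub_cancel_right, Pi.add_apply, Pi.single_eq_same]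
    · have : J k = 0 := by
        by_contra h0
        refine hJ ⟨J - Pi.single k 1, tsub_add_cancel_of_le fun i => ?_⟩
        by_cases hi : i = k
        · subst hi
          simpa using Nat.one_le_iff_ne_zero.2 h0
        · simp [hi]
      rw [this, zero_smul]
  have h3 := (hG v).map (FrechetUnion.tame_delta b i)
  simp only [delta_frobTerm] at h3
  refine h3.unique ?_
  refine FrechetUnion.SumsTo.sum fun k _ => ?_
  have hyk : 𝓢.SumsTo b _ (y k) := ⟨_, div_pos hr (by linarith), hy k⟩
  have h4 := ((h2 k).add (hyk.smul (-1))).smul (dlogCoeff D zs φ₂ k i - dlogCoeff D zs φ₁ k i)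
  have h5 := h4.add ((hG (X.Δ k v)).smul (dlogCoeff D zs φ₂ k i))
  simpa only [neg_smul, one_smul, add_neg_cancel, smul_zero, zero_add, ← sub_eq_add_neg] using h5

/-- The Taylor series for the inverse change of Frobenius. -/
theorem inverse (hG : IsTaylorSum 𝓢 b φ₂ F₁ G) (h : IsLiftPair 𝓢 φ₁ φ₂ r₀) (hq : 1 < q)
    (v : X.carrier) :
    𝓢.SumsTo b (fun K : Fin m → ℕ => (∏ i, frobQuot zs φ₂ φ₁ i ^ K i) • G (taylorOp X K v))
      (F₁.F v) := by
  obtain ⟨ρ, hρ0, hρ⟩ := h.left.exists_radius hq F₁ b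
  obtain ⟨r', hr', hv⟩ := 𝓢.exists_MM b v
  obtain ⟨r, hr, hrr', hrρ⟩ : ∃ r, 0 < r ∧ r ≤ r' ∧ r ≤ ρ :=
    ⟨min r' ρ, lt_min hr' hρ.pos, min_le_left _ _, min_le_right _ _⟩
  replace hv := 𝓢.MM_anti b hr hrr' hv
  set U : (Fin m → ℕ × ℕ) → S := fun T =>
    (∏ i, frobQuot zs φ₂ φ₁ i ^ (T i).2) * ∏ i, frobQuot zs φ₁ φ₂ i ^ (T i).1 with hU
  -- The composite series, expanded by the multiplication rule for divided powers. With `u`, `u'`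
  -- the quotients of the two directions, the entry at `(T, L)` is the `u^(T.1) u'^(T.2)` part of `∏
  -- (u_i + u'_i + u_i u'_i)^(L_i)`, applied to the divided power of index `L`.
  let f : (Fin m → ℕ × ℕ) × (Fin m → ℕ) → X.carrier := fun x =>
    (∏ i, mulCoeff (x.2 i) (x.1 i).1 (x.1 i).2) • U x.1 • F₁.F (taylorOp X x.2 v)
  have hcoef : ∀ (T : Fin m → ℕ × ℕ) (L : Fin m → ℕ),
      ∏ i, mulCoeff (L i) (T i).1 (T i).2 ≠ 0 →
      ∀ i, L i ≤ (T i).1 + (T i).2 ∧ (T i).1 ≤ L i ∧ (T i).2 ≤ L i := fun T L hTL i =>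
    mulCoeff_ne_zero fun h0 => hTL (Finset.prod_eq_zero (Finset.mem_univ i) h0)
  obtain ⟨y, hy⟩ : ∃ y, HS (𝓢.Nhds b (r / q)) f y := by
    refine exists_HS_div hq hr (fun x => AddSubgroup.nsmul_mem _ (𝓢.smul_MM b (𝓢.Mem_mul
      (prod_pow_Mem (h.symm.div_Mem hq hr (hrρ.trans hρ0)) _)
      (prod_pow_Mem (h.div_Mem hq hr (hrρ.trans hρ0)) _))
      (hρ.frob_MM hr hrρ (hρ.taylor_MM hr hrρ hv _))) _) fun s hs hsr C => ?_
    obtain ⟨c, hc⟩ := hρ.frob_WM s hs (hsr.trans hrρ)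
    obtain ⟨C', hC'⟩ := 𝓢.exists_WM b hr hv hs hsr
    obtain ⟨N, hN⟩ := exists_nat_ge ((C - (C' + c)) * (8 / 3))
    -- A nonzero coefficient forces both components of `T` to be at most `L`, so bounding `|L|`
    -- leaves finitely many entries. It also forces `|L|` to be at most the total degree of `T`, so
    -- the powers of `u` and `u'` gain at least `|L|/2`, against the loss `|L|/8`.
    refine ((Set.finite_Iic fun _ : Fin m => (N, N)).prod (finite_sum_le N)).subset ?_
    rintro ⟨T, L⟩ hTL
    have h0 : ∏ i, mulCoeff (L i) (T i).1 (T i).2 ≠ 0 := fun h0 => hTL (by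
      change (∏ i, mulCoeff (L i) (T i).1 (T i).2) • _ ∈ _
      rw [h0, zero_smul]
      exact AddSubgroup.zero_mem _)
    have hL : ∑ i, L i ≤ N := by
      by_contra hcon
      refine hTL (AddSubgroup.nsmul_mem _ (𝓢.WM_anti b ?_ (𝓢.smul_WM b (𝓢.W_mul
        (prod_pow_W (h.symm.div_bound hq hs (hsr.trans (hrρ.trans hρ0))) fun i => (T i).2)
        (prod_pow_W (h.div_bound hq hs (hsr.trans (hrρ.trans hρ0))) fun i => (T i).1))
        (hc C' v L hC'))) _)
      have h1 : ∑ i, L i ≤ ∑ i, (T i).1 + ∑ i, (T i).2 := by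
        rw [← Finset.sum_add_distrib]
        exact Finset.sum_le_sum fun i _ => (hcoef T L h0 i).1
      have h1' : ((∑ i, L i : ℕ) : ℝ) ≤ (∑ i, (T i).1 : ℕ) + (∑ i, (T i).2 : ℕ) := by
        exact_mod_cast h1
      have h2 : (N : ℝ) ≤ (∑ i, L i : ℕ) := by
        have hcon' : N < ∑ i, L i := not_le.1 hcon
        exact_mod_cast hcon'.le
      linarith
    have hLi : ∀ i, L i ≤ N := fun i =>
      (Finset.single_le_sum (f := L) (fun _ _ => Nat.zero_le _) (Finset.mem_univ i)).trans hL
    exact ⟨fun i => ⟨(hcoef T L h0 i).2.1.trans (hLi i), (hcoef T L h0 i).2.2.trans (hLi i)⟩, hL⟩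
  -- summing over `T` first
  have hyF : y = F₁.F v := by
    classical
    have h1 : HS (𝓢.Nhds b (r / q)) (fun L : Fin m → ℕ => if L = 0 then F₁.F v else 0) y := by
      refine hy.fiber_finite (fun x => x.2) (fun L => (Fintype.piFinset fun i =>
        Finset.range (L i + 1) ×ˢ Finset.range (L i + 1)).map
          ⟨fun T => (T, L), fun T T' hT => (Prod.ext_iff.1 hT).1⟩) ?_ ?_ ?_
      · intro L x hx
        obtain ⟨T, -, rfl⟩ := Finset.mem_map.1 hx
        rfl
      · rintro ⟨T, L⟩ hTL
        have h0 : ∏ i, mulCoeff (L i) (T i).1 (T i).2 ≠ 0 := fun h0 => hTL (by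
          change (∏ i, mulCoeff (L i) (T i).1 (T i).2) • _ = _
          rw [h0, zero_smul])
        refine Finset.mem_map.2 ⟨T, Fintype.mem_piFinset.2 fun i => ?_, rfl⟩
        have := hcoef T L h0 i
        exact Finset.mem_product.2 ⟨Finset.mem_range.2 (Nat.lt_succ_of_le this.2.1),
          Finset.mem_range.2 (Nat.lt_succ_of_le this.2.2)⟩
      · intro L
        rw [Finset.sum_map]
        change ∑ T ∈ _, (∏ i, mulCoeff (L i) (T i).1 (T i).2) • U T • F₁.F (taylorOp X L v) = _
        simp only [← Nat.cast_smul_eq_nsmul S, smul_smul]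
        rw [← Finset.sum_smul]
        have h2 : ∀ T : Fin m → ℕ × ℕ, ((∏ i, mulCoeff (L i) (T i).1 (T i).2 : ℕ) : S) * U T =
            ∏ i, ((mulCoeff (L i) (T i).1 (T i).2 : S) *
              (frobQuot zs φ₁ φ₂ i ^ (T i).1 * frobQuot zs φ₂ φ₁ i ^ (T i).2)) := by
          intro T
          rw [hU, Finset.prod_mul_distrib, Finset.prod_mul_distrib, Nat.cast_prod,
            mul_comm (∏ i, frobQuot zs φ₁ φ₂ i ^ (T i).1)]
        simp only [h2]
        rw [← Finset.prod_univ_sum (fun i => Finset.range (L i + 1) ×ˢ Finset.range (L i + 1))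
          (fun i (t : ℕ × ℕ) => (mulCoeff (L i) t.1 t.2 : S) *
              (frobQuot zs φ₁ φ₂ i ^ t.1 * frobQuot zs φ₂ φ₁ i ^ t.2))]
        -- The inner sum is `∏ (u_i + u'_i + u_i u'_i)^(L_i)`, which is zero unless `L = 0`.
        simp only [sum_mulCoeff, frobQuot_add_frobQuot]
        split_ifs with hL
        · subst hL
          simp [taylorOp_zero]
        · obtain ⟨i, hi⟩ := Function.ne_iff.1 hL
          rw [Finset.prod_eq_zero (Finset.mem_univ i) (zero_pow hi), zero_smul]
    have h2 := h1.unique (𝓢.Nhds_sep b (div_pos hr (by linarith))) (HS.single 0 fun L hL => if_neg hL)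
    rw [h2, if_pos rfl]
  -- summing over `L` first
  rw [hyF] at hy
  have h1 : HS (𝓢.Nhds b (r / q)) (fun T : Fin m → ℕ × ℕ => U T •
      F₁.F (taylorOp X (fun i => (T i).1) (taylorOp X (fun i => (T i).2) v))) (F₁.F v) := by
    refine hy.fiber_finite (fun x => x.1) (fun T => (Fintype.piFinset fun i =>
        Finset.range ((T i).1 + (T i).2 + 1)).map
          ⟨fun L => (T, L), fun T T' hT => (Prod.ext_iff.1 hT).2⟩) ?_ ?_ ?_
    · intro L x hx
      obtain ⟨T, -, rfl⟩ := Finset.mem_map.1 hx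
      rfl
    · rintro ⟨T, L⟩ hTL
      have h0 : ∏ i, mulCoeff (L i) (T i).1 (T i).2 ≠ 0 := fun h0 => hTL (by
        change (∏ i, mulCoeff (L i) (T i).1 (T i).2) • _ = _
        rw [h0, zero_smul])
      refine Finset.mem_map.2 ⟨L, Fintype.mem_piFinset.2 fun i => ?_, rfl⟩
      have := hcoef T L h0 i
      exact Finset.mem_range.2 (Nat.lt_succ_of_le this.1)
    · intro T
      rw [Finset.sum_map, taylorOp_taylorOp, map_sum, Finset.smul_sum]
      refine Finset.sum_congr rfl fun L _ => ?_
      rw [map_nsmul, smul_comm]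
      rfl
  -- On the fiber over `K` the sum is `u'^K` times the Taylor series of the divided power `T_K v`,
  -- and this has sum `G (T_K v)`.
  refine ⟨_, div_pos hr (by linarith), h1.fiber (fun T i => (T i).2) fun V hV K => ?_⟩
  have h2 := hG.hs h hq hρ hρ0 hr hrρ (hρ.taylor_MM hr hrρ hv K)
  have h3 := h2.map (𝓕' := 𝓢.Nhds b (r / q))
    (DistribSMul.toAddMonoidHom X.carrier (∏ i, frobQuot zs φ₂ φ₁ i ^ K i)) (by
    rintro _ ⟨s, hs, hsr, C, rfl⟩
    have hsI := FrechetUnion.mul_mem_I hq hs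
    have hq0 : 0 < q := by linarith
    have hsr' := (le_div_iff₀ hq0).1 hsr
    have hW := prod_pow_W (h.symm.div_bound hq hsI (hsr'.trans (hrρ.trans hρ0))) K
    rw [mul_div_cancel_right₀ _ hq0.ne'] at hW
    refine ⟨_, 𝓢.mem_Nhds b hs hsr C, fun x hx => ⟨𝓢.smul_MM b (prod_pow_Mem
      (h.symm.div_Mem hq hr (hrρ.trans hρ0)) K) hx.1, 𝓢.WM_anti b ?_ (𝓢.smul_WM b hW hx.2)⟩⟩
    have : (0 : ℝ) ≤ (∑ i, K i : ℕ) := Nat.cast_nonneg _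
    linarith)
  obtain ⟨A, hA⟩ := h3 V hV
  refine ⟨A.map ⟨fun J i => (J i, K i), fun J J' hJ => funext fun i =>
    (Prod.ext_iff.1 (congrFun hJ i)).1⟩, ?_, fun B hB hB' => ?_⟩
  · intro T hT
    obtain ⟨J, -, rfl⟩ := Finset.mem_map.1 hT
    rfl
  · classical
    have h4 := hA (B.image fun T i => (T i).1) (by
      intro J hJ
      exact Finset.mem_image.2 ⟨_, hB (Finset.mem_map.2 ⟨J, hJ, rfl⟩), rfl⟩)
    rw [Finset.sum_image (fun T hT T' hT' hTT => funext fun i => Prod.ext (congrFun hTT i)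
      ((congrFun (hB' T hT) i).trans (congrFun (hB' T' hT') i).symm))] at h4
    convert h4 using 2
    swap
    · rfl
    refine Finset.sum_congr rfl fun T hT => ?_
    rw [← hB' T hT, hU]
    exact mul_smul _ _ _

end IsTaylorSum

end TaylorSum

/-! ### The equivalence of categories -/

section ChangeOfFrobenius

open CategoryTheory

universe u w

variable {𝔬 : Type*} [CommRing 𝔬] {m : ℕ} {S : Type u} [CommRing S] [Algebra 𝔬 S] [Algebra ℚ S]
  {π : 𝔬} {p e : ℕ} [hp : Fact p.Prime] {q : ℝ} {D : Fin m → Derivation 𝔬 S S} {zs : Fin m → Sˣ}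
  {𝓢 : FrechetUnion π p e q D zs} {φ₁ φ₂ : S →+* S} {X : NablaMod.{u, w} D} {n : ℕ} {r₀ : ℝ}

/-- Let `L` be the linear map with `b_l ↦ G(b_l)` and `T` the action of `φ₂` on coordinates, so that
`G = L ∘ T`. The inverse Taylor series writes `F₁ v` as `L` of a convergent series, so the image of
`L` contains the basis `F₁(b)`. A surjective endomorphism of a finite module is bijective. -/
theorem IsTaylorSum.exists_basis {F₁ : FrobStr D zs φ₁ X} {b : Module.Basis (Fin n) S X.carrier}
    {G : X.carrier →+ X.carrier} (hG : IsTaylorSum 𝓢 b φ₂ F₁ G) (h : IsLiftPair 𝓢 φ₁ φ₂ r₀)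
    (hq : 1 < q) : ∃ b' : Module.Basis (Fin n) S X.carrier, ∀ l, b' l = G (b l) := by
  have hq0 : 0 < q := by linarith
  let L : X.carrier →ₗ[S] X.carrier := b.constr S fun l => G (b l)
  have hLb : ∀ l, L (b l) = G (b l) := fun l => b.constr_basis S _ l
  let T : X.carrier → X.carrier := fun v => b.equivFun.symm fun l => φ₂ (b.repr v l)
  have hT : ∀ v l, b.repr (T v) l = φ₂ (b.repr v l) := fun v l => by
    rw [← Module.Basis.equivFun_apply]
    change b.equivFun (b.equivFun.symm _) l = _
    rw [LinearEquiv.apply_symm_apply]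
  have hLT : ∀ v, L (T v) = G v := fun v => by
    rw [← b.sum_repr (T v), map_sum]
    conv_rhs => rw [← b.sum_repr v, map_sum]
    refine Finset.sum_congr rfl fun l _ => ?_
    rw [hG.map_smul h hq, _root_.map_smul, hLb, hT]
  have hrange : ∀ v, F₁.F v ∈ LinearMap.range L := by
    intro v
    obtain ⟨ρ, hρ0, hρ⟩ := h.left.exists_radius hq F₁ b
    obtain ⟨r', hr', hv⟩ := 𝓢.exists_MM b v
    obtain ⟨r, hr, hrr', hrρ⟩ : ∃ r, 0 < r ∧ r ≤ r' ∧ r ≤ ρ :=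
      ⟨min r' ρ, lt_min hr' hρ.pos, min_le_left _ _, min_le_right _ _⟩
    replace hv := 𝓢.MM_anti b hr hrr' hv
    obtain ⟨y, hy⟩ : ∃ y, HS (𝓢.Nhds b (r / q)) (fun K : Fin m → ℕ =>
        (∏ i, frobQuot zs φ₂ φ₁ i ^ K i) • T (taylorOp X K v)) y := by
      refine exists_HS_div hq hr (fun K => 𝓢.smul_MM b (prod_pow_Mem
        (h.symm.div_Mem hq hr (hrρ.trans hρ0)) K) fun l => ?_) fun s hs hsr C => ?_
      · rw [hT]
        exact h.right.map_Mem hr (hrρ.trans hρ0) (hρ.taylor_MM hr hrρ hv K l)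
      · obtain ⟨c, hc⟩ := hρ.taylor_WM s hs (hsr.trans hrρ)
        obtain ⟨C', hC'⟩ := 𝓢.exists_WM b hr hv hs hsr
        refine finite_of_le (c := C' + c) (fun K => 𝓢.WM_anti b (le_of_eq ?_) (𝓢.smul_WM b
          (prod_pow_W (h.symm.div_bound hq hs (hsr.trans (hrρ.trans hρ0))) K)
          (C' := C' + c - ((∑ i, K i : ℕ) : ℝ) / 8) fun l => ?_)) C
        · ring
        · rw [hT]
          exact h.right.map_W hs (hsr.trans (hrρ.trans hρ0)) (hc C' v K hC' l)
    have h1 : 𝓢.SumsTo b _ y := ⟨_, div_pos hr hq0, hy⟩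
    have h2 := h1.linear (b' := b) L
    simp only [_root_.map_smul, hLT] at h2
    exact ⟨y, h2.unique (hG.inverse h hq v)⟩
  have hsurj : Function.Surjective L := by
    obtain ⟨b₁, hb₁⟩ := F₁.isogeny n b
    rw [← LinearMap.range_eq_top, eq_top_iff, ← b₁.span_eq, Submodule.span_le]
    rintro _ ⟨l, rfl⟩
    rw [hb₁]
    exact hrange _
  refine ⟨b.map (LinearEquiv.ofBijective L
    (OrzechProperty.bijective_of_surjective_endomorphism L hsurj)), fun l => ?_⟩
  rw [Module.Basis.map_apply]
  exact hLb l

theorem IsLiftPair.exists_frobStr (h : IsLiftPair 𝓢 φ₁ φ₂ r₀) (hq : 1 < q)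
    (F₁ : FrobStr D zs φ₁ X) : ∃ F₂ : FrobStr D zs φ₂ X,
      ∀ (n : ℕ) (b : Module.Basis (Fin n) S X.carrier) (v : X.carrier),
        𝓢.SumsTo b (frobTerm φ₁ φ₂ X F₁ v) (F₂.F v) := by
  let b := (Module.Free.chooseBasis S X.carrier).reindex
    (Fintype.equivFin (Module.Free.ChooseBasisIndex S X.carrier))
  obtain ⟨G, hG⟩ := h.exists_isTaylorSum hq F₁ b
  -- Convergence does not depend on the basis: linear maps, in particular the identity between two
  -- bases, are bounded.
  have hG' : ∀ (n : ℕ) (b : Module.Basis (Fin n) S X.carrier), IsTaylorSum 𝓢 b φ₂ F₁ G :=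
    fun n b' v => (hG v).linear (b' := b') LinearMap.id
  exact ⟨{ F := { G with map_smul' := hG.map_smul h hq }
           isogeny := fun n b' => (hG' n b').exists_basis h hq
           compat := hG.compat h hq }, hG'⟩

/-- The Frobenius structure relative to `φ₂` defined by the Taylor series. -/
def changeFrob (h : IsLiftPair 𝓢 φ₁ φ₂ r₀) (hq : 1 < q) (F₁ : FrobStr D zs φ₁ X) :
    FrobStr D zs φ₂ X := (h.exists_frobStr hq F₁).choose

theorem sumsTo_changeFrob (h : IsLiftPair 𝓢 φ₁ φ₂ r₀) (hq : 1 < q) (F₁ : FrobStr D zs φ₁ X)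
    (b : Module.Basis (Fin n) S X.carrier) (v : X.carrier) :
    𝓢.SumsTo b (frobTerm φ₁ φ₂ X F₁ v) ((changeFrob h hq F₁).F v) :=
  (h.exists_frobStr hq F₁).choose_spec n b v

theorem exists_basis (X : NablaMod.{u, w} D) : ∃ n, Nonempty (Module.Basis (Fin n) S X.carrier) :=
  ⟨_, ⟨(Module.Free.chooseBasis S X.carrier).reindex
    (Fintype.equivFin (Module.Free.ChooseBasisIndex S X.carrier))⟩⟩

theorem changeFrob_changeFrob (h : IsLiftPair 𝓢 φ₁ φ₂ r₀) (hq : 1 < q) (F₁ : FrobStr D zs φ₁ X) :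
    changeFrob h.symm hq (changeFrob h hq F₁) = F₁ := by
  obtain ⟨n, ⟨b⟩⟩ := exists_basis X
  refine FrobStr.ext (LinearMap.ext fun v => ?_)
  have hG : IsTaylorSum 𝓢 b φ₂ F₁ (changeFrob h hq F₁).F.toAddMonoidHom :=
    sumsTo_changeFrob h hq F₁ b
  exact (sumsTo_changeFrob h.symm hq (changeFrob h hq F₁) b v).unique (hG.inverse h hq v)

theorem map_changeFrob (h : IsLiftPair 𝓢 φ₁ φ₂ r₀) (hq : 1 < q)
    {X Y : FNablaMod.{u, w} D zs φ₁} (f : X ⟶ Y) (v : X.base.carrier) :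
    f.hom.lin ((changeFrob h hq X.frob).F v) = (changeFrob h hq Y.frob).F (f.hom.lin v) := by
  obtain ⟨n, ⟨b⟩⟩ := exists_basis X.base
  obtain ⟨n', ⟨b'⟩⟩ := exists_basis Y.base
  have h1 := (sumsTo_changeFrob h hq X.frob b v).linear (b' := b') f.hom.lin
  refine h1.unique ?_
  have h2 := sumsTo_changeFrob h hq Y.frob b' (f.hom.lin v)
  convert h2 using 2 with J
  rw [frobTerm, frobTerm, _root_.map_smul, f.equivariant]
  exact congrArg (fun x => _ • Y.frob.F x)
    (map_taylorOp (f.hom.lin : X.base.carrier →+ Y.base.carrier) f.hom.comm J v)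

/-- The change of Frobenius, as a functor. -/
def changeFunctor (h : IsLiftPair 𝓢 φ₁ φ₂ r₀) (hq : 1 < q) :
    FNablaMod.{u, w} D zs φ₁ ⥤ FNablaMod.{u, w} D zs φ₂ where
  obj X := ⟨X.base, changeFrob h hq X.frob⟩
  map f := ⟨f.hom, map_changeFrob h hq f⟩

/-- Two Frobenius structures that agree define isomorphic `(F, ∇)`-modules. -/
def isoOfEq {F F' : FrobStr D zs φ₁ X} (h : F = F') :
    (⟨X, F⟩ : FNablaMod.{u, w} D zs φ₁) ≅ ⟨X, F'⟩ where
  hom := ⟨𝟙 X, fun v => by subst h; rfl⟩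
  inv := ⟨𝟙 X, fun v => by subst h; rfl⟩
  hom_inv_id := rfl
  inv_hom_id := rfl

/-- The change of Frobenius, as an equivalence of categories. -/
def changeEquivalence (h : IsLiftPair 𝓢 φ₁ φ₂ r₀) (hq : 1 < q) :
    FNablaMod.{u, w} D zs φ₁ ≌ FNablaMod.{u, w} D zs φ₂ :=
  CategoryTheory.Equivalence.mk (changeFunctor h hq) (changeFunctor h.symm hq)
    (NatIso.ofComponents (fun X => isoOfEq (changeFrob_changeFrob h hq X.frob).symm)
      fun _ => rfl)
    (NatIso.ofComponents (fun X => isoOfEq (changeFrob_changeFrob h.symm hq X.frob))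
      fun _ => rfl)

/-- Convergence in `S`. -/
def FrechetUnion.Conv (𝓢 : FrechetUnion π p e q D zs) {ι : Type} (l : Filter ι) (f : ι → S)
    (y : S) : Prop :=
  ∃ r, 0 < r ∧ ∀ s, 0 < s → s ≤ r → ∀ C, ∀ᶠ i in l, f i - y ∈ 𝓢.Mem r ∧ f i - y ∈ 𝓢.W s C

theorem exists_changeEquivalence (h : IsLiftPair 𝓢 φ₁ φ₂ r₀) (hq : 1 < q) :
    ∃ e : FNablaMod.{u, w} D zs φ₁ ≌ FNablaMod.{u, w} D zs φ₂,
      e.functor ⋙ forgetF D zs φ₂ = forgetF D zs φ₁ ∧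
      e.inverse ⋙ forgetF D zs φ₁ = forgetF D zs φ₂ ∧
      ∀ (X : NablaMod.{u, w} D) (F₁ : FrobStr D zs φ₁ X), ∃ F₂ : FrobStr D zs φ₂ X,
        e.functor.obj ⟨X, F₁⟩ = ⟨X, F₂⟩ ∧
        ∀ v, SeriesConverges 𝓢.Conv (taylorTerm φ₁ φ₂ X F₁ v) (F₂.F v) := by
  refine ⟨changeEquivalence h hq, rfl, rfl, fun X F₁ => ⟨changeFrob h hq F₁, rfl, ?_⟩⟩
  intro v n b l
  obtain ⟨r, hr, hs⟩ := sumsTo_changeFrob h hq F₁ b v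
  refine ⟨r, hr, fun s hs0 hsr C => ?_⟩
  obtain ⟨A₀, hA₀⟩ := hs _ (𝓢.mem_Nhds b (𝓢.mem_I s hs0) hsr C)
  refine eventually_atTop.2 ⟨A₀, fun A hA => ?_⟩
  have h1 := hA₀ A hA
  have h2 : ∑ J ∈ A, b.repr (taylorTerm φ₁ φ₂ X F₁ v J) l - b.repr ((changeFrob h hq F₁).F v) l =
      b.repr (∑ J ∈ A, frobTerm φ₁ φ₂ X F₁ v J - (changeFrob h hq F₁).F v) l := by
    rw [map_sub, Finsupp.sub_apply, map_sum, Finsupp.finsetSum_apply]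
    simp only [taylorTerm_eq]
  rw [h2]
  exact ⟨h1.1 l, h1.2 l⟩

theorem seqCont_derivation (𝓢 : FrechetUnion π p e q D zs) (i : Fin m) :
    SeqCont 𝓢.Conv (D i) := by
  rintro x y ⟨r, hr, h⟩
  refine ⟨r, hr, fun s hs hsr C => (h s hs hsr C).mono fun k hk => ?_⟩
  rw [← map_sub]
  exact ⟨𝓢.D_Mem i hk.1, 𝓢.D_W i hk.2⟩

theorem IsLift.seqCont (h : IsLift 𝓢 φ₁ r₀) (hq : 1 < q) : SeqCont 𝓢.Conv φ₁ := by
  have hq0 : 0 < q := by linarith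
  rintro x y ⟨r, hr, hx⟩
  have hm := lt_min hr h.pos
  refine ⟨min r r₀ / q, div_pos hm hq0, fun s hs hsr C => ?_⟩
  have hsq := mul_pos hs hq0
  have hsr' := (le_div_iff₀ hq0).1 hsr
  refine (hx _ hsq (hsr'.trans (min_le_left _ _)) C).mono fun k hk => ?_
  rw [← map_sub]
  refine ⟨h.map_Mem hm (min_le_right _ _) (𝓢.Mem_anti hm (min_le_left _ _) hk.1), ?_⟩
  have := h.map_W (𝓢.mem_I _ hsq) (hsr'.trans (min_le_right _ _)) hk.2
  rwa [mul_div_cancel_right₀ _ hq0.ne'] at this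

end ChangeOfFrobenius

/-! ### Coefficients and valuations on `Γ[1/π]` -/

section CoefficientsPi

variable {𝔬 : Type*} [CommRing 𝔬] {L : Type*} [AddCommGroup L] [LinearOrder L]
  [IsOrderedAddMonoid L] {π : 𝔬} {lam : L →+ ℝ}

/-- The canonical map from `Γ` to `Γ[1/π]`. -/
abbrev toPi (π : 𝔬) (lam : L →+ ℝ) : Gam π lam →+* GamPi π lam := algebraMap _ _

/-- The coefficient of `x ∈ Γ[1/π]` at `z` has valuation at least `d`. -/
def CoeffGE (z : L) (d : ℝ) (x : GamPi π lam) : Prop :=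
  ∃ (k : ℕ) (a : Gam π lam), x * piLoc π lam ^ k = toPi π lam a ∧
    ∀ n : ℕ, coeffHom (n + 1) z a ≠ 0 → d + k ≤ n

/-- `w_s(x) ≥ C`, for `x ∈ Γ[1/π]` and any real `s`. -/
def PiGE (s C : ℝ) (x : GamPi π lam) : Prop := ∀ z, CoeffGE z (C - s * lam z) x

theorem exists_rep (x : GamPi π lam) :
    ∃ (k : ℕ) (a : Gam π lam), x * piLoc π lam ^ k = toPi π lam a := by
  obtain ⟨⟨a, ⟨_, k, rfl⟩⟩, h⟩ := IsLocalization.surj (Submonoid.powers (piG π lam)) x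
  exact ⟨k, a, by rw [← h, map_pow]⟩

theorem isUnit_piLoc : IsUnit (piLoc π lam) :=
  IsLocalization.Away.algebraMap_isUnit (piG π lam)

theorem algebraMap_piLoc : algebraMap 𝔬 (GamPi π lam) π = piLoc π lam :=
  IsScalarTower.algebraMap_apply 𝔬 (Gam π lam) (GamPi π lam) π

theorem toPi_algebraMap (c : 𝔬) :
    toPi π lam (algebraMap 𝔬 _ c) = algebraMap 𝔬 (GamPi π lam) c :=
  (IsScalarTower.algebraMap_apply 𝔬 (Gam π lam) (GamPi π lam) c).symm

theorem rep_add {x : GamPi π lam} {k : ℕ} {a : Gam π lam} (h : x * piLoc π lam ^ k = toPi π lam a)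
    (l : ℕ) : x * piLoc π lam ^ (l + k) = toPi π lam (piG π lam ^ l * a) := by
  rw [map_mul, ← h, map_pow]
  ring

theorem exists_eq_div (k : ℕ) (a : Gam π lam) :
    ∃ x : GamPi π lam, x * piLoc π lam ^ k = toPi π lam a := by
  obtain ⟨u, hu⟩ := (isUnit_piLoc (π := π) (lam := lam)).pow k
  exact ⟨toPi π lam a * ↑u⁻¹, by rw [← hu, mul_assoc, Units.inv_mul, mul_one]⟩

variable [IsDomain 𝔬]

theorem toPi_injective (hπ : π ≠ 0) : Function.Injective (toPi π lam) := by
  intro a b h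
  obtain ⟨⟨_, k, rfl⟩, hc⟩ := (IsLocalization.eq_iff_exists (Submonoid.powers (piG π lam)) _).1 h
  exact piG_mul_left_cancel hπ hc

theorem rep_unique (hπ : π ≠ 0) {x : GamPi π lam} {k l : ℕ} {a b : Gam π lam}
    (ha : x * piLoc π lam ^ k = toPi π lam a) (hb : x * piLoc π lam ^ l = toPi π lam b) :
    piG π lam ^ l * a = piG π lam ^ k * b := by
  apply toPi_injective hπ
  rw [← rep_add ha, ← rep_add hb, add_comm]

/-- Two fractions for `x` satisfy `π^l a = π^k b`, and multiplication by a power of `π` just shifts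
the levels; so any fraction can be used. -/
theorem coeffGE_iff (hπ : π ≠ 0) {x : GamPi π lam} {k : ℕ} {a : Gam π lam}
    (ha : x * piLoc π lam ^ k = toPi π lam a) {z : L} {d : ℝ} :
    CoeffGE z d x ↔ ∀ n : ℕ, coeffHom (n + 1) z a ≠ 0 → d + k ≤ n := by
  refine ⟨?_, fun h => ⟨k, a, ha, h⟩⟩
  rintro ⟨l, b, hb, h⟩ n hn
  have h1 := rep_unique hπ ha hb
  have h2 : coeffHom (l + (n + 1)) z (piG π lam ^ l * a) ≠ 0 :=
    (coeffHom_piG_pow_mul_eq_zero hπ).not.2 hn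
  rw [h1] at h2
  have h3 : k ≤ l + n := by
    by_contra hcon
    exact h2 (coeffHom_eq_zero_of_le (by omega) (coeffHom_piG_pow_mul k z b))
  obtain ⟨j, hj⟩ := Nat.exists_eq_add_of_le h3
  rw [← add_assoc, hj, add_assoc, Ne, coeffHom_piG_pow_mul_eq_zero hπ] at h2
  have h4 := h j h2
  have h5 : (l : ℝ) + n = k + j := by exact_mod_cast hj
  linarith

theorem piGE_iff (hπ : π ≠ 0) {x : GamPi π lam} {k : ℕ} {a : Gam π lam}
    (ha : x * piLoc π lam ^ k = toPi π lam a) {s C : ℝ} :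
    PiGE s C x ↔ ∀ (n : ℕ) z, coeffHom (n + 1) z a ≠ 0 → C + k ≤ s * lam z + n := by
  refine ⟨fun h n z hn => ?_, fun h z => (coeffGE_iff hπ ha).2 fun n hn => ?_⟩
  · linarith [(coeffGE_iff hπ ha).1 (h z) n hn]
  · linarith [h n z hn]

theorem CoeffGE.anti {z : L} {d d' : ℝ} {x : GamPi π lam} (h : CoeffGE z d x) (hd : d' ≤ d) :
    CoeffGE z d' x := by
  obtain ⟨k, a, ha, h⟩ := h
  exact ⟨k, a, ha, fun n hn => by linarith [h n hn]⟩

theorem PiGE.anti {s C C' : ℝ} {x : GamPi π lam} (h : PiGE s C x) (hC : C' ≤ C) : PiGE s C' x :=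
  fun z => (h z).anti (by linarith)

theorem CoeffGE.zero (z : L) (d : ℝ) : CoeffGE z d (0 : GamPi π lam) :=
  ⟨0, 0, by simp, fun _ hn => absurd (map_zero _) hn⟩

theorem CoeffGE.neg {z : L} {d : ℝ} {x : GamPi π lam} (h : CoeffGE z d x) : CoeffGE z d (-x) := by
  obtain ⟨k, a, ha, h⟩ := h
  refine ⟨k, -a, by rw [neg_mul, ha, map_neg], fun n hn => h n fun h0 => hn ?_⟩
  rw [map_neg, h0, neg_zero]

theorem exists_common_rep (x y : GamPi π lam) : ∃ (k : ℕ) (a b : Gam π lam),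
    x * piLoc π lam ^ k = toPi π lam a ∧ y * piLoc π lam ^ k = toPi π lam b := by
  obtain ⟨k, a, ha⟩ := exists_rep x
  obtain ⟨l, b, hb⟩ := exists_rep y
  exact ⟨l + k, _, _, rep_add ha l, by rw [add_comm]; exact rep_add hb k⟩

theorem CoeffGE.add (hπ : π ≠ 0) {z : L} {d : ℝ} {x y : GamPi π lam} (hx : CoeffGE z d x)
    (hy : CoeffGE z d y) : CoeffGE z d (x + y) := by
  obtain ⟨k, a, b, ha, hb⟩ := exists_common_rep x y
  rw [coeffGE_iff hπ ha] at hx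
  rw [coeffGE_iff hπ hb] at hy
  refine ⟨k, a + b, by rw [add_mul, ha, hb, map_add], fun n hn => ?_⟩
  by_cases h : coeffHom (n + 1) z a = 0
  · refine hy n fun h' => hn ?_
    rw [map_add, h, h', add_zero]
  · exact hx n h

theorem PiGE.zero (s C : ℝ) : PiGE s C (0 : GamPi π lam) := fun z => CoeffGE.zero z _

theorem PiGE.neg {s C : ℝ} {x : GamPi π lam} (h : PiGE s C x) : PiGE s C (-x) :=
  fun z => (h z).neg

theorem PiGE.add (hπ : π ≠ 0) {s C : ℝ} {x y : GamPi π lam} (hx : PiGE s C x) (hy : PiGE s C y) :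
    PiGE s C (x + y) := fun z => (hx z).add hπ (hy z)

theorem PiGE.mul (hπ : π ≠ 0) {s C D : ℝ} {x y : GamPi π lam} (hx : PiGE s C x)
    (hy : PiGE s D y) : PiGE s (C + D) (x * y) := by
  obtain ⟨k, a, ha⟩ := exists_rep x
  obtain ⟨l, b, hb⟩ := exists_rep y
  rw [piGE_iff hπ ha] at hx
  rw [piGE_iff hπ hb] at hy
  refine (piGE_iff hπ (k := k + l) (a := a * b) ?_).2 fun n z hn => ?_
  · rw [map_mul, ← ha, ← hb]
    ring
  · obtain ⟨u, v, i, j, rfl, hij, hu, hv⟩ := exists_of_coeff_mul a b hn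
    have h1 := hx i u hu
    have h2 := hy j v hv
    have h3 : (i : ℝ) + j ≤ n := by exact_mod_cast hij
    push_cast
    rw [map_add]
    linarith

/-- Convexity of `w_s` in `s`. -/
theorem PiGE.of_endpoints (hπ : π ≠ 0) {s t r C : ℝ} {x : GamPi π lam} (ht : PiGE t C x)
    (hr : PiGE r C x) (hts : t ≤ s) (hsr : s ≤ r) : PiGE s C x := by
  obtain ⟨k, a, ha⟩ := exists_rep x
  rw [piGE_iff hπ ha] at *
  intro n z hn
  have h1 := ht n z hn
  have h2 := hr n z hn
  rcases le_total 0 (lam z) with h | h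
  · nlinarith
  · nlinarith

theorem PiGE.const (s : ℝ) (c : 𝔬) (hπ : π ≠ 0) :
    PiGE s 0 (algebraMap 𝔬 (GamPi π lam) c) := by
  refine (piGE_iff hπ (k := 0) (a := algebraMap 𝔬 _ c) ?_).2 fun n z hn => ?_
  · rw [pow_zero, mul_one, toPi_algebraMap]
  · rw [(coeff_algebraMap_ne_zero (lam := lam) hn).1]
    simp

theorem PiGE.piLoc_pow (hπ : π ≠ 0) (s : ℝ) (k : ℕ) : PiGE s k (piLoc π lam ^ k) := by
  refine (piGE_iff hπ (k := 0) (a := algebraMap 𝔬 _ (π ^ k)) ?_).2 fun n z hn => ?_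
  · rw [pow_zero, mul_one, map_pow, map_pow]
  · obtain ⟨rfl, h⟩ := coeff_algebraMap_ne_zero (lam := lam) hn
    have : k ≤ n := by
      by_contra hcon
      exact h (pow_dvd_pow π (by omega))
    have : (k : ℝ) ≤ n := by exact_mod_cast this
    simpa using this

theorem PiGE.of_mul_piLoc_pow_eq_one (hπ : π ≠ 0) (s : ℝ) {k : ℕ} {x : GamPi π lam}
    (h : x * piLoc π lam ^ k = 1) : PiGE s (-k) x := by
  refine (piGE_iff hπ (k := k) (a := 1) (by rw [h, map_one])).2 fun n z hn => ?_
  rw [← map_one (algebraMap 𝔬 (Gam π lam))] at hn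
  rw [(coeff_algebraMap_ne_zero (lam := lam) hn).1]
  simp

theorem gE_iff (hπ : π ≠ 0) {r s C : ℝ} (hs : 0 < s) {x : GamPi π lam} :
    GE r s C x ↔ MemR r x ∧ PiGE s C x := by
  constructor
  · rintro ⟨k, a, ha, hx, hw⟩
    exact ⟨⟨k, a, ha, hx⟩, (piGE_iff hπ hx).2 ((le_wN_iff hs _ _).1 hw)⟩
  · rintro ⟨⟨k, a, ha, hx⟩, hw⟩
    exact ⟨k, a, ha, hx, (le_wN_iff hs _ _).2 ((piGE_iff hπ hx).1 hw)⟩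

theorem memR_iff (hπ : π ≠ 0) {r : ℝ} (hr : 0 < r) {x : GamPi π lam} {k : ℕ} {a : Gam π lam}
    (ha : x * piLoc π lam ^ k = toPi π lam a) : MemR r x ↔ a ∈ GamN π lam r := by
  refine ⟨?_, fun h => ⟨k, a, h, ha⟩⟩
  rintro ⟨l, b, hb, hx⟩
  have h1 := rep_unique hπ ha hx
  have h2 : piG π lam ^ k * b ∈ GamN π lam r := GamN_mul hr (by
    rw [← map_pow]
    exact GamN_algebraMap hr _) hb
  rw [← h1, mem_GamN_iff hr] at h2
  rw [mem_GamN_iff hr]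
  intro C
  obtain ⟨N, hN⟩ := h2 (C + l)
  refine ⟨N, fun n hn z hz => ?_⟩
  have := hN (l + n) (by omega) z
    ((coeffHom_piG_pow_mul_eq_zero (k := l) (n := n + 1) hπ).not.2 hz)
  push_cast at this
  linarith

theorem MemR.neg {r : ℝ} (hr : 0 < r) {x : GamPi π lam} (h : MemR r x) : MemR r (-x) := by
  have := (MemR.algebraMap (π := π) (lam := lam) hr (-1)).mul hr h
  rwa [map_neg, map_one, neg_one_mul] at this

theorem MemR.sub {r : ℝ} (hr : 0 < r) {x y : GamPi π lam} (hx : MemR r x) (hy : MemR r y) :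
    MemR r (x - y) := by
  rw [sub_eq_add_neg]
  exact hx.add hr (hy.neg hr)

theorem MemR.of_mul_piLoc_pow_eq_one {r : ℝ} (hr : 0 < r) {k : ℕ} {x : GamPi π lam}
    (h : x * piLoc π lam ^ k = 1) : MemR r x :=
  ⟨k, 1, by
    simpa using GamN_algebraMap (π := π) (lam := lam) hr 1, by rw [h, map_one]⟩

/-- `Γ_r[1/π]` is closed in `Γ[1/π]` for `w_r`. -/
theorem MemR.of_approx (hπ : π ≠ 0) {r : ℝ} (hr : 0 < r) {x : GamPi π lam}
    (h : ∀ C, ∃ y, MemR r y ∧ PiGE r C (x - y)) : MemR r x := by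
  obtain ⟨k, a, ha⟩ := exists_rep x
  rw [memR_iff hπ hr ha, mem_GamN_iff hr]
  intro C
  obtain ⟨y, hy, hxy⟩ := h (C - k)
  obtain ⟨l, b, hb⟩ := exists_rep y
  have ha' := rep_add ha l
  have hb' := rep_add hb k
  rw [add_comm k l] at hb'
  rw [memR_iff hπ hr hb', mem_GamN_iff hr] at hy
  obtain ⟨N, hN⟩ := hy (C + l)
  refine ⟨N, fun n hn z hz => ?_⟩
  have hz' : coeffHom (l + n + 1) z (piG π lam ^ l * a) ≠ 0 :=
    (coeffHom_piG_pow_mul_eq_zero (k := l) (n := n + 1) hπ).not.2 hz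
  by_cases h0 : coeffHom (l + n + 1) z (piG π lam ^ k * b) = 0
  · have h1 : (x - y) * piLoc π lam ^ (l + k) =
        toPi π lam (piG π lam ^ l * a - piG π lam ^ k * b) := by
      rw [sub_mul, map_sub, ha', hb']
    have h2 := (piGE_iff hπ h1).1 hxy (l + n) z (by rwa [map_sub, h0, sub_zero])
    push_cast at h2
    linarith
  · have h2 := hN (l + n) (by omega) z h0
    push_cast at h2
    linarith

variable [IsDiscreteValuationRing 𝔬] [IsAdicComplete (IsLocalRing.maximalIdeal 𝔬) 𝔬]

/-- At `s = 0` the bound is `π`-adic: the coefficients of `π^k x` are integral. -/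
theorem exists_toPi_eq (hπ : Irreducible π) (hlam : StrictMono lam) {k : ℕ} {x : GamPi π lam}
    (h : PiGE 0 (-k) x) : ∃ a, x * piLoc π lam ^ k = toPi π lam a := by
  obtain ⟨l, b, hb⟩ := exists_rep x
  have hb' := rep_add hb k
  rw [piGE_iff hπ.ne_zero hb] at h
  have h1 : piG π lam ^ l ∣ piG π lam ^ k * b := by
    rw [piG_pow_dvd_iff hπ hlam]
    intro z
    by_contra h0
    rcases le_total l k with hlk | hkl
    · exact h0 (coeffHom_eq_zero_of_le hlk (coeffHom_piG_pow_mul k z b))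
    · obtain ⟨j, rfl⟩ := Nat.exists_eq_add_of_le hkl
      rcases j with _ | j
      · exact h0 (coeffHom_piG_pow_mul k z b)
      · have h2 := h j z ((coeffHom_piG_pow_mul_eq_zero hπ.ne_zero).not.1 h0)
        push_cast at h2
        linarith
  obtain ⟨a, ha⟩ := h1
  refine ⟨a, (isUnit_piLoc.pow l).mul_left_injective ?_⟩
  change x * _ * _ = _ * _
  rw [mul_assoc, ← pow_add, hb', ha, map_mul, map_pow, mul_comm]

theorem eq_zero_of_piGE (hπ : Irreducible π) {s : ℝ} {x : GamPi π lam} (h : ∀ C, PiGE s C x) :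
    x = 0 := by
  obtain ⟨k, a, ha⟩ := exists_rep x
  have h0 : a = 0 := Gam.ext_coeff fun n z => by
    rw [map_zero]
    by_contra hn
    rcases n with _ | n
    · exact hn (coeffHom_eq_zero_of_dvd (by simp))
    · have := (piGE_iff hπ.ne_zero ha).1 (h (s * lam z + n - k + 1)) n z hn
      linarith
  rw [h0, map_zero] at ha
  exact (isUnit_piLoc.pow k).mul_left_injective (by simpa using ha)

/-- `Γ` is `π`-adically complete. -/
theorem exists_limit_gam (hπ : Irreducible π) (hlam : StrictMono lam) (f : ℕ → Gam π lam)
    (hf : ∀ n, piG π lam ^ n ∣ f (n + 1) - f n) : ∃ y, ∀ n, piG π lam ^ n ∣ f n - y := by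
  choose c hc using fun n => exists_coeffs hπ (f n)
  have h1 : ∀ z, ∃ d, ∀ n, π ^ n ∣ c n z - d := fun z =>
    exists_limit hπ (fun n => c n z) fun n => by
      rw [← mk_span_pow_eq_zero, map_sub, ← hc, ← hc, ← map_sub]
      exact coeffHom_eq_zero_of_dvd (hf n)
  choose d hd using h1
  have h2 : ∀ n z, coeffHom n z (f n) = Ideal.Quotient.mk _ (d z) := fun n z => by
    rw [hc, ← sub_eq_zero, ← map_sub, mk_span_pow_eq_zero]
    exact hd z n
  obtain ⟨y, hy⟩ := exists_of_coeffs (π := π) hlam d fun n b => by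
    refine (finite_coeffs (hc n) n b).subset ?_
    rintro z ⟨hz, hb⟩
    refine ⟨fun h' => hz ?_, hb⟩
    rw [← mk_span_pow_eq_zero, ← h2, hc, mk_span_pow_eq_zero]
    exact h'
  refine ⟨y, fun n => (piG_pow_dvd_iff hπ hlam).2 fun z => ?_⟩
  rw [map_sub, h2, hy, sub_self]

end CoefficientsPi

/-! ### Valuations of natural numbers -/

section NatValuation

variable {𝔬 : Type*} [CommRing 𝔬] [IsDomain 𝔬] [IsDiscreteValuationRing 𝔬] [CharZero 𝔬]

/-- The valuation of the natural numbers in a discrete valuation ring of mixed characteristic. -/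
theorem exists_natCast_eq {p : ℕ} [Fact p.Prime] [CharP (IsLocalRing.ResidueField 𝔬) p] {π : 𝔬}
    (hπ : Irreducible π) :
    ∃ e : ℕ, ∀ k : ℕ, k ≠ 0 → ∃ u : 𝔬ˣ, (k : 𝔬) = u * π ^ (e * padicValNat p k) := by
  have hp : p.Prime := Fact.out
  obtain ⟨e, v, hv⟩ := IsDiscreteValuationRing.eq_unit_mul_pow_irreducible
    (Nat.cast_ne_zero.2 hp.ne_zero : (p : 𝔬) ≠ 0) hπ
  refine ⟨e, fun k hk => ?_⟩
  have h1 : IsUnit ((k / p ^ k.factorization p : ℕ) : 𝔬) := by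
    rw [← IsLocalRing.residue_ne_zero_iff_isUnit, map_natCast, Ne, CharP.cast_eq_zero_iff _ p]
    exact Nat.not_dvd_ordCompl hp hk
  obtain ⟨w, hw⟩ := h1
  refine ⟨v ^ padicValNat p k * w, ?_⟩
  have h2 := congrArg (Nat.cast : ℕ → 𝔬) (Nat.ordProj_mul_ordCompl_eq_self k p)
  rw [Nat.cast_mul, Nat.cast_pow, hv, ← hw, Nat.factorization_def k hp] at h2
  rw [← h2, mul_pow, ← pow_mul]
  push_cast
  ring

end NatValuation

/-! ### The derivations on `Γ[1/π]` -/

section DerivationPi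

variable {𝔬 : Type*} [CommRing 𝔬] {L : Type*} [AddCommGroup L] [LinearOrder L]
  [IsOrderedAddMonoid L] {π : 𝔬} {lam : L →+ ℝ}

theorem coeffHom_partialMu (mu : L →+ ℤ) (n : ℕ) (z : L) (x : Gam π lam) :
    coeffHom n z (partialMu mu x) = (mu z : 𝔬 ⧸ Ideal.span {π ^ n}) * coeffHom n z x := rfl

theorem partialMu_mul (mu : L →+ ℤ) (x y : Gam π lam) :
    partialMu mu (x * y) = x * partialMu mu y + y * partialMu mu x := by
  refine Gam.ext_coeff fun n z => ?_
  rw [map_add, mul_comm y, coeffHom_partialMu]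
  have hx : ((partialMu mu x).1 n).support ⊆ (x.1 n).support := fun z hz => right_ne_zero_of_mul hz
  have hy : ((partialMu mu y).1 n).support ⊆ (y.1 n).support := fun z hz => right_ne_zero_of_mul hz
  change _ * (x.1 n * y.1 n).coeff z = (x.1 n * (partialMu mu y).1 n).coeff z +
    ((partialMu mu x).1 n * y.1 n).coeff z
  rw [HahnSeries.coeff_mul, HahnSeries.coeff_mul_right' (y.1 n).isPWO_support hy,
    HahnSeries.coeff_mul_left' (x.1 n).isPWO_support hx, ← Finset.sum_add_distrib, Finset.mul_sum]
  refine Finset.sum_congr rfl fun ij hij => ?_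
  have h : ij.1 + ij.2 = z := by simpa using (Finset.mem_antidiagonal.1 hij).2.2
  change _ = (x.1 n).coeff ij.1 * ((mu ij.2 : 𝔬 ⧸ Ideal.span {π ^ n}) * (y.1 n).coeff ij.2) +
    ((mu ij.1 : 𝔬 ⧸ Ideal.span {π ^ n}) * (x.1 n).coeff ij.1) * (y.1 n).coeff ij.2
  rw [← h, map_add]
  push_cast
  ring

theorem partialMu_add (mu : L →+ ℤ) (x y : Gam π lam) :
    partialMu mu (x + y) = partialMu mu x + partialMu mu y :=
  Gam.ext_coeff fun n z => by simp only [coeffHom_partialMu, map_add, mul_add]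

theorem partialMu_algebraMap_mul (mu : L →+ ℤ) (c : 𝔬) (x : Gam π lam) :
    partialMu mu (algebraMap 𝔬 _ c * x) = algebraMap 𝔬 _ c * partialMu mu x :=
  Gam.ext_coeff fun n z => by
    simp only [coeffHom_partialMu, coeffHom_algebraMap_mul]
    ring

theorem partialMu_mono (mu : L →+ ℤ) (z : L) :
    partialMu mu (mono π lam z) = algebraMap 𝔬 _ (mu z : 𝔬) * mono π lam z :=
  Gam.ext_coeff fun n y => by
    rw [coeffHom_partialMu, coeffHom_algebraMap_mul, coeffHom_mono, map_intCast]
    split_ifs with h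
    · rw [h]
    · rw [mul_zero, mul_zero]

variable [IsDomain 𝔬]

theorem CoeffGE.of_mul (hπ : π ≠ 0) {x y : GamPi π lam} {k v : ℕ} {a b : Gam π lam} {z : L}
    {d : ℝ} {w : 𝔬} (ha : x * piLoc π lam ^ k = toPi π lam a)
    (hb : y * piLoc π lam ^ k = toPi π lam b)
    (h : ∀ n, coeffHom n z b = Ideal.Quotient.mk _ (π ^ v * w) * coeffHom n z a)
    (hx : CoeffGE z d x) : CoeffGE z (d + v) y := by
  rw [coeffGE_iff hπ ha] at hx
  refine (coeffGE_iff hπ hb).2 fun n hn => ?_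
  obtain ⟨A, hA⟩ := Ideal.Quotient.mk_surjective (coeffHom (n + 1) z a)
  rw [h, ← hA, ← map_mul, Ne, mk_span_pow_eq_zero] at hn
  have hv : v ≤ n := by
    by_contra hcon
    exact hn (((pow_dvd_pow π (by omega)).mul_right w).mul_right A)
  obtain ⟨j, rfl⟩ := Nat.exists_eq_add_of_le hv
  have h1 := hx j (by
    rw [coeffHom_apply, coeff_of_le a z A (show j + 1 ≤ v + j + 1 by omega) hA.symm, Ne,
      mk_span_pow_eq_zero]
    intro h2
    refine hn ?_
    rw [add_assoc, pow_add, mul_assoc]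
    exact mul_dvd_mul_left _ (h2.mul_left w))
  push_cast
  linarith

theorem PiGE.of_mul (hπ : π ≠ 0) {x y : GamPi π lam} {k : ℕ} {a b : Gam π lam} {s C : ℝ}
    (ha : x * piLoc π lam ^ k = toPi π lam a) (hb : y * piLoc π lam ^ k = toPi π lam b)
    {w : L → 𝔬} (h : ∀ n z, coeffHom n z b = Ideal.Quotient.mk _ (w z) * coeffHom n z a)
    {v : ℕ} (hv : ∀ z, π ^ v ∣ w z) (hx : PiGE s C x) : PiGE s (C + v) y := by
  intro z
  obtain ⟨w', hw'⟩ := hv z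
  refine ((hx z).of_mul hπ ha hb (v := v) (w := w') fun n => ?_).anti (by linarith)
  rw [h, hw']

theorem MemR.of_mul (hπ : π ≠ 0) {x y : GamPi π lam} {k : ℕ} {a b : Gam π lam} {r : ℝ}
    (hr : 0 < r)
    (ha : x * piLoc π lam ^ k = toPi π lam a) (hb : y * piLoc π lam ^ k = toPi π lam b)
    {w : L → 𝔬} (h : ∀ n z, coeffHom n z b = Ideal.Quotient.mk _ (w z) * coeffHom n z a)
    (hx : MemR r x) : MemR r y := by
  rw [memR_iff hπ hr ha, mem_GamN_iff hr] at hx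
  rw [memR_iff hπ hr hb, mem_GamN_iff hr]
  intro C
  obtain ⟨N, hN⟩ := hx C
  refine ⟨N, fun n hn z hz => hN n hn z fun h0 => hz ?_⟩
  change coeffHom (n + 1) z b = 0
  rw [h, coeffHom_apply, h0, mul_zero]

/-- The extension of `∂_μ` to `Γ[1/π]`. -/
theorem exists_derivationPi (hπ : π ≠ 0) (mu : L →+ ℤ) :
    ∃ T : Derivation 𝔬 (GamPi π lam) (GamPi π lam), ∀ x k a, x * piLoc π lam ^ k = toPi π lam a →
      T x * piLoc π lam ^ k = toPi π lam (partialMu mu a) := by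
  have h1 : ∀ x : GamPi π lam, ∃ y : GamPi π lam, ∀ k a, x * piLoc π lam ^ k = toPi π lam a →
      y * piLoc π lam ^ k = toPi π lam (partialMu mu a) := by
    intro x
    obtain ⟨k, a, ha⟩ := exists_rep x
    obtain ⟨y, hy⟩ := exists_eq_div k (partialMu mu a)
    refine ⟨y, fun l b hb => (isUnit_piLoc.pow k).mul_left_injective ?_⟩
    have h2 := congrArg (fun t => toPi π lam (partialMu mu t)) (rep_unique hπ ha hb)
    simp only [← map_pow (algebraMap 𝔬 (Gam π lam)), partialMu_algebraMap_mul] at h2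
    rw [map_pow, map_pow, map_mul, map_mul, map_pow, map_pow, ← hy] at h2
    change y * _ * _ = _ * _
    rw [mul_comm (toPi π lam (partialMu mu b)), ← h2]
    ring
  choose T hT using h1
  have hu : ∀ {x y : GamPi π lam} {k : ℕ}, x * piLoc π lam ^ k = y * piLoc π lam ^ k → x = y :=
    fun {x y k} h => (isUnit_piLoc.pow k).mul_left_injective h
  refine ⟨Derivation.mk'
    { toFun := T, map_add' := fun x y => ?_, map_smul' := fun c x => ?_ } fun x y => ?_, hT⟩
  · obtain ⟨k, a, b, ha, hb⟩ := exists_common_rep x y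
    refine hu (k := k) ?_
    rw [hT (x + y) k (a + b) (by rw [add_mul, ha, hb, map_add]), add_mul, hT x k a ha, hT y k b hb,
      partialMu_add, map_add]
  · obtain ⟨k, a, ha⟩ := exists_rep x
    refine hu (k := k) ?_
    rw [hT (c • x) k (algebraMap 𝔬 _ c * a) (by
      rw [Algebra.smul_def, mul_assoc, ha, map_mul, toPi_algebraMap]), partialMu_algebraMap_mul,
      map_mul, ← hT x k a ha, toPi_algebraMap, RingHom.id_apply, Algebra.smul_def, mul_assoc]
  · obtain ⟨k, a, ha⟩ := exists_rep x
    obtain ⟨l, b, hb⟩ := exists_rep y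
    refine hu (k := k + l) ?_
    change T (x * y) * _ = (x * T y + y * T x) * _
    rw [hT (x * y) (k + l) (a * b) (by rw [map_mul, ← ha, ← hb]; ring), partialMu_mul, map_add,
      map_mul, map_mul, ← hT x k a ha, ← hT y l b hb, ← ha, ← hb]
    ring

variable {mu : L →+ ℤ} {T : Derivation 𝔬 (GamPi π lam) (GamPi π lam)}

/-- The operator is diagonal: `∂_μ` multiplies the coefficient of `{z}` by `μ(z)`, so the product of
the `∂_μ - (t + l)` multiplies it by an integer. -/
theorem fallProd_rep (hT : ∀ x k a, x * piLoc π lam ^ k = toPi π lam a →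
      T x * piLoc π lam ^ k = toPi π lam (partialMu mu a)) (t P : ℕ) {x : GamPi π lam} {k : ℕ}
    {a : Gam π lam} (ha : x * piLoc π lam ^ k = toPi π lam a) :
    ∃ b, fallProd (derEnd T) t P x * piLoc π lam ^ k = toPi π lam b ∧
      ∀ n z, coeffHom n z b = Ideal.Quotient.mk _
        ((∏ l ∈ Finset.range P, (mu z - (t + l : ℕ)) : ℤ) : 𝔬) * coeffHom n z a := by
  induction P generalizing x a with
  | zero => exact ⟨a, ha, fun n z => by simp⟩
  | succ P ih =>
    obtain ⟨b, hb, h⟩ := ih (x := T x - ((t + P : ℕ) : GamPi π lam) * x)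
      (a := partialMu mu a - algebraMap 𝔬 _ ((t + P : ℕ) : 𝔬) * a) (by
        rw [sub_mul, hT x k a ha, mul_assoc, ha, map_sub, map_mul, toPi_algebraMap, map_natCast])
    refine ⟨b, ?_, fun n z => ?_⟩
    · rw [← hb, fallProd_succ]
      change fallProd (derEnd T) t P (T x - ((t + P : ℕ) : AddMonoid.End (GamPi π lam)) x) * _ = _
      rw [← nsmul_eq_mul, AddMonoid.End.natCast_apply]
    · rw [h, map_sub, coeffHom_partialMu, coeffHom_algebraMap_mul, Finset.prod_range_succ,
        Int.cast_mul, map_mul, mul_assoc]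
      congr 1
      rw [Int.cast_sub, map_sub, sub_mul, map_intCast, Int.cast_natCast]

/-- Read backwards, it is the ascending product of `P` consecutive integers starting at `M - t - P +
1`. -/
theorem factorial_dvd_prod_sub (M : ℤ) (t P : ℕ) :
    (P.factorial : ℤ) ∣ ∏ l ∈ Finset.range P, (M - (t + l : ℕ)) := by
  rw [← Finset.prod_range_reflect]
  convert Nat.factorial_coe_dvd_prod P (M - t - P + 1) using 1
  refine Finset.prod_congr rfl fun l hl => ?_
  have := Finset.mem_range.1 hl
  have h : ((P - 1 - l : ℕ) : ℤ) = P - 1 - l := by omega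
  push_cast
  rw [h]
  ring

theorem PiGE.fallProd (hπ : π ≠ 0) (hT : ∀ x k a, x * piLoc π lam ^ k = toPi π lam a →
      T x * piLoc π lam ^ k = toPi π lam (partialMu mu a)) {s C : ℝ} {x : GamPi π lam} {p e : ℕ}
    (he : ∀ k : ℕ, k ≠ 0 → ∃ u : 𝔬ˣ, (k : 𝔬) = u * π ^ (e * padicValNat p k)) (t P : ℕ)
    (hx : PiGE s C x) :
    PiGE s (C + e * padicValNat p P.factorial) (fallProd (derEnd T) t P x) := by
  obtain ⟨k, a, ha⟩ := exists_rep x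
  obtain ⟨b, hb, h⟩ := fallProd_rep hT t P ha
  have := hx.of_mul hπ ha hb h (v := e * padicValNat p P.factorial) fun z => by
    obtain ⟨w, hw⟩ := factorial_dvd_prod_sub (mu z) t P
    obtain ⟨u, hu⟩ := he _ P.factorial_ne_zero
    rw [hw, Int.cast_mul, Int.cast_natCast, hu]
    exact (Dvd.intro_left _ rfl).mul_right _
  push_cast at this
  exact this

theorem MemR.deriv (hπ : π ≠ 0) (hT : ∀ x k a, x * piLoc π lam ^ k = toPi π lam a →
      T x * piLoc π lam ^ k = toPi π lam (partialMu mu a)) {r : ℝ} (hr : 0 < r) {x : GamPi π lam}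
    (hx : MemR r x) : MemR r (T x) := by
  obtain ⟨k, a, ha⟩ := exists_rep x
  exact hx.of_mul hπ hr ha (hT x k a ha) (w := fun z => (mu z : 𝔬)) fun n z => by
    rw [map_intCast, coeffHom_partialMu]

theorem PiGE.deriv (hπ : π ≠ 0) (hT : ∀ x k a, x * piLoc π lam ^ k = toPi π lam a →
      T x * piLoc π lam ^ k = toPi π lam (partialMu mu a)) {s C : ℝ} {x : GamPi π lam}
    (hx : PiGE s C x) : PiGE s C (T x) := by
  obtain ⟨k, a, ha⟩ := exists_rep x
  simpa using hx.of_mul hπ ha (hT x k a ha) (w := fun z => (mu z : 𝔬)) (v := 0) (fun n z => by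
    rw [map_intCast, coeffHom_partialMu]) (by simp)

end DerivationPi

/-! ### Frobenius lifts on `Γ[1/π]` -/

section FrobeniusPi

variable {𝔬 : Type*} [CommRing 𝔬] {L : Type*} [AddCommGroup L] [LinearOrder L]
  [IsOrderedAddMonoid L] {π : 𝔬} {lam : L →+ ℝ} {q : ℕ} {σK : 𝔬 →+* 𝔬}
  {σ : Gam π lam →+* Gam π lam}

/-- The extension of a Frobenius lift to `Γ[1/π]`. -/
theorem exists_frobeniusPi (hσ : IsFrobeniusLift q σK σ) (hσπ : ∃ u : 𝔬ˣ, σK π = u * π) :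
    ∃ φ : GamPi π lam →+* GamPi π lam, ∀ a, φ (toPi π lam a) = toPi π lam (σ a) := by
  have h : IsUnit (((toPi π lam).comp σ) (piG π lam)) := by
    obtain ⟨u, hu⟩ := hσπ
    rw [RingHom.comp_apply, hσ.extends_base, hu, map_mul, map_mul]
    exact ((u.isUnit.map _).map _).mul isUnit_piLoc
  exact ⟨IsLocalization.Away.lift (piG π lam) h, fun a => IsLocalization.Away.lift_eq _ h a⟩

variable {φ : GamPi π lam →+* GamPi π lam}

theorem frobeniusPi_rep (hσ : IsFrobeniusLift q σK σ) (hσπ : ∃ u : 𝔬ˣ, σK π = u * π)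
    (hφ : ∀ a, φ (toPi π lam a) = toPi π lam (σ a)) {x : GamPi π lam} {k : ℕ} {a : Gam π lam}
    (ha : x * piLoc π lam ^ k = toPi π lam a) :
    ∃ c : 𝔬, φ x * piLoc π lam ^ k = toPi π lam (algebraMap 𝔬 _ c * σ a) := by
  obtain ⟨u, hu⟩ := hσπ
  refine ⟨↑(u⁻¹ ^ k), ?_⟩
  rw [map_mul, ← hφ a, ← ha, map_mul, map_pow, hφ, hσ.extends_base, hu, map_mul, map_mul, mul_pow,
    toPi_algebraMap, toPi_algebraMap, ← map_pow (algebraMap 𝔬 (GamPi π lam))]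
  rw [show ∀ A B X Y : GamPi π lam, A * (X * (B * Y)) = A * B * (X * Y) by intros; ring,
    ← map_mul, ← Units.val_pow_eq_pow_val, ← Units.val_mul, ← mul_pow, inv_mul_cancel, one_pow,
    Units.val_one, map_one, one_mul]

variable {ρ : ℝ}

theorem SlopeBound.map_GamN (hs : SlopeBound q σ ρ) (hq : 0 < q) (hρ : 0 ≤ ρ) {r : ℝ} (hr : 0 < r)
    (hrρ : ρ * r < 1) {a : Gam π lam} (ha : a ∈ GamN π lam r) : σ a ∈ GamN π lam (r / q) := by
  have hq' : (0 : ℝ) < q := by exact_mod_cast hq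
  rw [mem_GamN_iff hr] at ha
  rw [mem_GamN_iff (div_pos hr hq')]
  intro C
  obtain ⟨N, hN⟩ := ha C
  obtain ⟨B, hB⟩ := VGe.exists_bound a N
  obtain ⟨M, hM⟩ := exists_eventually_eq_min hr hrρ B C
  refine ⟨M, fun n hn z hz => ?_⟩
  -- As in the comparison of radii, the line that is only known beyond level `N` is completed by a
  -- line of slope `-ρ` to a steep sequence valid at all levels.
  have h1 := hs _ ((Steep.linear ρ B).min (Steep.div hr hrρ.le C)) n a (fun i _ => by
    by_cases hi : i ≤ N
    · refine (hB.anti hi).le ((min_le_left _ _).trans ?_)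
      have : 0 ≤ ρ * i := by positivity
      linarith
    · refine VGe.le (c := (C - i) / r) (fun z hz => ?_) (min_le_right _ _)
      rw [div_le_iff₀ hr]
      linarith [hN i (by omega) z hz]) n le_rfl z hz
  rw [min_eq_right (hM n hn), mul_div_assoc', div_le_iff₀ hr] at h1
  rw [div_mul_eq_mul_div, ← sub_le_iff_le_add, le_div_iff₀ hq']
  linarith

variable [IsDomain 𝔬]

theorem MemR.map_frobenius (hσ : IsFrobeniusLift q σK σ) (hσπ : ∃ u : 𝔬ˣ, σK π = u * π)
    (hφ : ∀ a, φ (toPi π lam a) = toPi π lam (σ a)) (hs : SlopeBound q σ ρ) (hq : 0 < q)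
    (hρ : 0 ≤ ρ) {r : ℝ} (hr : 0 < r) (hrρ : ρ * r < 1) {x : GamPi π lam} (hx : MemR r x) :
    MemR (r / q) (φ x) := by
  obtain ⟨k, a, ha, hx⟩ := hx
  obtain ⟨c, hc⟩ := frobeniusPi_rep hσ hσπ hφ hx
  have hq' : (0 : ℝ) < q := by exact_mod_cast hq
  exact ⟨k, _, GamN_mul (div_pos hr hq') (GamN_algebraMap (div_pos hr hq') c)
    (hs.map_GamN hq hρ hr hrρ ha), hc⟩

variable [IsDiscreteValuationRing 𝔬] [IsAdicComplete (IsLocalRing.maximalIdeal 𝔬) 𝔬]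

theorem PiGE.map_frobenius (hσ : IsFrobeniusLift q σK σ) (hσπ : ∃ u : 𝔬ˣ, σK π = u * π)
    (hπ : Irreducible π) (hlam : StrictMono lam)
    (hφ : ∀ a, φ (toPi π lam a) = toPi π lam (σ a)) (hs : SlopeBound q σ ρ) (hq : 0 < q)
    {s C : ℝ} (hs0 : 0 ≤ s) (hsρ : ρ * s ≤ 1) {x : GamPi π lam} (hx : PiGE s C x) :
    PiGE (s / q) C (φ x) := by
  have hq' : (0 : ℝ) < q := by exact_mod_cast hq
  obtain ⟨k, a, ha⟩ := exists_rep x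
  obtain ⟨c, hc⟩ := frobeniusPi_rep hσ hσπ hφ ha
  rw [piGE_iff hπ.ne_zero ha] at hx
  refine (piGE_iff hπ.ne_zero hc).2 fun n z hz => ?_
  rw [coeffHom_algebraMap_mul] at hz
  replace hz := right_ne_zero_of_mul hz
  -- At `s = 0` there is no line of slope `-1/s`; the claim is that `σ` preserves divisibility by
  -- powers of `π`.
  rcases hs0.eq_or_lt with rfl | hs0
  · rw [zero_div, zero_mul, zero_add]
    by_contra hcon
    refine hz (coeffHom_eq_zero_of_dvd ?_)
    rw [← pow_one σ]
    refine hσ.piG_pow_dvd hσπ 1 ((piG_pow_dvd_iff hπ hlam).2 fun y => ?_)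
    by_contra h0
    have := hx n y h0
    rw [zero_mul, zero_add] at this
    exact hcon this
  · have h1 := hs _ (Steep.div hs0 hsρ (C + k)) n a (fun i _ y hy => by
      rw [div_le_iff₀ hs0]
      linarith [hx i y hy]) n le_rfl z hz
    rw [mul_div_assoc', div_le_iff₀ hs0] at h1
    rw [div_mul_eq_mul_div, ← sub_le_iff_le_add, le_div_iff₀ hq']
    linarith

end FrobeniusPi

/-! ### Small elements and truncations -/

section ElementsPi

variable {𝔬 : Type*} [CommRing 𝔬] {L : Type*} [AddCommGroup L] [LinearOrder L]
  [IsOrderedAddMonoid L] {π : 𝔬} {lam : L →+ ℝ}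

theorem memR_toPi {r : ℝ} {a : Gam π lam} (ha : a ∈ GamN π lam r) : MemR r (toPi π lam a) :=
  ⟨0, a, ha, by rw [pow_zero, mul_one]⟩

variable [IsDomain 𝔬]

/-- The overconvergent elements divisible by `π` are small for all `w_s` with `s` small. -/
theorem exists_piGE_half (hπ : π ≠ 0) {r : ℝ} (hr : 0 < r) {a : Gam π lam} (ha : a ∈ GamN π lam r)
    (hd : piG π lam ∣ a) :
    ∃ t, 0 < t ∧ t ≤ r ∧ ∀ s, 0 ≤ s → s ≤ t → PiGE s (1 / 2) (toPi π lam a) := by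
  obtain ⟨B, hB⟩ := exists_le_wN hr ha
  rw [le_wN_iff hr] at hB
  obtain ⟨D, hD0, hDB⟩ : ∃ D : ℝ, 0 ≤ D ∧ -D ≤ B := ⟨|B|, abs_nonneg B, neg_abs_le B⟩
  have hD : 0 < 2 * (1 + D) := by linarith
  -- Interpolation between `w_0 ≥ 1` and `w_r ≥ -D` gives `w_s ≥ 1 - (s/r)(1 + D)`, which is at
  -- least `1/2` for `s` up to this radius.
  refine ⟨r / (2 * (1 + D)), div_pos hr hD, div_le_self hr.le (by linarith), fun s hs0 hs => ?_⟩
  rw [le_div_iff₀ hD] at hs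
  refine (piGE_iff hπ (k := 0) (by rw [pow_zero, mul_one])).2 fun n z hz => ?_
  have hn : 1 ≤ n := by
    by_contra hcon
    obtain rfl : n = 0 := by omega
    exact hz (coeffHom_eq_zero_of_dvd (by rwa [zero_add, pow_one]))
  have hn' : (1 : ℝ) ≤ n := by exact_mod_cast hn
  have h1 := hB n z hz
  have h2 : 0 ≤ s * (r * lam z + n + D) := mul_nonneg hs0 (by linarith)
  have h3 : 0 ≤ (r - s) * (n - 1) := by
    refine mul_nonneg ?_ (by linarith)
    nlinarith [mul_nonneg hs0 hD0]
  have h4 : r * (1 / 2) ≤ r * (s * lam z + n) := by linarith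
  simpa using le_of_mul_le_mul_left h4 hr

theorem PiGE.natCast (hπ : π ≠ 0) {p e : ℕ}
    (he : ∀ k : ℕ, k ≠ 0 → ∃ u : 𝔬ˣ, (k : 𝔬) = u * π ^ (e * padicValNat p k)) {k : ℕ}
    (hk : k ≠ 0) (s : ℝ) : PiGE s (e * padicValNat p k) (k : GamPi π lam) := by
  obtain ⟨u, hu⟩ := he k hk
  have := (PiGE.const (lam := lam) s (u : 𝔬) hπ).mul hπ (PiGE.piLoc_pow hπ s (e * padicValNat p k))
  rw [← algebraMap_piLoc, ← map_pow, ← map_mul, ← hu, map_natCast] at this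
  simpa using this

theorem exists_natCast_inv (hπ : π ≠ 0) {p e : ℕ}
    (he : ∀ k : ℕ, k ≠ 0 → ∃ u : 𝔬ˣ, (k : 𝔬) = u * π ^ (e * padicValNat p k)) {k : ℕ}
    (hk : k ≠ 0) : ∃ x : GamPi π lam, x * k = 1 ∧ (∀ s, PiGE s (-(e * padicValNat p k)) x) ∧
      ∀ r, 0 < r → MemR r x := by
  obtain ⟨u, hu⟩ := he k hk
  obtain ⟨y, hy⟩ := exists_eq_div (π := π) (lam := lam) (e * padicValNat p k) 1
  rw [map_one] at hy
  refine ⟨algebraMap 𝔬 _ ↑u⁻¹ * y, ?_, fun s => ?_, fun r hr => ?_⟩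
  · rw [← map_natCast (algebraMap 𝔬 (GamPi π lam)), hu, map_mul, map_pow, algebraMap_piLoc,
      show ∀ A B X Y : GamPi π lam, A * X * (B * Y) = A * B * (X * Y) by intros; ring, hy, mul_one,
      ← map_mul, Units.inv_mul, map_one]
  · have := (PiGE.const (lam := lam) s (↑u⁻¹ : 𝔬) hπ).mul hπ
      (PiGE.of_mul_piLoc_pow_eq_one hπ s hy)
    simpa using this
  · exact (MemR.algebraMap hr _).mul hr (MemR.of_mul_piLoc_pow_eq_one hr hy)

theorem mono_mem_GamN {r : ℝ} (hr : 0 < r) (z : L) : mono π lam z ∈ GamN π lam r := by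
  rw [mem_GamN_iff hr]
  intro C
  obtain ⟨N, hN⟩ := exists_nat_ge (C - r * lam z)
  refine ⟨N, fun n hn y h => ?_⟩
  have h1 := VGe.mono_self z n y h
  have : (N : ℝ) ≤ n := by exact_mod_cast hn
  have := mul_le_mul_of_nonneg_left h1 hr.le
  linarith

variable [IsDiscreteValuationRing 𝔬] [IsAdicComplete (IsLocalRing.maximalIdeal 𝔬) 𝔬]

/-- The finite sums of monomials are dense in `Γ_r[1/π]` for each `w_s`. -/
theorem exists_truncation (hπ : Irreducible π) {r s : ℝ} (hs : 0 < s)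
    (hsr : s ≤ r) {x : GamPi π lam} (hx : MemR r x) (C : ℝ) :
    ∃ (k : ℕ) (A : Finset L) (c : L → 𝔬) (y : GamPi π lam),
      y * piLoc π lam ^ k = toPi π lam (∑ z ∈ A, algebraMap 𝔬 _ (c z) * mono π lam z) ∧
      PiGE s C (x - y) := by
  classical
  obtain ⟨k, a, ha, hx⟩ := hx
  replace ha := GamN_mono (hs.trans_le hsr) hs hsr ha
  rw [mem_GamN_iff hs] at ha
  obtain ⟨N, hN⟩ := ha (C + k)
  obtain ⟨c, hc⟩ := exists_coeffs hπ a
  -- Beyond level `N` overconvergence suffices; at the lower levels, terms with `λ(z) > (C + k)/s`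
  -- are small whatever their coefficients. Only finitely many terms are left.
  have hfin := finite_coeffs hc N ((C + k) / s)
  obtain ⟨y, hy⟩ := exists_eq_div k (∑ z ∈ hfin.toFinset, algebraMap 𝔬 _ (c z) * mono π lam z)
  refine ⟨k, hfin.toFinset, c, y, hy, ?_⟩
  refine (piGE_iff hπ.ne_zero (k := k) (by rw [sub_mul, hx, hy, ← map_sub])).2 fun n z hz => ?_
  rw [map_sub, map_sum] at hz
  simp only [coeffHom_algebraMap_mul, coeffHom_mono, mul_ite, mul_one, mul_zero] at hz
  rw [Finset.sum_ite_eq] at hz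
  simp only [Set.Finite.mem_toFinset, Set.mem_ofPred_eq] at hz
  split_ifs at hz with h
  · rw [hc, sub_self] at hz
    exact absurd rfl hz
  · rw [sub_zero] at hz
    by_cases hn : N ≤ n
    · exact hN n hn z hz
    · rw [hc, Ne, mk_span_pow_eq_zero] at hz
      have h1 := not_and.1 h fun h2 => hz ((pow_dvd_pow π (by omega)).trans h2)
      rw [not_le, div_lt_iff₀ hs] at h1
      have : (0 : ℝ) ≤ n := n.cast_nonneg
      linarith

end ElementsPi

/-! ### The structure of a `ℚ`-algebra -/

section Rational

variable {𝔬 : Type*} [CommRing 𝔬] {π : 𝔬} {p e : ℕ} {S : Type*} [CommRing S] [Algebra 𝔬 S]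

/-- A ring in which `π` is invertible contains the rational numbers. -/
theorem exists_algebra_rat (hS : IsUnit (algebraMap 𝔬 S π))
    (he : ∀ k : ℕ, k ≠ 0 → ∃ u : 𝔬ˣ, (k : 𝔬) = u * π ^ (e * padicValNat p k)) :
    Nonempty (Algebra ℚ S) := by
  have h1 : ∀ k : ℕ, k ≠ 0 → IsUnit (k : S) := fun k hk => by
    obtain ⟨u, hu⟩ := he k hk
    rw [← map_natCast (algebraMap 𝔬 S), hu, map_mul, map_pow]
    exact (u.isUnit.map _).mul (hS.pow _)
  have h2 : ∀ y : nonZeroDivisors ℤ, IsUnit (Int.castRingHom S y) := fun y => by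
    have hy : (y : ℤ).natAbs ≠ 0 := Int.natAbs_ne_zero.2 (nonZeroDivisors.ne_zero y.2)
    rcases Int.natAbs_eq (y : ℤ) with h | h
    · rw [h, eq_intCast, Int.cast_natCast]
      exact h1 _ hy
    · rw [h, eq_intCast, Int.cast_neg, Int.cast_natCast]
      exact (h1 _ hy).neg
  exact ⟨(IsLocalization.lift (M := nonZeroDivisors ℤ) (S := ℚ) h2).toAlgebra⟩

end Rational

/-! ### From the axioms to the change of Frobenius -/

section Assembly

universe u w

variable {𝔬 : Type*} [CommRing 𝔬] {L : Type*} [AddCommGroup L] [LinearOrder L]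
  [IsOrderedAddMonoid L] {π : 𝔬} {lam : L →+ ℝ} {m : ℕ} {z : Module.Basis (Fin m) ℤ L} {q : ℕ}
  {σK : 𝔬 →+* 𝔬} {σ σ₁ σ₂ : Gam π lam →+* Gam π lam}
  {S : Type u} [CommRing S] [Algebra 𝔬 S] {ι : GamCon π lam →ₐ[𝔬] S}
  {D : Fin m → Derivation 𝔬 S S} {φ φ₁ φ₂ : S →+* S}

theorem exists_map_inv_coordUnits (hφ : ExtendsFromCon ι σ φ) (i : Fin m) :
    ∃ b : GamCon π lam, (b : Gam π lam) = σ (mono π lam (-z i)) ∧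
      ((↑(Units.map (φ : S →* S) (coordUnits z ι i))⁻¹ : S)) = ι b :=
  hφ ⟨mono π lam (-z i), mono_mem _⟩

theorem exists_map_coordUnits (hφ : ExtendsFromCon ι σ φ) (i : Fin m) :
    ∃ b : GamCon π lam, (b : Gam π lam) = σ (mono π lam (z i)) ∧
      φ (coordUnits z ι i) = ι b :=
  hφ ⟨mono π lam (z i), mono_mem _⟩

theorem IsFrobeniusLift.exists_map_mono (hσ : IsFrobeniusLift q σK σ) (y : L) :
    ∃ t, σ (mono π lam y) = mono π lam (q • y) + piG π lam * t := by
  obtain ⟨t, ht⟩ := hσ.lifts_pow (mono π lam y)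
  exact ⟨t, by rw [← ht, mono_pow, add_sub_cancel]⟩

/-- Both lifts send `{z_i}` to `{q z_i}` modulo `π`, so the quotient of the images is `1` modulo
`π`. -/
theorem exists_frobQuot_eq (hσ₁ : IsFrobeniusLift q σK σ₁) (hσ₂ : IsFrobeniusLift q σK σ₂)
    (hφ₁ : ExtendsFromCon ι σ₁ φ₁) (hφ₂ : ExtendsFromCon ι σ₂ φ₂) (i : Fin m) :
    ∃ c : GamCon π lam, piG π lam ∣ c ∧ frobQuot (coordUnits z ι) φ₁ φ₂ i = ι c := by
  obtain ⟨b, hb, hb'⟩ := exists_map_coordUnits (z := z) hφ₂ i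
  obtain ⟨d, hd, hd'⟩ := exists_map_inv_coordUnits (z := z) hφ₁ i
  refine ⟨b * d - 1, ?_, by rw [frobQuot, hb', hd', map_sub, map_mul, map_one]⟩
  obtain ⟨s, hs⟩ := hσ₂.exists_map_mono (z i)
  obtain ⟨t, ht⟩ := hσ₁.exists_map_mono (-z i)
  change _ ∣ (b : Gam π lam) * d - 1
  have h1 : mono π lam (q • z i) * mono π lam (q • -z i) = 1 := by
    rw [mono_mul_mono, ← smul_add, add_neg_cancel, smul_zero, mono_zero]
  rw [hb, hd, hs, ht]
  exact ⟨s * mono π lam (q • -z i) + mono π lam (q • z i) * t + piG π lam * s * t, by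
    linear_combination h1⟩

/-- The image of `{z_h}` is `{q z_h} + π t`, and `∂_i {q z_h}` is divisible by `q`, hence by `π`. -/
theorem exists_dlogCoeff_eq (hσ : IsFrobeniusLift q σK σ) (hqπ : π ∣ (q : 𝔬))
    (hφ : ExtendsFromCon ι σ φ)
    (hD : ∀ i, ExtendsFromCon ι (partialMu (z.coord i).toAddMonoidHom) (D i)) (h i : Fin m) :
    ∃ c : GamCon π lam, piG π lam ∣ c ∧ dlogCoeff D (coordUnits z ι) φ h i = ι c := by
  obtain ⟨b, hb, hb'⟩ := exists_map_coordUnits (z := z) hφ h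
  obtain ⟨d, hd, hd'⟩ := exists_map_inv_coordUnits (z := z) hφ h
  obtain ⟨f, hf, hf'⟩ := hD i b
  refine ⟨f * d, ?_, by rw [dlogCoeff, hb', hd', hf', map_mul]⟩
  obtain ⟨t, ht⟩ := hσ.exists_map_mono (z h)
  change _ ∣ (f : Gam π lam) * d
  refine Dvd.dvd.mul_right ?_ _
  rw [hf, hb, ht, partialMu_add, partialMu_algebraMap_mul, partialMu_mono]
  refine dvd_add (Dvd.dvd.mul_right ?_ _) (dvd_mul_right _ _)
  rw [map_nsmul, nsmul_eq_mul, Int.cast_mul, Int.cast_natCast, map_mul]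
  exact (map_dvd (algebraMap 𝔬 (Gam π lam)) hqπ).mul_right _

variable {p e : ℕ} [Fact p.Prime]

/-- The elements of `Γ_con` that are divisible by `π` become small for small radii. -/
def SmallMultiples (𝓢 : FrechetUnion π p e q D (coordUnits z ι)) : Prop :=
  ∀ c : GamCon π lam, piG π lam ∣ c → ∃ t, 0 < t ∧ ι c ∈ 𝓢.Mem t ∧
    ∀ s ∈ 𝓢.I, s ≤ t → ι c ∈ 𝓢.W s (1 / 2)

variable {𝓢 : FrechetUnion π p e q D (coordUnits z ι)}

theorem SmallMultiples.exists_radius (h𝓢 : SmallMultiples 𝓢) {κ : Type*} [Finite κ]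
    (c : κ → GamCon π lam) (hc : ∀ k, piG π lam ∣ c k) : ∃ t, 0 < t ∧ ∀ k, ι (c k) ∈ 𝓢.Mem t ∧
      ∀ s ∈ 𝓢.I, s ≤ t → ι (c k) ∈ 𝓢.W s (1 / 2) := by
  choose t ht h1 h2 using fun k => h𝓢 (c k) (hc k)
  obtain ⟨t₀, ht₀, h⟩ : ∃ t₀, 0 < t₀ ∧ ∀ k, t₀ ≤ t k := by
    rcases isEmpty_or_nonempty κ with _ | _
    · exact ⟨1, one_pos, fun k => isEmptyElim k⟩
    · obtain ⟨k₀, hk₀⟩ := Finite.exists_min t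
      exact ⟨t k₀, ht k₀, hk₀⟩
  exact ⟨t₀, ht₀, fun k => ⟨𝓢.Mem_anti ht₀ (h k) (h1 k), fun s hs hst => h2 k s hs (hst.trans (h k))⟩⟩

theorem exists_isLift (h𝓢 : SmallMultiples 𝓢) (hσ : IsFrobeniusLift q σK σ) (hqπ : π ∣ (q : 𝔬))
    (hφ : ExtendsFromCon ι σ φ)
    (hD : ∀ i, ExtendsFromCon ι (partialMu (z.coord i).toAddMonoidHom) (D i)) {r₀ : ℝ}
    (hr₀ : 0 < r₀) (hMem : ∀ {r x}, 0 < r → r ≤ r₀ → x ∈ 𝓢.Mem r → φ x ∈ 𝓢.Mem (r / q))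
    (hW : ∀ {s C x}, s ∈ 𝓢.I → s ≤ r₀ → x ∈ 𝓢.W s C → φ x ∈ 𝓢.W (s / q) C) :
    ∃ r₁, 0 < r₁ ∧ IsLift 𝓢 φ r₁ := by
  choose c hc hc' using fun hi : Fin m × Fin m =>
    exists_dlogCoeff_eq (z := z) hσ hqπ hφ hD hi.1 hi.2
  obtain ⟨t, ht, h⟩ := h𝓢.exists_radius c hc
  have hm := lt_min hr₀ ht
  refine ⟨min r₀ t, hm, hm, fun hr hrr => hMem hr (hrr.trans (min_le_left _ _)),
    fun hs hsr => hW hs (hsr.trans (min_le_left _ _)), fun k i => ?_, fun k i hs hsr => ?_⟩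
  · rw [hc' (k, i)]
    exact 𝓢.Mem_anti hm (min_le_right _ _) (h (k, i)).1
  · rw [hc' (k, i)]
    exact (h (k, i)).2 _ hs (hsr.trans (min_le_right _ _))

theorem changeOfFrobenius_of_frechetUnion (h𝓢 : SmallMultiples 𝓢)
    (hS : IsUnit (algebraMap 𝔬 S π))
    (he : ∀ k : ℕ, k ≠ 0 → ∃ u : 𝔬ˣ, (k : 𝔬) = u * π ^ (e * padicValNat p k)) (hq : 1 < q)
    (hqπ : π ∣ (q : 𝔬)) (hσ₁ : IsFrobeniusLift q σK σ₁) (hσ₂ : IsFrobeniusLift q σK σ₂)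
    (hφ₁ : ExtendsFromCon ι σ₁ φ₁) (hφ₂ : ExtendsFromCon ι σ₂ φ₂)
    (hD : ∀ i, ExtendsFromCon ι (partialMu (z.coord i).toAddMonoidHom) (D i)) {r₀ : ℝ}
    (hr₀ : 0 < r₀) (hMem₁ : ∀ {r x}, 0 < r → r ≤ r₀ → x ∈ 𝓢.Mem r → φ₁ x ∈ 𝓢.Mem (r / q))
    (hW₁ : ∀ {s C x}, s ∈ 𝓢.I → s ≤ r₀ → x ∈ 𝓢.W s C → φ₁ x ∈ 𝓢.W (s / q) C)
    (hMem₂ : ∀ {r x}, 0 < r → r ≤ r₀ → x ∈ 𝓢.Mem r → φ₂ x ∈ 𝓢.Mem (r / q))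
    (hW₂ : ∀ {s C x}, s ∈ 𝓢.I → s ≤ r₀ → x ∈ 𝓢.W s C → φ₂ x ∈ 𝓢.W (s / q) C) :
    ChangeOfFrobenius.{u, w} z σ₁ σ₂ S ι 𝓢.Conv := by
  obtain ⟨hQ⟩ := exists_algebra_rat hS he
  have hq' : (1 : ℝ) < q := by exact_mod_cast hq
  obtain ⟨r₁, hr₁, h₁⟩ := exists_isLift h𝓢 hσ₁ hqπ hφ₁ hD hr₀ hMem₁ hW₁
  obtain ⟨r₂, hr₂, h₂⟩ := exists_isLift h𝓢 hσ₂ hqπ hφ₂ hD hr₀ hMem₂ hW₂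
  choose c hc hc' using exists_frobQuot_eq (z := z) hσ₁ hσ₂ hφ₁ hφ₂
  choose d hd hd' using exists_frobQuot_eq (z := z) hσ₂ hσ₁ hφ₂ hφ₁
  obtain ⟨r₃, hr₃, h₃⟩ := h𝓢.exists_radius c hc
  obtain ⟨r₄, hr₄, h₄⟩ := h𝓢.exists_radius d hd
  obtain ⟨r, hr, hrr₁, hrr₂, hrr₃, hrr₄⟩ : ∃ r, 0 < r ∧ r ≤ r₁ ∧ r ≤ r₂ ∧ r ≤ r₃ ∧ r ≤ r₄ :=
    ⟨min (min r₁ r₂) (min r₃ r₄), lt_min (lt_min hr₁ hr₂) (lt_min hr₃ hr₄),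
      (min_le_left _ _).trans (min_le_left _ _), (min_le_left _ _).trans (min_le_right _ _),
      (min_le_right _ _).trans (min_le_left _ _), (min_le_right _ _).trans (min_le_right _ _)⟩
  have hbase : ∀ a : 𝔬, φ₁ (algebraMap 𝔬 S a) = φ₂ (algebraMap 𝔬 S a) := by
    intro a
    obtain ⟨b₁, hb₁, h1⟩ := hφ₁ (algebraMap 𝔬 _ a)
    obtain ⟨b₂, hb₂, h2⟩ := hφ₂ (algebraMap 𝔬 _ a)
    rw [AlgHom.commutes] at h1 h2
    rw [h1, h2]
    congr 1
    refine Subtype.ext ?_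
    rw [hb₁, hb₂]
    exact (hσ₁.extends_base a).trans (hσ₂.extends_base a).symm
  have h : IsLiftPair 𝓢 φ₁ φ₂ r :=
    { isUnit_pi := hS
      left := h₁.mono hr hrr₁
      right := h₂.mono hr hrr₂
      base := hbase
      quot_Mem := fun i => by
        rw [hc']
        exact 𝓢.Mem_anti hr hrr₃ (h₃ i).1
      quot_W := fun i hs hsr => by
        rw [hc']
        exact (h₃ i).2 _ hs (hsr.trans hrr₃)
      quot_Mem' := fun i => by
        rw [hd']
        exact 𝓢.Mem_anti hr hrr₄ (h₄ i).1
      quot_W' := fun i hs hsr => by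
        rw [hd']
        exact (h₄ i).2 _ hs (hsr.trans hrr₄) }
  exact ⟨D, φ₁, φ₂, fun i => ⟨hD i, seqCont_derivation 𝓢 i⟩, ⟨hφ₁, h₁.seqCont hq'⟩,
    ⟨hφ₂, h₂.seqCont hq'⟩, exists_changeEquivalence h hq'⟩

end Assembly

/-! ### Convergence of series in `Γ[1/π]` -/

section CompletePi

variable {𝔬 : Type*} [CommRing 𝔬] {L : Type*} [AddCommGroup L] [LinearOrder L]
  [IsOrderedAddMonoid L] {π : 𝔬} {lam : L →+ ℝ} [IsDomain 𝔬]

/-- The elements of `Γ[1/π]` with `w_s ≥ C`. -/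
def piGEGroup (lam : L →+ ℝ) (hπ : π ≠ 0) (s C : ℝ) : AddSubgroup (GamPi π lam) where
  carrier := {x | PiGE s C x}
  zero_mem' := PiGE.zero s C
  add_mem' := PiGE.add hπ
  neg_mem' := PiGE.neg

/-- The group `Γ_r[1/π]`, for `r > 0`. -/
def memRGroup (π : 𝔬) (lam : L →+ ℝ) (r : ℝ) : AddSubgroup (GamPi π lam) where
  carrier := {x | 0 < r → MemR r x}
  zero_mem' hr := by simpa using MemR.algebraMap (π := π) (lam := lam) hr 0
  add_mem' hx hy hr := (hx hr).add hr (hy hr)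
  neg_mem' hx hr := (hx hr).neg hr

theorem exists_nat_piGE_zero (hπ : π ≠ 0) (x : GamPi π lam) : ∃ k : ℕ, PiGE 0 (-k) x := by
  obtain ⟨k, a, ha⟩ := exists_rep x
  refine ⟨k, (piGE_iff hπ ha).2 fun n z _ => ?_⟩
  have : (0 : ℝ) ≤ n := n.cast_nonneg
  linarith

theorem MemR.exists_piGE (hπ : π ≠ 0) {r s : ℝ} {x : GamPi π lam} (hx : MemR r x) (hs : 0 ≤ s)
    (hsr : s ≤ r) : ∃ C, PiGE s C x := by
  rcases hs.eq_or_lt with rfl | hs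
  · obtain ⟨k, hk⟩ := exists_nat_piGE_zero hπ x
    exact ⟨_, hk⟩
  · obtain ⟨C, hC⟩ := hx.exists_GE hs hsr
    exact ⟨C, ((gE_iff hπ hs).1 hC).2⟩

theorem piGE_zero_of_dvd (hπ : π ≠ 0) {x : GamPi π lam} {k n : ℕ} {a : Gam π lam}
    (ha : x * piLoc π lam ^ k = toPi π lam a) (h : piG π lam ^ n ∣ a) : PiGE 0 (n - k) x := by
  refine (piGE_iff hπ ha).2 fun j z hz => ?_
  have hj : n ≤ j := by
    by_contra hcon
    exact hz (coeffHom_eq_zero_of_dvd ((pow_dvd_pow _ (by omega)).trans h))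
  have : (n : ℝ) ≤ j := by exact_mod_cast hj
  linarith

variable [IsDiscreteValuationRing 𝔬] [IsAdicComplete (IsLocalRing.maximalIdeal 𝔬) 𝔬]

theorem dvd_of_piGE_zero (hπ : Irreducible π) (hlam : StrictMono lam) {x : GamPi π lam} {k n : ℕ}
    {a : Gam π lam} (ha : x * piLoc π lam ^ k = toPi π lam a) (h : PiGE 0 n x) :
    piG π lam ^ n ∣ a := by
  refine (piG_pow_dvd_iff hπ hlam).2 fun z => ?_
  by_contra h0
  rcases n with _ | n
  · exact h0 (coeffHom_eq_zero_of_dvd (by simp))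
  · have := (piGE_iff hπ.ne_zero ha).1 h n z h0
    have hk : (0 : ℝ) ≤ k := k.cast_nonneg
    push_cast at this
    linarith

/-- Series in `Γ[1/π]` whose terms tend to zero converge `π`-adically. -/
theorem exists_adic_sum (hπ : Irreducible π) (hlam : StrictMono lam) (f : ℕ → GamPi π lam)
    (hf : ∀ C, ∀ᶠ i in atTop, PiGE 0 C (f i)) :
    ∃ y, ∀ C, ∀ᶠ k in atTop, PiGE 0 C (∑ i ∈ Finset.range k, f i - y) := by
  obtain ⟨K, hK⟩ : ∃ K : ℕ, ∀ i, PiGE 0 (-K) (f i) := by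
    obtain ⟨N, hN⟩ := eventually_atTop.1 (hf 0)
    choose k hk using fun i => exists_nat_piGE_zero hπ.ne_zero (f i)
    refine ⟨∑ i ∈ Finset.range N, k i, fun i => ?_⟩
    by_cases hi : N ≤ i
    · exact (hN i hi).anti (neg_nonpos.2 (Nat.cast_nonneg _))
    · refine (hk i).anti (neg_le_neg (Nat.cast_le.2 ?_))
      exact Finset.single_le_sum (f := k) (fun _ _ => Nat.zero_le _)
        (Finset.mem_range.2 (not_le.1 hi))
  choose a ha using fun i => exists_toPi_eq hπ hlam (hK i)
  choose N hN using fun n : ℕ => eventually_atTop.1 (hf n)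
  have hdvd : ∀ n i, N n ≤ i → piG π lam ^ n ∣ a i := fun n i hi =>
    dvd_of_piGE_zero hπ hlam (ha i) (hN n i hi)
  have hsum : ∀ n k l, N n ≤ k → k ≤ l →
      piG π lam ^ n ∣ ∑ i ∈ Finset.range l, a i - ∑ i ∈ Finset.range k, a i := by
    intro n k l hk hkl
    rw [← Finset.sum_Ico_eq_sub _ hkl]
    exact Finset.dvd_sum fun i hi => hdvd n i (hk.trans (Finset.mem_Ico.1 hi).1)
  -- Partial sums of the thresholds, so that the sequence is monotone as well as large enough.
  let M : ℕ → ℕ := fun n => ∑ j ∈ Finset.range (n + 1), N j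
  have hM : ∀ n, N n ≤ M n := fun n =>
    Finset.single_le_sum (f := N) (fun _ _ => Nat.zero_le _) (Finset.self_mem_range_succ n)
  obtain ⟨b, hb⟩ := exists_limit_gam hπ hlam (fun n => ∑ i ∈ Finset.range (M n), a i) fun n =>
    hsum n _ _ (hM n) (by
      change _ ≤ ∑ j ∈ Finset.range (n + 1 + 1), N j
      rw [Finset.sum_range_succ _ (n + 1)]
      exact Nat.le_add_right _ _)
  obtain ⟨y, hy⟩ := exists_eq_div K b
  refine ⟨y, fun C => ?_⟩
  obtain ⟨n, hn⟩ := exists_nat_ge (C + K)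
  refine eventually_atTop.2 ⟨M n, fun k hk => ?_⟩
  refine (piGE_zero_of_dvd hπ.ne_zero (n := n) (k := K)
    (a := ∑ i ∈ Finset.range k, a i - b) ?_ ?_).anti (by linarith)
  · rw [sub_mul, Finset.sum_mul, hy, map_sub, map_sum]
    simp only [ha]
  · have := dvd_add (hsum n _ _ (hM n) hk) (hb n)
    rwa [sub_add_sub_cancel] at this

/-- If the partial sums converge `π`-adically, then they converge for every `w_s` for which the
terms tend to zero. -/
theorem eventually_piGE_sum_sub (hπ : π ≠ 0) {f : ℕ → GamPi π lam} {y : GamPi π lam}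
    (hy : ∀ C, ∀ᶠ k in atTop, PiGE 0 C (∑ i ∈ Finset.range k, f i - y)) {s C : ℝ}
    (hf : ∀ᶠ i in atTop, PiGE s C (f i)) :
    ∀ᶠ k in atTop, PiGE s C (∑ i ∈ Finset.range k, f i - y) := by
  obtain ⟨N, hN⟩ := eventually_atTop.1 hf
  refine eventually_atTop.2 ⟨N, fun k hk z => ?_⟩
  -- The bound is checked one coefficient at a time: at a fixed `z` a sufficiently late partial sum
  -- is `π`-adically close to `y`, and it differs from the `k`-th one by terms with `w_s ≥ C`.
  obtain ⟨M, hM⟩ := eventually_atTop.1 (hy (C - s * lam z))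
  have h1 : PiGE s C (∑ i ∈ Finset.range (max k M), f i - ∑ i ∈ Finset.range k, f i) := by
    rw [← Finset.sum_Ico_eq_sub _ (le_max_left k M)]
    exact (piGEGroup lam hπ s C).sum_mem fun i hi =>
      hN i (hk.trans (Finset.mem_Ico.1 hi).1)
  have h2 := (h1.neg z).add hπ ((hM _ (le_max_right k M) z).anti (d' := C - s * lam z) (by simp))
  rwa [neg_sub, sub_add_sub_cancel] at h2

/-- The hypothesis at `s = 0` produces the limit inside `Γ[1/π]`; overconvergence passes to it
because `Γ_r[1/π]` is closed there for `w_r`. -/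
theorem exists_sum_pi (hπ : Irreducible π) (hlam : StrictMono lam) {r : ℝ} (hr : 0 < r)
    (f : ℕ → GamPi π lam) (hf : ∀ i, MemR r (f i))
    (h : ∀ s, 0 ≤ s → s ≤ r → ∀ C, ∀ᶠ i in atTop, PiGE s C (f i)) :
    ∃ y, MemR r y ∧ ∀ s, 0 ≤ s → s ≤ r → ∀ C,
      ∀ᶠ k in atTop, PiGE s C (∑ i ∈ Finset.range k, f i - y) := by
  obtain ⟨y, hy⟩ := exists_adic_sum hπ hlam f (h 0 le_rfl hr.le)
  refine ⟨y, MemR.of_approx hπ.ne_zero hr fun C => ?_, fun s hs hsr C =>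
    eventually_piGE_sum_sub hπ.ne_zero hy (h s hs hsr C)⟩
  obtain ⟨N, hN⟩ := eventually_atTop.1
    (eventually_piGE_sum_sub hπ.ne_zero hy (h r hr.le le_rfl C))
  refine ⟨∑ i ∈ Finset.range N, f i, ?_, ?_⟩
  · exact (memRGroup π lam r).sum_mem (fun i _ _ => hf i) hr
  · have := (hN N le_rfl).neg
    rwa [neg_sub] at this

/-- A subring that contains `𝔬` and the monomials of a basis and their inverses contains all
monomials. -/
theorem mono_mem_subring {m : ℕ} (z : Module.Basis (Fin m) ℤ L) {S : Type*} [CommRing S]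
    [Algebra 𝔬 S] (ι : GamCon π lam →ₐ[𝔬] S) (Q : Subring S)
    (h1 : ∀ h, (coordUnits z ι h : S) ∈ Q) (h2 : ∀ h, (↑(coordUnits z ι h)⁻¹ : S) ∈ Q) (y : L) :
    ι ⟨mono π lam y, mono_mem y⟩ ∈ Q := by
  have hmul : ∀ a b : L, ι ⟨mono π lam (a + b), mono_mem _⟩ =
      ι ⟨mono π lam a, mono_mem a⟩ * ι ⟨mono π lam b, mono_mem b⟩ := fun a b => by
    rw [← map_mul]
    exact congrArg ι (Subtype.ext (mono_mul_mono a b).symm)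
  let H : AddSubgroup L :=
    { carrier := {y | ι ⟨mono π lam y, mono_mem y⟩ ∈ Q ∧ ι ⟨mono π lam (-y), mono_mem _⟩ ∈ Q}
      zero_mem' := by
        have : ι ⟨mono π lam 0, mono_mem 0⟩ = 1 := map_one ι
        simp only [Set.mem_ofPred_eq, neg_zero, this]
        exact ⟨Q.one_mem, Q.one_mem⟩
      add_mem' := by
        rintro a b ⟨ha, ha'⟩ ⟨hb, hb'⟩
        simp only [Set.mem_ofPred_eq, neg_add, hmul]
        exact ⟨Q.mul_mem ha hb, Q.mul_mem ha' hb'⟩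
      neg_mem' := by
        rintro a ⟨ha, ha'⟩
        simp only [Set.mem_ofPred_eq, neg_neg]
        exact ⟨ha', ha⟩ }
  have h3 : Submodule.span ℤ (Set.range z) ≤ H.toIntSubmodule := by
    rw [Submodule.span_le]
    rintro _ ⟨i, rfl⟩
    exact ⟨h1 i, h2 i⟩
  have h4 : y ∈ H.toIntSubmodule := h3 (by rw [z.span_eq]; trivial)
  exact h4.1

end CompletePi

/-! ### `Γ_con[1/π]` as a union of Fréchet rings -/

section ConPi

universe u w

variable {𝔬 : Type*} [CommRing 𝔬] {L : Type*} [AddCommGroup L] [LinearOrder L]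
  [IsOrderedAddMonoid L] {π : 𝔬} {lam : L →+ ℝ} [IsDomain 𝔬] {m : ℕ}
  {z : Module.Basis (Fin m) ℤ L}

/-- A subring of `S` that contains `π x` only if it contains `x` has the same property for
powers of `π`. -/
theorem mem_of_pow_mul_mem {S : Type*} [CommRing S] [Algebra 𝔬 S] {Q : Subring S}
    (hQ : ∀ x, algebraMap 𝔬 S π * x ∈ Q → x ∈ Q) (k : ℕ) {x : S}
    (hx : algebraMap 𝔬 S π ^ k * x ∈ Q) : x ∈ Q := by
  induction k with
  | zero => simpa using hx
  | succ k ih => exact ih (hQ _ (by rwa [← mul_assoc, ← pow_succ']))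

theorem extendsFromCon_deriv {T : Derivation 𝔬 (GamPi π lam) (GamPi π lam)} {mu : L →+ ℤ}
    (hπ : π ≠ 0) (hT : ∀ x k a, x * piLoc π lam ^ k = toPi π lam a →
      T x * piLoc π lam ^ k = toPi π lam (partialMu mu a)) (a : GamCon π lam) :
    ∃ b : GamCon π lam, (b : Gam π lam) = partialMu mu a ∧
      T (toPi π lam a) = toPi π lam (b : Gam π lam) := by
  obtain ⟨a, r, hr, ha⟩ := a
  have h1 := hT (toPi π lam a) 0 a (by rw [pow_zero, mul_one])
  refine ⟨⟨partialMu mu a, r, hr, ?_⟩, rfl, by simpa using h1⟩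
  exact (memR_iff hπ hr h1).1 ((memR_toPi ha).deriv hπ hT hr)

/-- The restriction to `Γ_con[1/π]` of the extension of `∂_μ`. -/
theorem exists_derivationConPi {T : Derivation 𝔬 (GamPi π lam) (GamPi π lam)} {mu : L →+ ℤ}
    (hπ : π ≠ 0) (hT : ∀ x k a, x * piLoc π lam ^ k = toPi π lam a →
      T x * piLoc π lam ^ k = toPi π lam (partialMu mu a)) :
    ∃ D : Derivation 𝔬 (GamConPi π lam) (GamConPi π lam), ∀ x, (D x : GamPi π lam) = T x := by
  have h : ∀ x : GamConPi π lam, T x ∈ GamConPi π lam := by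
    rintro ⟨x, r, hr, hx⟩
    exact ⟨r, hr, hx.deriv hπ hT hr⟩
  exact ⟨Derivation.mk'
    { toFun := fun x => ⟨T x, h x⟩
      map_add' := fun x y => Subtype.ext (map_add T _ _)
      map_smul' := fun c x => Subtype.ext (T.map_smul c _) }
    fun x y => Subtype.ext (T.leibniz _ _), fun x => rfl⟩

theorem coe_fallProd {T : Derivation 𝔬 (GamPi π lam) (GamPi π lam)}
    {D : Derivation 𝔬 (GamConPi π lam) (GamConPi π lam)} (hD : ∀ x, (D x : GamPi π lam) = T x)
    (t P : ℕ) (x : GamConPi π lam) :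
    (fallProd (derEnd D) t P x : GamPi π lam) = fallProd (derEnd T) t P x := by
  induction P generalizing x with
  | zero => rfl
  | succ P ih =>
    rw [fallProd_succ, fallProd_succ]
    change ((fallProd (derEnd D) t P (D x - ((t + P : ℕ) : AddMonoid.End (GamConPi π lam)) x) :
      GamConPi π lam) : GamPi π lam) =
      fallProd (derEnd T) t P (T x - ((t + P : ℕ) : AddMonoid.End (GamPi π lam)) x)
    rw [ih, AddMonoid.End.natCast_apply, AddMonoid.End.natCast_apply, ← hD]
    rfl

theorem partialMu_coord_mono [DecidableEq (Fin m)] (i h : Fin m) :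
    partialMu (z.coord i).toAddMonoidHom (mono π lam (z h)) =
      if i = h then mono π lam (z h) else 0 := by
  rw [partialMu_mono]
  change algebraMap 𝔬 _ ((z.coord i (z h) : ℤ) : 𝔬) * _ = _
  rw [Module.Basis.coord_apply, Module.Basis.repr_self, Finsupp.single_apply]
  by_cases hi : i = h
  · rw [if_pos hi.symm, if_pos hi, Int.cast_one, map_one, one_mul]
  · rw [if_neg (Ne.symm hi), if_neg hi, Int.cast_zero, map_zero, zero_mul]

variable [IsDiscreteValuationRing 𝔬] [IsAdicComplete (IsLocalRing.maximalIdeal 𝔬) 𝔬]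

/-- A truncation is `π^-k` times a finite sum `∑ c_z {z}`. That sum lies in `Q` because all
monomials do, and `Q` allows division by `π`. -/
theorem exists_mem_subring (hπ : Irreducible π) (Q : Subring (GamConPi π lam))
    (hQ : ∀ c, algebraMap 𝔬 (GamConPi π lam) c ∈ Q)
    (h1 : ∀ h, (coordUnits z (toConPi π lam) h : GamConPi π lam) ∈ Q)
    (h2 : ∀ h, (↑(coordUnits z (toConPi π lam) h)⁻¹ : GamConPi π lam) ∈ Q)
    (h3 : ∀ x, algebraMap 𝔬 (GamConPi π lam) π * x ∈ Q → x ∈ Q) {r s : ℝ} (hs : 0 < s)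
    (hsr : s ≤ r) {x : GamPi π lam} (hx : MemR r x) (C : ℝ) :
    ∃ y ∈ Q, MemR r (y : GamPi π lam) ∧ PiGE s C (x - (y : GamPi π lam)) := by
  obtain ⟨k, A, c, y, hy, hxy⟩ := exists_truncation hπ hs hsr hx C
  have hy' : ∀ t, 0 < t → MemR t y := fun t ht => by
    refine ⟨k, _, ?_, hy⟩
    have : ∀ A : Finset L, ∑ z ∈ A, algebraMap 𝔬 _ (c z) * mono π lam z ∈ GamN π lam t := by
      classical
      intro A
      induction A using Finset.induction_on with
      | empty => simpa using GamN_algebraMap (π := π) (lam := lam) ht 0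
      | insert a A ha ih =>
        rw [Finset.sum_insert ha]
        exact GamN_add ht (GamN_mul ht (GamN_algebraMap ht _) (mono_mem_GamN ht a)) ih
    exact this A
  refine ⟨⟨y, 1, one_pos, hy' 1 one_pos⟩, mem_of_pow_mul_mem h3 k ?_, hy' r (hs.trans_le hsr), hxy⟩
  have h4 : algebraMap 𝔬 (GamConPi π lam) π ^ k * ⟨y, 1, one_pos, hy' 1 one_pos⟩ =
      ∑ z ∈ A, algebraMap 𝔬 _ (c z) * toConPi π lam ⟨mono π lam z, mono_mem z⟩ := by
    refine Subtype.ext ?_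
    rw [AddSubmonoidClass.coe_finsetSum]
    change algebraMap 𝔬 (GamPi π lam) π ^ k * y = ∑ z ∈ A, algebraMap 𝔬 (GamPi π lam) (c z) *
      toPi π lam (mono π lam z)
    rw [algebraMap_piLoc, mul_comm, hy, map_sum]
    simp only [map_mul, toPi_algebraMap]
  rw [h4]
  exact Q.sum_mem fun a _ => Q.mul_mem (hQ _) (mono_mem_subring z _ Q h1 h2 a)

/-- `Γ_con[1/π]` as a union of Fréchet rings, for the valuations `w_s`, `s ∈ [0, r]`. -/
def frechetUnionConPi (hπ : Irreducible π) (hlam : StrictMono lam) {p e q : ℕ}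
    (he : ∀ k : ℕ, k ≠ 0 → ∃ u : 𝔬ˣ, (k : 𝔬) = u * π ^ (e * padicValNat p k))
    {T : Fin m → Derivation 𝔬 (GamPi π lam) (GamPi π lam)}
    (hT : ∀ i x k a, x * piLoc π lam ^ k = toPi π lam a →
      T i x * piLoc π lam ^ k = toPi π lam (partialMu (z.coord i).toAddMonoidHom a))
    {D : Fin m → Derivation 𝔬 (GamConPi π lam) (GamConPi π lam)}
    (hD : ∀ i x, (D i x : GamPi π lam) = T i x) :
    FrechetUnion π p e q D (coordUnits z (toConPi π lam)) where
  -- The value `s = 0` is what makes completeness true: for positive `s` alone, limits are only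
  -- found in `Γ_an,r`.
  I := Set.Ici 0
  Mem r := (memRGroup π lam r).comap (GamConPi π lam).val.toRingHom.toAddMonoidHom
  W s C := (piGEGroup lam hπ.ne_zero s C).comap (GamConPi π lam).val.toRingHom.toAddMonoidHom
  nonneg s hs := hs
  mem_I s hs := hs.le
  Mem_anti ht htr x hx _ := (hx (ht.trans_le htr)).mono ht htr
  Mem_mul hx hy hr := (hx hr).mul hr (hy hr)
  Mem_algebraMap c hr := MemR.algebraMap hr c
  Mem_natCast_mul := by
    intro r k x hk hx hr
    obtain ⟨y, hy, -, hy'⟩ := exists_natCast_inv (lam := lam) hπ.ne_zero he hk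
    have := (hy' r hr).mul hr (hx hr)
    change MemR r (y * ((k : GamPi π lam) * (x : GamPi π lam))) at this
    rwa [← mul_assoc, hy, one_mul] at this
  W_anti hC x hx := PiGE.anti hx hC
  W_mul hx hy := PiGE.mul hπ.ne_zero hx hy
  W_algebraMap c := PiGE.const _ c hπ.ne_zero
  W_natCast_mul := by
    intro s C k x hk
    constructor
    · intro hx
      obtain ⟨y, hy, hy', -⟩ := exists_natCast_inv (lam := lam) hπ.ne_zero he hk
      have := (hy' s).mul hπ.ne_zero hx
      change PiGE s _ (y * ((k : GamPi π lam) * (x : GamPi π lam))) at this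
      rw [← mul_assoc, hy, one_mul] at this
      exact this.anti (by linarith)
    · intro hx
      exact ((PiGE.natCast hπ.ne_zero he hk s).mul hπ.ne_zero hx).anti (by linarith)
  exists_Mem x := by
    obtain ⟨r, hr, hx⟩ := x.2
    exact ⟨r, hr, fun _ => hx⟩
  exists_W hr hx s hs hsr := (hx hr).exists_piGE hπ.ne_zero hs hsr
  exists_W_unif := by
    intro r x hr hx
    obtain ⟨A, hA⟩ := (hx hr).exists_piGE hπ.ne_zero le_rfl hr.le
    obtain ⟨B, hB⟩ := (hx hr).exists_piGE hπ.ne_zero hr.le le_rfl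
    -- By convexity the bounds at `0` and at `r` hold on the whole interval `[0, r]`.
    exact ⟨min A B, fun s hs hsr _ => (hA.anti (min_le_left A B)).of_endpoints hπ.ne_zero
      (hB.anti (min_le_right A B)) hs hsr⟩
  sep _ h := Subtype.ext (eq_zero_of_piGE hπ h)
  complete := by
    intro r f hr hf h
    obtain ⟨y, hy, hy'⟩ := exists_sum_pi hπ hlam hr (fun i => (f i : GamPi π lam))
      (fun i => hf i hr) h
    refine ⟨⟨y, r, hr, hy⟩, fun _ => hy, fun s hs hsr C => (hy' s hs hsr C).mono fun k hk => ?_⟩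
    change PiGE s C ((∑ i ∈ Finset.range k, f i : GamConPi π lam) - y : GamPi π lam)
    rwa [AddSubmonoidClass.coe_finsetSum]
  dense := by
    rintro Q h0 h1 h2 h3 ⟨x, r, hr, hx⟩
    refine ⟨r, hr, fun s hs hsr C => ?_⟩
    obtain ⟨y, hyQ, hy, hxy⟩ := exists_mem_subring hπ Q h0 h1 h2 h3 hs hsr hx C
    exact ⟨y, hyQ, fun _ => hx.sub hr hy, hxy⟩
  D_Mem := by
    intro r x i hx hr
    change MemR r (D i x : GamPi π lam)
    rw [hD]
    exact (hx hr).deriv hπ.ne_zero (hT i) hr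
  D_W := by
    intro s C x i hx
    change PiGE s C (D i x : GamPi π lam)
    rw [hD]
    exact PiGE.deriv hπ.ne_zero (hT i) hx
  D_block := by
    intro s C x i t P hx
    change PiGE s _ (fallProd (derEnd (D i)) t P x : GamPi π lam)
    rw [coe_fallProd (hD i)]
    exact PiGE.fallProd hπ.ne_zero (hT i) he t P hx
  D_unit := by
    intro i h
    refine Subtype.ext ?_
    rw [hD]
    have := hT i (toPi π lam (mono π lam (z h))) 0 _ (by rw [pow_zero, mul_one])
    rw [pow_zero, mul_one, partialMu_coord_mono] at this
    change T i (toPi π lam (mono π lam (z h))) = _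
    rw [this]
    split_ifs
    · rfl
    · exact map_zero _

end ConPi

/-! ### The change of Frobenius over `Γ_con[1/π]` -/

section ConPi

universe u w

variable {𝔬 : Type*} [CommRing 𝔬] {L : Type*} [AddCommGroup L] [LinearOrder L]
  [IsOrderedAddMonoid L] {π : 𝔬} {lam : L →+ ℝ} [IsDomain 𝔬] {m : ℕ}
  {z : Module.Basis (Fin m) ℤ L} {q : ℕ} {σK : 𝔬 →+* 𝔬} {σ σ₁ σ₂ : Gam π lam →+* Gam π lam}
  {ρ : ℝ}

theorem mul_lt_one_of_le (hρ : 0 < ρ) {r : ℝ} (hr : r ≤ 1 / (2 * ρ)) : ρ * r < 1 := by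
  have h := mul_le_mul_of_nonneg_left hr hρ.le
  rw [mul_one_div, div_mul_cancel_right₀ hρ.ne'] at h
  exact h.trans_lt (by norm_num)

theorem SlopeBound.map_GamCon (hs : SlopeBound q σ ρ) (hq : 0 < q) (hρ : 0 < ρ)
    (a : GamCon π lam) : σ a ∈ GamCon π lam := by
  obtain ⟨a, r, hr, ha⟩ := a
  have hm : 0 < min r (1 / (2 * ρ)) := lt_min hr (by positivity)
  exact ⟨_, div_pos hm (Nat.cast_pos.2 hq), hs.map_GamN hq hρ.le hm
    (mul_lt_one_of_le hρ (min_le_right _ _)) (GamN_mono hr hm (min_le_left _ _) ha)⟩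

/-- The restriction to `Γ_con[1/π]` of the extension of a Frobenius lift. -/
theorem exists_frobeniusConPi (hσ : IsFrobeniusLift q σK σ) (hσπ : ∃ u : 𝔬ˣ, σK π = u * π)
    (hs : SlopeBound q σ ρ) (hq : 0 < q) (hρ : 0 < ρ) {φ : GamPi π lam →+* GamPi π lam}
    (hφ : ∀ a, φ (toPi π lam a) = toPi π lam (σ a)) :
    ∃ ψ : GamConPi π lam →+* GamConPi π lam, ∀ x, (ψ x : GamPi π lam) = φ x := by
  have h : ∀ x : GamConPi π lam, φ x ∈ GamConPi π lam := by
    rintro ⟨x, r, hr, hx⟩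
    have hm : 0 < min r (1 / (2 * ρ)) := lt_min hr (by positivity)
    exact ⟨_, div_pos hm (Nat.cast_pos.2 hq), (hx.mono hm (min_le_left _ _)).map_frobenius hσ hσπ
      hφ hs hq hρ.le hm (mul_lt_one_of_le hρ (min_le_right _ _))⟩
  exact ⟨{ toFun := fun x => ⟨φ x, h x⟩
           map_zero' := Subtype.ext (map_zero φ)
           map_one' := Subtype.ext (map_one φ)
           map_add' := fun x y => Subtype.ext (map_add φ _ _)
           map_mul' := fun x y => Subtype.ext (map_mul φ _ _) }, fun x => rfl⟩

variable [IsDiscreteValuationRing 𝔬] [IsAdicComplete (IsLocalRing.maximalIdeal 𝔬) 𝔬]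

theorem changeOfFrobenius_conPi (hπ : Irreducible π) (hlam : StrictMono lam) {p e : ℕ}
    [Fact p.Prime] (hq : 1 < q)
    (he : ∀ k : ℕ, k ≠ 0 → ∃ u : 𝔬ˣ, (k : 𝔬) = u * π ^ (e * padicValNat p k))
    (hqπ : π ∣ (q : 𝔬)) (hσπ : ∃ u : 𝔬ˣ, σK π = u * π) (hσ₁ : IsFrobeniusLift q σK σ₁)
    (hσ₂ : IsFrobeniusLift q σK σ₂) (hρ : 0 < ρ) (hs₁ : SlopeBound q σ₁ ρ)
    (hs₂ : SlopeBound q σ₂ ρ) :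
    ChangeOfFrobenius.{_, w} z σ₁ σ₂ (GamConPi π lam) (toConPi π lam) TendstoCon := by
  have hq0 : 0 < q := by omega
  have hr₀ : 0 < 1 / (2 * ρ) := by positivity
  choose T hT using fun i =>
    exists_derivationPi (lam := lam) hπ.ne_zero (z.coord i).toAddMonoidHom
  choose D hD using fun i => exists_derivationConPi hπ.ne_zero (hT i)
  obtain ⟨φ₁, hφ₁⟩ := exists_frobeniusPi hσ₁ hσπ
  obtain ⟨φ₂, hφ₂⟩ := exists_frobeniusPi hσ₂ hσπ
  obtain ⟨ψ₁, hψ₁⟩ := exists_frobeniusConPi hσ₁ hσπ hs₁ hq0 hρ hφ₁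
  obtain ⟨ψ₂, hψ₂⟩ := exists_frobeniusConPi hσ₂ hσπ hs₂ hq0 hρ hφ₂
  let 𝓢 := frechetUnionConPi (q := q) hπ hlam he hT hD
  -- Both notions of convergence test positive `s` only, although `0` belongs to the index set of
  -- this Fréchet union.
  have hconv : (fun {_} => TendstoCon : Convergence (GamConPi π lam)) = fun {_} => 𝓢.Conv := by
    funext κ l f y
    refine propext (exists_congr fun r => and_congr_right fun hr => forall_congr' fun s =>
      forall_congr' fun hs => forall_congr' fun _ => forall_congr' fun C => ?_)
    refine eventually_congr (Eventually.of_forall fun i => ?_)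
    rw [gE_iff hπ.ne_zero hs]
    exact and_congr_left fun _ => ⟨fun h _ => h, fun h => h hr⟩
  refine hconv ▸ ?_
  have hlift : ∀ {σ : Gam π lam →+* Gam π lam} {φ : GamPi π lam →+* GamPi π lam}
      {ψ : GamConPi π lam →+* GamConPi π lam}, SlopeBound q σ ρ →
      (∀ a, φ (toPi π lam a) = toPi π lam (σ a)) → (∀ x, (ψ x : GamPi π lam) = φ x) →
      ExtendsFromCon (toConPi π lam) σ ψ := fun {σ φ ψ} hs hφ hψ a =>
    ⟨⟨σ a, hs.map_GamCon hq0 hρ a⟩, rfl, Subtype.ext (by rw [hψ]; exact hφ a)⟩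
  have hMem : ∀ {σ : Gam π lam →+* Gam π lam} {φ : GamPi π lam →+* GamPi π lam}
      {ψ : GamConPi π lam →+* GamConPi π lam}, IsFrobeniusLift q σK σ → SlopeBound q σ ρ →
      (∀ a, φ (toPi π lam a) = toPi π lam (σ a)) → (∀ x, (ψ x : GamPi π lam) = φ x) →
      ∀ {r x}, 0 < r → r ≤ 1 / (2 * ρ) → x ∈ 𝓢.Mem r → ψ x ∈ 𝓢.Mem (r / q) := by
    intro σ φ ψ hσ hs hφ hψ r x hr hrr hx _
    change MemR (r / q) (ψ x : GamPi π lam)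
    rw [hψ]
    exact (hx hr).map_frobenius hσ hσπ hφ hs hq0 hρ.le hr (mul_lt_one_of_le hρ hrr)
  have hW : ∀ {σ : Gam π lam →+* Gam π lam} {φ : GamPi π lam →+* GamPi π lam}
      {ψ : GamConPi π lam →+* GamConPi π lam}, IsFrobeniusLift q σK σ → SlopeBound q σ ρ →
      (∀ a, φ (toPi π lam a) = toPi π lam (σ a)) → (∀ x, (ψ x : GamPi π lam) = φ x) →
      ∀ {s C x}, s ∈ 𝓢.I → s ≤ 1 / (2 * ρ) → x ∈ 𝓢.W s C → ψ x ∈ 𝓢.W (s / q) C := by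
    intro σ φ ψ hσ hs hφ hψ s C x hs0 hsr hx
    change PiGE (s / q) C (ψ x : GamPi π lam)
    rw [hψ]
    exact PiGE.map_frobenius hσ hσπ hπ hlam hφ hs hq0 hs0 (mul_lt_one_of_le hρ hsr).le hx
  refine changeOfFrobenius_of_frechetUnion (𝓢 := 𝓢) (φ₁ := ψ₁) (φ₂ := ψ₂) (r₀ := 1 / (2 * ρ))
    ?_ ?_ he hq hqπ hσ₁ hσ₂ (hlift hs₁ hφ₁ hψ₁) (hlift hs₂ hφ₂ hψ₂) ?_ hr₀
    (hMem hσ₁ hs₁ hφ₁ hψ₁) (hW hσ₁ hs₁ hφ₁ hψ₁) (hMem hσ₂ hs₂ hφ₂ hψ₂) (hW hσ₂ hs₂ hφ₂ hψ₂)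
  · rintro ⟨c, r, hr, hc⟩ hd
    obtain ⟨t, ht, htr, h⟩ := exists_piGE_half hπ.ne_zero hr hc hd
    exact ⟨t, ht, fun _ => memR_toPi (GamN_mono hr ht htr hc), h⟩
  · obtain ⟨y, hy⟩ := exists_eq_div (π := π) (lam := lam) 1 1
    rw [map_one] at hy
    refine IsUnit.of_mul_eq_one ⟨y, 1, one_pos, MemR.of_mul_piLoc_pow_eq_one one_pos hy⟩
      (Subtype.ext ?_)
    change algebraMap 𝔬 (GamPi π lam) π * y = 1
    rw [algebraMap_piLoc, mul_comm, ← hy, pow_one]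
  · intro i a
    obtain ⟨b, hb, hb'⟩ := extendsFromCon_deriv hπ.ne_zero (hT i) a
    exact ⟨b, hb, Subtype.ext (by rw [hD]; exact hb')⟩

end ConPi

/-! ### `Γ_an,con` through Cauchy sequences -/

section AnBasics

variable {𝔬 : Type*} [CommRing 𝔬] {L : Type*} [AddCommGroup L] [LinearOrder L]
  [IsOrderedAddMonoid L] {π : 𝔬} {lam : L →+ ℝ}

/-- The element `y ∈ Γ_an,con` is represented by the sequence `u`. -/
def IsRep (u : ℕ → GamPi π lam) (y : GamAnCon π lam) : Prop :=
  ∃ h : u ∈ CauchySeqs π lam, GamAnCon.mk π lam ⟨u, h⟩ = y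

theorem CauR.exists_isRep {r : ℝ} (hr : 0 < r) {u : ℕ → GamPi π lam} (hu : CauR r u) :
    ∃ y, IsRep u y := ⟨_, ⟨r, hr, hu⟩, rfl⟩

theorem exists_isRep (y : GamAnCon π lam) : ∃ u r, 0 < r ∧ CauR r u ∧ IsRep u y := by
  obtain ⟨⟨u, r, hr, hu⟩, rfl⟩ := Ideal.Quotient.mk_surjective y
  exact ⟨u, r, hr, hu, _, rfl⟩

section Operations

variable {u v : ℕ → GamPi π lam} {y w : GamAnCon π lam}

theorem IsRep.add (hu : IsRep u y) (hv : IsRep v w) : IsRep (u + v) (y + w) := by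
  obtain ⟨hu, rfl⟩ := hu
  obtain ⟨hv, rfl⟩ := hv
  exact ⟨add_mem hu hv, map_add (GamAnCon.mk π lam) ⟨u, hu⟩ ⟨v, hv⟩⟩

theorem IsRep.mul (hu : IsRep u y) (hv : IsRep v w) : IsRep (u * v) (y * w) := by
  obtain ⟨hu, rfl⟩ := hu
  obtain ⟨hv, rfl⟩ := hv
  exact ⟨mul_mem hu hv, map_mul (GamAnCon.mk π lam) ⟨u, hu⟩ ⟨v, hv⟩⟩

theorem IsRep.neg (hu : IsRep u y) : IsRep (-u) (-y) := by
  obtain ⟨hu, rfl⟩ := hu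
  exact ⟨neg_mem hu, map_neg (GamAnCon.mk π lam) ⟨u, hu⟩⟩

theorem IsRep.sub (hu : IsRep u y) (hv : IsRep v w) : IsRep (u - v) (y - w) := by
  rw [sub_eq_add_neg, sub_eq_add_neg]
  exact hu.add hv.neg

theorem IsRep.algebraMap (c : 𝔬) :
    IsRep (fun _ => algebraMap 𝔬 (GamPi π lam) c) (algebraMap 𝔬 (GamAnCon π lam) c) :=
  ⟨(CauchySeqs π lam).algebraMap_mem c, (GamAnCon.mk π lam).commutes c⟩

theorem isRep_zero_iff : IsRep u 0 ↔ u ∈ CauchySeqs π lam ∧ ∃ r, 0 < r ∧ NullR r u := by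
  constructor
  · rintro ⟨h, h0⟩
    exact ⟨h, (Ideal.Quotient.eq_zero_iff_mem (I := NullSeqs π lam)).1 h0⟩
  · rintro ⟨h, h0⟩
    exact ⟨h, (Ideal.Quotient.eq_zero_iff_mem (I := NullSeqs π lam)).2 h0⟩

theorem isRep_zero : IsRep (0 : ℕ → GamPi π lam) 0 :=
  ⟨zero_mem _, map_zero (GamAnCon.mk π lam)⟩

theorem IsRep.congr (hu : IsRep u y) (h : IsRep (u - v) 0) : IsRep v y := by
  have := hu.sub h
  rwa [sub_sub_cancel, sub_zero] at this

end Operations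

variable [IsDomain 𝔬]

theorem cauR_iff (hπ : π ≠ 0) {r : ℝ} {u : ℕ → GamPi π lam} : CauR r u ↔ (∀ i, MemR r (u i)) ∧
    ∀ s, 0 < s → s ≤ r → ∀ C : ℝ, ∃ N, ∀ i ≥ N, ∀ j ≥ N, PiGE s C (u i - u j) := by
  refine and_congr_right fun h => forall_congr' fun s => forall_congr' fun hs =>
    forall_congr' fun hsr => forall_congr' fun C => exists_congr fun N => ?_
  refine forall₂_congr fun i _ => forall₂_congr fun j _ => ?_
  rw [gE_iff hπ hs]
  exact and_iff_right ((h i).sub (hs.trans_le hsr) (h j))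

theorem CauR.add (hπ : π ≠ 0) {r : ℝ} (hr : 0 < r) {u v : ℕ → GamPi π lam} (hu : CauR r u)
    (hv : CauR r v) : CauR r (u + v) := by
  rw [cauR_iff hπ] at *
  refine ⟨fun i => (hu.1 i).add hr (hv.1 i), fun s hs hsr C => ?_⟩
  obtain ⟨N, hN⟩ := hu.2 s hs hsr C
  obtain ⟨M, hM⟩ := hv.2 s hs hsr C
  refine ⟨max N M, fun i hi j hj => ?_⟩
  have h1 := (hN i ((le_max_left _ _).trans hi) j ((le_max_left _ _).trans hj)).add hπ
    (hM i ((le_max_right _ _).trans hi) j ((le_max_right _ _).trans hj))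
  rwa [show u i - u j + (v i - v j) = (u + v) i - (u + v) j by
    simp only [Pi.add_apply]; ring] at h1

theorem CauR.neg (hπ : π ≠ 0) {r : ℝ} (hr : 0 < r) {u : ℕ → GamPi π lam} (hu : CauR r u) :
    CauR r (-u) := by
  rw [cauR_iff hπ] at *
  refine ⟨fun i => (hu.1 i).neg hr, fun s hs hsr C => ?_⟩
  obtain ⟨N, hN⟩ := hu.2 s hs hsr C
  refine ⟨N, fun i hi j hj => ?_⟩
  have h1 := (hN i hi j hj).neg
  rwa [show -(u i - u j) = (-u) i - (-u) j by simp only [Pi.neg_apply]; ring] at h1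

theorem CauR.sub (hπ : π ≠ 0) {r : ℝ} (hr : 0 < r) {u v : ℕ → GamPi π lam} (hu : CauR r u)
    (hv : CauR r v) : CauR r (u - v) := by
  rw [sub_eq_add_neg]
  exact hu.add hπ hr (hv.neg hπ hr)

theorem CauR.mul (hπ : π ≠ 0) {r : ℝ} (hr : 0 < r) {u v : ℕ → GamPi π lam} (hu : CauR r u)
    (hv : CauR r v) : CauR r (u * v) := by
  refine (cauR_iff hπ).2 ⟨fun i => (hu.1 i).mul hr (hv.1 i), fun s hs hsr C => ?_⟩
  obtain ⟨A, hA⟩ := hu.bdd hs hsr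
  obtain ⟨B, hB⟩ := hv.bdd hs hsr
  obtain ⟨N, hN⟩ := ((cauR_iff hπ).1 hu).2 s hs hsr (C - B)
  obtain ⟨M, hM⟩ := ((cauR_iff hπ).1 hv).2 s hs hsr (C - A)
  refine ⟨max N M, fun i hi j hj => ?_⟩
  have h1 := (hN i ((le_max_left _ _).trans hi) j ((le_max_left _ _).trans hj)).mul hπ
    ((gE_iff hπ hs).1 (hB i)).2
  have h2 := (hM i ((le_max_right _ _).trans hi) j ((le_max_right _ _).trans hj)).mul hπ
    ((gE_iff hπ hs).1 (hA j)).2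
  rw [sub_add_cancel] at h1 h2
  have := h1.add hπ h2
  rwa [show (u i - u j) * v i + (v i - v j) * u j = (u * v) i - (u * v) j by
    simp only [Pi.mul_apply]; ring] at this

theorem CauR.const {r : ℝ} (hr : 0 < r) {x : GamPi π lam} (hx : MemR r x) :
    CauR r fun _ => x :=
  ⟨fun _ => hx, fun s hs _ C => ⟨0, fun i _ j _ => by
    rw [sub_self]
    exact GE.zero hr hs C⟩⟩

/-- A Cauchy sequence with coefficients tending to zero is a null sequence. -/
theorem CauR.nullR (hπ : π ≠ 0) {r : ℝ} {u : ℕ → GamPi π lam} (hu : CauR r u)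
    (h : ∀ z d, ∀ᶠ i in atTop, CoeffGE z d (u i)) : NullR r u := by
  intro s hs hsr C
  obtain ⟨N, hN⟩ := ((cauR_iff hπ).1 hu).2 s hs hsr C
  refine ⟨N, fun i hi => (gE_iff hπ hs).2 ⟨hu.1 i, fun z => ?_⟩⟩
  obtain ⟨M, hM⟩ := eventually_atTop.1 (h z (C - s * lam z))
  have := (hN i hi (max N M) (le_max_left _ _) z).add hπ (hM _ (le_max_right N M))
  rwa [sub_add_cancel] at this

theorem NullR.coeffGE (hπ : π ≠ 0) {r : ℝ} (hr : 0 < r) {u : ℕ → GamPi π lam} (hu : NullR r u)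
    (z : L) (d : ℝ) : ∀ᶠ i in atTop, CoeffGE z d (u i) := by
  obtain ⟨N, hN⟩ := hu r hr le_rfl (d + r * lam z)
  refine eventually_atTop.2 ⟨N, fun i hi => ?_⟩
  exact (((gE_iff hπ hr).1 (hN i hi)).2 z).anti (by linarith)

theorem NullR.eventually (hπ : π ≠ 0) {r s : ℝ} {u : ℕ → GamPi π lam} (hu : NullR r u)
    (hs : 0 < s) (hsr : s ≤ r) (C : ℝ) : ∀ᶠ i in atTop, PiGE s C (u i) := by
  obtain ⟨N, hN⟩ := hu s hs hsr C
  exact eventually_atTop.2 ⟨N, fun i hi => ((gE_iff hπ hs).1 (hN i hi)).2⟩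

/-- Being null for some small radius makes every coefficient tend to zero, and this makes a sequence
that is Cauchy up to radius `r` null up to radius `r`. In other words, `Γ_an,r` embeds into the
direct limit. -/
theorem IsRep.nullR (hπ : π ≠ 0) {r : ℝ} {u : ℕ → GamPi π lam} (h : IsRep u 0) (hu : CauR r u) :
    NullR r u := by
  obtain ⟨-, t, ht, hn⟩ := isRep_zero_iff.1 h
  exact hu.nullR hπ fun z d => hn.coeffGE hπ ht z d

theorem CauR.shift {r : ℝ} {u : ℕ → GamPi π lam} (hu : CauR r u) (k : ℕ) :
    CauR r fun i => u (i + k) := by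
  refine ⟨fun i => hu.1 _, fun s hs hsr C => ?_⟩
  obtain ⟨N, hN⟩ := hu.2 s hs hsr C
  exact ⟨N, fun i hi j hj => hN _ (by omega) _ (by omega)⟩

theorem IsRep.shift (hπ : π ≠ 0) {r : ℝ} (hr : 0 < r) {u : ℕ → GamPi π lam} {y : GamAnCon π lam}
    (h : IsRep u y) (hu : CauR r u) (k : ℕ) : IsRep (fun i => u (i + k)) y := by
  refine h.congr (isRep_zero_iff.2 ⟨⟨r, hr, hu.sub hπ hr (hu.shift k)⟩, r, hr, ?_⟩)
  intro s hs hsr C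
  obtain ⟨N, hN⟩ := hu.2 s hs hsr C
  exact ⟨N, fun i hi => hN i hi (i + k) (by omega)⟩

/-- `y ∈ Γ_an,r`. -/
def MemAn (r : ℝ) (y : GamAnCon π lam) : Prop := ∃ u, CauR r u ∧ IsRep u y

theorem gEAn_iff_exists (hπ : π ≠ 0) {r s C : ℝ} (hs : 0 < s) {y : GamAnCon π lam} :
    GEAn r s C y ↔ ∃ u, CauR r u ∧ IsRep u y ∧ ∀ i, PiGE s C (u i) := by
  constructor
  · rintro ⟨x, hx, rfl, h⟩
    exact ⟨x.1, hx, ⟨x.2, rfl⟩, fun i => ((gE_iff hπ hs).1 (h i)).2⟩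
  · rintro ⟨u, hu, ⟨h, rfl⟩, hC⟩
    exact ⟨⟨u, h⟩, hu, rfl, fun i => (gE_iff hπ hs).2 ⟨hu.1 i, hC i⟩⟩

/-- Any two representatives differ by a null sequence, so the bound can be read on each of them;
dropping initial terms turns an eventual bound into one for all terms. -/
theorem gEAn_iff_eventually (hπ : π ≠ 0) {r s C : ℝ} (hs : 0 < s) (hsr : s ≤ r)
    {y : GamAnCon π lam} {u : ℕ → GamPi π lam} (hu : CauR r u) (huy : IsRep u y) :
    GEAn s s C y ↔ ∀ᶠ i in atTop, PiGE s C (u i) := by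
  have hus := hu.mono hs hsr
  rw [gEAn_iff_exists hπ hs]
  constructor
  · rintro ⟨v, hv, hvy, hC⟩
    have h1 := huy.sub hvy
    rw [sub_self] at h1
    refine ((h1.nullR hπ (hus.sub hπ hs hv)).eventually hπ hs le_rfl C).mono fun i hi => ?_
    have := PiGE.add hπ hi (hC i)
    rwa [Pi.sub_apply, sub_add_cancel] at this
  · intro h
    obtain ⟨N, hN⟩ := eventually_atTop.1 h
    exact ⟨_, hus.shift N, huy.shift hπ hs hus N, fun i => hN _ (by omega)⟩

theorem gEAn_iff (hπ : π ≠ 0) {r s C : ℝ} (hs : 0 < s) (hsr : s ≤ r) {y : GamAnCon π lam} :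
    GEAn r s C y ↔ MemAn r y ∧ GEAn s s C y := by
  constructor
  · intro h
    obtain ⟨u, hu, huy, hC⟩ := (gEAn_iff_exists hπ hs).1 h
    exact ⟨⟨u, hu, huy⟩, (gEAn_iff_eventually hπ hs hsr hu huy).2 (Eventually.of_forall hC)⟩
  · rintro ⟨⟨u, hu, huy⟩, h⟩
    obtain ⟨N, hN⟩ := eventually_atTop.1 ((gEAn_iff_eventually hπ hs hsr hu huy).1 h)
    exact (gEAn_iff_exists hπ hs).2 ⟨_, hu.shift N, huy.shift hπ (hs.trans_le hsr) hu N,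
      fun i => hN _ (by omega)⟩

theorem MemAn.mono {r t : ℝ} (ht : 0 < t) (htr : t ≤ r) {y : GamAnCon π lam} (h : MemAn r y) :
    MemAn t y := by
  obtain ⟨u, hu, huy⟩ := h
  exact ⟨u, hu.mono ht htr, huy⟩

theorem MemAn.add (hπ : π ≠ 0) {r : ℝ} (hr : 0 < r) {x y : GamAnCon π lam} (hx : MemAn r x)
    (hy : MemAn r y) : MemAn r (x + y) := by
  obtain ⟨u, hu, hux⟩ := hx
  obtain ⟨v, hv, hvy⟩ := hy
  exact ⟨_, hu.add hπ hr hv, hux.add hvy⟩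

theorem MemAn.mul (hπ : π ≠ 0) {r : ℝ} (hr : 0 < r) {x y : GamAnCon π lam} (hx : MemAn r x)
    (hy : MemAn r y) : MemAn r (x * y) := by
  obtain ⟨u, hu, hux⟩ := hx
  obtain ⟨v, hv, hvy⟩ := hy
  exact ⟨_, hu.mul hπ hr hv, hux.mul hvy⟩

theorem MemAn.neg (hπ : π ≠ 0) {r : ℝ} (hr : 0 < r) {x : GamAnCon π lam} (hx : MemAn r x) :
    MemAn r (-x) := by
  obtain ⟨u, hu, hux⟩ := hx
  exact ⟨_, hu.neg hπ hr, hux.neg⟩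

theorem GEAn.anti {r s C D : ℝ} (hr : 0 < r) (hCD : D ≤ C) {y : GamAnCon π lam}
    (h : GEAn r s C y) : GEAn r s D y := by
  obtain ⟨x, hx, hxy, hC⟩ := h
  exact ⟨x, hx, hxy, fun i => (hC i).mono hr le_rfl hCD⟩

theorem GEAn.add (hπ : π ≠ 0) {s C : ℝ} (hs : 0 < s) {x y : GamAnCon π lam}
    (hx : GEAn s s C x) (hy : GEAn s s C y) : GEAn s s C (x + y) := by
  obtain ⟨u, hu, hux, h1⟩ := (gEAn_iff_exists hπ hs).1 hx
  obtain ⟨v, hv, hvy, h2⟩ := (gEAn_iff_exists hπ hs).1 hy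
  exact (gEAn_iff_exists hπ hs).2 ⟨_, hu.add hπ hs hv, hux.add hvy, fun i => (h1 i).add hπ (h2 i)⟩

theorem GEAn.neg (hπ : π ≠ 0) {s C : ℝ} (hs : 0 < s) {x : GamAnCon π lam}
    (hx : GEAn s s C x) : GEAn s s C (-x) := by
  obtain ⟨u, hu, hux, h1⟩ := (gEAn_iff_exists hπ hs).1 hx
  exact (gEAn_iff_exists hπ hs).2 ⟨_, hu.neg hπ hs, hux.neg, fun i => (h1 i).neg⟩

theorem GEAn.mul (hπ : π ≠ 0) {s C D : ℝ} (hs : 0 < s) {x y : GamAnCon π lam}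
    (hx : GEAn s s C x) (hy : GEAn s s D y) : GEAn s s (C + D) (x * y) := by
  obtain ⟨u, hu, hux, h1⟩ := (gEAn_iff_exists hπ hs).1 hx
  obtain ⟨v, hv, hvy, h2⟩ := (gEAn_iff_exists hπ hs).1 hy
  exact (gEAn_iff_exists hπ hs).2 ⟨_, hu.mul hπ hs hv, hux.mul hvy, fun i => (h1 i).mul hπ (h2 i)⟩

/-- The canonical map from `Γ_con[1/π]` to `Γ_an,con`. -/
def conToAn (π : 𝔬) (lam : L →+ ℝ) : GamConPi π lam →ₐ[𝔬] GamAnCon π lam :=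
  (GamAnCon.mk π lam).comp
    (((Pi.constAlgHom 𝔬 ℕ (GamPi π lam)).comp (GamConPi π lam).val).codRestrict
      (CauchySeqs π lam) (by
        rintro ⟨x, r, hr, hx⟩
        exact ⟨r, hr, CauR.const hr hx⟩))

theorem isRep_conToAn (x : GamConPi π lam) :
    IsRep (fun _ => (x : GamPi π lam)) (conToAn π lam x) := ⟨_, rfl⟩

theorem memAn_conToAn {r : ℝ} (hr : 0 < r) {x : GamConPi π lam} (hx : MemR r (x : GamPi π lam)) :
    MemAn r (conToAn π lam x) := ⟨_, CauR.const hr hx, isRep_conToAn x⟩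

theorem gEAn_conToAn_iff (hπ : π ≠ 0) {s C : ℝ} (hs : 0 < s) {x : GamConPi π lam}
    (hx : MemR s (x : GamPi π lam)) :
    GEAn s s C (conToAn π lam x) ↔ PiGE s C (x : GamPi π lam) := by
  rw [gEAn_iff_eventually hπ hs le_rfl (CauR.const hs hx) (isRep_conToAn x)]
  exact eventually_const

end AnBasics

/-! ### Extension of bounded maps to `Γ_an,con` -/

section AnMaps

variable {𝔬 : Type*} [CommRing 𝔬] {L : Type*} [AddCommGroup L] [LinearOrder L]
  [IsOrderedAddMonoid L] {π : 𝔬} {lam : L →+ ℝ}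

theorem IsRep.unique {u : ℕ → GamPi π lam} {y w : GamAnCon π lam} (h : IsRep u y)
    (h' : IsRep u w) : y = w := by
  obtain ⟨_, rfl⟩ := h
  obtain ⟨_, rfl⟩ := h'
  rfl

theorem IsRep.nsmul {u : ℕ → GamPi π lam} {y : GamAnCon π lam} (h : IsRep u y) (n : ℕ) :
    IsRep (n • u) (n • y) := by
  obtain ⟨hu, rfl⟩ := h
  exact ⟨nsmul_mem hu n, map_nsmul (GamAnCon.mk π lam) n ⟨u, hu⟩⟩

variable [IsDomain 𝔬]

/-- The additive map `T` of `Γ[1/π]` does not decrease the valuations, if `w_s` is replaced by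
`w_{s/κ}`, for `s ≤ r₀`. -/
structure IsBounded (T : GamPi π lam →+ GamPi π lam) (κ r₀ : ℝ) : Prop where
  pos : 0 < κ
  radius_pos : 0 < r₀
  map_memR : ∀ {r x}, 0 < r → r ≤ r₀ → MemR r x → MemR (r / κ) (T x)
  map_piGE : ∀ {s C x}, 0 < s → s ≤ r₀ → PiGE s C x → PiGE (s / κ) C (T x)

variable {T : GamPi π lam →+ GamPi π lam} {κ r₀ : ℝ}

theorem IsBounded.cauR (hT : IsBounded T κ r₀) (hπ : π ≠ 0) {r : ℝ} (hr : 0 < r) (hrr : r ≤ r₀)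
    {u : ℕ → GamPi π lam} (hu : CauR r u) : CauR (r / κ) fun i => T (u i) := by
  rw [cauR_iff hπ] at *
  refine ⟨fun i => hT.map_memR hr hrr (hu.1 i), fun s hs hsr C => ?_⟩
  rw [le_div_iff₀ hT.pos] at hsr
  have hs' := mul_pos hs hT.pos
  obtain ⟨N, hN⟩ := hu.2 (s * κ) hs' hsr C
  refine ⟨N, fun i hi j hj => ?_⟩
  have := hT.map_piGE hs' (hsr.trans hrr) (hN i hi j hj)
  rwa [mul_div_cancel_right₀ _ hT.pos.ne', map_sub] at this

theorem IsBounded.mem_cauchySeqs (hT : IsBounded T κ r₀) (hπ : π ≠ 0) {u : ℕ → GamPi π lam}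
    (hu : u ∈ CauchySeqs π lam) : (fun i => T (u i)) ∈ CauchySeqs π lam := by
  obtain ⟨r, hr, hu⟩ := hu
  have hm := lt_min hr hT.radius_pos
  exact ⟨_, div_pos hm hT.pos, hT.cauR hπ hm (min_le_right _ _) (hu.mono hm (min_le_left _ _))⟩

theorem IsBounded.isRep_zero (hT : IsBounded T κ r₀) (hπ : π ≠ 0) {u : ℕ → GamPi π lam}
    (hu : IsRep u 0) : IsRep (fun i => T (u i)) 0 := by
  obtain ⟨hu, r, hr, hn⟩ := isRep_zero_iff.1 hu
  have hm := lt_min hr hT.radius_pos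
  refine isRep_zero_iff.2 ⟨hT.mem_cauchySeqs hπ hu, min r r₀ / κ, div_pos hm hT.pos, ?_⟩
  intro s hs hsr C
  rw [le_div_iff₀ hT.pos] at hsr
  have hs' := mul_pos hs hT.pos
  obtain ⟨N, hN⟩ := hn (s * κ) hs' (hsr.trans (min_le_left _ _)) C
  refine ⟨N, fun i hi => (gE_iff hπ hs).2 ?_⟩
  obtain ⟨h1, h2⟩ := (gE_iff hπ hs').1 (hN i hi)
  have h3 := hT.map_piGE hs' (hsr.trans (min_le_right _ _)) h2
  rw [mul_div_cancel_right₀ _ hT.pos.ne'] at h3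
  exact ⟨hT.map_memR hm (min_le_right _ _) (h1.mono hm (min_le_left _ _)), h3⟩

/-- A bounded map extends to `Γ_an,con`. -/
theorem IsBounded.exists_extension (hT : IsBounded T κ r₀) (hπ : π ≠ 0) :
    ∃ f : GamAnCon π lam → GamAnCon π lam, ∀ u y, IsRep u y → IsRep (fun i => T (u i)) (f y) := by
  have h : ∀ y : GamAnCon π lam, ∃ w, ∀ u, IsRep u y → IsRep (fun i => T (u i)) w := by
    rintro y
    obtain ⟨u, r, hr, hu, huy⟩ := exists_isRep y
    refine ⟨_, fun v hv => IsRep.congr (⟨hT.mem_cauchySeqs hπ ⟨r, hr, hu⟩, rfl⟩ :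
      IsRep (fun i => T (u i)) _) ?_⟩
    have h1 := huy.sub hv
    rw [sub_self] at h1
    have h2 := hT.isRep_zero hπ h1
    convert h2 using 1
    funext i
    simp only [Pi.sub_apply, map_sub]
  choose f hf using h
  exact ⟨f, fun u y => hf y u⟩

theorem IsBounded.memAn (hT : IsBounded T κ r₀) (hπ : π ≠ 0) {f : GamAnCon π lam → GamAnCon π lam}
    (hf : ∀ u y, IsRep u y → IsRep (fun i => T (u i)) (f y)) {r : ℝ} (hr : 0 < r) (hrr : r ≤ r₀)
    {y : GamAnCon π lam} (hy : MemAn r y) : MemAn (r / κ) (f y) := by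
  obtain ⟨u, hu, huy⟩ := hy
  exact ⟨_, hT.cauR hπ hr hrr hu, hf _ _ huy⟩

theorem IsBounded.gEAn (hT : IsBounded T κ r₀) (hπ : π ≠ 0) {f : GamAnCon π lam → GamAnCon π lam}
    (hf : ∀ u y, IsRep u y → IsRep (fun i => T (u i)) (f y)) {s C : ℝ} (hs : 0 < s) (hsr : s ≤ r₀)
    {y : GamAnCon π lam} (hy : GEAn s s C y) : GEAn (s / κ) (s / κ) C (f y) := by
  obtain ⟨u, hu, huy, h⟩ := (gEAn_iff_exists hπ hs).1 hy
  exact (gEAn_iff_exists hπ (div_pos hs hT.pos)).2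
    ⟨_, hT.cauR hπ hs hsr hu, hf _ _ huy, fun i => hT.map_piGE hs hsr (h i)⟩

theorem exists_ringHom_an (hπ : π ≠ 0) {φ : GamPi π lam →+* GamPi π lam}
    (hφ : IsBounded (φ : GamPi π lam →+ GamPi π lam) κ r₀) :
    ∃ ψ : GamAnCon π lam →+* GamAnCon π lam,
      ∀ u y, IsRep u y → IsRep (fun i => φ (u i)) (ψ y) := by
  obtain ⟨f, hf⟩ := hφ.exists_extension hπ
  have hc : ∀ c : 𝔬, φ (algebraMap 𝔬 _ c) = algebraMap 𝔬 _ c →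
      f (algebraMap 𝔬 _ c) = algebraMap 𝔬 _ c := fun c hc => by
    have h1 : IsRep (fun _ => φ (algebraMap 𝔬 _ c)) _ := hf _ _ (IsRep.algebraMap c)
    rw [hc] at h1
    exact h1.unique (IsRep.algebraMap c)
  refine ⟨{ toFun := f, map_one' := ?_, map_mul' := fun x y => ?_, map_zero' := ?_,
            map_add' := fun x y => ?_ }, hf⟩
  · simpa using hc 1
  · obtain ⟨u, _, _, _, hu⟩ := exists_isRep x
    obtain ⟨v, _, _, _, hv⟩ := exists_isRep y
    refine (hf _ _ (hu.mul hv)).unique ?_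
    convert (hf _ _ hu).mul (hf _ _ hv) using 1
    funext i
    exact map_mul φ (u i) (v i)
  · simpa using hc 0
  · obtain ⟨u, _, _, _, hu⟩ := exists_isRep x
    obtain ⟨v, _, _, _, hv⟩ := exists_isRep y
    refine (hf _ _ (hu.add hv)).unique ?_
    convert (hf _ _ hu).add (hf _ _ hv) using 1
    funext i
    exact map_add φ (u i) (v i)

theorem exists_derivation_an (hπ : π ≠ 0) {T : Derivation 𝔬 (GamPi π lam) (GamPi π lam)}
    (hT : IsBounded (T : GamPi π lam →ₗ[𝔬] GamPi π lam).toAddMonoidHom κ r₀) :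
    ∃ D : Derivation 𝔬 (GamAnCon π lam) (GamAnCon π lam),
      ∀ u y, IsRep u y → IsRep (fun i => T (u i)) (D y) := by
  obtain ⟨f, hf⟩ := hT.exists_extension hπ
  refine ⟨Derivation.mk'
    { toFun := f, map_add' := fun x y => ?_, map_smul' := fun c x => ?_ } fun x y => ?_, hf⟩
  · obtain ⟨u, _, _, _, hu⟩ := exists_isRep x
    obtain ⟨v, _, _, _, hv⟩ := exists_isRep y
    refine (hf _ _ (hu.add hv)).unique ?_
    convert (hf _ _ hu).add (hf _ _ hv) using 1
    funext i
    exact map_add T (u i) (v i)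
  · obtain ⟨u, _, _, _, hu⟩ := exists_isRep x
    rw [RingHom.id_apply, Algebra.smul_def, Algebra.smul_def]
    refine (hf _ _ ((IsRep.algebraMap c).mul hu)).unique ?_
    convert (IsRep.algebraMap c).mul (hf _ _ hu) using 1
    funext i
    change T (algebraMap 𝔬 _ c * u i) = algebraMap 𝔬 _ c * T (u i)
    rw [← Algebra.smul_def, ← Algebra.smul_def, T.map_smul]
  · obtain ⟨u, _, _, _, hu⟩ := exists_isRep x
    obtain ⟨v, _, _, _, hv⟩ := exists_isRep y
    refine (hf _ _ (hu.mul hv)).unique ?_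
    change IsRep _ (x * f y + y * f x)
    convert (hu.mul (hf _ _ hv)).add (hv.mul (hf _ _ hu)) using 1
    funext i
    exact T.leibniz (u i) (v i)

theorem isRep_fallProd {T : Derivation 𝔬 (GamPi π lam) (GamPi π lam)}
    {D : Derivation 𝔬 (GamAnCon π lam) (GamAnCon π lam)}
    (hD : ∀ u y, IsRep u y → IsRep (fun i => T (u i)) (D y)) (t P : ℕ) {u : ℕ → GamPi π lam}
    {y : GamAnCon π lam} (h : IsRep u y) :
    IsRep (fun i => fallProd (derEnd T) t P (u i)) (fallProd (derEnd D) t P y) := by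
  induction P generalizing u y with
  | zero => exact h
  | succ P ih =>
    have := ih ((hD _ _ h).sub (h.nsmul (t + P)))
    rw [fallProd_succ, fallProd_succ]
    exact this

end AnMaps

/-! ### Approximation and completeness in `Γ_an,con` -/

section AnComplete

variable {𝔬 : Type*} [CommRing 𝔬] {L : Type*} [AddCommGroup L] [LinearOrder L]
  [IsOrderedAddMonoid L] {π : 𝔬} {lam : L →+ ℝ} [IsDomain 𝔬]

theorem memR_zero {r : ℝ} (hr : 0 < r) : MemR r (0 : GamPi π lam) := by
  simpa using MemR.algebraMap (π := π) (lam := lam) hr 0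

/-- The elements of `Γ_an,s` with `w_s ≥ C`, for `s > 0`. -/
def anGEGroup (lam : L →+ ℝ) (hπ : π ≠ 0) (s C : ℝ) : AddSubgroup (GamAnCon π lam) where
  carrier := {y | 0 < s → GEAn s s C y}
  zero_mem' hs := (gEAn_iff_exists hπ hs).2
    ⟨_, CauR.const hs (memR_zero hs), isRep_zero,
      fun _ => PiGE.zero _ _⟩
  add_mem' hx hy hs := (hx hs).add hπ hs (hy hs)
  neg_mem' hx hs := (hx hs).neg hπ hs

/-- The group `Γ_an,r`, for `r > 0`. -/
def memAnGroup (lam : L →+ ℝ) (hπ : π ≠ 0) (r : ℝ) : AddSubgroup (GamAnCon π lam) where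
  carrier := {y | 0 < r → MemAn r y}
  zero_mem' hr := ⟨_, CauR.const hr (memR_zero hr), isRep_zero⟩
  add_mem' hx hy hr := (hx hr).add hπ hr (hy hr)
  neg_mem' hx hr := (hx hr).neg hπ hr

/-- A late term of a representing sequence is close for `w_t` and for `w_r`, hence, by convexity,
uniformly for all `s` between `t` and `r`. -/
theorem MemAn.exists_approx (hπ : π ≠ 0) {r t : ℝ} (ht : 0 < t) (htr : t ≤ r) {y : GamAnCon π lam}
    (hy : MemAn r y) (C : ℝ) : ∃ x : GamConPi π lam, MemR r (x : GamPi π lam) ∧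
      ∀ s, t ≤ s → s ≤ r → GEAn s s C (y - conToAn π lam x) := by
  have hr := ht.trans_le htr
  obtain ⟨u, hu, huy⟩ := hy
  obtain ⟨N, hN⟩ := ((cauR_iff hπ).1 hu).2 t ht htr C
  obtain ⟨M, hM⟩ := ((cauR_iff hπ).1 hu).2 r hr le_rfl C
  refine ⟨⟨u (max N M), r, hr, hu.1 _⟩, hu.1 _, fun s hts hsr => ?_⟩
  rw [gEAn_iff_eventually hπ (ht.trans_le hts) hsr (hu.sub hπ hr (CauR.const hr (hu.1 (max N M))))
    (huy.sub (isRep_conToAn ⟨u (max N M), r, hr, hu.1 _⟩))]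
  refine eventually_atTop.2 ⟨max N M, fun i hi => ?_⟩
  exact (hN i ((le_max_left _ _).trans hi) _ (le_max_left _ _)).of_endpoints hπ
    (hM i ((le_max_right _ _).trans hi) _ (le_max_right _ _)) hts hsr

/-- A diagonal argument: approximate the `k`-th partial sum by an element of `Γ_r[1/π]` to accuracy
`k` on `[r/(k+1), r]`. For each fixed `s` this is eventually as accurate as wanted, so the
approximations form a Cauchy sequence, and the element it represents is the sum. -/
theorem exists_sum_an (hπ : π ≠ 0) {r : ℝ} (hr : 0 < r) (f : ℕ → GamAnCon π lam)
    (hf : ∀ i, MemAn r (f i))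
    (h : ∀ s, 0 < s → s ≤ r → ∀ C, ∀ᶠ i in atTop, GEAn s s C (f i)) :
    ∃ y, MemAn r y ∧ ∀ s, 0 < s → s ≤ r → ∀ C,
      ∀ᶠ k in atTop, GEAn s s C (∑ i ∈ Finset.range k, f i - y) := by
  let S : ℕ → GamAnCon π lam := fun k => ∑ i ∈ Finset.range k, f i
  have hS : ∀ k, MemAn r (S k) := fun k =>
    (memAnGroup lam hπ r).sum_mem (fun i _ _ => hf i) hr
  have hk : ∀ k : ℕ, 0 < r / (k + 1) := fun k => by positivity
  choose x hx hSx using fun k : ℕ => (hS k).exists_approx hπ (hk k)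
    (div_le_self hr.le (by
      have : (0 : ℝ) ≤ k := k.cast_nonneg
      linarith)) k
  have hSx' : ∀ s, 0 < s → s ≤ r → ∀ C, ∀ᶠ k in atTop, GEAn s s C (S k - conToAn π lam (x k)) := by
    intro s hs hsr C
    obtain ⟨N, hN⟩ := exists_nat_ge (max C (r / s))
    refine eventually_atTop.2 ⟨N, fun k hk => ?_⟩
    have h1 : (N : ℝ) ≤ k := by exact_mod_cast hk
    refine (hSx k s ?_ hsr).anti hs (((le_max_left _ _).trans hN).trans h1)
    have h2 := ((le_max_right _ _).trans hN).trans h1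
    rw [div_le_iff₀ hs] at h2
    rw [div_le_iff₀ (by positivity)]
    linarith
  have hcau : CauR r fun k => (x k : GamPi π lam) := by
    refine (cauR_iff hπ).2 ⟨hx, fun s hs hsr C => ?_⟩
    obtain ⟨N, hN⟩ := eventually_atTop.1 ((h s hs hsr C).and (hSx' s hs hsr C))
    refine ⟨N, fun i hi j hj => ?_⟩
    have h1 : ∀ k ≥ N, S k - S N ∈ anGEGroup lam hπ s C := fun k hk => by
      change ∑ i ∈ Finset.range k, f i - ∑ i ∈ Finset.range N, f i ∈ _
      rw [← Finset.sum_Ico_eq_sub _ hk]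
      exact sum_mem fun l hl _ => (hN l (Finset.mem_Ico.1 hl).1).1
    have h2 : ∀ k ≥ N, S k - conToAn π lam (x k) ∈ anGEGroup lam hπ s C := fun k hk _ =>
      (hN k hk).2
    have h3 := sub_mem (sub_mem (h1 i hi) (h2 i hi)) (sub_mem (h1 j hj) (h2 j hj))
    rw [show S i - S N - (S i - conToAn π lam (x i)) - (S j - S N - (S j - conToAn π lam (x j))) =
      conToAn π lam (x i - x j) by rw [map_sub]; ring] at h3
    exact (gEAn_conToAn_iff hπ hs (((hx i).sub hr (hx j)).mono hs hsr)).1 (h3 hs)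
  obtain ⟨y, hy⟩ := hcau.exists_isRep hr
  refine ⟨y, ⟨_, hcau, hy⟩, fun s hs hsr C => ?_⟩
  obtain ⟨N, hN⟩ := ((cauR_iff hπ).1 hcau).2 s hs hsr C
  filter_upwards [hSx' s hs hsr C, eventually_ge_atTop N] with k h1 hk
  have h2 : GEAn s s C (conToAn π lam (x k) - y) := by
    rw [gEAn_iff_eventually hπ hs hsr ((CauR.const hr (hx k)).sub hπ hr hcau)
      ((isRep_conToAn _).sub hy)]
    exact eventually_atTop.2 ⟨N, fun i hi => hN k hk i hi⟩
  have := h1.add hπ hs h2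
  rwa [sub_add_sub_cancel] at this

end AnComplete

/-! ### `Γ_an,con` as a union of Fréchet rings -/

section AnCon

universe u w

variable {𝔬 : Type*} [CommRing 𝔬] {L : Type*} [AddCommGroup L] [LinearOrder L]
  [IsOrderedAddMonoid L] {π : 𝔬} {lam : L →+ ℝ} [IsDomain 𝔬] {m : ℕ}
  {z : Module.Basis (Fin m) ℤ L} {q : ℕ} {σK : 𝔬 →+* 𝔬} {σ σ₁ σ₂ : Gam π lam →+* Gam π lam}
  {ρ : ℝ}

theorem isBounded_deriv {T : Derivation 𝔬 (GamPi π lam) (GamPi π lam)} {mu : L →+ ℤ}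
    (hπ : π ≠ 0) (hT : ∀ x k a, x * piLoc π lam ^ k = toPi π lam a →
      T x * piLoc π lam ^ k = toPi π lam (partialMu mu a)) {r₀ : ℝ} (hr₀ : 0 < r₀) :
    IsBounded (T : GamPi π lam →ₗ[𝔬] GamPi π lam).toAddMonoidHom 1 r₀ where
  pos := one_pos
  radius_pos := hr₀
  map_memR hr _ hx := by
    rw [div_one]
    exact hx.deriv hπ hT hr
  map_piGE _ _ hx := by
    rw [div_one]
    exact hx.deriv hπ hT

theorem isRep_toAnCon (a : GamCon π lam) :
    IsRep (fun _ => toPi π lam (a : Gam π lam)) (toAnCon π lam a) :=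
  isRep_conToAn (toConPi π lam a)

theorem exists_natCast_inv_conPi (hπ : π ≠ 0) {p e : ℕ}
    (he : ∀ k : ℕ, k ≠ 0 → ∃ u : 𝔬ˣ, (k : 𝔬) = u * π ^ (e * padicValNat p k)) {k : ℕ}
    (hk : k ≠ 0) : ∃ x : GamAnCon π lam, x * k = 1 ∧
      (∀ s, 0 < s → GEAn s s (-(e * padicValNat p k)) x) ∧ ∀ r, 0 < r → MemAn r x := by
  obtain ⟨y, hy, h1, h2⟩ := exists_natCast_inv (lam := lam) hπ he hk
  let y' : GamConPi π lam := ⟨y, 1, one_pos, h2 1 one_pos⟩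
  refine ⟨conToAn π lam y', ?_, fun s hs => (gEAn_conToAn_iff hπ hs (h2 s hs)).2 (h1 s),
    fun r hr => memAn_conToAn hr (h2 r hr)⟩
  rw [← map_natCast (conToAn π lam), ← map_mul, ← map_one (conToAn π lam)]
  exact congrArg _ (Subtype.ext hy)

theorem GEAn.natCast (hπ : π ≠ 0) {p e : ℕ}
    (he : ∀ k : ℕ, k ≠ 0 → ∃ u : 𝔬ˣ, (k : 𝔬) = u * π ^ (e * padicValNat p k)) {k : ℕ}
    (hk : k ≠ 0) {s : ℝ} (hs : 0 < s) : GEAn s s (e * padicValNat p k) (k : GamAnCon π lam) := by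
  have hm : MemR s ((k : GamConPi π lam) : GamPi π lam) := by
    have := MemR.algebraMap (π := π) (lam := lam) hs (k : 𝔬)
    rwa [map_natCast] at this
  rw [← map_natCast (conToAn π lam), gEAn_conToAn_iff hπ hs hm]
  exact PiGE.natCast hπ he hk s

theorem MemAn.exists_gEAn (hπ : π ≠ 0) {r s : ℝ} (hs : 0 < s) (hsr : s ≤ r) {y : GamAnCon π lam}
    (hy : MemAn r y) : ∃ C, GEAn s s C y := by
  obtain ⟨u, hu, huy⟩ := hy
  obtain ⟨B, hB⟩ := hu.bdd hs hsr
  exact ⟨B, (gEAn_iff_eventually hπ hs hsr hu huy).2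
    (Eventually.of_forall fun i => ((gE_iff hπ hs).1 (hB i)).2)⟩

theorem GEAn.of_endpoints (hπ : π ≠ 0) {t s r C : ℝ} (ht0 : 0 < t) {y : GamAnCon π lam}
    (hy : MemAn r y) (ht : GEAn t t C y) (hr : GEAn r r C y) (hts : t ≤ s) (hsr : s ≤ r) :
    GEAn s s C y := by
  obtain ⟨u, hu, huy⟩ := hy
  have hs := ht0.trans_le hts
  rw [gEAn_iff_eventually hπ ht0 (hts.trans hsr) hu huy] at ht
  rw [gEAn_iff_eventually hπ (hs.trans_le hsr) le_rfl hu huy] at hr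
  rw [gEAn_iff_eventually hπ hs hsr hu huy]
  filter_upwards [ht, hr] with i h1 h2
  exact h1.of_endpoints hπ h2 hts hsr

theorem eq_zero_of_gEAn (hπ : π ≠ 0) {s : ℝ} (hs : 0 < s) {y : GamAnCon π lam}
    (h : ∀ C, GEAn s s C y) : y = 0 := by
  obtain ⟨u, hu, huy, -⟩ := (gEAn_iff_exists hπ hs).1 (h 0)
  refine huy.unique (isRep_zero_iff.2 ⟨⟨s, hs, hu⟩, s, hs, hu.nullR hπ fun z d => ?_⟩)
  refine ((gEAn_iff_eventually hπ hs le_rfl hu huy).1 (h (d + s * lam z))).mono fun i hi => ?_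
  exact (hi z).anti (by linarith)

variable [IsDiscreteValuationRing 𝔬] [IsAdicComplete (IsLocalRing.maximalIdeal 𝔬) 𝔬]

/-- `Γ_an,con` as a union of Fréchet rings, for the valuations `w_s`, `s ∈ (0, r]`. -/
def frechetUnionAnCon (hπ : Irreducible π) {p e q : ℕ} (hq : 1 < q)
    (he : ∀ k : ℕ, k ≠ 0 → ∃ u : 𝔬ˣ, (k : 𝔬) = u * π ^ (e * padicValNat p k))
    {T : Fin m → Derivation 𝔬 (GamPi π lam) (GamPi π lam)}
    (hT : ∀ i x k a, x * piLoc π lam ^ k = toPi π lam a →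
      T i x * piLoc π lam ^ k = toPi π lam (partialMu (z.coord i).toAddMonoidHom a))
    {D : Fin m → Derivation 𝔬 (GamAnCon π lam) (GamAnCon π lam)}
    (hD : ∀ i u y, IsRep u y → IsRep (fun j => T i (u j)) (D i y)) :
    FrechetUnion π p e q D (coordUnits z (toAnCon π lam)) where
  -- There is no `w_0`: the completions involve positive `s` only, and coefficients may be
  -- `π`-adically unbounded.
  I := Set.Ioi 0
  Mem r := memAnGroup lam hπ.ne_zero r
  W s C := anGEGroup lam hπ.ne_zero s C
  nonneg s hs := le_of_lt hs
  mem_I s hs := hs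
  Mem_anti ht htr x hx _ := (hx (ht.trans_le htr)).mono ht htr
  Mem_mul hx hy hr := (hx hr).mul hπ.ne_zero hr (hy hr)
  Mem_algebraMap c hr := by
    rw [← (conToAn π lam).commutes]
    exact memAn_conToAn hr (MemR.algebraMap hr c)
  Mem_natCast_mul := by
    intro r k x hk hx hr
    obtain ⟨y, hy, -, hy'⟩ := exists_natCast_inv_conPi (lam := lam) hπ.ne_zero he hk
    have := (hy' r hr).mul hπ.ne_zero hr (hx hr)
    rwa [← mul_assoc, hy, one_mul] at this
  W_anti hC x hx hs := (hx hs).anti hs hC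
  W_mul hx hy hs := (hx hs).mul hπ.ne_zero hs (hy hs)
  W_algebraMap c hs := by
    rw [← (conToAn π lam).commutes]
    exact (gEAn_conToAn_iff hπ.ne_zero hs (MemR.algebraMap hs c)).2 (PiGE.const _ c hπ.ne_zero)
  W_natCast_mul := by
    intro s C k x hk
    constructor
    · intro hx hs
      obtain ⟨y, hy, hy', -⟩ := exists_natCast_inv_conPi (lam := lam) hπ.ne_zero he hk
      have := (hy' s hs).mul hπ.ne_zero hs (hx hs)
      rw [← mul_assoc, hy, one_mul] at this
      exact this.anti hs (by linarith)
    · intro hx hs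
      exact ((GEAn.natCast hπ.ne_zero he hk hs).mul hπ.ne_zero hs (hx hs)).anti hs (by linarith)
  exists_Mem x := by
    obtain ⟨u, r, hr, hu, hux⟩ := exists_isRep x
    exact ⟨r, hr, fun _ => ⟨u, hu, hux⟩⟩
  exists_W := by
    intro r x hr hx s hs hsr
    obtain ⟨C, hC⟩ := (hx hr).exists_gEAn hπ.ne_zero hs hsr
    exact ⟨C, fun _ => hC⟩
  exists_W_unif := by
    intro r x hr hx
    have hq' : (1 : ℝ) < q := by exact_mod_cast hq
    have hrq : 0 < r / q := div_pos hr (by linarith)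
    -- By convexity the bounds at the endpoints `r/q` and `r` hold on the whole period.
    obtain ⟨A, hA⟩ := (hx hr).exists_gEAn hπ.ne_zero hrq (div_le_self hr.le hq'.le)
    obtain ⟨B, hB⟩ := (hx hr).exists_gEAn hπ.ne_zero hr le_rfl
    refine ⟨min A B, fun s hs hsr h _ => ?_⟩
    rcases h with rfl | h
    · exact absurd hs (lt_irrefl (0 : ℝ))
    · exact GEAn.of_endpoints hπ.ne_zero hrq (hx hr) (hA.anti hrq (min_le_left _ _))
        (hB.anti hr (min_le_right _ _)) h hsr
  sep hs h := eq_zero_of_gEAn hπ.ne_zero hs fun C => h C hs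
  complete := by
    intro r f hr hf h
    obtain ⟨y, hy, hy'⟩ := exists_sum_an hπ.ne_zero hr f (fun i => hf i hr)
      fun s hs hsr C => (h s hs hsr C).mono fun i hi => hi hs
    exact ⟨y, fun _ => hy, fun s hs hsr C => (hy' s hs hsr C).mono fun k hk _ => hk⟩
  dense := by
    intro Q h0 h1 h2 h3 y
    obtain ⟨u, r, hr, hu, huy⟩ := exists_isRep y
    have hy : MemAn r y := ⟨u, hu, huy⟩
    refine ⟨r, hr, fun s hs hsr C => ?_⟩
    obtain ⟨x, hx, hxy⟩ := hy.exists_approx hπ.ne_zero hs hsr C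
    obtain ⟨x', hx'Q, hx', hxx'⟩ := exists_mem_subring (z := z) hπ
      (Q.comap (conToAn π lam : GamConPi π lam →+* GamAnCon π lam))
      (fun c => by
        change conToAn π lam _ ∈ Q
        rw [AlgHom.commutes]
        exact h0 c) h1 h2 (fun x hx => by
        change conToAn π lam _ ∈ Q at hx
        rw [map_mul, AlgHom.commutes] at hx
        exact h3 _ hx) hs hsr hx C
    refine ⟨conToAn π lam x', hx'Q, ?_, ?_⟩
    · exact sub_mem (S := AddSubgroup (GamAnCon π lam)) (fun _ => hy)
        (fun _ => memAn_conToAn hr hx')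
    · intro _
      have h4 := (gEAn_conToAn_iff (x := x - x') hπ.ne_zero hs
        ((hx.sub hr hx').mono hs hsr)).2 hxx'
      have h5 := (hxy s le_rfl hsr).add hπ.ne_zero hs h4
      rwa [map_sub, sub_add_sub_cancel] at h5
  D_Mem := by
    intro r x i hx hr
    have := (isBounded_deriv hπ.ne_zero (hT i) hr).memAn hπ.ne_zero (hD i) hr le_rfl (hx hr)
    rwa [div_one] at this
  D_W := by
    intro s C x i hx hs
    have := (isBounded_deriv hπ.ne_zero (hT i) hs).gEAn hπ.ne_zero (hD i) hs le_rfl (hx hs)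
    rwa [div_one] at this
  D_block := by
    intro s C x i t P hx hs
    obtain ⟨u, hu, hux, h⟩ := (gEAn_iff_exists hπ.ne_zero hs).1 (hx hs)
    refine (gEAn_iff_exists hπ.ne_zero hs).2 ⟨_, ?_, isRep_fallProd (hD i) t P hux, fun j =>
      PiGE.fallProd hπ.ne_zero (hT i) he t P (h j)⟩
    have hb := isBounded_deriv hπ.ne_zero (hT i) hs
    clear hx hux h
    induction P generalizing u with
    | zero => exact hu
    | succ P ih =>
      simp only [fallProd_succ]
      refine ih (fun j => T i (u j) - ((t + P : ℕ) : AddMonoid.End (GamPi π lam)) (u j)) ?_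
      have h1 := hb.cauR hπ.ne_zero hs le_rfl hu
      rw [div_one] at h1
      have h2 := (CauR.const hs (MemR.algebraMap (π := π) (lam := lam) hs
        ((t + P : ℕ) : 𝔬))).mul hπ.ne_zero hs hu
      convert h1.sub hπ.ne_zero hs h2 using 1
      funext j
      change _ = T i (u j) - algebraMap 𝔬 (GamPi π lam) ((t + P : ℕ) : 𝔬) * u j
      rw [map_natCast, AddMonoid.End.natCast_apply, nsmul_eq_mul]
  D_unit := by
    intro i h
    have h1 := hT i (toPi π lam (mono π lam (z h))) 0 _ (by rw [pow_zero, mul_one])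
    rw [pow_zero, mul_one, partialMu_coord_mono] at h1
    have h2 : IsRep _ (coordUnits z (toAnCon π lam) h : GamAnCon π lam) :=
      isRep_toAnCon ⟨mono π lam (z h), mono_mem _⟩
    have h3 := hD i _ _ h2
    refine h3.unique ?_
    change IsRep (fun _ => T i (toPi π lam (mono π lam (z h)))) _
    rw [h1]
    split_ifs
    · exact h2
    · rw [map_zero]
      exact isRep_zero

end AnCon

/-! ### The change of Frobenius over `Γ_an,con` -/

section AnCon

universe u w

variable {𝔬 : Type*} [CommRing 𝔬] {L : Type*} [AddCommGroup L] [LinearOrder L]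
  [IsOrderedAddMonoid L] {π : 𝔬} {lam : L →+ ℝ} [IsDomain 𝔬] {m : ℕ}
  {z : Module.Basis (Fin m) ℤ L} {q : ℕ} {σK : 𝔬 →+* 𝔬} {σ σ₁ σ₂ : Gam π lam →+* Gam π lam}
  {ρ : ℝ} [IsDiscreteValuationRing 𝔬] [IsAdicComplete (IsLocalRing.maximalIdeal 𝔬) 𝔬]

theorem isBounded_frobenius (hπ : Irreducible π) (hlam : StrictMono lam)
    (hσ : IsFrobeniusLift q σK σ) (hσπ : ∃ u : 𝔬ˣ, σK π = u * π) (hs : SlopeBound q σ ρ)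
    (hq : 0 < q) (hρ : 0 < ρ) {φ : GamPi π lam →+* GamPi π lam}
    (hφ : ∀ a, φ (toPi π lam a) = toPi π lam (σ a)) :
    IsBounded (φ : GamPi π lam →+ GamPi π lam) q (1 / (2 * ρ)) where
  pos := Nat.cast_pos.2 hq
  radius_pos := by positivity
  map_memR hr hrr hx := hx.map_frobenius hσ hσπ hφ hs hq hρ.le hr (mul_lt_one_of_le hρ hrr)
  map_piGE hs0 hsr hx := hx.map_frobenius hσ hσπ hπ hlam hφ hs hq hs0.le
    (mul_lt_one_of_le hρ hsr).le

theorem changeOfFrobenius_anCon (hπ : Irreducible π) (hlam : StrictMono lam) {p e : ℕ}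
    [Fact p.Prime] (hq : 1 < q)
    (he : ∀ k : ℕ, k ≠ 0 → ∃ u : 𝔬ˣ, (k : 𝔬) = u * π ^ (e * padicValNat p k))
    (hqπ : π ∣ (q : 𝔬)) (hσπ : ∃ u : 𝔬ˣ, σK π = u * π) (hσ₁ : IsFrobeniusLift q σK σ₁)
    (hσ₂ : IsFrobeniusLift q σK σ₂) (hρ : 0 < ρ) (hs₁ : SlopeBound q σ₁ ρ)
    (hs₂ : SlopeBound q σ₂ ρ) :
    ChangeOfFrobenius.{_, w} z σ₁ σ₂ (GamAnCon π lam) (toAnCon π lam) TendstoAn := by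
  have hq0 : 0 < q := by omega
  have hr₀ : 0 < 1 / (2 * ρ) := by positivity
  choose T hT using fun i =>
    exists_derivationPi (lam := lam) hπ.ne_zero (z.coord i).toAddMonoidHom
  choose D hD using fun i => exists_derivation_an hπ.ne_zero
    (isBounded_deriv hπ.ne_zero (hT i) one_pos)
  obtain ⟨φ₁, hφ₁⟩ := exists_frobeniusPi hσ₁ hσπ
  obtain ⟨φ₂, hφ₂⟩ := exists_frobeniusPi hσ₂ hσπ
  have hb₁ := isBounded_frobenius hπ hlam hσ₁ hσπ hs₁ hq0 hρ hφ₁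
  have hb₂ := isBounded_frobenius hπ hlam hσ₂ hσπ hs₂ hq0 hρ hφ₂
  obtain ⟨ψ₁, hψ₁⟩ := exists_ringHom_an hπ.ne_zero hb₁
  obtain ⟨ψ₂, hψ₂⟩ := exists_ringHom_an hπ.ne_zero hb₂
  let 𝓢 := frechetUnionAnCon hπ hq he hT hD
  have hconv : (fun {_} => TendstoAn : Convergence (GamAnCon π lam)) = fun {_} => 𝓢.Conv := by
    funext κ l f y
    refine propext (exists_congr fun r => and_congr_right fun hr => forall_congr' fun s =>
      forall_congr' fun hs => forall_congr' fun hsr => forall_congr' fun C => ?_)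
    refine eventually_congr (Eventually.of_forall fun i => ?_)
    rw [gEAn_iff hπ.ne_zero hs hsr]
    exact and_congr ⟨fun h _ => h, fun h => h hr⟩ ⟨fun h _ => h, fun h => h hs⟩
  refine hconv ▸ ?_
  have hlift : ∀ {σ : Gam π lam →+* Gam π lam} {φ : GamPi π lam →+* GamPi π lam}
      {ψ : GamAnCon π lam →+* GamAnCon π lam}, SlopeBound q σ ρ →
      (∀ a, φ (toPi π lam a) = toPi π lam (σ a)) →
      (∀ u y, IsRep u y → IsRep (fun i => φ (u i)) (ψ y)) →
      ExtendsFromCon (toAnCon π lam) σ ψ := fun {σ φ ψ} hs hφ hψ a => by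
    refine ⟨⟨σ a, hs.map_GamCon hq0 hρ a⟩, rfl, (hψ _ _ (isRep_toAnCon a)).unique ?_⟩
    rw [hφ]
    exact isRep_toAnCon ⟨σ a, _⟩
  refine changeOfFrobenius_of_frechetUnion (𝓢 := 𝓢) (φ₁ := ψ₁) (φ₂ := ψ₂) (r₀ := 1 / (2 * ρ))
    ?_ ?_ he hq hqπ hσ₁ hσ₂ (hlift hs₁ hφ₁ hψ₁) (hlift hs₂ hφ₂ hψ₂) ?_ hr₀
    (fun hr hrr hx _ => hb₁.memAn hπ.ne_zero hψ₁ hr hrr (hx hr))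
    (fun hs hsr hx _ => hb₁.gEAn hπ.ne_zero hψ₁ hs hsr (hx hs))
    (fun hr hrr hx _ => hb₂.memAn hπ.ne_zero hψ₂ hr hrr (hx hr))
    (fun hs hsr hx _ => hb₂.gEAn hπ.ne_zero hψ₂ hs hsr (hx hs))
  · rintro ⟨c, r, hr, hc⟩ hd
    obtain ⟨t, ht, htr, h⟩ := exists_piGE_half hπ.ne_zero hr hc hd
    have hm : ∀ s, 0 < s → s ≤ t → MemR s (toPi π lam c) := fun s hs hst =>
      memR_toPi (GamN_mono hr hs (hst.trans htr) hc)
    refine ⟨t, ht, fun _ => memAn_conToAn ht (x := toConPi π lam ⟨c, r, hr, hc⟩) (hm t ht le_rfl),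
      fun s hs hst _ => ?_⟩
    exact (gEAn_conToAn_iff (x := toConPi π lam ⟨c, r, hr, hc⟩) hπ.ne_zero hs (hm s hs hst)).2
      (h s (le_of_lt hs) hst)
  · obtain ⟨y, hy⟩ := exists_eq_div (π := π) (lam := lam) 1 1
    rw [map_one] at hy
    refine IsUnit.of_mul_eq_one
      (conToAn π lam ⟨y, 1, one_pos, MemR.of_mul_piLoc_pow_eq_one one_pos hy⟩) ?_
    rw [← (conToAn π lam).commutes, ← map_mul, ← map_one (conToAn π lam)]
    refine congrArg _ (Subtype.ext ?_)
    change algebraMap 𝔬 (GamPi π lam) π * y = 1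
    rw [algebraMap_piLoc, mul_comm, ← hy, pow_one]
  · intro i a
    obtain ⟨b, hb, hb'⟩ := extendsFromCon_deriv hπ.ne_zero (hT i) a
    refine ⟨b, hb, (hD i _ _ (isRep_toAnCon a)).unique ?_⟩
    rw [hb']
    exact isRep_toAnCon b

end AnCon

end FakeAnnulus

end

/-! ### Conclusion -/

theorem propositionP {𝔬 : Type*} [CommRing 𝔬] [IsDomain 𝔬] [IsDiscreteValuationRing 𝔬]
    [CharZero 𝔬] [IsAdicComplete (IsLocalRing.maximalIdeal 𝔬) 𝔬]
    (p : ℕ) [Fact p.Prime] [CharP (IsLocalRing.ResidueField 𝔬) p] (q : ℕ)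
    (hq : ∃ a : ℕ, 0 < a ∧ q = p ^ a) (π : 𝔬) (hπ : Irreducible π)
    (σK : 𝔬 →+* 𝔬) (hσK : ∀ c, π ∣ σK c - c ^ q)
    {m : ℕ} {L : Type*} [AddCommGroup L] [LinearOrder L] [IsOrderedAddMonoid L]
    (z : Module.Basis (Fin m) ℤ L) (lam : L →+ ℝ) (hlam : StrictMono lam)
    (σ₁ σ₂ : FakeAnnulus.Gam π lam →+* FakeAnnulus.Gam π lam)
    (hσ₁ : FakeAnnulus.IsFrobeniusLift q σK σ₁) (hσ₂ : FakeAnnulus.IsFrobeniusLift q σK σ₂)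
    (hc₁ : FakeAnnulus.LevelwiseContinuous σ₁) (hc₂ : FakeAnnulus.LevelwiseContinuous σ₂)
    (hu₁ : FakeAnnulus.HasEnoughUnits p q σ₁) (hu₂ : FakeAnnulus.HasEnoughUnits p q σ₂)
    (hz₁ : FakeAnnulus.MonomialsAreUnits p q σ₁) (hz₂ : FakeAnnulus.MonomialsAreUnits p q σ₂) :
    -- for small `r`, the rings `Γ_r` and valuations `w_r` of `σ₁`, of `σ₂`, and the naive ones agree
    (∃ r₀ : ℝ, 0 < r₀ ∧ ∀ r, 0 < r → r ≤ r₀ →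
      (FakeAnnulus.GamF p q σ₁ r = FakeAnnulus.GamN π lam r ∧
        FakeAnnulus.GamF p q σ₂ r = FakeAnnulus.GamN π lam r) ∧
      ∀ x : FakeAnnulus.Gam π lam, FakeAnnulus.wF p q σ₁ r x = FakeAnnulus.wN r x ∧
        FakeAnnulus.wF p q σ₂ r x = FakeAnnulus.wN r x) ∧
    FakeAnnulus.ChangeOfFrobenius z σ₁ σ₂ (FakeAnnulus.GamAnCon π lam)
      (FakeAnnulus.toAnCon π lam) FakeAnnulus.TendstoAn ∧
    FakeAnnulus.ChangeOfFrobenius z σ₁ σ₂ (FakeAnnulus.GamConPi π lam)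
      (FakeAnnulus.toConPi π lam) FakeAnnulus.TendstoCon := by
  obtain ⟨a, ha, rfl⟩ := hq
  have hp : p.Prime := Fact.out
  have hpπ : π ∣ (p : 𝔬) := FakeAnnulus.pi_dvd_prime hπ
  have hq1 : 1 < p ^ a := Nat.one_lt_pow ha.ne' hp.one_lt
  have hqπ : π ∣ ((p ^ a : ℕ) : 𝔬) := by
    rw [Nat.cast_pow]
    exact hpπ.trans (dvd_pow_self _ ha.ne')
  have hσπ := FakeAnnulus.exists_unit_map_pi (p := p) (by omega) hπ hσK
  obtain ⟨e, he⟩ := FakeAnnulus.exists_natCast_eq (p := p) hπ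
  obtain ⟨ρ₁, hρ₁, hs₁, h₁⟩ := FakeAnnulus.exists_radius ha hpπ hπ hlam hσ₁ hσπ hc₁ z hz₁
  obtain ⟨ρ₂, hρ₂, hs₂, h₂⟩ := FakeAnnulus.exists_radius ha hpπ hπ hlam hσ₂ hσπ hc₂ z hz₂
  have hρ : 0 < max ρ₁ ρ₂ := lt_max_of_lt_left hρ₁
  have hs₁' := hs₁.mono (le_max_left ρ₁ ρ₂)
  have hs₂' := hs₂.mono (le_max_right ρ₁ ρ₂)
  -- This radius makes `ρ r < 1` for the slopes `ρ` of both lifts.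
  refine ⟨⟨1 / (2 * max ρ₁ ρ₂), by positivity, fun r hr hrr => ?_⟩,
    FakeAnnulus.changeOfFrobenius_anCon hπ hlam hq1 he hqπ hσπ hσ₁ hσ₂ hρ hs₁' hs₂',
    FakeAnnulus.changeOfFrobenius_conPi hπ hlam hq1 he hqπ hσπ hσ₁ hσ₂ hρ hs₁' hs₂'⟩
  have h := FakeAnnulus.mul_lt_one_of_le hρ hrr
  obtain ⟨h1, h1'⟩ := h₁ r hr
    ((mul_le_mul_of_nonneg_right (le_max_left _ _) hr.le).trans_lt h)
  obtain ⟨h2, h2'⟩ := h₂ r hr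
    ((mul_le_mul_of_nonneg_right (le_max_right _ _) hr.le).trans_lt h)
  exact ⟨⟨h1, h2⟩, fun x => ⟨h1' x, h2' x⟩⟩
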